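/- Let $M\subset\mathbb{C}^2$ be a real-analytic real hypersurface and let $p\in M$ be a point of generic Levi degeneracy: the determinant of the Levi form of $M$ (a scalar function near $p$, computed in a local frame of the complex tangent bundle $T^{\mathbb C}M=TM\cap J\,TM$) vanishes at $p$, but its differential at $p$ does not vanish identically on the complex tangent space $T^{\mathbb C}_pM$. Write $(z,w)=(z,u+iv)$ for the coordinates of $\mathbb{C}^2$. A normalizing map of $M$ at a point $q\in M$ is a local biholomorphic map $F$ at $q$ with $F(q)=0$ that sends the germ of $M$ at $q$ to the germ at $0$ of a real-analytic hypersurface in (convergent) normal form $$v=2\operatorname{Re}(z^2\bar z)+\sum_{k,l\ge 2}\Phi_{kl}(u)z^k\bar z^l,\qquad \operatorname{Re}\Phi_{32}(u)=\operatorname{Im}\Phi_{42}(u)=0,$$ where the $\Phi_{kl}$ are real-analytic near $0$. Then: 1. There is a normalizing map of $M$ at $p$. 2. The germ at $p$ of a normalizing map $F$ is uniquely determined by $dF|_{T^{\mathbb C}_pM}$: if $F,G$ are normalizing maps of $M$ at $p$ (possibly with different normal forms) and $dF_p=dG_p$ on $T^{\mathbb C}_pM$, then $F=G$ near $p$. 3.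 Near $p$, the Levi degeneracy set $\Sigma$ of $M$ (the set of points of $M$ at which the Levi form vanishes) is a real-analytic embedded surface, all of whose points are generic Levi degeneracies, and it is canonically foliated by degenerate chains. Precisely: for $q\in\Sigma$ near $p$, the real line $l(q)=(dF_q)^{-1}(\mathbb{R}\cdot(0,1))$ does not depend on the choice of the normalizing map $F$ of $M$ at $q$; degenerate chains are the integral curves of the slope field $l$; they are the leaves of a real-analytic foliation of $\Sigma$ near $p$, and every degenerate chain through a point of $\Sigma$ near $p$ is locally contained in the leaf through that point. For every normalizing map $F$ of $M$ at $p$, the degenerate chain through $p$ is given near $p$ by $z=0$ in the normal form, that is, it is $\{x\in M: z(F(x))=0\}$ near $p$. -/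

import Mathlib

open Set Filter Topology

noncomputable section

namespace LeviDegenerate

/-- `ρ` is a real-analytic local defining function of the set `M ⊆ ℂ²` near the point `q`, with
nonvanishing differential at `q`. -/
def IsLocalDefiningFunction (M : Set (ℂ × ℂ)) (q : ℂ × ℂ) (ρ : ℂ × ℂ → ℝ) : Prop :=
  AnalyticAt ℝ ρ q ∧ fderiv ℝ ρ q ≠ 0 ∧ ∀ᶠ x in 𝓝 q, (x ∈ M ↔ ρ x = 0)

/-- `M` is an (embedded, locally closed) real-analytic real hypersurface of `ℂ²`. -/
def IsRealAnalyticHypersurface (M : Set (ℂ × ℂ)) : Prop :=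
  ∀ q ∈ M, ∃ ρ, IsLocalDefiningFunction M q ρ

/-- The real tangent space `T_q M`: the vectors annihilated by the differentials at `q` of the local
defining functions (which are all proportional). -/
def tangentVectors (M : Set (ℂ × ℂ)) (q : ℂ × ℂ) : Set (ℂ × ℂ) :=
  {X | ∀ ρ, IsLocalDefiningFunction M q ρ → fderiv ℝ ρ q X = 0}

/-- The complex tangent space `T_q M ∩ J T_q M`, with `J` the multiplication by `i`. -/
def complexTangentVectors (M : Set (ℂ × ℂ)) (q : ℂ × ℂ) : Set (ℂ × ℂ) :=
  {X | X ∈ tangentVectors M q ∧ Complex.I • X ∈ tangentVectors M q}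

/-- The Wirtinger derivative `∂ρ/∂z = (∂ρ/∂x - i ∂ρ/∂y)/2` in the first coordinate `z = x + iy`. -/
def wirtingerZ (ρ : ℂ × ℂ → ℝ) (q : ℂ × ℂ) : ℂ :=
  ((fderiv ℝ ρ q (1, 0) : ℝ) - Complex.I * (fderiv ℝ ρ q (Complex.I, 0) : ℝ)) / 2

/-- The Wirtinger derivative `∂ρ/∂w` in the second coordinate. -/
def wirtingerW (ρ : ℂ × ℂ → ℝ) (q : ℂ × ℂ) : ℂ :=
  ((fderiv ℝ ρ q (0, 1) : ℝ) - Complex.I * (fderiv ℝ ρ q (0, Complex.I) : ℝ)) / 2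

/-- The vector field `X = (ρ_w, -ρ_z)`. It satisfies `dρ(X) = dρ(J X) = 0` and vanishes only where
`dρ` does, so along `M = {ρ = 0}` it is a frame of the complex line bundle `T M ∩ J T M`. -/
def tangentialField (ρ : ℂ × ℂ → ℝ) (q : ℂ × ℂ) : ℂ × ℂ :=
  (wirtingerW ρ q, -wirtingerZ ρ q)

/-- The Levi determinant. In `ℂ²` the complex tangent space is one-dimensional over `ℂ`, so the
Levi form `(X, Y) ↦ [X - iJX, Y + iJY]` modulo complex tangent vectors is a `1 × 1` matrix in the
frame `X` above, with entry `[X - iJX, X + iJX] = 2i [X, JX]`. The real form `Y ↦ dρ(J Y)`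
identifies the quotient of `T M` by the complex tangent bundle with `ℝ`, and gives the value below
(up to the constant `2i`). Another choice of `ρ` or of the frame multiplies this function, along
`M`, by a function without zeros. -/
def leviDeterminant (ρ : ℂ × ℂ → ℝ) (q : ℂ × ℂ) : ℝ :=
  fderiv ℝ ρ q (Complex.I • VectorField.lieBracket ℝ (tangentialField ρ)
    (fun x => Complex.I • tangentialField ρ x) q)

/-- The Levi degeneracy set of `M`: the points of `M` at which the Levi form vanishes. -/
def leviDegeneracySet (M : Set (ℂ × ℂ)) : Set (ℂ × ℂ) :=
  {q | q ∈ M ∧ ∃ ρ, IsLocalDefiningFunction M q ρ ∧ leviDeterminant ρ q = 0}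

/-- `M` has a generic Levi degeneracy at `p`: the determinant of the Levi form vanishes at `p`,
but its differential restricted to the complex tangent space at `p` does not. -/
def HasGenericLeviDegeneracyAt (M : Set (ℂ × ℂ)) (p : ℂ × ℂ) : Prop :=
  p ∈ M ∧ ∃ ρ, IsLocalDefiningFunction M p ρ ∧ leviDeterminant ρ p = 0 ∧
    ∃ X ∈ complexTangentVectors M p, fderiv ℝ (leviDeterminant ρ) p X ≠ 0

/-- The real-analytic germ at `0` of `φ(z, u)` has the form
`φ(z, u) = 2 Re(z² z̄) + ∑_{k, l ≥ 2} Φ_{kl}(u) z^k z̄^l` with real-analytic coefficients and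
`Re Φ₃₂ = Im Φ₄₂ = 0`. -/
def IsNormalFormFunction (φ : ℂ × ℝ → ℝ) : Prop :=
  AnalyticAt ℝ φ 0 ∧
  ∃ (Φ : ℕ → ℕ → ℝ → ℂ) (ε : ℝ), 0 < ε ∧
    (∀ k l, AnalyticOnNhd ℝ (Φ k l) (Ioo (-ε) ε)) ∧
    (∀ u ∈ Ioo (-ε) ε, (Φ 3 2 u).re = 0 ∧ (Φ 4 2 u).im = 0) ∧
    ∀ z : ℂ, ‖z‖ < ε → ∀ u ∈ Ioo (-ε) ε,
      HasSum (fun n : ℕ × ℕ =>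
          Φ (n.1 + 2) (n.2 + 2) u * z ^ (n.1 + 2) * (starRingEnd ℂ z) ^ (n.2 + 2))
        ((φ (z, u) - 2 * (z ^ 2 * starRingEnd ℂ z).re : ℝ) : ℂ)

/-- `F` is a local biholomorphic map at `p` with `F p = 0`. -/
def IsLocalBiholomorphismToZero (F : ℂ × ℂ → ℂ × ℂ) (p : ℂ × ℂ) : Prop :=
  AnalyticAt ℂ F p ∧ Function.Bijective (fderiv ℂ F p) ∧ F p = 0

/-- The local biholomorphic map `F` sends the germ `(M, p)` to the germ at `0` of a hypersurface
`v = φ(z, u)` in normal form, in the coordinates `(z, w)`, `w = u + iv`. -/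
def IsNormalizingMap (M : Set (ℂ × ℂ)) (p : ℂ × ℂ) (F : ℂ × ℂ → ℂ × ℂ) : Prop :=
  IsLocalBiholomorphismToZero F p ∧
  ∃ φ, IsNormalFormFunction φ ∧
    ∀ᶠ x in 𝓝 p, (x ∈ M ↔ (F x).2.im = φ ((F x).1, (F x).2.re))

/-- The real line in `ℂ²` spanned by `dF_q⁻¹(0, 1)`. -/
def pulledBackDirection (F : ℂ × ℂ → ℂ × ℂ) (q : ℂ × ℂ) : Set (ℂ × ℂ) :=
  {v | ∃ c : ℝ, fderiv ℂ F q v = (0, (c : ℂ))}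

/-- The slope of the degenerate chains at `q`: the vectors in the line spanned by `dF_q⁻¹(0, 1)`,
for some map `F` that brings `M` into normal form at `q`. -/
def chainSlope (M : Set (ℂ × ℂ)) (q : ℂ × ℂ) : Set (ℂ × ℂ) :=
  {v | ∃ F, IsNormalizingMap M q F ∧ v ∈ pulledBackDirection F q}

/-- The curve `γ`, restricted to the open interval `(a, b)`, is a regular real-analytic
parametrization of (a piece of) a degenerate chain: an integral curve of the slope field
`chainSlope` in the set of generic Levi degeneracies. -/
def IsDegenerateChain (M : Set (ℂ × ℂ)) (γ : ℝ → ℂ × ℂ) (a b : ℝ) : Prop :=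
  ∀ t ∈ Ioo a b, AnalyticAt ℝ γ t ∧ HasGenericLeviDegeneracyAt M (γ t) ∧
    deriv γ t ≠ 0 ∧ deriv γ t ∈ chainSlope M (γ t)

/-- `ψ`, on the square `(-ε, ε)²`, is a real-analytic foliation chart centred at `p` of the Levi
degeneracy set in the open set `U`: an analytic embedding with image `U ∩ Σ`, immersive at every
point, for which the curves `t ↦ ψ (s, t)` are degenerate chains. -/
def IsChainFoliationChart (M : Set (ℂ × ℂ)) (p : ℂ × ℂ) (U : Set (ℂ × ℂ))
    (ψ : ℝ × ℝ → ℂ × ℂ) (ε : ℝ) : Prop :=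
  AnalyticOnNhd ℝ ψ (Ioo (-ε) ε ×ˢ Ioo (-ε) ε) ∧
  (∀ x ∈ Ioo (-ε) ε ×ˢ Ioo (-ε) ε, Function.Injective (fderiv ℝ ψ x)) ∧
  IsEmbedding ((Ioo (-ε) ε ×ˢ Ioo (-ε) ε).domRestrict ψ) ∧
  ψ '' (Ioo (-ε) ε ×ˢ Ioo (-ε) ε) = U ∩ leviDegeneracySet M ∧
  ψ (0, 0) = p ∧
  ∀ s ∈ Ioo (-ε) ε, IsDegenerateChain M (fun t => ψ (s, t)) (-ε) ε

end LeviDegenerate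

end

noncomputable section

namespace LeviDegenerate

open Complex (I)

open scoped ContDiff

section Limits

variable {E : Type*} [NormedAddCommGroup E]

lemma tendsto_ofReal_zero : Tendsto (fun t : ℝ => (t : ℂ)) (𝓝 0) (𝓝 0) :=
  Complex.continuous_ofReal.tendsto' _ _ Complex.ofReal_zero

lemma tendsto_zero_prodMk : Tendsto (fun t : E => ((0 : ℂ), t)) (𝓝 0) (𝓝 0) :=
  Continuous.tendsto' (by fun_prop) _ _ rfl

lemma tendsto_prodMk_zero : Tendsto (fun t : E => (t, (0 : ℂ))) (𝓝 0) (𝓝 0) :=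
  Continuous.tendsto' (by fun_prop) _ _ rfl

lemma tendsto_snd_zero : Tendsto (fun y : ℂ × E => y.2) (𝓝 0) (𝓝 0) :=
  Continuous.tendsto' (by fun_prop) _ _ rfl

lemma tendsto_slice : Tendsto (fun x : ℂ × E => (x.1, (0 : ℂ), x.2)) (𝓝 0) (𝓝 0) :=
  Continuous.tendsto' (by fun_prop) _ _ rfl

lemma tendsto_star_zero [StarAddMonoid E] [ContinuousStar E] :
    Tendsto (fun t : E => star t) (𝓝 0) (𝓝 0) :=
  continuous_star.tendsto' _ _ (star_zero _)

end Limits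

/-! ### Superposition operators and parametric primitives -/

section Superposition

variable {𝕜 : Type*} [NontriviallyNormedField 𝕜] {K : Type*} [TopologicalSpace K] [CompactSpace K]
  {E : Type*} [NormedAddCommGroup E] [NormedSpace 𝕜 E]
  {G : Type*} [NormedAddCommGroup G] [NormedSpace 𝕜 G]

/-- The multilinear map on spaces of continuous functions acting pointwise by `p`. -/
def pointwiseMultilinear {n : ℕ} (p : ContinuousMultilinearMap 𝕜 (fun _ : Fin n => E) G) :
    ContinuousMultilinearMap 𝕜 (fun _ : Fin n => C(K, E)) C(K, G) :=
  MultilinearMap.mkContinuous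
    { toFun := fun m => ⟨fun x => p (fun i => m i x), by fun_prop⟩
      map_update_add' := by
        intro _ m i a b
        ext x
        have h : ∀ c : C(K, E), (fun j => (Function.update m i c j) x)
            = Function.update (fun j => m j x) i (c x) := by
          intro c
          funext j
          by_cases hj : j = i
          · subst hj; simp
          · simp [hj]
        have hd : ‹DecidableEq (Fin n)› = instDecidableEqFin n := Subsingleton.elim _ _
        subst hd
        simp [h]
      map_update_smul' := by
        intro _ m i a b
        ext x
        have h : ∀ c : C(K, E), (fun j => (Function.update m i c j) x)
            = Function.update (fun j => m j x) i (c x) := by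
          intro c
          funext j
          by_cases hj : j = i
          · subst hj; simp
          · simp [hj]
        have hd : ‹DecidableEq (Fin n)› = instDecidableEqFin n := Subsingleton.elim _ _
        subst hd
        simp [h] }
    ‖p‖ (by
      intro m
      rw [ContinuousMap.norm_le _ (by positivity)]
      intro x
      refine (p.le_opNorm _).trans ?_
      gcongr with i
      exact (m i).norm_coe_le_norm x)

lemma norm_pointwiseMultilinear_le {n : ℕ}
    (p : ContinuousMultilinearMap 𝕜 (fun _ : Fin n => E) G) :
    ‖(pointwiseMultilinear p : ContinuousMultilinearMap 𝕜 (fun _ : Fin n => C(K, E)) C(K, G))‖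
      ≤ ‖p‖ :=
  MultilinearMap.mkContinuous_norm_le _ (norm_nonneg _) _

/-- The superposition operator of an analytic function is analytic. -/
theorem exists_analyticAt_superposition [CompleteSpace G] {f : E → G} {x₀ : E}
    (hf : AnalyticAt 𝕜 f x₀) :
    ∃ N : C(K, E) → C(K, G), AnalyticAt 𝕜 N 0 ∧
      ∀ᶠ α in 𝓝 (0 : C(K, E)), ∀ x, N α x = f (x₀ + α x) := by
  obtain ⟨p, r, hp⟩ := hf
  let P : FormalMultilinearSeries 𝕜 C(K, E) C(K, G) := fun n => pointwiseMultilinear (p n)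
  have hle : r ≤ P.radius :=
    hp.r_le.trans (FormalMultilinearSeries.radius_le_of_le
      (fun n => norm_pointwiseMultilinear_le (p n)))
  have hP : HasFPowerSeriesOnBall P.sum P 0 r :=
    (P.hasFPowerSeriesOnBall (hp.r_pos.trans_le hle)).mono hp.r_pos hle
  refine ⟨P.sum, hP.analyticAt, ?_⟩
  filter_upwards [Metric.eball_mem_nhds (0 : C(K, E)) hp.r_pos] with α hα x
  have h1 := hP.hasSum hα
  rw [zero_add] at h1
  have h2 : HasSum (fun n => (P n fun _ => α) x) (P.sum α x) :=
    h1.map ((ContinuousMap.evalCLM (M := G) 𝕜 x).toLinearMap.toAddMonoidHom)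
      (ContinuousMap.evalCLM (M := G) 𝕜 x).continuous
  have h3 : α x ∈ Metric.eball (0 : E) r := by
    simp only [Metric.mem_eball, edist_zero_right] at hα ⊢
    refine lt_of_le_of_lt ?_ hα
    exact enorm_le_iff_norm_le.2 (α.norm_coe_le_norm x)
  exact h2.unique (hp.hasSum h3)

end Superposition

open MeasureTheory in
/-- The Volterra operator on continuous functions on `[0, 1]`. -/
def volterra : C(unitInterval, ℂ) →L[ℂ] C(unitInterval, ℂ) :=
  LinearMap.mkContinuous
    { toFun := fun α => ⟨fun τ => ∫ σ in (0 : ℝ)..τ, IccExtend zero_le_one α σ, by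
        have h : Continuous fun τ : ℝ => ∫ σ in (0 : ℝ)..τ, IccExtend zero_le_one α σ :=
          intervalIntegral.continuous_primitive
            (fun a b => (α.continuous.Icc_extend').intervalIntegrable a b) 0
        exact h.comp continuous_subtype_val⟩
      map_add' := by
        intro α β
        ext τ
        simp only [ContinuousMap.coe_mk, ContinuousMap.add_apply]
        rw [← intervalIntegral.integral_add
          ((α.continuous.Icc_extend').intervalIntegrable _ _)
          ((β.continuous.Icc_extend').intervalIntegrable _ _)]
        rfl
      map_smul' := by
        intro c α
        ext τ
        simp only [ContinuousMap.coe_mk, ContinuousMap.smul_apply, RingHom.id_apply]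
        rw [← intervalIntegral.integral_smul]
        rfl }
    1 (by
      intro α
      rw [one_mul, ContinuousMap.norm_le _ (norm_nonneg _)]
      intro τ
      have h := intervalIntegral.norm_integral_le_of_norm_le_const (a := 0) (b := (τ : ℝ))
        (f := IccExtend zero_le_one α) (C := ‖α‖) (fun σ _ => α.norm_coe_le_norm _)
      refine h.trans ?_
      have h0 := τ.2.1
      have h1 := τ.2.2
      rw [sub_zero, abs_of_nonneg h0]
      exact mul_le_of_le_one_right (norm_nonneg _) h1)

lemma volterra_apply (α : C(unitInterval, ℂ)) (τ : unitInterval) :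
    volterra α τ = ∫ σ in (0 : ℝ)..τ, IccExtend zero_le_one α σ := rfl

/-- Division of an analytic function vanishing on a hyperplane by the corresponding coordinate. -/
theorem exists_eq_fst_mul {E : Type*} [NormedAddCommGroup E] [NormedSpace ℂ E]
    {G : ℂ × E → ℂ} {x₀ : E} (hG : AnalyticAt ℂ G (0, x₀))
    (h0 : ∀ᶠ x in 𝓝 x₀, G (0, x) = 0) :
    ∃ D : ℂ × E → ℂ, AnalyticAt ℂ D (0, x₀) ∧ (∀ᶠ y in 𝓝 (0, x₀), G y = y.1 * D y) := by
  have hd : AnalyticAt ℂ (fun y => fderiv ℂ G y (1, 0)) (0, x₀) :=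
    ((ContinuousLinearMap.apply ℂ ℂ ((1 : ℂ), (0 : E))).analyticAt _).comp hG.fderiv
  obtain ⟨N, hN, hNe⟩ := exists_analyticAt_superposition (K := unitInterval) hd
  let path : ℂ × E →L[ℂ] C(unitInterval, ℂ × E) :=
    LinearMap.mkContinuous
      { toFun := fun y => ⟨fun s => (((s : ℝ) : ℂ) * y.1, y.2), by fun_prop⟩
        map_add' := by intro a b; ext s <;> simp [mul_add]
        map_smul' := by intro a b; ext s <;> simp [mul_left_comm] }
      1 (by
        intro y
        rw [one_mul, ContinuousMap.norm_le _ (norm_nonneg _)]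
        intro s
        have h0 := s.2.1
        have h1 := s.2.2
        simp only [LinearMap.coe_mk, AddHom.coe_mk, ContinuousMap.coe_mk, Prod.norm_mk]
        refine max_le ?_ (norm_snd_le y)
        rw [norm_mul, Complex.norm_real, Real.norm_of_nonneg h0]
        exact (mul_le_of_le_one_left (norm_nonneg _) h1).trans (norm_fst_le y))
  have hpath : ∀ y s, path y s = (((s : ℝ) : ℂ) * y.1, y.2) := fun _ _ => rfl
  let ev : C(unitInterval, ℂ) →L[ℂ] ℂ := (ContinuousMap.evalCLM (M := ℂ) ℂ 1).comp volterra
  refine ⟨fun y => ev (N (path (y - (0, x₀)))), ?_, ?_⟩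
  · refine (ev.analyticAt _).comp ?_
    refine AnalyticAt.comp_of_eq (g := N) hN ?_ (by simp)
    exact (path.analyticAt _).comp (by fun_prop)
  · have hc : ContinuousAt (fun y : ℂ × E => path (y - (0, x₀))) (0, x₀) := by fun_prop
    have hc' : Tendsto (fun y : ℂ × E => path (y - (0, x₀))) (𝓝 (0, x₀)) (𝓝 0) := by
      simpa [ContinuousAt] using hc
    obtain ⟨r, hr, hball⟩ := hG.exists_ball_analyticOnNhd
    have hz : ∀ᶠ y in 𝓝 ((0 : ℂ), x₀), G (0, y.2) = 0 :=
      (continuous_snd.tendsto ((0 : ℂ), x₀)).eventually h0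
    filter_upwards [hc'.eventually hNe, Metric.ball_mem_nhds ((0 : ℂ), x₀) hr, hz]
      with y hy hyb hy0
    have hseg : ∀ s ∈ Icc (0 : ℝ) 1, ((s : ℂ) * y.1, y.2) ∈ Metric.ball ((0 : ℂ), x₀) r := by
      intro s hs
      rw [Metric.mem_ball, Prod.dist_eq, max_lt_iff] at hyb ⊢
      refine ⟨lt_of_le_of_lt ?_ hyb.1, hyb.2⟩
      simp only [dist_zero_right, norm_mul, Complex.norm_real, Real.norm_of_nonneg hs.1]
      exact mul_le_of_le_one_left (norm_nonneg _) hs.2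
    have hderiv : ∀ s ∈ uIcc (0 : ℝ) 1, HasDerivAt (fun s : ℝ => G ((s : ℂ) * y.1, y.2))
        (y.1 * fderiv ℂ G ((s : ℂ) * y.1, y.2) (1, 0)) s := by
      intro s hs
      rw [uIcc_of_le zero_le_one] at hs
      have h1 : HasFDerivAt G (fderiv ℂ G ((s : ℂ) * y.1, y.2)) ((s : ℂ) * y.1, y.2) :=
        (hball _ (hseg s hs)).differentiableAt.hasFDerivAt
      have h2 : HasDerivAt (fun s : ℝ => ((s : ℂ) * y.1, y.2)) (y.1, (0 : E)) s := by
        refine HasDerivAt.prodMk ?_ (hasDerivAt_const _ _)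
        simpa using (Complex.ofRealCLM.hasDerivAt (x := s)).mul_const y.1
      have h3 := (h1.restrictScalars ℝ).comp_hasDerivAt s h2
      convert! h3 using 1
      have : ((y.1, 0) : ℂ × E) = y.1 • (1, 0) := by simp
      simp [this, -Prod.smul_mk]
    have hcont : ContinuousOn (fun s : ℝ => y.1 * fderiv ℂ G ((s : ℂ) * y.1, y.2) (1, 0))
        (uIcc 0 1) := by
      rw [uIcc_of_le zero_le_one]
      intro s hs
      refine ContinuousAt.continuousWithinAt ?_
      refine continuousAt_const.mul ?_
      have h1 : ContinuousAt (fun y => fderiv ℂ G y (1, 0)) ((s : ℂ) * y.1, y.2) :=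
        ((hball _ (hseg s hs)).fderiv.continuousAt).clm_apply continuousAt_const
      exact ContinuousAt.comp (f := fun s : ℝ => ((s : ℂ) * y.1, y.2)) h1
        (by fun_prop)
    have hftc := intervalIntegral.integral_eq_sub_of_hasDerivAt hderiv hcont.intervalIntegrable
    have hval : ev (N (path (y - (0, x₀))))
        = ∫ s in (0 : ℝ)..1, fderiv ℂ G ((s : ℂ) * y.1, y.2) (1, 0) := by
      change volterra (N (path (y - (0, x₀)))) 1 = _
      rw [volterra_apply]
      refine intervalIntegral.integral_congr fun s hs => ?_
      rw [uIcc_of_le (by simp)] at hs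
      rw [IccExtend_of_mem _ _ (by simpa using hs), hy, hpath]
      congr 2
      ext <;> simp
    rw [hval, ← intervalIntegral.integral_const_mul, hftc]
    simp [hy0]

open scoped ContDiff

attribute [fun_prop] analyticAt_fst analyticAt_snd

/-! ### Reflection of analytic functions -/

section Reflection

variable {E : Type*} [NormedAddCommGroup E] [StarAddMonoid E]
  {F : Type*} [NormedAddCommGroup F] [StarAddMonoid F]

/-- The function `x ↦ conj (f (conj x))`. -/
def reflect (f : E → F) (x : E) : F := star (f (star x))

lemma reflect_apply (f : E → F) (x : E) : reflect f x = star (f (star x)) := rfl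

variable [NormedSpace ℂ E] [StarModule ℂ E] [NormedStarGroup E]
  [NormedSpace ℂ F] [StarModule ℂ F] [NormedStarGroup F]

/-- The conjugate of a multilinear map. -/
def reflectMultilinear {n : ℕ} (p : ContinuousMultilinearMap ℂ (fun _ : Fin n => E) F) :
    ContinuousMultilinearMap ℂ (fun _ : Fin n => E) F :=
  MultilinearMap.mkContinuous
    { toFun := fun m => star (p (fun i => star (m i)))
      map_update_add' := by
        intro _ m i a b
        have h : ∀ c : E, (fun j => star (Function.update m i c j))
            = Function.update (fun j => star (m j)) i (star c) := by
          intro c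
          funext j
          by_cases hj : j = i
          · subst hj; simp
          · simp [hj]
        have hd : ‹DecidableEq (Fin n)› = instDecidableEqFin n := Subsingleton.elim _ _
        subst hd
        simp [h]
      map_update_smul' := by
        intro _ m i a b
        have h : ∀ c : E, (fun j => star (Function.update m i c j))
            = Function.update (fun j => star (m j)) i (star c) := by
          intro c
          funext j
          by_cases hj : j = i
          · subst hj; simp
          · simp [hj]
        have hd : ‹DecidableEq (Fin n)› = instDecidableEqFin n := Subsingleton.elim _ _
        subst hd
        simp [h] }
    ‖p‖ (by
      intro m
      simp only [MultilinearMap.coe_mk, norm_star]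
      refine (p.le_opNorm _).trans ?_
      simp)

theorem analyticAt_reflect [CompleteSpace F] {f : E → F} {x : E}
    (hf : AnalyticAt ℂ f (star x)) : AnalyticAt ℂ (reflect f) x := by
  obtain ⟨p, r, hp⟩ := hf
  let P : FormalMultilinearSeries ℂ E F := fun n => reflectMultilinear (p n)
  have hle : r ≤ P.radius :=
    hp.r_le.trans (FormalMultilinearSeries.radius_le_of_le
      (fun n => MultilinearMap.mkContinuous_norm_le _ (norm_nonneg _) _))
  refine ⟨P, r, hle, hp.r_pos, ?_⟩
  intro y hy
  have h1 : star y ∈ Metric.eball (0 : E) r := by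
    simp only [Metric.mem_eball, edist_zero_right] at hy ⊢
    refine lt_of_le_of_lt ?_ hy
    exact enorm_le_iff_norm_le.2 (by simp)
  have h2 := (hp.hasSum h1).star
  rw [← star_add] at h2
  exact h2

lemma fderiv_reflect {f : E → F} {x : E} (hf : DifferentiableAt ℂ f (star x)) (v : E) :
    fderiv ℂ (reflect f) x v = star (fderiv ℂ f (star x) (star v)) := by
  have h := hf.hasFDerivAt.star_star
  rw [star_star] at h
  have h2 : (star ∘ f ∘ star) = reflect f := rfl
  rw [h2] at h
  rw [h.fderiv]
  rfl

end Reflection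

lemma deriv_reflect {f : ℂ → ℂ} {x : ℂ} (hf : DifferentiableAt ℂ f (star x)) :
    deriv (reflect f) x = star (deriv f (star x)) := by
  rw [← fderiv_apply_one_eq_deriv, fderiv_reflect hf, star_one, fderiv_apply_one_eq_deriv]

instance : NormedStarGroup (ℂ × ℂ) := ⟨fun x => by simp [Prod.norm_def]⟩
instance : NormedStarGroup (ℂ × ℂ × ℂ) := ⟨fun x => by simp [Prod.norm_def]⟩

/-! ### Complexification -/

/-- A real-analytic function extends to a holomorphic function on a complexification: here `J`
embeds the real space `E` in the complex space `V`, and the coordinates `c i` of `E` with respect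
to the family `e` extend to the complex linear forms `ℓ i`. -/
theorem exists_complexification {E : Type*} [NormedAddCommGroup E] [NormedSpace ℝ E]
    {V : Type*} [NormedAddCommGroup V] [NormedSpace ℂ V] {ι : Type*} [Fintype ι]
    {f : E → ℂ} {x₀ : E} (hf : AnalyticAt ℝ f x₀) (e : ι → E) (c : ι → E → ℝ)
    (hc : ∀ x, ∑ i, c i x • e i = x) (ℓ : ι → V →L[ℂ] ℂ) (J : E →L[ℝ] V)
    (hJ : ∀ i x, ℓ i (J x) = (c i x : ℂ)) :
    ∃ F : V → ℂ, AnalyticAt ℂ F (J x₀) ∧ ∀ᶠ x in 𝓝 x₀, F (J x) = f x := by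
  classical
  obtain ⟨p, r, hp⟩ := hf
  let P : FormalMultilinearSeries ℂ V ℂ := fun n =>
    ∑ s : Fin n → ι, p n (fun i => e (s i)) •
      (ContinuousMultilinearMap.mkPiAlgebra ℂ (Fin n) ℂ).compContinuousLinearMap
        (fun i => ℓ (s i))
  let a : ℝ := ∑ i, ‖e i‖
  let b : ℝ := ∑ i, ‖ℓ i‖
  have ha : 0 ≤ a := by positivity
  have hb : 0 ≤ b := by positivity
  let C : ℝ := Fintype.card ι * (a * b) + 1
  have hC : 0 < C := by positivity
  have hPn : ∀ n, ‖P n‖ ≤ ‖p n‖ * C ^ n := by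
    intro n
    have hs : ∀ s : Fin n → ι, ‖p n (fun i => e (s i)) •
      (ContinuousMultilinearMap.mkPiAlgebra ℂ (Fin n) ℂ).compContinuousLinearMap
        (fun i => ℓ (s i))‖ ≤ ‖p n‖ * (a * b) ^ n := by
      intro s
      rw [norm_smul, mul_pow, ← mul_assoc]
      have h1 : ‖p n (fun i => e (s i))‖ ≤ ‖p n‖ * a ^ n := by
        refine (p n).le_opNorm _ |>.trans ?_
        gcongr
        calc ∏ i, ‖e (s i)‖ ≤ ∏ _i : Fin n, a :=
              Finset.prod_le_prod (fun _ _ => norm_nonneg _) (fun i _ =>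
                Finset.single_le_sum (f := fun i => ‖e i‖) (fun _ _ => norm_nonneg _)
                  (Finset.mem_univ (s i)))
          _ = a ^ n := by simp
      have h2 : ‖(ContinuousMultilinearMap.mkPiAlgebra ℂ (Fin n) ℂ).compContinuousLinearMap
        (fun i => ℓ (s i))‖ ≤ b ^ n := by
        refine (ContinuousMultilinearMap.norm_compContinuousLinearMap_le _ _).trans ?_
        rw [ContinuousMultilinearMap.norm_mkPiAlgebra, one_mul]
        calc ∏ i, ‖ℓ (s i)‖ ≤ ∏ _i : Fin n, b :=
              Finset.prod_le_prod (fun _ _ => norm_nonneg _) (fun i _ =>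
                Finset.single_le_sum (f := fun i => ‖ℓ i‖) (fun _ _ => norm_nonneg _)
                  (Finset.mem_univ (s i)))
          _ = b ^ n := by simp
      gcongr
    calc ‖P n‖ ≤ ∑ _s : Fin n → ι, ‖p n‖ * (a * b) ^ n :=
          (norm_sum_le _ _).trans (Finset.sum_le_sum fun s _ => hs s)
      _ = ‖p n‖ * (Fintype.card ι * (a * b)) ^ n := by
          simp [mul_pow]; ring
      _ ≤ ‖p n‖ * C ^ n := by
          gcongr
          simp [C]
  obtain ⟨ρ, hρ0, hρ⟩ := ENNReal.lt_iff_exists_nnreal_btwn.1 (hp.r_pos.trans_le hp.r_le)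
  have hρ0' : (0 : ℝ) < ρ := by exact_mod_cast hρ0
  obtain ⟨K, hK, hKb⟩ := p.norm_mul_pow_le_of_lt_radius hρ
  have hrad : 0 < P.radius := by
    let δ : NNReal := ⟨ρ / C, by positivity⟩
    have hδ : (δ : ℝ) = ρ / C := rfl
    have h : (δ : ENNReal) ≤ P.radius := by
      refine P.le_radius_of_bound K fun n => ?_
      refine le_trans ?_ (hKb n)
      rw [hδ]
      calc ‖P n‖ * (ρ / C) ^ n ≤ (‖p n‖ * C ^ n) * (ρ / C) ^ n := by
            gcongr; exact hPn n
        _ = ‖p n‖ * ρ ^ n := by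
            rw [mul_assoc, ← mul_pow, mul_div_cancel₀ _ hC.ne']
    refine lt_of_lt_of_le ?_ h
    simp only [ENNReal.coe_pos]
    exact NNReal.coe_pos.1 (hδ ▸ div_pos hρ0' hC)
  have hPs := P.hasFPowerSeriesOnBall hrad
  refine ⟨fun v => P.sum (v - J x₀), ?_, ?_⟩
  · exact AnalyticAt.comp_of_eq hPs.analyticAt (by fun_prop) (by simp)
  · have h1 : Tendsto (fun x => J x - J x₀) (𝓝 x₀) (𝓝 0) := by
      have : ContinuousAt (fun x => J x - J x₀) x₀ := by fun_prop
      simpa [ContinuousAt] using this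
    have h2 : Tendsto (fun x => x - x₀) (𝓝 x₀) (𝓝 0) := by
      have : ContinuousAt (fun x => x - x₀) x₀ := by fun_prop
      simpa [ContinuousAt] using this
    filter_upwards [h1.eventually (Metric.eball_mem_nhds (0 : V) hrad),
      h2.eventually (Metric.eball_mem_nhds (0 : E) hp.r_pos)] with x hx1 hx2
    have h3 := hPs.hasSum hx1
    have h4 := hp.hasSum hx2
    rw [zero_add] at h3
    rw [add_sub_cancel] at h4
    refine h3.unique ?_
    convert! h4 using 2 with n
    have h5 : (fun _ : Fin n => x - x₀) = fun _ => ∑ i, c i (x - x₀) • e i := by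
      simp [hc]
    rw [h5, ContinuousMultilinearMap.map_sum]
    simp only [P, _root_.sum_apply, _root_.smul_apply,
      ContinuousMultilinearMap.compContinuousLinearMap_apply,
      ContinuousMultilinearMap.mkPiAlgebra_apply]
    refine Finset.sum_congr rfl fun s _ => ?_
    rw [ContinuousMultilinearMap.map_smul_univ, ← map_sub]
    simp only [hJ, smul_eq_mul, Complex.real_smul, Complex.ofReal_prod]
    ring

/-! ### The identity principle along real points -/

lemma eventually_zero_of_real {E : Type*} [NormedAddCommGroup E] [NormedSpace ℂ E]
    {G : ℂ × E → ℂ} {x₀ : E} (hG : AnalyticAt ℂ G (0, x₀)) (S : Set E)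
    (h : ∀ᶠ y in 𝓝 ((0 : ℝ), x₀), y.2 ∈ S → G (y.1, y.2) = 0) :
    ∀ᶠ y in 𝓝 ((0 : ℂ), x₀), y.2 ∈ S → G y = 0 := by
  obtain ⟨r, hr, hball⟩ := hG.exists_ball_analyticOnNhd
  rw [nhds_prod_eq] at h
  obtain ⟨pa, hpa, pb, hpb, hab⟩ := Filter.eventually_prod_iff.1 h
  rw [nhds_prod_eq]
  refine Filter.eventually_prod_iff.2 ⟨_, Metric.ball_mem_nhds (0 : ℂ) hr,
    fun x => pb x ∧ x ∈ Metric.ball x₀ r, hpb.and (Metric.ball_mem_nhds x₀ hr), ?_⟩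
  intro τ hτ x hx hxS
  have han : AnalyticOnNhd ℂ (fun τ => G (τ, x)) (Metric.ball 0 r) := by
    intro t ht
    refine (hball (t, x) ?_).comp₂ (f := fun t => t) (g := fun _ => x) analyticAt_id
      analyticAt_const
    rw [← ball_prod_same]
    exact ⟨ht, hx.2⟩
  refine han.eqOn_zero_of_preconnected_of_frequently_eq_zero
    (convex_ball (0 : ℂ) r).isPreconnected (Metric.mem_ball_self hr) ?_ hτ
  have h1 : Tendsto (fun t : ℝ => (t : ℂ)) (𝓝[≠] 0) (𝓝[≠] 0) := by
    refine tendsto_nhdsWithin_of_tendsto_nhds_of_eventually_within _ ?_ ?_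
    · exact (Complex.continuous_ofReal.tendsto' 0 0 (by simp)).mono_left nhdsWithin_le_nhds
    · filter_upwards [self_mem_nhdsWithin] with t ht
      simpa using ht
  refine h1.frequently (Eventually.frequently ?_)
  filter_upwards [nhdsWithin_le_nhds hpa] with t ht
  exact hab ht hx.1 hxS

lemma eventually_zero_of_real₁ {G : ℂ → ℂ} (hG : AnalyticAt ℂ G 0)
    (h : ∀ᶠ t : ℝ in 𝓝 0, G t = 0) : ∀ᶠ z in 𝓝 (0 : ℂ), G z = 0 := by
  have h1 : Tendsto (fun t : ℝ => (t : ℂ)) (𝓝[≠] 0) (𝓝[≠] 0) := by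
    refine tendsto_nhdsWithin_of_tendsto_nhds_of_eventually_within _ ?_ ?_
    · exact (Complex.continuous_ofReal.tendsto' 0 0 (by simp)).mono_left nhdsWithin_le_nhds
    · filter_upwards [self_mem_nhdsWithin] with t ht
      simpa using ht
  exact hG.frequently_zero_iff_eventually_zero.1
    (h1.frequently (Eventually.frequently (nhdsWithin_le_nhds h)))

/-- A holomorphic function of `(z, ζ, τ)` that vanishes for `ζ = z̄` and real `τ` is zero. -/
theorem eventually_zero_of_conj {D : ℂ × ℂ × ℂ → ℂ} (hD : AnalyticAt ℂ D 0)
    (h : ∀ᶠ y in 𝓝 (0 : ℂ × ℝ), D (y.1, star y.1, y.2) = 0) : ∀ᶠ y in 𝓝 0, D y = 0 := by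
  let A : ℂ × ℂ × ℂ → ℂ × ℂ × ℂ := fun y =>
    (y.1 + I * y.2.1, y.1 - I * y.2.1, y.2.2)
  have hA : ∀ y, AnalyticAt ℂ A y := fun y => by simp only [A]; fun_prop
  have hDA : AnalyticAt ℂ (D ∘ A) 0 := AnalyticAt.comp_of_eq hD (hA _) (by simp [A])
  have h1 : ∀ᶠ y in 𝓝 ((0 : ℝ), ((0 : ℂ), (0 : ℂ))),
      y.2 ∈ {x : ℂ × ℂ | x.1.im = 0 ∧ x.2.im = 0} → (D ∘ A) (y.1, y.2) = 0 := by
    have hc : Tendsto (fun y : ℝ × ℂ × ℂ => ((y.1 + I * y.2.1, y.2.2.re) : ℂ × ℝ))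
        (𝓝 (0, 0, 0)) (𝓝 0) :=
      Continuous.tendsto' (by fun_prop) _ _ (by simp)
    filter_upwards [hc.eventually h] with y hy hS
    have e1 : (y.2.1.re : ℂ) = y.2.1 := by apply Complex.ext <;> simp [hS.1]
    have e2 : (y.2.2.re : ℂ) = y.2.2 := by apply Complex.ext <;> simp [hS.2]
    simp only [Function.comp_apply, A]
    rw [← e1] at hy ⊢
    simpa [e2, sub_eq_add_neg] using hy
  have h2 := eventually_zero_of_real (x₀ := ((0 : ℂ), (0 : ℂ))) hDA _ h1
  let s1 : ℂ × ℂ × ℂ → ℂ × ℂ × ℂ := fun y => (y.2.1, y.1, y.2.2)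
  have hs1 : ∀ y, AnalyticAt ℂ s1 y := fun y => by simp only [s1]; fun_prop
  have h3 : ∀ᶠ y in 𝓝 ((0 : ℝ), ((0 : ℂ), (0 : ℂ))),
      y.2 ∈ {x : ℂ × ℂ | x.2.im = 0} → ((D ∘ A) ∘ s1) (y.1, y.2) = 0 := by
    have hc : Tendsto (fun y : ℝ × ℂ × ℂ => s1 (y.1, y.2)) (𝓝 (0, 0, 0)) (𝓝 (0, 0, 0)) :=
      Continuous.tendsto' (by simp only [s1]; fun_prop) _ _ (by simp [s1])
    filter_upwards [hc.eventually h2] with y hy hS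
    exact hy ⟨by simp [s1], hS⟩
  have h4 := eventually_zero_of_real (x₀ := ((0 : ℂ), (0 : ℂ)))
    (AnalyticAt.comp_of_eq hDA (hs1 _) (by simp [s1])) _ h3
  let s2 : ℂ × ℂ × ℂ → ℂ × ℂ × ℂ := fun y => (y.2.2, y.2.1, y.1)
  have hs2 : ∀ y, AnalyticAt ℂ s2 y := fun y => by simp only [s2]; fun_prop
  have h5 : ∀ᶠ y in 𝓝 ((0 : ℝ), ((0 : ℂ), (0 : ℂ))),
      y.2 ∈ (univ : Set (ℂ × ℂ)) → (((D ∘ A) ∘ s1) ∘ s2) (y.1, y.2) = 0 := by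
    have hc : Tendsto (fun y : ℝ × ℂ × ℂ => s2 (y.1, y.2)) (𝓝 (0, 0, 0)) (𝓝 (0, 0, 0)) :=
      Continuous.tendsto' (by simp only [s2]; fun_prop) _ _ (by simp [s2])
    filter_upwards [hc.eventually h4] with y hy _
    exact hy (by simp [s2])
  have h6 := eventually_zero_of_real (x₀ := ((0 : ℂ), (0 : ℂ)))
    (AnalyticAt.comp_of_eq (AnalyticAt.comp_of_eq hDA (hs1 0) (by simp [s1])) (hs2 _)
      (by simp [s2])) _ h5
  let B : ℂ × ℂ × ℂ → ℂ × ℂ × ℂ := fun y =>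
    (y.2.2, (y.1 + y.2.1) / 2, (y.1 - y.2.1) / (2 * I))
  have hB : Tendsto B (𝓝 0) (𝓝 (0, 0, 0)) :=
    Continuous.tendsto' (by simp only [B]; fun_prop) _ _ (by simp [B])
  filter_upwards [hB.eventually h6] with y hy
  have e : A (s1 (s2 (B y))) = y := by
    have hI : I ≠ 0 := Complex.I_ne_zero
    simp only [A, s1, s2, B]
    refine Prod.ext ?_ (Prod.ext ?_ rfl) <;> simp only <;> field_simp <;> ring
  have := hy (mem_univ _)
  simpa [Function.comp_apply, e] using this

/-! ### Implicit and inverse functions -/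

lemma isInvertible_of_apply_one_ne_zero {𝕜 : Type*} [RCLike 𝕜] {L : 𝕜 →L[𝕜] 𝕜} (h : L 1 ≠ 0) :
    L.IsInvertible := by
  refine ⟨ContinuousLinearEquiv.unitsEquivAut 𝕜 (Units.mk0 _ h), ?_⟩
  ext
  simp [ContinuousLinearEquiv.unitsEquivAut]

/-- The analytic implicit function theorem for a scalar equation. -/
theorem exists_implicit {𝕜 : Type*} [RCLike 𝕜] {E : Type*} [NormedAddCommGroup E]
    [NormedSpace 𝕜 E] [CompleteSpace E] {f : E × 𝕜 → 𝕜} {x₀ : E} {y₀ : 𝕜}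
    (hf : AnalyticAt 𝕜 f (x₀, y₀)) (h0 : f (x₀, y₀) = 0)
    (hd : fderiv 𝕜 f (x₀, y₀) (0, 1) ≠ 0) :
    ∃ ψ : E → 𝕜, AnalyticAt 𝕜 ψ x₀ ∧ ψ x₀ = y₀ ∧
      ∀ᶠ v in 𝓝 (x₀, y₀), (f v = 0 ↔ v.2 = ψ v.1) := by
  have hcd : ContDiffAt 𝕜 ω f (x₀, y₀) := hf.contDiffAt
  have hinv : (fderiv 𝕜 f (x₀, y₀) ∘L .inr 𝕜 E 𝕜).IsInvertible :=
    isInvertible_of_apply_one_ne_zero (by simpa using hd)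
  refine ⟨hcd.implicitFunction (by simp) hinv,
    (hcd.contDiffAt_implicitFunction (by simp) hinv).analyticAt,
    hcd.implicitFunction_apply_self (by simp) hinv, ?_⟩
  filter_upwards [hcd.eventually_apply_eq_iff_implicitFunction (by simp) hinv] with v hv
  rw [h0] at hv
  rw [hv, eq_comm]

/-- The analytic inverse function theorem. -/
theorem exists_openPartialHomeomorph {𝕜 : Type*} [RCLike 𝕜] {E F : Type*} [NormedAddCommGroup E]
    [NormedSpace 𝕜 E] [CompleteSpace E] [NormedAddCommGroup F] [NormedSpace 𝕜 F] [CompleteSpace F]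
    {f : E → F} {q : E} (hf : AnalyticAt 𝕜 f q) (hbij : Function.Bijective (fderiv 𝕜 f q)) :
    ∃ e : OpenPartialHomeomorph E F, (∀ x, e x = f x) ∧ q ∈ e.source ∧
      AnalyticAt 𝕜 e.symm (f q) := by
  have hcd : ContDiffAt 𝕜 ω f q := hf.contDiffAt
  let L : E ≃L[𝕜] F := ContinuousLinearEquiv.ofBijective (fderiv 𝕜 f q)
    (LinearMap.ker_eq_bot.2 hbij.1) (LinearMap.range_eq_top.2 hbij.2)
  have hL : HasFDerivAt f (L : E →L[𝕜] F) q := by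
    have : (L : E →L[𝕜] F) = fderiv 𝕜 f q := by ext; rfl
    rw [this]
    exact hf.differentiableAt.hasFDerivAt
  refine ⟨hcd.toOpenPartialHomeomorph f hL (by simp), fun x => rfl,
    hcd.mem_toOpenPartialHomeomorph_source hL (by simp), ?_⟩
  exact (hcd.to_localInverse hL (by simp)).analyticAt

/-! ### Partial derivatives -/

lemma analyticAt_fderiv_apply {𝕜 : Type*} [RCLike 𝕜] {E F : Type*} [NormedAddCommGroup E]
    [NormedSpace 𝕜 E] [NormedAddCommGroup F] [NormedSpace 𝕜 F] [CompleteSpace F]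
    {f : E → F} {x : E} (hf : AnalyticAt 𝕜 f x) (v : E) :
    AnalyticAt 𝕜 (fun y => fderiv 𝕜 f y v) x :=
  ((ContinuousLinearMap.apply 𝕜 F v).analyticAt _).comp hf.fderiv

lemma deriv_slice {E : Type*} [NormedAddCommGroup E] [NormedSpace ℂ E] {G : ℂ × E → ℂ}
    {y : ℂ × E} (hG : DifferentiableAt ℂ G y) :
    deriv (fun z => G (z, y.2)) y.1 = fderiv ℂ G y (1, 0) := by
  have h1 : HasDerivAt (fun z => (z, y.2)) ((1 : ℂ), (0 : E)) y.1 :=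
    (hasDerivAt_id _).prodMk (hasDerivAt_const _ _)
  exact (HasFDerivAt.comp_hasDerivAt y.1 (hG.hasFDerivAt) h1).deriv

theorem analyticAt_iteratedDeriv_slice {E : Type*} [NormedAddCommGroup E] [NormedSpace ℂ E]
    {G : ℂ × E → ℂ} {y₀ : ℂ × E} (hG : AnalyticAt ℂ G y₀) (k : ℕ) :
    AnalyticAt ℂ (fun y : ℂ × E => iteratedDeriv k (fun z => G (z, y.2)) y.1) y₀ := by
  induction k with
  | zero => simpa using hG
  | succ k ih =>
    refine (analyticAt_fderiv_apply ih (1, 0)).congr ?_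
    filter_upwards [ih.eventually_analyticAt] with y hy
    rw [← deriv_slice hy.differentiableAt]
    simp only [iteratedDeriv_succ]

open scoped ContDiff

/-! ### Straightening a holomorphic slope field -/

section FlowBox

local notation "I01" => unitInterval

/-- The path `τ ↦ (α τ, t τ)` as a function of `(t, α)`. -/
def graphPath : ℂ × C(I01, ℂ) →L[ℂ] C(I01, ℂ × ℂ) :=
  LinearMap.mkContinuous
    { toFun := fun y => ⟨fun s => (y.2 s, y.1 * ((s : ℝ) : ℂ)), by fun_prop⟩
      map_add' := by intro a b; ext s <;> simp [add_mul]
      map_smul' := by intro a b; ext s <;> simp [mul_assoc] }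
    1 (by
      intro y
      rw [one_mul, ContinuousMap.norm_le _ (norm_nonneg _)]
      intro s
      have h0 := s.2.1
      have h1 := s.2.2
      simp only [LinearMap.coe_mk, AddHom.coe_mk, ContinuousMap.coe_mk, Prod.norm_mk]
      refine max_le ((y.2.norm_coe_le_norm s).trans (norm_snd_le y)) ?_
      rw [norm_mul, Complex.norm_real, Real.norm_of_nonneg h0]
      exact (mul_le_of_le_one_right (norm_nonneg _) h1).trans (norm_fst_le y))

lemma graphPath_zero : graphPath (0, 0) = 0 := map_zero graphPath

lemma graphPath_apply (y : ℂ × C(I01, ℂ)) (s : I01) :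
    graphPath y s = (y.2 s, y.1 * ((s : ℝ) : ℂ)) := rfl

lemma star_integral (f : ℝ → ℂ) (b : ℝ) :
    star (∫ σ in (0 : ℝ)..b, f σ) = ∫ σ in (0 : ℝ)..b, star (f σ) := by
  simp only [intervalIntegral, star_sub]
  exact congrArg₂ (· - ·) integral_conj.symm integral_conj.symm

/-- Rescaling the time of a continuous path. -/
def rescale (l : I01) (α : C(I01, ℂ)) : C(I01, ℂ) := ⟨fun s => α (l * s), by fun_prop⟩

lemma volterra_rescale (l : I01) (α : C(I01, ℂ)) (τ : I01) :
    volterra α (l * τ) = ((l : ℝ) : ℂ) * volterra (rescale l α) τ := by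
  rw [volterra_apply, volterra_apply]
  have h' : ∫ σ in (0 : ℝ)..((l * τ : I01) : ℝ), IccExtend zero_le_one α σ
      = ((l : ℝ) : ℂ) * ∫ σ in (0 : ℝ)..τ, IccExtend zero_le_one α (l * σ) := by
    have := intervalIntegral.smul_integral_comp_mul_left (a := 0) (b := (τ : ℝ))
      (f := IccExtend zero_le_one α) (l : ℝ)
    rw [mul_zero] at this
    rw [← Complex.real_smul, this]
    rfl
  rw [h']
  congr 1
  refine intervalIntegral.integral_congr fun s hs => ?_
  rw [uIcc_of_le τ.2.1] at hs
  have hs1 : s ∈ Icc (0 : ℝ) 1 := ⟨hs.1, hs.2.trans τ.2.2⟩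
  rw [IccExtend_of_mem _ _ hs1]
  rw [IccExtend_of_mem _ _ (unitInterval.mul_mem l.2 hs1)]
  rfl

/-- Local solution of `Y_t = S(Y, t)`, `Y(s, 0) = s`, holomorphic in `(s, t)`. -/
theorem exists_flowBox {S : ℂ × ℂ → ℂ} (hS : AnalyticAt ℂ S 0)
    (hreal : ∀ᶠ y in 𝓝 (0 : ℂ × ℂ), reflect S y = S y) :
    ∃ Y : ℂ × ℂ → ℂ, AnalyticAt ℂ Y 0 ∧ (∀ᶠ s in 𝓝 (0 : ℂ), Y (s, 0) = s) ∧
      (∀ᶠ y in 𝓝 (0 : ℂ × ℂ), fderiv ℂ Y y (0, 1) = S (Y y, y.2)) ∧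
      (∀ᶠ y in 𝓝 (0 : ℂ × ℂ), reflect Y y = Y y) := by
  obtain ⟨N, hN, hNe⟩ := exists_analyticAt_superposition (K := I01) hS
  let cst : ℂ →L[ℂ] C(I01, ℂ) := ContinuousLinearMap.toSpanSingleton ℂ (1 : C(I01, ℂ))
  have hcst : ∀ s τ, cst s τ = s := by intro s τ; simp [cst]
  let Φ : (ℂ × ℂ) × C(I01, ℂ) → C(I01, ℂ) := fun v =>
    v.2 - cst v.1.1 - v.1.2 • volterra (N (graphPath (v.1.2, v.2)))
  have hgp : AnalyticAt ℂ (fun v : (ℂ × ℂ) × C(I01, ℂ) => graphPath (v.1.2, v.2)) 0 :=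
    (graphPath.analyticAt _).comp (by fun_prop)
  have hΦ : AnalyticAt ℂ Φ 0 := by
    have h2 : AnalyticAt ℂ (fun v : (ℂ × ℂ) × C(I01, ℂ) =>
        volterra (N (graphPath (v.1.2, v.2)))) 0 :=
      (volterra.analyticAt _).comp (AnalyticAt.comp_of_eq hN hgp (by simp [graphPath_zero]))
    have h3 : AnalyticAt ℂ (fun v : (ℂ × ℂ) × C(I01, ℂ) => cst v.1.1) 0 :=
      (cst.analyticAt _).comp (by fun_prop)
    have h4 : AnalyticAt ℂ (fun v : (ℂ × ℂ) × C(I01, ℂ) => v.1.2) 0 := by fun_prop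
    exact (analyticAt_snd.sub h3).sub (h4.smul h2)
  have hΦ0 : Φ (0, 0) = 0 := by
    ext τ
    simp [Φ, ContinuousMap.smul_apply]
  have hcd : ContDiffAt ℂ ω Φ ((0 : ℂ × ℂ), (0 : C(I01, ℂ))) := hΦ.contDiffAt
  have hinv : (fderiv ℂ Φ ((0 : ℂ × ℂ), (0 : C(I01, ℂ))) ∘L .inr ℂ (ℂ × ℂ) C(I01, ℂ)).IsInvertible := by
    have h1 : HasFDerivAt Φ (fderiv ℂ Φ ((0 : ℂ × ℂ), (0 : C(I01, ℂ)))) (0, 0) :=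
      hΦ.differentiableAt.hasFDerivAt
    have h2 : HasFDerivAt (fun α : C(I01, ℂ) => ((0 : ℂ × ℂ), α))
        (.inr ℂ (ℂ × ℂ) C(I01, ℂ)) 0 := (ContinuousLinearMap.inr ℂ (ℂ × ℂ) C(I01, ℂ)).hasFDerivAt
    have h3 := HasFDerivAt.comp (0 : C(I01, ℂ)) h1 h2
    have h4 : Φ ∘ (fun α : C(I01, ℂ) => ((0 : ℂ × ℂ), α)) = id := by
      funext α
      ext τ
      simp [Φ, ContinuousMap.smul_apply]
    rw [h4] at h3
    have h5 := h3.unique (hasFDerivAt_id _)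
    rw [h5]
    exact ⟨ContinuousLinearEquiv.refl ℂ _, by ext; rfl⟩
  set A := hcd.implicitFunction (by simp) hinv with hA
  have hAan : AnalyticAt ℂ A 0 := (hcd.contDiffAt_implicitFunction (by simp) hinv).analyticAt
  have hA0 : A 0 = 0 := hcd.implicitFunction_apply_self (by simp) hinv
  have hiff : ∀ᶠ v in 𝓝 ((0 : ℂ × ℂ), (0 : C(I01, ℂ))), Φ v = 0 ↔ A v.1 = v.2 := by
    filter_upwards [hcd.eventually_apply_eq_iff_implicitFunction (by simp) hinv] with v hv
    rwa [hΦ0] at hv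
  have hgp0 : Tendsto (fun v : (ℂ × ℂ) × C(I01, ℂ) => graphPath (v.1.2, v.2)) (𝓝 (0, 0)) (𝓝 0) := by
    have := hgp.continuousAt.tendsto
    rwa [Prod.fst_zero, Prod.snd_zero, Prod.snd_zero, graphPath_zero] at this
  have hboth := hiff.and (hgp0.eventually hNe)
  obtain ⟨δ, hδ, hδb⟩ := Metric.eventually_nhds_iff_ball.1 hboth
  have key : ∀ p : ℂ × ℂ, ‖p‖ < δ → ∀ α : C(I01, ℂ), ‖α‖ < δ →
      ((A p = α) ↔ ∀ τ : I01, α τ = p.1 + p.2 *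
        ∫ σ in (0 : ℝ)..τ, IccExtend zero_le_one
          (fun s : I01 => S (α s, p.2 * ((s : ℝ) : ℂ))) σ) := by
    intro p hp α hα
    have hmem : (p, α) ∈ Metric.ball ((0 : ℂ × ℂ), (0 : C(I01, ℂ))) δ := by
      rw [← ball_prod_same]
      exact ⟨by simpa using hp, by simpa using hα⟩
    obtain ⟨h1, h2⟩ := hδb _ hmem
    rw [← h1]
    have h3 : ∀ τ : I01, volterra (N (graphPath (p.2, α))) τ
        = ∫ σ in (0 : ℝ)..τ, IccExtend zero_le_one
          (fun s : I01 => S (α s, p.2 * ((s : ℝ) : ℂ))) σ := by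
      intro τ
      rw [volterra_apply]
      have h4 : (N (graphPath (p.2, α)) : I01 → ℂ)
          = fun s : I01 => S (α s, p.2 * ((s : ℝ) : ℂ)) := by
        funext s
        rw [h2, graphPath_apply, zero_add]
      rw [h4]
    constructor
    · intro h τ
      have := congrArg (fun β : C(I01, ℂ) => β τ) h
      simp only [Φ, ContinuousMap.sub_apply, ContinuousMap.smul_apply, hcst, h3,
        ContinuousMap.zero_apply, smul_eq_mul] at this
      linear_combination this
    · intro h
      ext τ
      simp only [Φ, ContinuousMap.sub_apply, ContinuousMap.smul_apply, hcst, h3,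
        ContinuousMap.zero_apply, smul_eq_mul]
      linear_combination h τ
  have hsmall : ∀ᶠ p in 𝓝 (0 : ℂ × ℂ), ‖p‖ < δ ∧ ‖A p‖ < δ := by
    have h1 : Tendsto (fun p => ‖A p‖) (𝓝 0) (𝓝 0) := by
      have := hAan.continuousAt.norm
      simpa [ContinuousAt, hA0] using this
    have h2 : Tendsto (fun p : ℂ × ℂ => ‖p‖) (𝓝 0) (𝓝 0) :=
      (continuous_norm.tendsto' _ _ (by simp))
    exact (h2.eventually (gt_mem_nhds hδ)).and (h1.eventually (gt_mem_nhds hδ))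
  obtain ⟨δ', hδ', hδb'⟩ := Metric.eventually_nhds_iff_ball.1 hsmall
  let Y : ℂ × ℂ → ℂ := fun p => A p 1
  have hY : AnalyticAt ℂ Y 0 :=
    ((ContinuousMap.evalCLM (M := ℂ) ℂ (1 : I01)).analyticAt _).comp hAan
  have hscale : ∀ p ∈ Metric.ball (0 : ℂ × ℂ) δ', ∀ l : I01,
      A p l = Y (p.1, p.2 * ((l : ℝ) : ℂ)) := by
    intro p hp l
    obtain ⟨hp1, hp2⟩ := hδb' p hp
    have hfix := (key p hp1 _ hp2).1 rfl
    have hp3 : ‖(p.1, p.2 * ((l : ℝ) : ℂ))‖ < δ := by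
      refine lt_of_le_of_lt ?_ hp1
      rw [Prod.norm_mk]
      refine max_le (norm_fst_le p) ?_
      rw [norm_mul, Complex.norm_real, Real.norm_of_nonneg l.2.1]
      exact (mul_le_of_le_one_right (norm_nonneg _) l.2.2).trans (norm_snd_le p)
    have hp4 : ‖rescale l (A p)‖ < δ := by
      refine lt_of_le_of_lt ?_ hp2
      rw [ContinuousMap.norm_le _ (norm_nonneg _)]
      exact fun s => (A p).norm_coe_le_norm _
    have := (key _ hp3 _ hp4).2 ?_
    · change _ = A _ 1
      rw [this]
      simp [rescale]
    · intro τ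
      change A p (l * τ) = _
      rw [hfix (l * τ)]
      have hmem : (p, A p) ∈ Metric.ball ((0 : ℂ × ℂ), (0 : C(I01, ℂ))) δ := by
        rw [← ball_prod_same]
        exact ⟨by simpa using hp1, by simpa using hp2⟩
      obtain ⟨-, h2⟩ := hδb _ hmem
      have h3 : (fun s : I01 => S (A p s, p.2 * ((s : ℝ) : ℂ))) = N (graphPath (p.2, A p)) := by
        funext s
        rw [h2, graphPath_apply, zero_add]
      have h4 := volterra_rescale l (N (graphPath (p.2, A p))) τ
      rw [volterra_apply, volterra_apply] at h4
      rw [h3, h4]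
      have h5 : (rescale l (N (graphPath (p.2, A p))) : I01 → ℂ)
          = fun s : I01 => S (rescale l (A p) s, p.2 * ((l : ℝ) : ℂ) * ((s : ℝ) : ℂ)) := by
        funext s
        change N (graphPath (p.2, A p)) (l * s) = S (A p (l * s), _)
        rw [h2, graphPath_apply, zero_add]
        push_cast
        ring_nf
      rw [h5]
      ring
  have hode : ∀ p ∈ Metric.ball (0 : ℂ × ℂ) (δ' / 2), DifferentiableAt ℂ Y p →
      ContinuousAt S (Y p, p.2) →
      p.2 * fderiv ℂ Y p (0, 1) = p.2 * S (Y p, p.2) := by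
    intro p hp hYp hSp
    have hp' : (p.1, 2 * p.2) ∈ Metric.ball (0 : ℂ × ℂ) δ' := by
      rw [mem_ball_zero_iff, Prod.norm_def, max_lt_iff] at hp ⊢
      simp only [norm_mul, Complex.norm_ofNat]
      exact ⟨by linarith [hp.1], by linarith [hp.2]⟩
    obtain ⟨hp1, hp2⟩ := hδb' _ hp'
    have hfix := (key _ hp1 _ hp2).1 rfl
    let c : I01 := ⟨1 / 2, by norm_num, by norm_num⟩
    set k : ℝ → ℂ := IccExtend zero_le_one
      (fun s : I01 => S (A (p.1, 2 * p.2) s, 2 * p.2 * ((s : ℝ) : ℂ))) with hk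
    have hkc : Continuous k := by
      have hmem : ((p.1, 2 * p.2), A (p.1, 2 * p.2)) ∈
          Metric.ball ((0 : ℂ × ℂ), (0 : C(I01, ℂ))) δ := by
        rw [← ball_prod_same]
        exact ⟨by simpa using hp1, by simpa using hp2⟩
      obtain ⟨-, h2⟩ := hδb _ hmem
      have h3 : (fun s : I01 => S (A (p.1, 2 * p.2) s, 2 * p.2 * ((s : ℝ) : ℂ)))
          = N (graphPath (2 * p.2, A (p.1, 2 * p.2))) := by
        funext s
        rw [h2, graphPath_apply, zero_add]
      rw [hk, h3]
      exact (ContinuousMap.continuous _).Icc_extend'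
    have hd1 : HasDerivAt (fun l : ℝ => p.1 + 2 * p.2 * ∫ σ in (0 : ℝ)..l, k σ)
        (2 * p.2 * k (1 / 2)) (1 / 2) := by
      have := intervalIntegral.integral_hasDerivAt_right (hkc.intervalIntegrable 0 (1 / 2))
        (hkc.stronglyMeasurableAtFilter _ _) hkc.continuousAt
      exact (this.const_mul (2 * p.2)).const_add _
    have hd2 : HasDerivAt (fun l : ℝ => Y (p.1, 2 * p.2 * (l : ℂ)))
        (2 * p.2 * fderiv ℂ Y p (0, 1)) (1 / 2) := by
      have h1 : HasDerivAt (fun l : ℝ => (p.1, 2 * p.2 * (l : ℂ))) ((0 : ℂ), 2 * p.2) (1 / 2) := by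
        refine (hasDerivAt_const _ _).prodMk ?_
        simpa using (Complex.ofRealCLM.hasDerivAt (x := (1 / 2 : ℝ))).const_mul (2 * p.2)
      have h0 : (p.1, 2 * p.2 * (((1 / 2 : ℝ)) : ℂ)) = p := by
        ext <;> push_cast <;> ring_nf
      have h2 : HasFDerivAt Y (fderiv ℂ Y p) (p.1, 2 * p.2 * (((1 / 2 : ℝ)) : ℂ)) := by
        rw [h0]; exact hYp.hasFDerivAt
      have h3 := (h2.restrictScalars ℝ).comp_hasDerivAt _ h1
      convert! h3 using 1
      have : ((0 : ℂ), 2 * p.2) = (2 * p.2) • ((0 : ℂ), (1 : ℂ)) := by simp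
      rw [ContinuousLinearMap.coe_restrictScalars', this, map_smul, smul_eq_mul]
    have heq : (fun l : ℝ => Y (p.1, 2 * p.2 * (l : ℂ))) =ᶠ[𝓝 (1 / 2)]
        fun l : ℝ => p.1 + 2 * p.2 * ∫ σ in (0 : ℝ)..l, k σ := by
      filter_upwards [Icc_mem_nhds (show (0 : ℝ) < 1 / 2 by norm_num)
        (show (1 / 2 : ℝ) < 1 by norm_num)] with l hl
      have h1 := hscale _ hp' ⟨l, hl⟩
      have h2 := hfix ⟨l, hl⟩
      simp only at h1 h2
      rw [← h1, h2]
    have huniq := hd2.unique (hd1.congr_of_eventuallyEq heq)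
    have hk2 : k (1 / 2) = S (Y p, p.2) := by
      rw [hk, IccExtend_of_mem _ _ c.2]
      have h1 := hscale _ hp' c
      simp only at h1
      have e : 2 * p.2 * (((c : I01) : ℝ) : ℂ) = p.2 := by
        simp only [c]; push_cast; ring
      rw [e] at h1
      change S (A (p.1, 2 * p.2) c, 2 * p.2 * (((c : I01) : ℝ) : ℂ)) = _
      rw [h1, e]
    rw [hk2] at huniq
    linear_combination huniq / 2
  have hSY : AnalyticAt ℂ (fun y : ℂ × ℂ => S (Y y, y.2)) 0 :=
    AnalyticAt.comp_of_eq hS (hY.prod analyticAt_snd)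
      (by change (Y 0, 0) = 0; simp [Y, hA0])
  refine ⟨Y, hY, ?_, ?_, ?_⟩
  · have hc := tendsto_prodMk_zero (E := ℂ)
    filter_upwards [hc.eventually hsmall] with s hs
    have := (key _ hs.1 _ hs.2).1 rfl 1
    simpa using this
  · have hcont : ContinuousAt (fun y : ℂ × ℂ => (Y y, y.2)) 0 :=
      hY.continuousAt.prodMk continuousAt_snd
    have hS' : ∀ᶠ y in 𝓝 (0 : ℂ × ℂ), ContinuousAt S (Y y, y.2) := by
      have h0 : ((Y 0, (0 : ℂ × ℂ).2) : ℂ × ℂ) = 0 := by simp [Y, hA0]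
      have := hcont.tendsto
      rw [h0] at this
      exact this.eventually hS.eventually_continuousAt
    let D : ℂ × ℂ → ℂ := fun y => fderiv ℂ Y y (0, 1) - S (Y y, y.2)
    have hD : AnalyticAt ℂ D 0 := (analyticAt_fderiv_apply hY _).sub hSY
    have h1 : ∀ᶠ y in 𝓝 (0 : ℂ × ℂ), y.2 ≠ 0 → D y = 0 := by
      filter_upwards [Metric.ball_mem_nhds (0 : ℂ × ℂ) (half_pos hδ'),
        hY.eventually_analyticAt, hS'] with y hy1 hy2 hy3 hy4
      have := hode y hy1 hy2.differentiableAt hy3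
      exact sub_eq_zero.2 (mul_left_cancel₀ hy4 this)
    filter_upwards [h1.eventually_nhds, hD.eventually_continuousAt] with y hy1 hy2
    have h3 : Tendsto (fun t : ℂ => D (y.1, y.2 + t)) (𝓝[≠] 0) (𝓝 (D y)) := by
      have : Tendsto (fun t : ℂ => (y.1, y.2 + t)) (𝓝 0) (𝓝 y) :=
        Continuous.tendsto' (by fun_prop) _ _ (by simp)
      exact (hy2.tendsto.comp this).mono_left nhdsWithin_le_nhds
    have h4 : ∀ᶠ t in 𝓝[≠] (0 : ℂ), D (y.1, y.2 + t) = 0 := by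
      have : Tendsto (fun t : ℂ => (y.1, y.2 + t)) (𝓝[≠] 0) (𝓝 y) :=
        (Continuous.tendsto' (by fun_prop) _ _ (by simp)).mono_left nhdsWithin_le_nhds
      have h5 : ∀ᶠ t in 𝓝[≠] (0 : ℂ), y.2 + t ≠ 0 := by
        by_cases h : y.2 = 0
        · filter_upwards [self_mem_nhdsWithin] with t ht
          simpa [h] using ht
        · have : Tendsto (fun t : ℂ => y.2 + t) (𝓝[≠] 0) (𝓝 y.2) :=
            (Continuous.tendsto' (by fun_prop) _ _ (by simp)).mono_left nhdsWithin_le_nhds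
          exact this.eventually (isOpen_ne.mem_nhds h)
      filter_upwards [this.eventually hy1, h5] with t ht1 ht2
      exact ht1 ht2
    have h6 : D y = 0 := tendsto_nhds_unique (h3.congr' h4) tendsto_const_nhds
    exact sub_eq_zero.1 h6
  · obtain ⟨δ₂, hδ₂, hreal'⟩ := Metric.eventually_nhds_iff_ball.1 hreal
    have hsmall2 : ∀ᶠ p in 𝓝 (0 : ℂ × ℂ), ‖p‖ < δ₂ ∧ ‖A p‖ < δ₂ := by
      have h1 : Tendsto (fun p => ‖A p‖) (𝓝 0) (𝓝 0) := by
        have := hAan.continuousAt.norm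
        simpa [ContinuousAt, hA0] using this
      have h2 : Tendsto (fun p : ℂ × ℂ => ‖p‖) (𝓝 0) (𝓝 0) :=
        (continuous_norm.tendsto' _ _ (by simp))
      exact (h2.eventually (gt_mem_nhds hδ₂)).and (h1.eventually (gt_mem_nhds hδ₂))
    have hst : Tendsto (fun p : ℂ × ℂ => star p) (𝓝 0) (𝓝 0) :=
      continuous_star.tendsto' _ _ (by simp)
    filter_upwards [hst.eventually hsmall, hst.eventually hsmall2] with p hp hp2
    have hfix := (key _ hp.1 _ hp.2).1 rfl
    have h1 : A p = star (A (star p)) := by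
      have hn : ‖star (A (star p))‖ < δ :=
        lt_of_le_of_lt ((ContinuousMap.norm_le _ (norm_nonneg _)).2 fun s => by
          simpa using (A (star p)).norm_coe_le_norm s) hp.2
      refine (key p (by simpa using hp.1) _ hn).2 fun τ => ?_
      rw [ContinuousMap.star_apply, hfix τ, star_add, star_mul', star_integral]
      congr 1
      · simp
      · congr 1
        · simp
        · refine intervalIntegral.integral_congr fun s hs => ?_
          rw [uIcc_of_le τ.2.1] at hs
          have hs1 : s ∈ Icc (0 : ℝ) 1 := ⟨hs.1, hs.2.trans τ.2.2⟩
          rw [IccExtend_of_mem _ _ hs1, IccExtend_of_mem _ _ hs1]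
          have hm : ((star (A (star p)) : C(I01, ℂ)) ⟨s, hs1⟩, p.2 * (s : ℂ)) ∈
              Metric.ball (0 : ℂ × ℂ) δ₂ := by
            rw [mem_ball_zero_iff, Prod.norm_mk, max_lt_iff]
            refine ⟨lt_of_le_of_lt ?_ hp2.2, lt_of_le_of_lt ?_ hp2.1⟩
            · simpa using (A (star p)).norm_coe_le_norm ⟨s, hs1⟩
            · rw [norm_mul, Complex.norm_real, Real.norm_of_nonneg hs1.1, norm_star]
              exact (mul_le_of_le_one_right (norm_nonneg _) hs1.2).trans (norm_snd_le p)
          have := hreal' _ hm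
          change star _ = S _
          rw [← this, reflect_apply]
          simp [Prod.star_def]
    change star (A (star p) 1) = A p 1
    rw [h1]
    rfl

end FlowBox

/-! ### Taylor jets at the origin -/

/-- The Taylor series at `0` of a function of one variable. -/
def jet (u : ℂ → ℂ) : PowerSeries ℂ := PowerSeries.mk fun n => iteratedDeriv n u 0 / n.factorial

lemma coeff_jet (u : ℂ → ℂ) (n : ℕ) :
    PowerSeries.coeff n (jet u) = iteratedDeriv n u 0 / n.factorial := PowerSeries.coeff_mk _ _

lemma coeff_zero_jet (u : ℂ → ℂ) : PowerSeries.coeff 0 (jet u) = u 0 := by simp [coeff_jet]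

lemma coeff_one_jet (u : ℂ → ℂ) : PowerSeries.coeff 1 (jet u) = deriv u 0 := by
  simp [coeff_jet, iteratedDeriv_one]

lemma jet_congr {u v : ℂ → ℂ} (h : u =ᶠ[𝓝 0] v) : jet u = jet v := by
  ext n
  rw [coeff_jet, coeff_jet, h.iteratedDeriv_eq n]

lemma jet_mul {u v : ℂ → ℂ} (hu : AnalyticAt ℂ u 0) (hv : AnalyticAt ℂ v 0) :
    jet (fun z => u z * v z) = jet u * jet v := by
  ext n
  rw [coeff_jet, PowerSeries.coeff_mul, iteratedDeriv_fun_mul hu.contDiffAt hv.contDiffAt,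
    Finset.Nat.sum_antidiagonal_eq_sum_range_succ_mk, Finset.sum_div]
  refine Finset.sum_congr rfl fun i hi => ?_
  have hi' : i ≤ n := Nat.lt_succ_iff.1 (Finset.mem_range.1 hi)
  rw [coeff_jet, coeff_jet, Nat.cast_choose ℂ hi']
  have h1 : (n.factorial : ℂ) ≠ 0 := by exact_mod_cast n.factorial_ne_zero
  have h2 : (i.factorial : ℂ) ≠ 0 := by exact_mod_cast i.factorial_ne_zero
  have h3 : ((n - i).factorial : ℂ) ≠ 0 := by exact_mod_cast (n - i).factorial_ne_zero
  field_simp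

lemma jet_add {u v : ℂ → ℂ} (hu : AnalyticAt ℂ u 0) (hv : AnalyticAt ℂ v 0) :
    jet (fun z => u z + v z) = jet u + jet v := by
  ext n
  rw [coeff_jet, map_add, coeff_jet, coeff_jet, iteratedDeriv_fun_add hu.contDiffAt hv.contDiffAt,
    add_div]

lemma jet_const_mul (u : ℂ → ℂ) (c : ℂ) :
    jet (fun z => c * u z) = PowerSeries.C c * jet u := by
  ext n
  rw [coeff_jet, PowerSeries.coeff_C_mul, coeff_jet, iteratedDeriv_const_mul_field, mul_div_assoc]

lemma jet_const (c : ℂ) : jet (fun _ => c) = PowerSeries.C c := by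
  ext n
  rw [coeff_jet, PowerSeries.coeff_C, iteratedDeriv_const]
  split_ifs with h <;> simp [h]

lemma jet_id : jet (fun z => z) = PowerSeries.X := by
  ext n
  rw [coeff_jet, PowerSeries.coeff_X, iteratedDeriv_fun_id_zero]
  split_ifs with h <;> simp [h]

lemma jet_pow {u : ℂ → ℂ} (hu : AnalyticAt ℂ u 0) (k : ℕ) :
    jet (fun z => u z ^ k) = jet u ^ k := by
  induction k with
  | zero => simpa using jet_const 1
  | succ k ih =>
    have h := jet_mul (hu.fun_pow k) hu
    rw [pow_succ, ← ih, ← h]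
    rfl

/-! ### Double power series expansions -/

section

variable {E : Type*} [NormedAddCommGroup E] [NormedSpace ℂ E]

/-- The coefficient of `ζ^l` in the Taylor expansion of `G (z, ζ, τ)` at `ζ = 0`. -/
def coeffSnd (G : ℂ × ℂ × E → ℂ) (l : ℕ) (x : ℂ × E) : ℂ :=
  iteratedDeriv l (fun ζ => G (x.1, ζ, x.2)) 0 / l.factorial

/-- The coefficient of `z^k ζ^l` in the Taylor expansion of `G (z, ζ, τ)` at `z = ζ = 0`. -/
def coeffBoth (G : ℂ × ℂ × E → ℂ) (k l : ℕ) (τ : E) : ℂ :=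
  iteratedDeriv k (fun z => coeffSnd G l (z, τ)) 0 / k.factorial

lemma analyticAt_coeffSnd {G : ℂ × ℂ × E → ℂ} {x : ℂ × E} (hG : AnalyticAt ℂ G (x.1, 0, x.2))
    (l : ℕ) : AnalyticAt ℂ (coeffSnd G l) x := by
  let G' : ℂ × ℂ × E → ℂ := fun y => G (y.2.1, y.1, y.2.2)
  have hG' : AnalyticAt ℂ G' (0, x) :=
    AnalyticAt.comp_of_eq hG (f := fun y : ℂ × ℂ × E => (y.2.1, y.1, y.2.2)) (by fun_prop) rfl
  have h := analyticAt_iteratedDeriv_slice hG' l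
  have h2 : AnalyticAt ℂ (fun x : ℂ × E => iteratedDeriv l (fun z => G' (z, x)) 0) x :=
    h.comp_of_eq (f := fun x : ℂ × E => ((0 : ℂ), x)) (by fun_prop) rfl
  exact h2.div_const

lemma analyticAt_coeffBoth {G : ℂ × ℂ × E → ℂ} {τ : E} (hG : AnalyticAt ℂ G (0, 0, τ))
    (k l : ℕ) : AnalyticAt ℂ (coeffBoth G k l) τ := by
  have h := analyticAt_iteratedDeriv_slice (y₀ := ((0 : ℂ), τ)) (analyticAt_coeffSnd hG l) k
  have h2 : AnalyticAt ℂ (fun τ : E => iteratedDeriv k (fun z => coeffSnd G l (z, τ)) 0) τ :=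
    h.comp_of_eq (f := fun τ : E => ((0 : ℂ), τ)) (by fun_prop) rfl
  exact h2.div_const

end

theorem exists_hasSum_coeffBoth {G : ℂ × ℂ × ℂ → ℂ} (hG : AnalyticAt ℂ G 0) :
    ∃ ε : ℝ, 0 < ε ∧ (∀ k l τ, ‖τ‖ < ε → AnalyticAt ℂ (coeffBoth G k l) τ) ∧
      (∀ z τ : ℂ, ‖z‖ < ε → ‖τ‖ < ε → ∀ l,
        HasSum (fun k => coeffBoth G k l τ * z ^ k) (coeffSnd G l (z, τ))) ∧
      ∀ z ζ τ : ℂ, ‖z‖ < ε → ‖ζ‖ < ε → ‖τ‖ < ε →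
        HasSum (fun n : ℕ × ℕ => coeffBoth G n.1 n.2 τ * z ^ n.1 * ζ ^ n.2) (G (z, ζ, τ)) := by
  obtain ⟨C, hCdef⟩ : ∃ C, C = ‖G 0‖ + 1 := ⟨_, rfl⟩
  have hCpos : 0 < C := by rw [hCdef]; positivity
  have hbd : ∀ᶠ y in 𝓝 (0 : ℂ × ℂ × ℂ), AnalyticAt ℂ G y ∧ ‖G y‖ ≤ C := by
    refine hG.eventually_analyticAt.and ?_
    have := hG.continuousAt.norm.eventually (ge_mem_nhds (show ‖G 0‖ < C by linarith))
    exact this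
  obtain ⟨R, hR, hRb⟩ := Metric.eventually_nhds_iff_ball.1 hbd
  obtain ⟨r, hr0, hrR⟩ := exists_between hR
  have hmem : ∀ z ζ τ : ℂ, ‖z‖ < R → ‖ζ‖ < R → ‖τ‖ < R →
      ((z, ζ, τ) : ℂ × ℂ × ℂ) ∈ Metric.ball (0 : ℂ × ℂ × ℂ) R := by
    intro z ζ τ h1 h2 h3
    rw [mem_ball_zero_iff, Prod.norm_mk, Prod.norm_mk]
    exact max_lt h1 (max_lt h2 h3)
  have hslice : ∀ z τ : ℂ, ‖z‖ < R → ‖τ‖ < R →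
      DifferentiableOn ℂ (fun ζ => G (z, ζ, τ)) (Metric.ball 0 R) := by
    intro z τ hz hτ ζ hζ
    have h1 : DifferentiableAt ℂ G (z, ζ, τ) :=
      (hRb _ (hmem z ζ τ hz (by simpa using hζ) hτ)).1.differentiableAt
    exact (DifferentiableAt.comp ζ (f := fun ζ => (z, ζ, τ)) h1 (by fun_prop)).differentiableWithinAt
  have hsub : Metric.closedBall (0 : ℂ) r ⊆ Metric.ball 0 R := Metric.closedBall_subset_ball hrR
  have he : ∀ l z τ, ‖z‖ < R → ‖τ‖ < R → ‖coeffSnd G l (z, τ)‖ ≤ C / r ^ l := by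
    intro l z τ hz hτ
    have hd : DiffContOnCl ℂ (fun ζ => G (z, ζ, τ)) (Metric.ball 0 r) :=
      (((hslice z τ hz hτ).mono hsub).diffContOnCl_ball subset_rfl)
    have := Complex.norm_iteratedDeriv_le_of_forall_mem_sphere_norm_le l hr0 hd (C := C) (by
      intro ζ hζ
      refine (hRb _ (hmem z ζ τ hz ?_ hτ)).2
      rw [mem_sphere_zero_iff_norm] at hζ
      linarith)
    rw [coeffSnd, norm_div, Complex.norm_natCast, div_le_iff₀ (by positivity)]
    calc _ ≤ _ := this
      _ = _ := by ring
  have hesl : ∀ l τ, ‖τ‖ < R →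
      DifferentiableOn ℂ (fun z => coeffSnd G l (z, τ)) (Metric.ball 0 R) := by
    intro l τ hτ z hz
    have h1 : DifferentiableAt ℂ (coeffSnd G l) (z, τ) :=
      (analyticAt_coeffSnd (hRb _ (hmem z 0 τ (by simpa using hz) (by simpa using hR) hτ)).1
        l).differentiableAt
    exact (DifferentiableAt.comp z (f := fun z => (z, τ)) h1 (by fun_prop)).differentiableWithinAt
  have hdb : ∀ k l τ, ‖τ‖ < R → ‖coeffBoth G k l τ‖ ≤ C / r ^ l / r ^ k := by
    intro k l τ hτ
    have hd : DiffContOnCl ℂ (fun z => coeffSnd G l (z, τ)) (Metric.ball 0 r) :=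
      (((hesl l τ hτ).mono hsub).diffContOnCl_ball subset_rfl)
    have := Complex.norm_iteratedDeriv_le_of_forall_mem_sphere_norm_le k hr0 hd (C := C / r ^ l) (by
      intro z hz
      refine he l z τ ?_ hτ
      rw [mem_sphere_zero_iff_norm] at hz
      linarith)
    rw [coeffBoth, norm_div, Complex.norm_natCast, div_le_iff₀ (by positivity)]
    calc _ ≤ _ := this
      _ = _ := by ring
  have hsum1 : ∀ z τ : ℂ, ‖z‖ < R → ‖τ‖ < R → ∀ l,
      HasSum (fun k => coeffBoth G k l τ * z ^ k) (coeffSnd G l (z, τ)) := by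
    intro z τ hz hτ l
    have := Complex.hasSum_taylorSeries_on_ball (hesl l τ hτ) (z := z) (by simpa using hz)
    convert! this using 2 with k
    simp only [coeffBoth, sub_zero, smul_eq_mul]
    ring
  refine ⟨r, hr0, ?_, fun z τ hz hτ => hsum1 z τ (hz.trans hrR) (hτ.trans hrR), ?_⟩
  · intro k l τ hτ
    exact analyticAt_coeffBoth (hRb _ (hmem 0 0 τ (by simpa using hR) (by simpa using hR)
      (hτ.trans hrR))).1 k l
  · intro z ζ τ hz hζ hτ
    have hsummable : Summable (fun n : ℕ × ℕ => coeffBoth G n.1 n.2 τ * z ^ n.1 * ζ ^ n.2) := by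
      have h1 : Summable (fun n : ℕ × ℕ => ((‖z‖ / r) ^ n.1) * (C * (‖ζ‖ / r) ^ n.2)) := by
        refine Summable.mul_of_nonneg
          (summable_geometric_of_lt_one (by positivity) ((div_lt_one hr0).2 hz))
          ((summable_geometric_of_lt_one (by positivity) ((div_lt_one hr0).2 hζ)).mul_left C)
          (fun _ => by simp only [Pi.zero_apply]; positivity)
          (fun _ => by simp only [Pi.zero_apply]; positivity)
      refine Summable.of_norm_bounded h1 fun n => ?_
      rw [norm_mul, norm_mul, norm_pow, norm_pow]
      calc ‖coeffBoth G n.1 n.2 τ‖ * ‖z‖ ^ n.1 * ‖ζ‖ ^ n.2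
          ≤ C / r ^ n.2 / r ^ n.1 * ‖z‖ ^ n.1 * ‖ζ‖ ^ n.2 := by
            gcongr
            exact hdb _ _ _ (hτ.trans hrR)
        _ = _ := by
            rw [div_pow, div_pow]
            field_simp
    have h2 : HasSum (fun l => coeffSnd G l (z, τ) * ζ ^ l) (G (z, ζ, τ)) := by
      have := Complex.hasSum_taylorSeries_on_ball (hslice z τ (hz.trans hrR) (hτ.trans hrR))
        (z := ζ) (by simpa using hζ.trans hrR)
      convert! this using 2 with l
      simp only [coeffSnd, sub_zero, smul_eq_mul]
      ring
    have h3 := ((Equiv.prodComm ℕ ℕ).summable_iff.2 hsummable).hasSum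
    have h4 := h3.prod_fiberwise (fun l =>
      (hsum1 z τ (hz.trans hrR) (hτ.trans hrR) l).mul_right (ζ ^ l))
    have h5 := h4.unique h2
    have h6 : ∑' b : ℕ × ℕ, ((fun n : ℕ × ℕ => coeffBoth G n.1 n.2 τ * z ^ n.1 * ζ ^ n.2) ∘
        Equiv.prodComm ℕ ℕ) b = _ := (Equiv.prodComm ℕ ℕ).tsum_eq
      (fun n : ℕ × ℕ => coeffBoth G n.1 n.2 τ * z ^ n.1 * ζ ^ n.2)
    rw [← h5, h6]
    exact hsummable.hasSum

/-- Uniqueness of expansions in powers of `z` and `z̄`. -/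
theorem eq_zero_of_hasSum_conj {a : ℕ → ℕ → ℂ} {ε : ℝ} (hε : 0 < ε)
    (h : ∀ z : ℂ, ‖z‖ < ε →
      HasSum (fun n : ℕ × ℕ => a n.1 n.2 * z ^ n.1 * (starRingEnd ℂ z) ^ n.2) 0) (k l : ℕ) :
    a k l = 0 := by
  have hdiag : ∀ w : ℂ, ‖w‖ = 1 → ∀ n,
      ∑ m ∈ Finset.HasAntidiagonal.antidiagonal n, a m.1 m.2 * w ^ m.1 * (starRingEnd ℂ w) ^ m.2 = 0 := by
    intro w hw
    let b : ℕ → ℂ := fun n =>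
      ∑ m ∈ Finset.HasAntidiagonal.antidiagonal n, a m.1 m.2 * w ^ m.1 * (starRingEnd ℂ w) ^ m.2
    have hser : ∀ t : ℝ, |t| < ε → HasSum (fun n => b n * (t : ℂ) ^ n) 0 := by
      intro t ht
      have h1 := h (t * w) (by simpa [hw] using ht)
      rw [← (Finset.HasAntidiagonal.sigmaAntidiagonalEquivProd).hasSum_iff] at h1
      have h2 := h1.sigma (fun n => hasSum_fintype _)
      convert! h2 using 2 with n
      have h3 := Finset.sum_coe_sort (Finset.HasAntidiagonal.antidiagonal n)
        (fun m => a m.1 m.2 * (t * w) ^ m.1 * (starRingEnd ℂ (t * w)) ^ m.2)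
      rw [Finset.sum_mul]
      refine Eq.trans ?_ h3.symm
      refine Finset.sum_congr rfl fun m hm => ?_
      rw [← Finset.HasAntidiagonal.mem_antidiagonal.1 hm]
      simp only [map_mul, Complex.conj_ofReal, mul_pow, pow_add]
      ring
    let p : FormalMultilinearSeries ℝ ℝ ℂ := fun n =>
      ContinuousMultilinearMap.mkPiRing ℝ (Fin n) (b n)
    have hp : HasFPowerSeriesAt (fun _ : ℝ => (0 : ℂ)) p 0 := by
      rw [hasFPowerSeriesAt_iff]
      filter_upwards [Metric.ball_mem_nhds (0 : ℝ) hε] with t ht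
      convert! hser t (by simpa using ht) using 2 with n
      simp [p, FormalMultilinearSeries.coeff, mul_comm]
    intro n
    have h0 : p n = 0 := by rw [HasFPowerSeriesAt.eq_zero hp]; rfl
    have h1 := congrArg (fun q => q (fun _ : Fin n => (1 : ℝ))) h0
    simpa [p] using h1
  let P : Polynomial ℂ := ∑ m ∈ Finset.HasAntidiagonal.antidiagonal (k + l),
    Polynomial.C (a m.1 m.2) * Polynomial.X ^ (2 * m.1)
  have hP : P = 0 := by
    have hinf : (Metric.sphere (0 : ℂ) 1).Infinite := by
      refine (isPreconnected_sphere (by rw [Complex.rank_real_complex]; norm_num) 0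
        1).infinite_of_nontrivial ⟨1, by simp, -1, by simp, ?_⟩
      norm_num
    refine Polynomial.eq_zero_of_infinite_isRoot P (hinf.mono fun w hw => ?_)
    have hw1 : ‖w‖ = 1 := by simpa using hw
    have hw2 : w * starRingEnd ℂ w = 1 := by
      rw [Complex.mul_conj, Complex.normSq_eq_norm_sq, hw1]; simp
    have h1 := hdiag w hw1 (k + l)
    simp only [Set.mem_ofPred_eq, Polynomial.IsRoot.def, P, Polynomial.eval_finsetSum,
      Polynomial.eval_mul, Polynomial.eval_C, Polynomial.eval_pow, Polynomial.eval_X]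
    rw [← mul_zero (w ^ (k + l)), ← h1, Finset.mul_sum]
    refine Finset.sum_congr rfl fun m hm => ?_
    rw [← Finset.HasAntidiagonal.mem_antidiagonal.1 hm, pow_add]
    have h2 : w ^ m.2 * (starRingEnd ℂ w) ^ m.2 = 1 := by rw [← mul_pow, hw2, one_pow]
    linear_combination (-a m.1 m.2 * w ^ (2 * m.1)) * h2
  have hc := congrArg (fun Q => Polynomial.coeff Q (2 * k)) hP
  simp only [P, Polynomial.finsetSum_coeff, Polynomial.coeff_C_mul, Polynomial.coeff_X_pow,
    Polynomial.coeff_zero] at hc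
  rw [Finset.sum_eq_single (k, l)] at hc
  · simpa using hc
  · intro m hm hne
    have : 2 * k ≠ 2 * m.1 := by
      intro h2
      have h3 := Finset.HasAntidiagonal.mem_antidiagonal.1 hm
      exact hne (Prod.ext (by simp only; omega) (by simp only; omega))
    simp [this]
  · intro hm
    simp at hm

/-! ### Graphs and their Segre functions -/

@[simp] lemma prod_mk_zero_zero {α β : Type*} [Zero α] [Zero β] : ((0 : α), (0 : β)) = 0 := rfl

lemma analyticAt_ofReal {E : Type*} [NormedAddCommGroup E] [NormedSpace ℝ E] {f : E → ℝ} {x : E}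
    (hf : AnalyticAt ℝ f x) : AnalyticAt ℝ (fun y => (f y : ℂ)) x :=
  (Complex.ofRealCLM.analyticAt _).comp hf

/-- The complexification of a real-analytic function of `(z, u)`. -/
theorem exists_complexification_graph {φ : ℂ × ℝ → ℝ} (hφ : AnalyticAt ℝ φ 0) :
    ∃ F : ℂ × ℂ × ℂ → ℂ, AnalyticAt ℂ F 0 ∧
      ∀ᶠ x in 𝓝 (0 : ℂ × ℝ), F (x.1, star x.1, x.2) = φ x := by
  let e : Fin 3 → ℂ × ℝ := ![(1, 0), (I, 0), (0, 1)]
  let c : Fin 3 → ℂ × ℝ → ℝ := ![fun x => x.1.re, fun x => x.1.im, fun x => x.2]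
  let p1 : ℂ × ℂ × ℂ →L[ℂ] ℂ := .fst ℂ ℂ (ℂ × ℂ)
  let p2 : ℂ × ℂ × ℂ →L[ℂ] ℂ := (ContinuousLinearMap.fst ℂ ℂ ℂ).comp (.snd ℂ ℂ (ℂ × ℂ))
  let p3 : ℂ × ℂ × ℂ →L[ℂ] ℂ := (ContinuousLinearMap.snd ℂ ℂ ℂ).comp (.snd ℂ ℂ (ℂ × ℂ))
  let ℓ : Fin 3 → ℂ × ℂ × ℂ →L[ℂ] ℂ :=
    ![(2⁻¹ : ℂ) • (p1 + p2), ((2 * I)⁻¹ : ℂ) • (p1 - p2), p3]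
  let J : ℂ × ℝ →L[ℝ] ℂ × ℂ × ℂ := (ContinuousLinearMap.fst ℝ ℂ ℝ).prod
    ((((Complex.conjCLE : ℂ ≃L[ℝ] ℂ) : ℂ →L[ℝ] ℂ).comp (.fst ℝ ℂ ℝ)).prod
      (Complex.ofRealCLM.comp (.snd ℝ ℂ ℝ)))
  obtain ⟨F, hF, hFe⟩ := exists_complexification (analyticAt_ofReal hφ) e c
    (by
      intro x
      rw [Fin.sum_univ_three]
      refine Prod.ext ?_ ?_
      · apply Complex.ext <;> simp [e, c]
      · simp [e, c]) ℓ J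
    (by
      intro i x
      have hI : I ≠ 0 := Complex.I_ne_zero
      have h1 : x.1 + (starRingEnd ℂ) x.1 = 2 * (x.1.re : ℂ) := by
        rw [Complex.add_conj]; push_cast; ring
      have h2 : x.1 - (starRingEnd ℂ) x.1 = 2 * I * (x.1.im : ℂ) := by
        rw [Complex.sub_conj]; push_cast; ring
      fin_cases i
      · simp [ℓ, p1, p2, J, c]
        linear_combination (1 / 2 : ℂ) * h1
      · simp [ℓ, p1, p2, J, c, h2]
        field_simp
        simp [Complex.I_sq]
      · simp [ℓ, p3, J, c])
  rw [map_zero] at hF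
  exact ⟨F, hF, hFe⟩

/-- The derivative of the complexification in the direction of the real variable is real. -/
lemma im_fderiv_complexification {φ : ℂ × ℝ → ℝ} {F : ℂ × ℂ × ℂ → ℂ} (hφ : AnalyticAt ℝ φ 0)
    (hF : AnalyticAt ℂ F 0) (hFe : ∀ᶠ x in 𝓝 (0 : ℂ × ℝ), F (x.1, star x.1, x.2) = φ x) :
    (fderiv ℂ F 0 (0, 0, 1)).im = 0 := by
  have h1 : HasDerivAt (fun t : ℝ => (((0 : ℂ), (0 : ℂ), (t : ℂ)) : ℂ × ℂ × ℂ)) (0, 0, 1) 0 :=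
    (hasDerivAt_const _ _).prodMk ((hasDerivAt_const _ _).prodMk
      (Complex.ofRealCLM.hasDerivAt (x := (0 : ℝ))))
  have h2 : HasDerivAt (fun t : ℝ => F (0, 0, (t : ℂ))) (fderiv ℂ F 0 (0, 0, 1)) 0 :=
    HasFDerivAt.comp_hasDerivAt_of_eq (0 : ℝ)
      (hF.differentiableAt.hasFDerivAt.restrictScalars ℝ) h1 (by simp)
  have h3 : HasDerivAt (fun t : ℝ => ((0 : ℂ), t)) ((0 : ℂ), (1 : ℝ)) 0 :=
    (hasDerivAt_const _ _).prodMk (hasDerivAt_id _)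
  have h4 : HasDerivAt (fun t : ℝ => φ (0, t)) (fderiv ℝ φ 0 (0, 1)) 0 :=
    HasFDerivAt.comp_hasDerivAt_of_eq (0 : ℝ) hφ.differentiableAt.hasFDerivAt h3 rfl
  have h5 := h4.ofReal_comp
  have h6 : (fun t : ℝ => F (0, 0, (t : ℂ))) =ᶠ[𝓝 0] fun t : ℝ => ((φ (0, t) : ℝ) : ℂ) := by
    have hc : Tendsto (fun t : ℝ => ((0 : ℂ), t)) (𝓝 0) (𝓝 0) :=
      Continuous.tendsto' (by fun_prop) _ _ rfl
    filter_upwards [hc.eventually hFe] with t ht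
    simpa using ht
  rw [h2.unique (h5.congr_of_eventuallyEq h6), Complex.ofReal_im]

lemma one_sub_I_mul_ne_zero {c : ℂ} (hc : c.im = 0) : 1 - I * c ≠ 0 := by
  intro h
  have := congrArg Complex.re h
  simp [hc] at this

lemma eq_I_mul_two_im (w : ℂ) : w - star w = 2 * I * (w.im : ℂ) := by
  have := Complex.sub_conj w
  rw [← starRingEnd_apply, this]; push_cast; ring

lemma eq_two_re (w : ℂ) : (w + star w) / 2 = (w.re : ℂ) := by
  have := Complex.add_conj w
  rw [← starRingEnd_apply, this]; push_cast; ring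

/-- The Segre function of the graph `v = φ(z, u)`: the graph is given near `0` by the equation
`w = Q(z, z̄, w̄)` with a holomorphic function `Q`. -/
theorem exists_segre {φ : ℂ × ℝ → ℝ} (hφ : AnalyticAt ℝ φ 0) (h0 : φ 0 = 0)
    {F : ℂ × ℂ × ℂ → ℂ} (hF : AnalyticAt ℂ F 0)
    (hFe : ∀ᶠ x in 𝓝 (0 : ℂ × ℝ), F (x.1, star x.1, x.2) = φ x) :
    ∃ Q : ℂ × ℂ × ℂ → ℂ, AnalyticAt ℂ Q 0 ∧ Q 0 = 0 ∧
      (∀ᶠ y in 𝓝 (0 : ℂ × ℂ), y.2.im = φ (y.1, y.2.re) ↔ y.2 = Q (y.1, star y.1, star y.2)) ∧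
      ∀ᶠ v in 𝓝 (0 : (ℂ × ℂ × ℂ) × ℂ), (v.2 = Q v.1 ↔
        v.2 - v.1.2.2 = 2 * I * F (v.1.1, v.1.2.1, (v.2 + v.1.2.2) / 2)) := by
  have hF0 : F 0 = 0 := by
    have := hFe.self_of_nhds
    simpa [h0] using this
  let E : (ℂ × ℂ × ℂ) × ℂ → ℂ := fun v =>
    v.2 - v.1.2.2 - 2 * I * F (v.1.1, v.1.2.1, (v.2 + v.1.2.2) / 2)
  have hE : AnalyticAt ℂ E 0 := by
    have h1 : AnalyticAt ℂ (fun v : (ℂ × ℂ × ℂ) × ℂ =>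
        F (v.1.1, v.1.2.1, (v.2 + v.1.2.2) / 2)) 0 :=
      AnalyticAt.comp_of_eq hF (f := fun v : (ℂ × ℂ × ℂ) × ℂ =>
        (v.1.1, v.1.2.1, (v.2 + v.1.2.2) / 2)) (by fun_prop) (by simp)
    simp only [E]
    exact AnalyticAt.sub (by fun_prop) (analyticAt_const.mul h1)
  have hE0 : E (0, 0) = 0 := by
    simp only [E]
    simpa using hF0
  have hd : fderiv ℂ E (0, 0) (0, 1) ≠ 0 := by
    have h1 : HasDerivAt (fun t : ℂ => ((0 : ℂ × ℂ × ℂ), t)) ((0 : ℂ × ℂ × ℂ), (1 : ℂ)) 0 :=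
      (hasDerivAt_const _ _).prodMk (hasDerivAt_id _)
    have h2 : HasDerivAt (fun t : ℂ => E (0, t)) (fderiv ℂ E (0, 0) (0, 1)) 0 :=
      HasFDerivAt.comp_hasDerivAt_of_eq (0 : ℂ) hE.differentiableAt.hasFDerivAt h1 rfl
    have h3 : HasDerivAt (fun t : ℂ => (((0 : ℂ), (0 : ℂ), t / 2) : ℂ × ℂ × ℂ))
        (0, 0, 1 / 2) 0 :=
      (hasDerivAt_const _ _).prodMk ((hasDerivAt_const _ _).prodMk
        ((hasDerivAt_id _).div_const 2))
    have h4 : HasDerivAt (fun t : ℂ => F (0, 0, t / 2)) (fderiv ℂ F 0 (0, 0, 1 / 2)) 0 :=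
      HasFDerivAt.comp_hasDerivAt_of_eq (0 : ℂ) hF.differentiableAt.hasFDerivAt h3 (by simp)
    have h5 : HasDerivAt (fun t : ℂ => E (0, t))
        (1 - 2 * I * fderiv ℂ F 0 (0, 0, 1 / 2)) 0 := by
      have := (hasDerivAt_id (0 : ℂ)).sub (h4.const_mul (2 * I))
      refine this.congr_of_eventuallyEq (Eventually.of_forall fun t => ?_)
      simp [E]
    rw [h2.unique h5]
    have h6 : ((0 : ℂ), (0 : ℂ), (1 / 2 : ℂ)) = (1 / 2 : ℂ) • ((0 : ℂ), (0 : ℂ), (1 : ℂ)) := by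
      simp
    rw [h6, map_smul, smul_eq_mul]
    convert! one_sub_I_mul_ne_zero (im_fderiv_complexification hφ hF hFe) using 1
    ring
  obtain ⟨Q, hQ, hQ0, hQe⟩ := exists_implicit hE hE0 hd
  have hiff : ∀ᶠ v in 𝓝 (0 : (ℂ × ℂ × ℂ) × ℂ), (v.2 = Q v.1 ↔
        v.2 - v.1.2.2 = 2 * I * F (v.1.1, v.1.2.1, (v.2 + v.1.2.2) / 2)) := by
    filter_upwards [hQe] with v hv
    rw [← hv]
    exact sub_eq_zero
  refine ⟨Q, hQ, hQ0, ?_, hiff⟩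
  have hc : Tendsto (fun y : ℂ × ℂ => (((y.1, star y.1, star y.2), y.2) : (ℂ × ℂ × ℂ) × ℂ))
      (𝓝 0) (𝓝 0) := Continuous.tendsto' (by fun_prop) _ _ (by simp)
  have hc2 : Tendsto (fun y : ℂ × ℂ => ((y.1, y.2.re) : ℂ × ℝ)) (𝓝 0) (𝓝 0) :=
    Continuous.tendsto' (by fun_prop) _ _ (by simp)
  filter_upwards [hc.eventually hiff, hc2.eventually hFe] with y hy1 hy2
  rw [hy1]
  rw [eq_I_mul_two_im, eq_two_re, hy2, mul_right_inj' (by simp)]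
  exact_mod_cast Iff.rfl

/-- The complexified graph is the smallest complex-analytic set containing the graph. -/
theorem eventually_zero_of_graph {φ : ℂ × ℝ → ℝ} (hφ : AnalyticAt ℝ φ 0) (h0 : φ 0 = 0)
    {D : ℂ × ℂ × ℂ → ℂ} (hD : AnalyticAt ℂ D 0)
    (h : ∀ᶠ x in 𝓝 (0 : ℂ × ℝ), D (x.1, star x.1, x.2 - I * φ x) = 0) :
    ∀ᶠ y in 𝓝 0, D y = 0 := by
  obtain ⟨F, hF, hFe⟩ := exists_complexification_graph hφ
  have hF0 : F 0 = 0 := by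
    have := hFe.self_of_nhds
    simpa [h0] using this
  let κ : ℂ × ℂ × ℂ → ℂ × ℂ × ℂ := fun y => (y.1, y.2.1, y.2.2 - I * F y)
  have hκ : AnalyticAt ℂ κ 0 := by simp only [κ]; fun_prop
  have hDκ : ∀ᶠ y in 𝓝 0, (D ∘ κ) y = 0 := by
    refine eventually_zero_of_conj
      (AnalyticAt.comp_of_eq hD hκ (by simp [κ, hF0])) ?_
    filter_upwards [h, hFe] with x hx hxF
    simp only [Function.comp_apply, κ, hxF]
    exact hx
  let E : (ℂ × ℂ × ℂ) × ℂ → ℂ := fun v => v.2 - I * F (v.1.1, v.1.2.1, v.2) - v.1.2.2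
  have hE : AnalyticAt ℂ E 0 := by
    have h1 : AnalyticAt ℂ (fun v : (ℂ × ℂ × ℂ) × ℂ => F (v.1.1, v.1.2.1, v.2)) 0 :=
      AnalyticAt.comp_of_eq hF (f := fun v : (ℂ × ℂ × ℂ) × ℂ => (v.1.1, v.1.2.1, v.2))
        (by fun_prop) (by simp)
    simp only [E]
    fun_prop
  have hE0 : E (0, 0) = 0 := by
    simp only [E]
    simpa using hF0
  have hd : fderiv ℂ E (0, 0) (0, 1) ≠ 0 := by
    have h1 : HasDerivAt (fun t : ℂ => ((0 : ℂ × ℂ × ℂ), t)) ((0 : ℂ × ℂ × ℂ), (1 : ℂ)) 0 :=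
      (hasDerivAt_const _ _).prodMk (hasDerivAt_id _)
    have h2 : HasDerivAt (fun t : ℂ => E (0, t)) (fderiv ℂ E (0, 0) (0, 1)) 0 :=
      HasFDerivAt.comp_hasDerivAt_of_eq (0 : ℂ) hE.differentiableAt.hasFDerivAt h1 rfl
    have h3 : HasDerivAt (fun t : ℂ => (((0 : ℂ), (0 : ℂ), t) : ℂ × ℂ × ℂ)) (0, 0, 1) 0 :=
      (hasDerivAt_const _ _).prodMk ((hasDerivAt_const _ _).prodMk (hasDerivAt_id _))
    have h4 : HasDerivAt (fun t : ℂ => F (0, 0, t)) (fderiv ℂ F 0 (0, 0, 1)) 0 :=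
      HasFDerivAt.comp_hasDerivAt_of_eq (0 : ℂ) hF.differentiableAt.hasFDerivAt h3 (by simp)
    have h5 : HasDerivAt (fun t : ℂ => E (0, t)) (1 - I * fderiv ℂ F 0 (0, 0, 1)) 0 := by
      have := (hasDerivAt_id (0 : ℂ)).sub (h4.const_mul I)
      refine this.congr_of_eventuallyEq (Eventually.of_forall fun t => ?_)
      simp [E]
    rw [h2.unique h5]
    exact one_sub_I_mul_ne_zero (im_fderiv_complexification hφ hF hFe)
  obtain ⟨T, hT, hT0, hTe⟩ := exists_implicit hE hE0 hd
  have hc1 : Tendsto (fun y : ℂ × ℂ × ℂ => ((y, T y) : (ℂ × ℂ × ℂ) × ℂ)) (𝓝 0) (𝓝 (0, 0)) := by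
    have := (continuousAt_id.prodMk hT.continuousAt).tendsto
    simpa [hT0] using this
  have hc2 : Tendsto (fun y : ℂ × ℂ × ℂ => (y.1, y.2.1, T y)) (𝓝 0) (𝓝 0) := by
    have : ContinuousAt (fun y : ℂ × ℂ × ℂ => (y.1, y.2.1, T y)) 0 := by
      have := hT.continuousAt
      fun_prop
    have := this.tendsto
    simpa [hT0] using this
  filter_upwards [hc1.eventually hTe, hc2.eventually hDκ] with y hy1 hy2
  have h1 := hy1.2 rfl
  simp only [E] at h1
  have h2 : κ (y.1, y.2.1, T y) = y := by
    refine Prod.ext rfl (Prod.ext rfl ?_)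
    simp only [κ]
    exact sub_eq_zero.1 h1
  rw [Function.comp_apply, h2] at hy2
  exact hy2

/-- A chart `Θ` at `q` in which `M` is the graph `v = φ(z, u)`, with Segre function `Q`. -/
structure IsSegreChart (M : Set (ℂ × ℂ)) (q : ℂ × ℂ) (Θ : ℂ × ℂ → ℂ × ℂ) (φ : ℂ × ℝ → ℝ)
    (Q : ℂ × ℂ × ℂ → ℂ) : Prop where
  biholo : IsLocalBiholomorphismToZero Θ q
  analytic_graph : AnalyticAt ℝ φ 0
  graph_zero : φ 0 = 0
  mem_iff : ∀ᶠ x in 𝓝 q, x ∈ M ↔ (Θ x).2.im = φ ((Θ x).1, (Θ x).2.re)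
  analytic : AnalyticAt ℂ Q 0
  segre_iff : ∀ᶠ y in 𝓝 (0 : ℂ × ℂ),
    y.2.im = φ (y.1, y.2.re) ↔ y.2 = Q (y.1, star y.1, star y.2)

lemma IsLocalBiholomorphismToZero.exists_inverse {Θ : ℂ × ℂ → ℂ × ℂ} {q : ℂ × ℂ}
    (h : IsLocalBiholomorphismToZero Θ q) :
    ∃ Ξ : ℂ × ℂ → ℂ × ℂ, AnalyticAt ℂ Ξ 0 ∧ Ξ 0 = q ∧ (∀ᶠ x in 𝓝 q, Ξ (Θ x) = x) ∧
      (∀ᶠ y in 𝓝 0, Θ (Ξ y) = y) ∧ Function.Bijective (fderiv ℂ Ξ 0) ∧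
      (∀ v, fderiv ℂ Θ q (fderiv ℂ Ξ 0 v) = v) ∧ (∀ v, fderiv ℂ Ξ 0 (fderiv ℂ Θ q v) = v) := by
  obtain ⟨e, he, heq, hes⟩ := exists_openPartialHomeomorph h.1 h.2.1
  rw [h.2.2] at hes
  have h0 : e.symm 0 = q := by rw [← h.2.2, ← he, e.left_inv heq]
  have h1 : ∀ᶠ x in 𝓝 q, e.symm (Θ x) = x := by
    filter_upwards [e.open_source.mem_nhds heq] with x hx
    rw [← he, e.left_inv hx]
  have ht : (0 : ℂ × ℂ) ∈ e.target := by
    rw [← h.2.2, ← he]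
    exact e.map_source heq
  have h2 : ∀ᶠ y in 𝓝 0, Θ (e.symm y) = y := by
    filter_upwards [e.open_target.mem_nhds ht] with y hy
    rw [← he, e.right_inv hy]
  have hΘd : HasFDerivAt Θ (fderiv ℂ Θ q) (e.symm 0) := by
    rw [h0]; exact h.1.differentiableAt.hasFDerivAt
  have hd1 := hΘd.comp (0 : ℂ × ℂ) hes.differentiableAt.hasFDerivAt
  have hr : ∀ v, fderiv ℂ Θ q (fderiv ℂ e.symm 0 v) = v := by
    intro v
    have := hd1.unique ((hasFDerivAt_id _).congr_of_eventuallyEq h2)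
    exact congrArg (fun L => L v) this
  have hl : ∀ v, fderiv ℂ e.symm 0 (fderiv ℂ Θ q v) = v := fun v => h.2.1.1 (hr _)
  exact ⟨e.symm, hes, h0, h1, h2, ⟨Function.LeftInverse.injective hr,
    Function.RightInverse.surjective hl⟩, hr, hl⟩

lemma IsSegreChart.map_zero {M : Set (ℂ × ℂ)} {q : ℂ × ℂ} {Θ : ℂ × ℂ → ℂ × ℂ} {φ : ℂ × ℝ → ℝ}
    {Q : ℂ × ℂ × ℂ → ℂ} (h : IsSegreChart M q Θ φ Q) : Q 0 = 0 := by
  have := h.segre_iff.self_of_nhds.1 (by simpa using h.graph_zero.symm)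
  simpa using this.symm

lemma IsSegreChart.mem {M : Set (ℂ × ℂ)} {q : ℂ × ℂ} {Θ : ℂ × ℂ → ℂ × ℂ} {φ : ℂ × ℝ → ℝ}
    {Q : ℂ × ℂ × ℂ → ℂ} (h : IsSegreChart M q Θ φ Q) : q ∈ M := by
  rw [h.mem_iff.self_of_nhds, h.biholo.2.2]
  simpa using h.graph_zero.symm

section Chart

variable {M : Set (ℂ × ℂ)} {q : ℂ × ℂ} {Θ : ℂ × ℂ → ℂ × ℂ} {φ : ℂ × ℝ → ℝ} {Q : ℂ × ℂ × ℂ → ℂ}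

lemma IsSegreChart.tendsto_graph (h : IsSegreChart M q Θ φ Q) :
    Tendsto (fun x : ℂ × ℝ => ((x.1, x.2 + I * φ x) : ℂ × ℂ)) (𝓝 0) (𝓝 0) := by
  have hc := h.analytic_graph.continuousAt
  have : ContinuousAt (fun x : ℂ × ℝ => ((x.1, x.2 + I * φ x) : ℂ × ℂ)) 0 := by fun_prop
  simpa [ContinuousAt, h.graph_zero] using this

lemma IsSegreChart.segre_graph (h : IsSegreChart M q Θ φ Q) :
    ∀ᶠ x in 𝓝 (0 : ℂ × ℝ),
      (x.2 + I * φ x : ℂ) = Q (x.1, star x.1, x.2 - I * φ x) := by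
  filter_upwards [h.tendsto_graph.eventually h.segre_iff] with x hx
  have h1 : ((x.2 : ℂ) + I * (φ x : ℂ)).re = x.2 := by simp
  have h2 : ((x.2 : ℂ) + I * (φ x : ℂ)).im = φ x := by simp
  have h3 : star ((x.2 : ℂ) + I * (φ x : ℂ)) = x.2 - I * φ x := by
    apply Complex.ext <;> simp
  simp only [h1, h2, h3] at hx
  exact hx.1 trivial

/-- The identity principle in a Segre chart. -/
lemma IsSegreChart.eventually_zero (h : IsSegreChart M q Θ φ Q) {D : ℂ × ℂ × ℂ → ℂ}
    (hD : AnalyticAt ℂ D 0)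
    (h0 : ∀ᶠ y in 𝓝 (0 : ℂ × ℂ), y.2.im = φ (y.1, y.2.re) → y.2 = Q (y.1, star y.1, star y.2) →
      D (y.1, star y.1, star y.2) = 0) : ∀ᶠ y in 𝓝 0, D y = 0 := by
  refine eventually_zero_of_graph h.analytic_graph h.graph_zero hD ?_
  filter_upwards [h.tendsto_graph.eventually h0, h.segre_graph] with x hx hx2
  have h1 : ((x.2 : ℂ) + I * (φ x : ℂ)).re = x.2 := by simp
  have h2 : ((x.2 : ℂ) + I * (φ x : ℂ)).im = φ x := by simp
  have h3 : star ((x.2 : ℂ) + I * (φ x : ℂ)) = x.2 - I * φ x := by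
    apply Complex.ext <;> simp
  simp only [h1, h2, h3] at hx
  exact hx trivial hx2

/-- The reality of the Segre function. -/
lemma IsSegreChart.reality (h : IsSegreChart M q Θ φ Q) :
    ∀ᶠ y in 𝓝 (0 : ℂ × ℂ × ℂ), reflect Q (y.2.1, y.1, Q y) = y.2.2 := by
  have hQ := h.analytic
  have hr : AnalyticAt ℂ (reflect Q) 0 := analyticAt_reflect (by simpa using hQ)
  have hD : AnalyticAt ℂ (fun y : ℂ × ℂ × ℂ => reflect Q (y.2.1, y.1, Q y) - y.2.2) 0 := by
    have : AnalyticAt ℂ (fun y : ℂ × ℂ × ℂ => reflect Q (y.2.1, y.1, Q y)) 0 :=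
      AnalyticAt.comp_of_eq hr (f := fun y : ℂ × ℂ × ℂ => (y.2.1, y.1, Q y)) (by fun_prop)
        (by simp [h.map_zero])
    fun_prop
  filter_upwards [h.eventually_zero hD (Eventually.of_forall fun y _ hy => by
    simp only
    rw [← hy, reflect_apply]
    have : star ((star y.1, y.1, y.2) : ℂ × ℂ × ℂ) = (y.1, star y.1, star y.2) := by
      simp [Prod.star_def]
    rw [this, ← hy, sub_self])] with y hy
  exact sub_eq_zero.1 hy

/-- The complexified transformation rule between two Segre charts. -/
theorem IsSegreChart.transition {Θ' : ℂ × ℂ → ℂ × ℂ} {φ' : ℂ × ℝ → ℝ} {Q' : ℂ × ℂ × ℂ → ℂ}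
    (h : IsSegreChart M q Θ φ Q) (h' : IsSegreChart M q Θ' φ' Q') {H : ℂ × ℂ → ℂ × ℂ}
    (hH : AnalyticAt ℂ H 0) (hHe : ∀ᶠ x in 𝓝 q, Θ' x = H (Θ x)) :
    ∀ᶠ y in 𝓝 (0 : ℂ × ℂ × ℂ), (H (y.1, Q y)).2 =
      Q' ((H (y.1, Q y)).1, (reflect H y.2).1, (reflect H y.2).2) := by
  have hQ := h.analytic
  have hH0 : H 0 = 0 := by
    have := hHe.self_of_nhds
    rwa [h.biholo.2.2, h'.biholo.2.2, eq_comm] at this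
  have hr : AnalyticAt ℂ (reflect H) 0 := analyticAt_reflect (by simpa using hH)
  have hr0 : reflect H 0 = 0 := by simp [reflect, hH0]
  have a1 : AnalyticAt ℂ (fun y : ℂ × ℂ × ℂ => H (y.1, Q y)) 0 :=
    AnalyticAt.comp_of_eq hH (f := fun y : ℂ × ℂ × ℂ => (y.1, Q y)) (by fun_prop)
      (by simp [h.map_zero])
  have a2 : AnalyticAt ℂ (fun y : ℂ × ℂ × ℂ => reflect H y.2) 0 :=
    AnalyticAt.comp_of_eq hr (f := fun y : ℂ × ℂ × ℂ => y.2) (by fun_prop) rfl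
  have b1 : AnalyticAt ℂ (fun y : ℂ × ℂ × ℂ => (H (y.1, Q y)).1) 0 := analyticAt_fst.comp a1
  have b2 : AnalyticAt ℂ (fun y : ℂ × ℂ × ℂ => (H (y.1, Q y)).2) 0 := analyticAt_snd.comp a1
  have b3 : AnalyticAt ℂ (fun y : ℂ × ℂ × ℂ => (reflect H y.2).1) 0 := analyticAt_fst.comp a2
  have b4 : AnalyticAt ℂ (fun y : ℂ × ℂ × ℂ => (reflect H y.2).2) 0 := analyticAt_snd.comp a2
  have hD : AnalyticAt ℂ (fun y : ℂ × ℂ × ℂ => (H (y.1, Q y)).2 -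
      Q' ((H (y.1, Q y)).1, (reflect H y.2).1, (reflect H y.2).2)) 0 := by
    refine b2.sub (AnalyticAt.comp_of_eq h'.analytic (b1.prod (b3.prod b4)) ?_)
    simp only [Prod.fst_zero, Prod.snd_zero, h.map_zero, hr0]
    rw [show ((0 : ℂ), (0 : ℂ)) = 0 from rfl, hH0]
    rfl
  obtain ⟨Ξ, hΞ, hΞ0, hΞ1, hΞ2, -⟩ := h.biholo.exists_inverse
  have hΞc : Tendsto Ξ (𝓝 0) (𝓝 q) := by
    have := hΞ.continuousAt.tendsto
    rwa [hΞ0] at this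
  have hHc : Tendsto H (𝓝 0) (𝓝 0) := by
    have := hH.continuousAt.tendsto
    rwa [hH0] at this
  filter_upwards [h.eventually_zero hD (by
    filter_upwards [hΞ2, hΞc.eventually hHe, hΞc.eventually h.mem_iff, hΞc.eventually h'.mem_iff,
      hHc.eventually h'.segre_iff] with y hy1 hy2 hy3 hy4 hy5 hg hs
    rw [hy1] at hy2 hy3
    rw [hy2, hy3] at hy4
    have h1 := hy5.1 (hy4.1 hg)
    have h2 : reflect H (star y.1, star y.2) = star (H y) := by
      rw [reflect_apply]
      simp [Prod.star_def]
    rw [← hs, h2]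
    exact sub_eq_zero.2 h1)] with y hy
  exact sub_eq_zero.1 hy

end Chart

/-! ### Construction of Segre charts and tangent spaces -/

section Chart

variable {M : Set (ℂ × ℂ)} {q : ℂ × ℂ} {Θ : ℂ × ℂ → ℂ × ℂ} {φ : ℂ × ℝ → ℝ} {Q : ℂ × ℂ × ℂ → ℂ}

lemma eq_two_re_of_real_linear (ℓ : ℂ × ℂ →L[ℝ] ℝ) (v : ℂ × ℂ) :
    ℓ v = 2 * (((ℓ (1, 0) : ℝ) - I * (ℓ (I, 0) : ℝ)) / 2 * v.1 +
      ((ℓ (0, 1) : ℝ) - I * (ℓ (0, I) : ℝ)) / 2 * v.2).re := by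
  have h : v = v.1.re • ((1 : ℂ), (0 : ℂ)) + v.1.im • (I, (0 : ℂ)) +
      (v.2.re • ((0 : ℂ), (1 : ℂ)) + v.2.im • ((0 : ℂ), I)) := by
    refine Prod.ext ?_ ?_ <;> apply Complex.ext <;> simp
  conv_lhs => rw [h]
  simp only [map_add, map_smul, smul_eq_mul]
  simp
  ring

lemma fderiv_eq_wirtinger (ρ : ℂ × ℂ → ℝ) (q v : ℂ × ℂ) :
    fderiv ℝ ρ q v = 2 * (wirtingerZ ρ q * v.1 + wirtingerW ρ q * v.2).re :=
  eq_two_re_of_real_linear _ v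

lemma analyticAt_real_of_complex {E F : Type*} [NormedAddCommGroup E] [NormedSpace ℂ E]
    [NormedAddCommGroup F] [NormedSpace ℂ F] {f : E → F} {x : E} (hf : AnalyticAt ℂ f x) :
    AnalyticAt ℝ f x :=
  hf.restrictScalars

lemma hasFDerivAt_real_of_complex {E F : Type*} [NormedAddCommGroup E] [NormedSpace ℂ E]
    [NormedAddCommGroup F] [NormedSpace ℂ F] {f : E → F} {x : E} (hf : AnalyticAt ℂ f x) :
    HasFDerivAt f ((fderiv ℂ f x).restrictScalars ℝ) x :=
  hf.differentiableAt.hasFDerivAt.restrictScalars ℝ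

lemma hasFDerivAt_comp_of_eq {𝕜 E F G : Type*} [NontriviallyNormedField 𝕜]
    [NormedAddCommGroup E] [NormedSpace 𝕜 E] [NormedAddCommGroup F] [NormedSpace 𝕜 F]
    [NormedAddCommGroup G] [NormedSpace 𝕜 G] {g : F → G} {f : E → F} {g' : F →L[𝕜] G}
    {f' : E →L[𝕜] F} {x : E} {y : F} (hg : HasFDerivAt g g' y) (hf : HasFDerivAt f f' x)
    (hy : f x = y) : HasFDerivAt (fun t => g (f t)) (g'.comp f') x := by
  subst hy
  exact hg.comp x hf

/-- A local biholomorphic chart in which `M` is a graph is a Segre chart. -/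
lemma exists_isSegreChart (hΘ : IsLocalBiholomorphismToZero Θ q) (hφ : AnalyticAt ℝ φ 0)
    (hM : ∀ᶠ x in 𝓝 q, x ∈ M ↔ (Θ x).2.im = φ ((Θ x).1, (Θ x).2.re)) (h0 : φ 0 = 0) :
    ∃ Q, IsSegreChart M q Θ φ Q := by
  obtain ⟨F, hF, hFe⟩ := exists_complexification_graph hφ
  obtain ⟨Q, hQ, -, hQe, -⟩ := exists_segre hφ h0 hF hFe
  exact ⟨Q, hΘ, hφ, h0, hM, hQ, hQe⟩

/-- The embedding `(z, u, v) ↦ (z, u + iv)`. -/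
def realCoordinates : (ℂ × ℝ) × ℝ →L[ℝ] ℂ × ℂ :=
  ((ContinuousLinearMap.fst ℝ ℂ ℝ).comp (.fst ℝ (ℂ × ℝ) ℝ)).prod
    (Complex.ofRealCLM.comp ((ContinuousLinearMap.snd ℝ ℂ ℝ).comp (.fst ℝ (ℂ × ℝ) ℝ)) +
      I • Complex.ofRealCLM.comp (.snd ℝ (ℂ × ℝ) ℝ))

@[simp] lemma realCoordinates_apply (y : (ℂ × ℝ) × ℝ) :
    realCoordinates y = (y.1.1, (y.1.2 : ℂ) + I * (y.2 : ℂ)) := by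
  simp [realCoordinates]

lemma realCoordinates_eq (y : ℂ × ℂ) : realCoordinates ((y.1, y.2.re), y.2.im) = y := by
  refine Prod.ext ?_ ?_
  · simp
  · simp only [realCoordinates_apply]
    rw [mul_comm, Complex.re_add_im]

/-- A hypersurface is a graph `v = φ(z, u)` with `dφ(0) = 0` in every chart whose second component
is adapted to the tangent space. -/
theorem exists_graph {ρ : ℂ × ℂ → ℝ} (hρ : IsLocalDefiningFunction M q ρ) (hq : q ∈ M)
    (hΘ : IsLocalBiholomorphismToZero Θ q) {κ : ℝ} (hκ : κ ≠ 0)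
    (hd : ∀ v, fderiv ℝ ρ q v = κ * (fderiv ℂ Θ q v).2.im) :
    ∃ φ Q, IsSegreChart M q Θ φ Q ∧ fderiv ℝ φ 0 = 0 := by
  obtain ⟨Ξ, hΞ, hΞ0, hΞ1, hΞ2, -, hΞ3, hΞ4⟩ := hΘ.exists_inverse
  have hρ0 : ρ q = 0 := hρ.2.2.self_of_nhds.1 hq
  have hΞρ : HasFDerivAt (fun y => ρ (Ξ y))
      ((fderiv ℝ ρ q).comp ((fderiv ℂ Ξ 0).restrictScalars ℝ)) 0 :=
    hasFDerivAt_comp_of_eq hρ.1.differentiableAt.hasFDerivAt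
      (hasFDerivAt_real_of_complex hΞ) hΞ0
  have haΞρ : AnalyticAt ℝ (fun y => ρ (Ξ y)) 0 :=
    AnalyticAt.comp_of_eq hρ.1 (analyticAt_real_of_complex hΞ) hΞ0
  let E : (ℂ × ℝ) × ℝ → ℝ := fun y => ρ (Ξ (realCoordinates y))
  have hE : AnalyticAt ℝ E 0 :=
    AnalyticAt.comp_of_eq (g := fun y => ρ (Ξ y)) haΞρ (realCoordinates.analyticAt 0) (map_zero _)
  have hEd : HasFDerivAt E (((fderiv ℝ ρ q).comp ((fderiv ℂ Ξ 0).restrictScalars ℝ)).comp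
      realCoordinates) 0 :=
    hasFDerivAt_comp_of_eq (g := fun y => ρ (Ξ y)) hΞρ realCoordinates.hasFDerivAt (map_zero _)
  have hEv : ∀ v, fderiv ℝ E 0 v = κ * v.2 := by
    intro v
    rw [hEd.fderiv]
    simp [hd, hΞ3]
  have hE0 : E (0, 0) = 0 := by simp [E, hΞ0, hρ0]
  obtain ⟨φ, hφ, hφ0, hφe⟩ := exists_implicit hE hE0
    (by rw [show ((0 : ℂ × ℝ), (0 : ℝ)) = 0 from rfl, hEv]; simpa using hκ)
  have hM : ∀ᶠ x in 𝓝 q, x ∈ M ↔ (Θ x).2.im = φ ((Θ x).1, (Θ x).2.re) := by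
    have hc : Tendsto (fun x => (((Θ x).1, (Θ x).2.re), (Θ x).2.im)) (𝓝 q) (𝓝 (0, 0)) := by
      have hΘc := hΘ.1.continuousAt
      have : ContinuousAt (fun x => (((Θ x).1, (Θ x).2.re), (Θ x).2.im)) q := by fun_prop
      simpa [ContinuousAt, hΘ.2.2] using this
    filter_upwards [hρ.2.2, hΞ1, hc.eventually hφe] with x hx1 hx2 hx3
    rw [hx1, ← hx3]
    simp only [E]
    rw [realCoordinates_eq, hx2]
  obtain ⟨Q, hQ⟩ := exists_isSegreChart hΘ hφ hM hφ0
  refine ⟨φ, Q, hQ, ?_⟩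
  have hg : HasFDerivAt (fun y => ((y, φ y) : (ℂ × ℝ) × ℝ))
      ((ContinuousLinearMap.id ℝ (ℂ × ℝ)).prod (fderiv ℝ φ 0)) 0 :=
    (hasFDerivAt_id _).prodMk hφ.differentiableAt.hasFDerivAt
  have hEg : HasFDerivAt (fun y => E (y, φ y)) ((fderiv ℝ E 0).comp
      ((ContinuousLinearMap.id ℝ (ℂ × ℝ)).prod (fderiv ℝ φ 0))) 0 :=
    hasFDerivAt_comp_of_eq hE.differentiableAt.hasFDerivAt hg (by rw [hφ0]; rfl)
  have hc : Tendsto (fun y => ((y, φ y) : (ℂ × ℝ) × ℝ)) (𝓝 0) (𝓝 (0, 0)) := by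
    have := hg.continuousAt.tendsto
    rwa [hφ0] at this
  have hz : (fun y => E (y, φ y)) =ᶠ[𝓝 0] fun _ => 0 := by
    filter_upwards [hc.eventually hφe] with y hy
    exact hy.2 rfl
  have := hEg.unique ((hasFDerivAt_const (0 : ℝ) (0 : ℂ × ℝ)).congr_of_eventuallyEq hz)
  ext v
  · have h1 := congrArg (fun L => L (v, 0)) this
    simpa [hEv, hκ] using h1
  · have h1 := congrArg (fun L => L (0, 1)) this
    simpa [hEv, hκ] using h1

/-- In a chart in which `M` is a graph with `dφ(0) = 0`, the differentials of the defining functions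
are multiples of the imaginary part of the second component. -/
theorem IsSegreChart.exists_fderiv_eq (h : IsSegreChart M q Θ φ Q) (hφ : fderiv ℝ φ 0 = 0)
    {ρ : ℂ × ℂ → ℝ} (hρ : IsLocalDefiningFunction M q ρ) :
    ∃ κ : ℝ, κ ≠ 0 ∧ ∀ v, fderiv ℝ ρ q v = κ * (fderiv ℂ Θ q v).2.im := by
  obtain ⟨Ξ, hΞ, hΞ0, hΞ1, hΞ2, -, hΞ3, hΞ4⟩ := h.biholo.exists_inverse
  have hΞρ : HasFDerivAt (fun y => ρ (Ξ y))
      ((fderiv ℝ ρ q).comp ((fderiv ℂ Ξ 0).restrictScalars ℝ)) 0 :=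
    hasFDerivAt_comp_of_eq hρ.1.differentiableAt.hasFDerivAt
      (hasFDerivAt_real_of_complex hΞ) hΞ0
  have hg : HasFDerivAt (fun y => realCoordinates (y, φ y))
      (realCoordinates.comp ((ContinuousLinearMap.id ℝ (ℂ × ℝ)).prod (0 : ℂ × ℝ →L[ℝ] ℝ))) 0 := by
    have h1 : HasFDerivAt φ (0 : ℂ × ℝ →L[ℝ] ℝ) 0 :=
      hφ ▸ h.analytic_graph.differentiableAt.hasFDerivAt
    exact realCoordinates.hasFDerivAt.comp (0 : ℂ × ℝ) ((hasFDerivAt_id _).prodMk h1)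
  have hEg : HasFDerivAt (fun y => ρ (Ξ (realCoordinates (y, φ y))))
      (((fderiv ℝ ρ q).comp ((fderiv ℂ Ξ 0).restrictScalars ℝ)).comp
        (realCoordinates.comp ((ContinuousLinearMap.id ℝ (ℂ × ℝ)).prod (0 : ℂ × ℝ →L[ℝ] ℝ)))) 0 :=
    hasFDerivAt_comp_of_eq (g := fun y => ρ (Ξ y)) hΞρ hg (by rw [h.graph_zero]; simp)
  have hc : Tendsto (fun y => realCoordinates (y, φ y)) (𝓝 0) (𝓝 0) := by
    have := hg.continuousAt.tendsto
    simpa [h.graph_zero] using this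
  have hΞc : Tendsto Ξ (𝓝 0) (𝓝 q) := by
    have := hΞ.continuousAt.tendsto
    rwa [hΞ0] at this
  have hz : (fun y => ρ (Ξ (realCoordinates (y, φ y)))) =ᶠ[𝓝 0] fun _ => 0 := by
    filter_upwards [(hΞc.comp hc).eventually hρ.2.2, (hΞc.comp hc).eventually h.mem_iff,
      hc.eventually hΞ2] with y hy1 hy2 hy3
    refine hy1.1 (hy2.2 ?_)
    simp only [Function.comp_apply]
    rw [hy3]
    simp
  have hu := hEg.unique ((hasFDerivAt_const (0 : ℝ) (0 : ℂ × ℝ)).congr_of_eventuallyEq hz)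
  have hk : ∀ v : ℂ × ℝ, fderiv ℝ ρ q (fderiv ℂ Ξ 0 (v.1, (v.2 : ℂ))) = 0 := by
    intro v
    simpa using congrArg (fun L => L v) hu
  set κ : ℝ := fderiv ℝ ρ q (fderiv ℂ Ξ 0 (0, I)) with hκ
  have hv : ∀ v, fderiv ℝ ρ q v = κ * (fderiv ℂ Θ q v).2.im := by
    intro v
    set y := fderiv ℂ Θ q v with hy
    have h1 : v = fderiv ℂ Ξ 0 (y.1, (y.2.re : ℂ)) + y.2.im • fderiv ℂ Ξ 0 (0, I) := by
      have h2 : y = (y.1, (y.2.re : ℂ)) + (y.2.im : ℂ) • ((0 : ℂ), I) := by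
        refine Prod.ext ?_ ?_
        · simp
        · simp
      have h3 : (y.2.im • fderiv ℂ Ξ 0 (0, I) : ℂ × ℂ) =
          (y.2.im : ℂ) • fderiv ℂ Ξ 0 (0, I) := rfl
      rw [h3, ← map_smul, ← map_add, ← h2, hy, hΞ4]
    rw [h1, map_add, hk (y.1, y.2.re), map_smul, zero_add, smul_eq_mul, mul_comm]
  refine ⟨κ, fun h0 => hρ.2.1 (ContinuousLinearMap.ext fun v => ?_), hv⟩
  simp [hv, h0]

theorem IsSegreChart.mem_complexTangentVectors_iff (h : IsSegreChart M q Θ φ Q)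
    (hφ : fderiv ℝ φ 0 = 0) {ρ : ℂ × ℂ → ℝ} (hρ : IsLocalDefiningFunction M q ρ) (v : ℂ × ℂ) :
    v ∈ complexTangentVectors M q ↔ (fderiv ℂ Θ q v).2 = 0 := by
  have ht : ∀ v, v ∈ tangentVectors M q ↔ (fderiv ℂ Θ q v).2.im = 0 := by
    intro v
    constructor
    · intro hv
      obtain ⟨κ, hκ, hk⟩ := h.exists_fderiv_eq hφ hρ
      have := hv ρ hρ
      rw [hk] at this
      exact (mul_eq_zero.1 this).resolve_left hκ
    · intro hv ρ' hρ'
      obtain ⟨κ, hκ, hk⟩ := h.exists_fderiv_eq hφ hρ'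
      rw [hk, hv, mul_zero]
  rw [complexTangentVectors, Set.mem_ofPred_eq, ht, ht, map_smul]
  simp only [Prod.smul_snd, smul_eq_mul, Complex.mul_im, Complex.I_re, Complex.I_im, zero_mul,
    one_mul, zero_add]
  exact ⟨fun h => Complex.ext h.2 h.1, fun h => by simp [h]⟩

/-- A linear chart adapted to the tangent space. -/
theorem exists_adapted_biholomorphism {ρ : ℂ × ℂ → ℝ} (hd : fderiv ℝ ρ q ≠ 0) :
    ∃ Θ, IsLocalBiholomorphismToZero Θ q ∧
      ∀ v, fderiv ℝ ρ q v = 1 * (fderiv ℂ Θ q v).2.im := by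
  set α : ℂ := 2 * I * wirtingerZ ρ q with hα
  set β : ℂ := 2 * I * wirtingerW ρ q with hβ
  let p1 : ℂ × ℂ →L[ℂ] ℂ := .fst ℂ ℂ ℂ
  let p2 : ℂ × ℂ →L[ℂ] ℂ := .snd ℂ ℂ ℂ
  let L : ℂ × ℂ →L[ℂ] ℂ × ℂ := (star β • p1 - star α • p2).prod (α • p1 + β • p2)
  have hL : ∀ v, L v = (star β * v.1 - star α * v.2, α * v.1 + β * v.2) := by
    intro v
    simp [L, p1, p2]
  have hdv : ∀ v, fderiv ℝ ρ q v = 1 * (L v).2.im := by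
    intro v
    rw [fderiv_eq_wirtinger, hL]
    simp [hα, hβ]
    ring
  have hdet : α * star α + β * star β ≠ 0 := by
    have h1 : α * star α + β * star β = ((Complex.normSq α + Complex.normSq β : ℝ) : ℂ) := by
      push_cast
      rw [← Complex.mul_conj, ← Complex.mul_conj]
      rfl
    rw [h1, Complex.ofReal_ne_zero]
    intro h2
    have h3 := Complex.normSq_nonneg α
    have h4 := Complex.normSq_nonneg β
    have h5 : α = 0 := Complex.normSq_eq_zero.1 (by linarith)
    have h6 : β = 0 := Complex.normSq_eq_zero.1 (by linarith)
    refine hd (ContinuousLinearMap.ext fun v => ?_)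
    rw [hdv, hL, h5, h6]
    simp
  have hinj : Function.Injective L := by
    refine (injective_iff_map_eq_zero L).2 fun v hv => ?_
    rw [hL, Prod.ext_iff] at hv
    obtain ⟨hv1, hv2⟩ := hv
    simp only [Prod.fst_zero, Prod.snd_zero] at hv1 hv2
    refine Prod.ext ?_ ?_
    · refine (mul_eq_zero.1 (?_ : (α * star α + β * star β) * v.1 = 0)).resolve_left hdet
      linear_combination β * hv1 + star α * hv2
    · refine (mul_eq_zero.1 (?_ : (α * star α + β * star β) * v.2 = 0)).resolve_left hdet
      linear_combination -α * hv1 + star β * hv2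
  have hfd : HasFDerivAt (fun x => L (x - q)) L q :=
    L.hasFDerivAt.comp q ((hasFDerivAt_id q).sub_const q)
  refine ⟨fun x => L (x - q), ⟨?_, ?_, by simp⟩, fun v => by rw [hfd.fderiv, hdv]⟩
  · exact (L.analyticAt _).comp (analyticAt_id.sub analyticAt_const)
  · rw [hfd.fderiv]
    exact ⟨hinj, LinearMap.injective_iff_surjective.1 hinj⟩

/-- Translation of a Segre chart to a nearby point of `M`. -/
theorem IsSegreChart.translate (h : IsSegreChart M q Θ φ Q) :
    ∀ᶠ x in 𝓝 q, x ∈ M → IsSegreChart M x (fun y => Θ y - Θ x)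
      (fun t => φ (t.1 + (Θ x).1, t.2 + (Θ x).2.re) - (Θ x).2.im)
      (fun y => Q (y + ((Θ x).1, star (Θ x).1, star (Θ x).2)) - (Θ x).2) := by
  have hΘc : Tendsto Θ (𝓝 q) (𝓝 0) := by
    have := h.biholo.1.continuousAt.tendsto
    rwa [h.biholo.2.2] at this
  have hbij : ∀ᶠ x in 𝓝 q, Function.Bijective (fderiv ℂ Θ x) := by
    obtain ⟨Ξ, hΞ, hΞ0, hΞ1, hΞ2, -⟩ := h.biholo.exists_inverse
    have hΞa := hΘc.eventually hΞ.eventually_analyticAt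
    filter_upwards [h.biholo.1.eventually_analyticAt, hΞa, hΞ1.eventually_nhds] with x h1 h2 h3
    have h4 := (h2.differentiableAt.hasFDerivAt.comp x h1.differentiableAt.hasFDerivAt).unique
      ((hasFDerivAt_id x).congr_of_eventuallyEq h3)
    have hinj : Function.Injective (fderiv ℂ Θ x) :=
      Function.LeftInverse.injective (g := fderiv ℂ Ξ (Θ x))
        fun v => congrArg (fun L => L v) h4
    exact ⟨hinj, LinearMap.injective_iff_surjective.1 hinj⟩
  have hc1 : Tendsto (fun x => ((Θ x).1, (Θ x).2.re)) (𝓝 q) (𝓝 0) :=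
    (Continuous.tendsto' (by fun_prop : Continuous fun y : ℂ × ℂ => (y.1, y.2.re)) 0 0
      (by simp)).comp hΘc
  have hc2 : Tendsto (fun x => ((Θ x).1, star (Θ x).1, star (Θ x).2)) (𝓝 q) (𝓝 0) :=
    (Continuous.tendsto' (by fun_prop : Continuous fun y : ℂ × ℂ => (y.1, star y.1, star y.2)) 0 0
      (by simp)).comp hΘc
  filter_upwards [hbij, h.biholo.1.eventually_analyticAt, h.mem_iff.eventually_nhds,
    hc1.eventually h.analytic_graph.eventually_analyticAt,
    hc2.eventually h.analytic.eventually_analyticAt,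
    hΘc.eventually h.segre_iff.eventually_nhds] with x h1 h2 h3 h4 h5 h6 hx
  have hg := h3.self_of_nhds.1 hx
  refine ⟨⟨h2.sub analyticAt_const, ?_, sub_self _⟩, ?_, ?_, ?_, ?_, ?_⟩
  · rwa [fderiv_sub_const]
  · refine AnalyticAt.sub (AnalyticAt.comp_of_eq h4
      (f := fun t : ℂ × ℝ => (t.1 + (Θ x).1, t.2 + (Θ x).2.re)) (by fun_prop) (by simp))
      analyticAt_const
  · simp [← hg]
  · filter_upwards [h3] with y hy
    rw [hy]
    simp [sub_eq_iff_eq_add]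
  · refine AnalyticAt.sub (AnalyticAt.comp_of_eq h5
      (f := fun t : ℂ × ℂ × ℂ => t + ((Θ x).1, star (Θ x).1, star (Θ x).2)) (by fun_prop)
      (by simp)) analyticAt_const
  · have hc : Tendsto (fun y : ℂ × ℂ => y + Θ x) (𝓝 0) (𝓝 (Θ x)) :=
      Continuous.tendsto' (by fun_prop) _ _ (by simp)
    filter_upwards [hc.eventually h6] with y hy
    simp only [Prod.fst_add, Prod.snd_add, Complex.add_im, Complex.add_re, star_add] at hy
    rw [eq_sub_iff_add_eq, hy, eq_sub_iff_add_eq]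
    rfl

end Chart

/-! ### The Levi determinant -/

lemma analyticAt_clm_apply {𝕜 E F G : Type*} [NontriviallyNormedField 𝕜]
    [NormedAddCommGroup E] [NormedSpace 𝕜 E] [NormedAddCommGroup F] [NormedSpace 𝕜 F]
    [NormedAddCommGroup G] [NormedSpace 𝕜 G] {f : E → F →L[𝕜] G} {g : E → F} {x : E}
    (hf : AnalyticAt 𝕜 f x) (hg : AnalyticAt 𝕜 g x) : AnalyticAt 𝕜 (fun y => f y (g y)) x :=
  AnalyticAt.comp (f := fun y => (f y, g y))
    ((ContinuousLinearMap.id 𝕜 (F →L[𝕜] G)).analyticAt_bilinear (f x, g x)) (hf.prod hg)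

lemma hasFDerivAt_fderiv_apply {𝕜 E F : Type*} [RCLike 𝕜]
    [NormedAddCommGroup E] [NormedSpace 𝕜 E] [NormedAddCommGroup F] [NormedSpace 𝕜 F]
    [CompleteSpace F] {f : E → F} {x : E} (hf : AnalyticAt 𝕜 f x) (a : E) :
    HasFDerivAt (fun y => fderiv 𝕜 f y a) ((fderiv 𝕜 (fderiv 𝕜 f) x).flip a) x :=
  (ContinuousLinearMap.apply 𝕜 F a).hasFDerivAt.comp x hf.fderiv.differentiableAt.hasFDerivAt

section

variable {ρ : ℂ × ℂ → ℝ} {q : ℂ × ℂ}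

lemma analyticAt_wirtingerZ (hρ : AnalyticAt ℝ ρ q) : AnalyticAt ℝ (wirtingerZ ρ) q := by
  have h1 := analyticAt_ofReal (analyticAt_clm_apply hρ.fderiv
    (analyticAt_const (v := ((1 : ℂ), (0 : ℂ)))))
  have h2 := analyticAt_ofReal (analyticAt_clm_apply hρ.fderiv
    (analyticAt_const (v := (I, (0 : ℂ)))))
  exact (h1.sub (analyticAt_const.mul h2)).div analyticAt_const two_ne_zero

lemma analyticAt_wirtingerW (hρ : AnalyticAt ℝ ρ q) : AnalyticAt ℝ (wirtingerW ρ) q := by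
  have h1 := analyticAt_ofReal (analyticAt_clm_apply hρ.fderiv
    (analyticAt_const (v := ((0 : ℂ), (1 : ℂ)))))
  have h2 := analyticAt_ofReal (analyticAt_clm_apply hρ.fderiv
    (analyticAt_const (v := ((0 : ℂ), I))))
  exact (h1.sub (analyticAt_const.mul h2)).div analyticAt_const two_ne_zero

lemma analyticAt_tangentialField (hρ : AnalyticAt ℝ ρ q) :
    AnalyticAt ℝ (tangentialField ρ) q :=
  (analyticAt_wirtingerW hρ).prod (analyticAt_wirtingerZ hρ).neg

/-- The Levi determinant is the trace of the real Hessian on the complex line spanned by the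
tangential field. -/
theorem leviDeterminant_eq (hρ : AnalyticAt ℝ ρ q) :
    leviDeterminant ρ q =
      fderiv ℝ (fderiv ℝ ρ) q (tangentialField ρ q) (tangentialField ρ q) +
      fderiv ℝ (fderiv ℝ ρ) q (I • tangentialField ρ q)
        (I • tangentialField ρ q) := by
  set X := tangentialField ρ q with hX
  set H := fderiv ℝ (fderiv ℝ ρ) q with hH
  have hXd : HasFDerivAt (tangentialField ρ) (fderiv ℝ (tangentialField ρ) q) q :=
    (analyticAt_tangentialField hρ).differentiableAt.hasFDerivAt
  have hWd : HasFDerivAt (wirtingerW ρ) (fderiv ℝ (wirtingerW ρ) q) q :=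
    (analyticAt_wirtingerW hρ).differentiableAt.hasFDerivAt
  have hZd : HasFDerivAt (wirtingerZ ρ) (fderiv ℝ (wirtingerZ ρ) q) q :=
    (analyticAt_wirtingerZ hρ).differentiableAt.hasFDerivAt
  have hW : ∀ v, fderiv ℝ (wirtingerW ρ) q v =
      ((H v (0, 1) : ℝ) - I * (H v (0, I) : ℝ)) / 2 := by
    intro v
    have h1 := Complex.ofRealCLM.hasFDerivAt.comp q
      (hasFDerivAt_fderiv_apply hρ ((0 : ℂ), (1 : ℂ)))
    have h2 := Complex.ofRealCLM.hasFDerivAt.comp q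
      (hasFDerivAt_fderiv_apply hρ ((0 : ℂ), I))
    have h3 := ((h1.sub (h2.const_mul I)).mul_const (2⁻¹ : ℂ))
    have h4 := congrArg (fun L => L v) (hWd.unique
      (h3.congr_of_eventuallyEq (Eventually.of_forall fun x => by
        simp [wirtingerW, div_eq_mul_inv])))
    rw [h4]
    simp [hH]
    ring
  have hZ : ∀ v, fderiv ℝ (wirtingerZ ρ) q v =
      ((H v (1, 0) : ℝ) - I * (H v (I, 0) : ℝ)) / 2 := by
    intro v
    have h1 := Complex.ofRealCLM.hasFDerivAt.comp q
      (hasFDerivAt_fderiv_apply hρ ((1 : ℂ), (0 : ℂ)))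
    have h2 := Complex.ofRealCLM.hasFDerivAt.comp q
      (hasFDerivAt_fderiv_apply hρ (I, (0 : ℂ)))
    have h3 := ((h1.sub (h2.const_mul I)).mul_const (2⁻¹ : ℂ))
    have h4 := congrArg (fun L => L v) (hZd.unique
      (h3.congr_of_eventuallyEq (Eventually.of_forall fun x => by
        simp [wirtingerZ, div_eq_mul_inv])))
    rw [h4]
    simp [hH]
    ring
  have hXv : ∀ v, fderiv ℝ (tangentialField ρ) q v =
      (fderiv ℝ (wirtingerW ρ) q v, -fderiv ℝ (wirtingerZ ρ) q v) := by
    intro v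
    exact congrArg (fun L => L v) (hXd.unique (hWd.prodMk hZd.neg))
  have hIX : ∀ v, fderiv ℝ (fun x => I • tangentialField ρ x) q v =
      I • fderiv ℝ (tangentialField ρ) q v := by
    intro v
    exact congrArg (fun L => L v) (hXd.const_smul I).fderiv
  rw [leviDeterminant, VectorField.lieBracket, hIX, fderiv_eq_wirtinger,
    eq_two_re_of_real_linear (H X) X, eq_two_re_of_real_linear (H (I • X))
      (I • X), ← hZ, ← hW, ← hZ, ← hW, hXv, hXv]
  have hX1 : X.1 = wirtingerW ρ q := rfl
  have hX2 : X.2 = -wirtingerZ ρ q := rfl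
  rw [← mul_add, ← Complex.add_re]
  congr 2
  simp only [Prod.smul_mk, Prod.mk_sub_mk, Prod.smul_fst, Prod.smul_snd, smul_eq_mul, hX1, hX2]
  ring_nf
  simp only [Complex.I_sq]
  ring

lemma analyticAt_leviDeterminant (hρ : AnalyticAt ℝ ρ q) :
    AnalyticAt ℝ (leviDeterminant ρ) q := by
  have hX := analyticAt_tangentialField hρ
  have hIX : AnalyticAt ℝ (fun x => I • tangentialField ρ x) q := by
    have := ((I • ContinuousLinearMap.id ℂ (ℂ × ℂ)).restrictScalars ℝ).analyticAt
      (tangentialField ρ q)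
    exact this.comp hX
  have h : AnalyticAt ℝ (fun y => fderiv ℝ (fderiv ℝ ρ) y (tangentialField ρ y)
      (tangentialField ρ y) + fderiv ℝ (fderiv ℝ ρ) y (I • tangentialField ρ y)
        (I • tangentialField ρ y)) q :=
    (analyticAt_clm_apply (analyticAt_clm_apply hρ.fderiv.fderiv hX) hX).add
      (analyticAt_clm_apply (analyticAt_clm_apply hρ.fderiv.fderiv hIX) hIX)
  refine h.congr ?_
  filter_upwards [hρ.eventually_analyticAt] with y hy
  exact (leviDeterminant_eq hy).symm

lemma IsLocalDefiningFunction.eventually {M : Set (ℂ × ℂ)} (h : IsLocalDefiningFunction M q ρ) :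
    ∀ᶠ x in 𝓝 q, IsLocalDefiningFunction M x ρ := by
  filter_upwards [h.1.eventually_analyticAt, h.1.fderiv.continuousAt.eventually_ne h.2.1,
    h.2.2.eventually_nhds] with x h1 h2 h3
  exact ⟨h1, h2, h3⟩

lemma tangentialField_ne_zero (h : fderiv ℝ ρ q ≠ 0) : tangentialField ρ q ≠ 0 := by
  intro h0
  rw [tangentialField, Prod.ext_iff] at h0
  refine h (ContinuousLinearMap.ext fun v => ?_)
  have h1 : wirtingerW ρ q = 0 := h0.1
  have h2 : wirtingerZ ρ q = 0 := neg_eq_zero.1 h0.2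
  rw [fderiv_eq_wirtinger, h1, h2]
  simp

theorem exists_complexification_defining (hρ : AnalyticAt ℝ ρ q) :
    ∃ R : (ℂ × ℂ) × ℂ × ℂ → ℂ, AnalyticAt ℂ R (q, star q) ∧
      ∀ᶠ x in 𝓝 q, R (x, star x) = ρ x := by
  let e : Fin 4 → ℂ × ℂ := ![(1, 0), (I, 0), (0, 1), (0, I)]
  let c : Fin 4 → ℂ × ℂ → ℝ :=
    ![fun x => x.1.re, fun x => x.1.im, fun x => x.2.re, fun x => x.2.im]
  let p1 : (ℂ × ℂ) × ℂ × ℂ →L[ℂ] ℂ := (ContinuousLinearMap.fst ℂ ℂ ℂ).comp (.fst ℂ _ _)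
  let p2 : (ℂ × ℂ) × ℂ × ℂ →L[ℂ] ℂ := (ContinuousLinearMap.snd ℂ ℂ ℂ).comp (.fst ℂ _ _)
  let p3 : (ℂ × ℂ) × ℂ × ℂ →L[ℂ] ℂ := (ContinuousLinearMap.fst ℂ ℂ ℂ).comp (.snd ℂ _ _)
  let p4 : (ℂ × ℂ) × ℂ × ℂ →L[ℂ] ℂ := (ContinuousLinearMap.snd ℂ ℂ ℂ).comp (.snd ℂ _ _)
  let ℓ : Fin 4 → (ℂ × ℂ) × ℂ × ℂ →L[ℂ] ℂ :=
    ![(2⁻¹ : ℂ) • (p1 + p3), ((2 * I)⁻¹ : ℂ) • (p1 - p3),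
      (2⁻¹ : ℂ) • (p2 + p4), ((2 * I)⁻¹ : ℂ) • (p2 - p4)]
  let J : ℂ × ℂ →L[ℝ] (ℂ × ℂ) × ℂ × ℂ := (ContinuousLinearMap.id ℝ (ℂ × ℂ)).prod
    ((((Complex.conjCLE : ℂ ≃L[ℝ] ℂ) : ℂ →L[ℝ] ℂ).comp (.fst ℝ ℂ ℂ)).prod
      (((Complex.conjCLE : ℂ ≃L[ℝ] ℂ) : ℂ →L[ℝ] ℂ).comp (.snd ℝ ℂ ℂ)))
  have h1 : ∀ z : ℂ, z + (starRingEnd ℂ) z = 2 * (z.re : ℂ) := fun z => by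
    rw [Complex.add_conj]; push_cast; ring
  have h2 : ∀ z : ℂ, z - (starRingEnd ℂ) z = 2 * I * (z.im : ℂ) := fun z => by
    rw [Complex.sub_conj]; push_cast; ring
  obtain ⟨R, hR, hRe⟩ := exists_complexification (analyticAt_ofReal hρ) e c
    (by
      intro x
      rw [Fin.sum_univ_four]
      refine Prod.ext ?_ ?_ <;> apply Complex.ext <;> simp [e, c]) ℓ J
    (by
      intro i x
      have hI : I ≠ 0 := Complex.I_ne_zero
      fin_cases i
      · simp [ℓ, p1, p3, J, c]
        linear_combination (1 / 2 : ℂ) * h1 x.1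
      · simp [ℓ, p1, p3, J, c, h2]
        field_simp
        simp [Complex.I_sq]
      · simp [ℓ, p2, p4, J, c]
        linear_combination (1 / 2 : ℂ) * h1 x.2
      · simp [ℓ, p2, p4, J, c, h2]
        field_simp
        simp [Complex.I_sq])
  exact ⟨R, hR, hRe⟩

/-- The map `x ↦ (x, x̄)`. -/
def conjGraph : ℂ × ℂ →L[ℝ] (ℂ × ℂ) × ℂ × ℂ :=
  (ContinuousLinearMap.id ℝ (ℂ × ℂ)).prod
    ((((Complex.conjCLE : ℂ ≃L[ℝ] ℂ) : ℂ →L[ℝ] ℂ).comp (.fst ℝ ℂ ℂ)).prod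
      (((Complex.conjCLE : ℂ ≃L[ℝ] ℂ) : ℂ →L[ℝ] ℂ).comp (.snd ℝ ℂ ℂ)))

variable {R : (ℂ × ℂ) × ℂ × ℂ → ℂ}

lemma fderiv_complexification (hR : AnalyticAt ℂ R (q, star q)) (hρ : AnalyticAt ℝ ρ q)
    (he : ∀ᶠ x in 𝓝 q, R (x, star x) = ρ x) (v : ℂ × ℂ) :
    fderiv ℂ R (q, star q) (v, star v) = fderiv ℝ ρ q v := by
  have h1 := hasFDerivAt_comp_of_eq (hasFDerivAt_real_of_complex hR)
    (conjGraph.hasFDerivAt (x := q)) rfl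
  have h2 := Complex.ofRealCLM.hasFDerivAt.comp q hρ.differentiableAt.hasFDerivAt
  exact congrArg (fun L => L v) (h1.unique (h2.congr_of_eventuallyEq he))

lemma fderiv_fderiv_complexification (hR : AnalyticAt ℂ R (q, star q)) (hρ : AnalyticAt ℝ ρ q)
    (he : ∀ᶠ x in 𝓝 q, R (x, star x) = ρ x) (u v : ℂ × ℂ) :
    fderiv ℂ (fderiv ℂ R) (q, star q) (u, star u) (v, star v) =
      fderiv ℝ (fderiv ℝ ρ) q u v := by
  have hc : Tendsto (fun x : ℂ × ℂ => (x, star x)) (𝓝 q) (𝓝 (q, star q)) :=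
    Continuous.tendsto (by fun_prop) q
  have h0 : ∀ᶠ x in 𝓝 q, fderiv ℂ R (x, star x) (v, star v) = (fderiv ℝ ρ x v : ℝ) := by
    filter_upwards [hc.eventually hR.eventually_analyticAt, hρ.eventually_analyticAt,
      he.eventually_nhds] with x hx1 hx2 hx3
    exact fderiv_complexification hx1 hx2 hx3 v
  have h1 := hasFDerivAt_comp_of_eq
    ((hasFDerivAt_fderiv_apply hR (v, star v)).restrictScalars ℝ)
    (conjGraph.hasFDerivAt (x := q)) rfl
  have h2 := Complex.ofRealCLM.hasFDerivAt.comp q (hasFDerivAt_fderiv_apply hρ v)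
  exact congrArg (fun L => L u) (h1.unique (h2.congr_of_eventuallyEq h0))

/-- The Levi determinant in terms of the complexified defining function. -/
lemma leviDeterminant_complexification (hR : AnalyticAt ℂ R (q, star q)) (hρ : AnalyticAt ℝ ρ q)
    (he : ∀ᶠ x in 𝓝 q, R (x, star x) = ρ x) :
    (leviDeterminant ρ q : ℂ) = 4 * fderiv ℂ (fderiv ℂ R) (q, star q)
      (0, star (tangentialField ρ q)) (tangentialField ρ q, 0) := by
  set X := tangentialField ρ q
  set H := fderiv ℂ (fderiv ℂ R) (q, star q)
  have hs : ∀ a b, H a b = H b a := fun a b =>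
    (hR.contDiffAt.isSymmSndFDerivAt_of_omega) a b
  have h1 : ((X, star X) : (ℂ × ℂ) × ℂ × ℂ) = (X, 0) + (0, star X) := by simp
  have h2 : ((I • X, star (I • X)) : (ℂ × ℂ) × ℂ × ℂ) =
      I • (X, 0) + (-I) • ((0 : ℂ × ℂ), star X) := by
    refine Prod.ext (by simp) ?_
    simp
  rw [leviDeterminant_eq hρ, Complex.ofReal_add, ← fderiv_fderiv_complexification hR hρ he,
    ← fderiv_fderiv_complexification hR hρ he, h1, h2]
  simp only [map_add, map_smul, _root_.add_apply, _root_.smul_apply,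
    smul_eq_mul]
  change H _ _ + H _ _ + (H _ _ + H _ _) + (I * (I * H _ _ + -I * H _ _) +
    -I * (I * H _ _ + -I * H _ _)) = _
  rw [hs (X, 0) (0, star X)]
  linear_combination (H (X, 0) (X, 0) - 2 * H (0, star X) (X, 0)
    + H (0, star X) (0, star X)) * Complex.I_sq

end

/-! ### The Levi determinant in a Segre chart -/

/-- The Levi determinant `Q_{zζ} Q_ω - Q_{zω} Q_ζ` of a Segre function `Q(z, ζ, ω)`. -/
def segreLevi (Q : ℂ × ℂ × ℂ → ℂ) (y : ℂ × ℂ × ℂ) : ℂ :=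
  fderiv ℂ (fun y => fderiv ℂ Q y (1, 0, 0)) y (0, 1, 0) * fderiv ℂ Q y (0, 0, 1) -
    fderiv ℂ (fun y => fderiv ℂ Q y (1, 0, 0)) y (0, 0, 1) * fderiv ℂ Q y (0, 1, 0)

lemma analyticAt_segreLevi {Q : ℂ × ℂ × ℂ → ℂ} {y : ℂ × ℂ × ℂ} (hQ : AnalyticAt ℂ Q y) :
    AnalyticAt ℂ (segreLevi Q) y := by
  have h1 := analyticAt_fderiv_apply hQ
  have h2 := analyticAt_fderiv_apply (h1 (1, 0, 0))
  exact ((h2 _).mul (h1 _)).sub ((h2 _).mul (h1 _))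

lemma segreLevi_translate (Q : ℂ × ℂ × ℂ → ℂ) (a y : ℂ × ℂ × ℂ) (c : ℂ) :
    segreLevi (fun y => Q (y + a) - c) y = segreLevi Q (y + a) := by
  have h1 : ∀ v, (fun y => fderiv ℂ (fun y => Q (y + a) - c) y v) =
      fun y => fderiv ℂ Q (y + a) v := by
    intro v
    funext y
    rw [fderiv_sub_const, fderiv_comp_add_right]
  have h2 : ∀ v y, fderiv ℂ (fun y => Q (y + a) - c) y v = fderiv ℂ Q (y + a) v :=
    fun v y => congrFun (h1 v) y
  simp only [segreLevi, h2]
  rw [fderiv_comp_add_right (f := fun y => fderiv ℂ Q y (1, 0, 0))]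

/-- The coefficient of the orthogonal projection of `v` to the line spanned by `X`. -/
def projectionCoefficient (v X : ℂ × ℂ) : ℂ :=
  (v.1 * star X.1 + v.2 * star X.2) / (X.1 * star X.1 + X.2 * star X.2)

lemma mul_star_add_ne_zero {X : ℂ × ℂ} (hX : X ≠ 0) :
    X.1 * star X.1 + X.2 * star X.2 ≠ 0 := by
  have h1 : X.1 * star X.1 + X.2 * star X.2 =
      ((Complex.normSq X.1 + Complex.normSq X.2 : ℝ) : ℂ) := by
    push_cast
    rw [← Complex.mul_conj, ← Complex.mul_conj]
    rfl
  rw [h1, Complex.ofReal_ne_zero]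
  intro h2
  have h3 := Complex.normSq_nonneg X.1
  have h4 := Complex.normSq_nonneg X.2
  exact hX (Prod.ext (Complex.normSq_eq_zero.1 (by linarith))
    (Complex.normSq_eq_zero.1 (by linarith)))

lemma eq_projectionCoefficient_smul {v X : ℂ × ℂ} (hX : X ≠ 0) (h : X.1 * v.2 = X.2 * v.1) :
    v = projectionCoefficient v X • X := by
  have h1 := mul_star_add_ne_zero hX
  refine Prod.ext ?_ ?_
  · rw [Prod.smul_fst, smul_eq_mul, projectionCoefficient, div_mul_eq_mul_div, eq_div_iff h1]
    linear_combination -star X.2 * h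
  · rw [Prod.smul_snd, smul_eq_mul, projectionCoefficient, div_mul_eq_mul_div, eq_div_iff h1]
    linear_combination star X.1 * h

lemma ContinuousAt.projectionCoefficient {E : Type*} [TopologicalSpace E] {v X : E → ℂ × ℂ}
    {x : E} (hv : ContinuousAt v x) (hX : ContinuousAt X x) (h0 : X x ≠ 0) :
    ContinuousAt (fun y => LeviDegenerate.projectionCoefficient (v y) (X y)) x := by
  have h1 := mul_star_add_ne_zero h0
  unfold LeviDegenerate.projectionCoefficient
  exact ContinuousAt.div (by fun_prop) (by fun_prop) h1

lemma fderiv_complexification_fst {ρ : ℂ × ℂ → ℝ} {q : ℂ × ℂ} {R : (ℂ × ℂ) × ℂ × ℂ → ℂ}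
    (hR : AnalyticAt ℂ R (q, star q)) (hρ : AnalyticAt ℝ ρ q)
    (he : ∀ᶠ x in 𝓝 q, R (x, star x) = ρ x) (v : ℂ × ℂ) :
    fderiv ℂ R (q, star q) (v, 0) = wirtingerZ ρ q * v.1 + wirtingerW ρ q * v.2 := by
  set c := wirtingerZ ρ q * v.1 + wirtingerW ρ q * v.2 with hc
  set L := fderiv ℂ R (q, star q)
  have h1 := fderiv_complexification hR hρ he v
  have h2 := fderiv_complexification hR hρ he (I • v)
  rw [fderiv_eq_wirtinger, ← hc] at h1
  have h3 : wirtingerZ ρ q * (I • v).1 + wirtingerW ρ q * (I • v).2 =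
      I * c := by
    rw [hc, Prod.smul_fst, Prod.smul_snd, smul_eq_mul, smul_eq_mul]; ring
  rw [fderiv_eq_wirtinger, h3] at h2
  have h4 : ((v, star v) : (ℂ × ℂ) × ℂ × ℂ) = (v, 0) + (0, star v) := by simp
  have h5 : ((I • v, star (I • v)) : (ℂ × ℂ) × ℂ × ℂ) =
      I • (v, 0) + (-I) • ((0 : ℂ × ℂ), star v) := by
    refine Prod.ext (by simp) ?_
    simp
  rw [h4, map_add] at h1
  rw [h5, map_add, map_smul, map_smul, smul_eq_mul, smul_eq_mul] at h2
  have h6 : c = (c.re : ℂ) + (c.im : ℂ) * I := (Complex.re_add_im c).symm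
  simp only [Complex.mul_re, Complex.I_re, Complex.I_im, zero_mul, one_mul, zero_sub] at h2
  push_cast at h1 h2
  rw [h6]
  linear_combination (1 / 2 : ℂ) * h1 - (1 / 2 : ℂ) * I * h2 + (1 / 2 : ℂ) *
    (L (v, 0) - L (0, star v)) * Complex.I_sq

lemma fderiv_complexification_snd {ρ : ℂ × ℂ → ℝ} {q : ℂ × ℂ} {R : (ℂ × ℂ) × ℂ × ℂ → ℂ}
    (hR : AnalyticAt ℂ R (q, star q)) (hρ : AnalyticAt ℝ ρ q)
    (he : ∀ᶠ x in 𝓝 q, R (x, star x) = ρ x) (v : ℂ × ℂ) :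
    fderiv ℂ R (q, star q) (0, star v) = star (wirtingerZ ρ q * v.1 + wirtingerW ρ q * v.2) := by
  set c := wirtingerZ ρ q * v.1 + wirtingerW ρ q * v.2 with hc
  have h1 := fderiv_complexification hR hρ he v
  rw [fderiv_eq_wirtinger, ← hc] at h1
  have h4 : ((v, star v) : (ℂ × ℂ) × ℂ × ℂ) = (v, 0) + (0, star v) := by simp
  rw [h4, map_add, fderiv_complexification_fst hR hρ he, ← hc] at h1
  have h2 := eq_two_re c
  push_cast at h1
  linear_combination h1 - 2 * h2

section Chart

variable {M : Set (ℂ × ℂ)} {q : ℂ × ℂ} {Θ : ℂ × ℂ → ℂ × ℂ} {φ : ℂ × ℝ → ℝ} {Q : ℂ × ℂ × ℂ → ℂ}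

lemma IsSegreChart.fderiv_omega_ne_zero (h : IsSegreChart M q Θ φ Q) :
    fderiv ℂ Q 0 (0, 0, 1) ≠ 0 := by
  have hQ := h.analytic
  have hr : AnalyticAt ℂ (reflect Q) 0 := analyticAt_reflect (by simpa using hQ)
  have h1 : HasFDerivAt (fun y : ℂ × ℂ × ℂ => (y.2.1, y.1, Q y))
      (((ContinuousLinearMap.fst ℂ ℂ ℂ).comp (.snd ℂ ℂ (ℂ × ℂ))).prod
        ((ContinuousLinearMap.fst ℂ ℂ (ℂ × ℂ)).prod (fderiv ℂ Q 0))) 0 :=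
    ((ContinuousLinearMap.fst ℂ ℂ ℂ).comp (.snd ℂ ℂ (ℂ × ℂ))).hasFDerivAt.prodMk
      ((ContinuousLinearMap.fst ℂ ℂ (ℂ × ℂ)).hasFDerivAt.prodMk hQ.differentiableAt.hasFDerivAt)
  have h2 := hasFDerivAt_comp_of_eq hr.differentiableAt.hasFDerivAt h1 (by simp [h.map_zero])
  have h3 := h2.unique
    ((((ContinuousLinearMap.snd ℂ ℂ ℂ).comp (.snd ℂ ℂ (ℂ × ℂ))).hasFDerivAt
      ).congr_of_eventuallyEq h.reality)
  have h4 := congrArg (fun L => L (0, 0, 1)) h3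
  intro h0
  simp [h0] at h4

/-- Along `M` the Levi determinant is a multiple of the Levi determinant of the Segre function. -/
theorem IsSegreChart.exists_leviDeterminant_eq (h : IsSegreChart M q Θ φ Q) {ρ : ℂ × ℂ → ℝ}
    (hρ : IsLocalDefiningFunction M q ρ) :
    ∃ U : ℂ × ℂ → ℂ, ContinuousAt U q ∧ U q ≠ 0 ∧ ∀ᶠ x in 𝓝 q, x ∈ M →
      (leviDeterminant ρ x : ℂ) =
        U x * segreLevi Q ((Θ x).1, star (Θ x).1, star (Θ x).2) := by
  have hQ := h.analytic
  obtain ⟨R, hR, he⟩ := exists_complexification_defining hρ.1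
  obtain ⟨Ξ, hΞ, hΞ0, hΞ1, hΞ2, hΞb, -⟩ := h.biholo.exists_inverse
  have hΞr : AnalyticAt ℂ (reflect Ξ) 0 := analyticAt_reflect (by simpa using hΞ)
  have hQ0 := h.map_zero
  have hκ : AnalyticAt ℂ (fun y : ℂ × ℂ × ℂ => (y.1, Q y)) 0 := by fun_prop
  have hκ0 : ((0 : ℂ × ℂ × ℂ).1, Q 0) = 0 := by rw [hQ0]; rfl
  have hP : AnalyticAt ℂ (fun y : ℂ × ℂ × ℂ => Ξ (y.1, Q y)) 0 :=
    AnalyticAt.comp_of_eq hΞ hκ hκ0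
  have hPb : AnalyticAt ℂ (fun y : ℂ × ℂ × ℂ => reflect Ξ y.2) 0 :=
    AnalyticAt.comp_of_eq hΞr (f := fun y : ℂ × ℂ × ℂ => y.2) (by fun_prop) rfl
  have hPP0 : (Ξ ((0 : ℂ × ℂ × ℂ).1, Q 0), reflect Ξ (0 : ℂ × ℂ × ℂ).2) = (q, star q) := by
    rw [hκ0, hΞ0, Prod.snd_zero, reflect_apply, star_zero, hΞ0]
  have hPP := hP.prod hPb
  have hzero : ∀ᶠ y in 𝓝 (0 : ℂ × ℂ × ℂ), R (Ξ (y.1, Q y), reflect Ξ y.2) = 0 := by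
    refine h.eventually_zero (D := fun y => R (Ξ (y.1, Q y), reflect Ξ y.2))
      (AnalyticAt.comp_of_eq hR hPP hPP0) ?_
    have hΞc : Tendsto Ξ (𝓝 0) (𝓝 q) := by
      have := hΞ.continuousAt.tendsto
      rwa [hΞ0] at this
    filter_upwards [hΞ2, hΞc.eventually hρ.2.2, hΞc.eventually h.mem_iff, hΞc.eventually he]
      with y hy1 hy2 hy3 hy4 hg hs
    rw [hy1] at hy3
    rw [← hs, reflect_apply]
    have : star ((star y.1, star y.2) : ℂ × ℂ) = y := by simp [Prod.star_def]
    rw [this]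
    change R (Ξ y, star (Ξ y)) = 0
    rw [hy4, hy2.1 (hy3.2 hg), Complex.ofReal_zero]
  have hQz := analyticAt_fderiv_apply hQ
  -- the differentiated identities
  have key : ∀ᶠ y in 𝓝 (0 : ℂ × ℂ × ℂ),
      fderiv ℂ R (Ξ (y.1, Q y), reflect Ξ y.2)
        (fderiv ℂ Ξ (y.1, Q y) (1, fderiv ℂ Q y (1, 0, 0)), 0) = 0 ∧
      fderiv ℂ R (Ξ (y.1, Q y), reflect Ξ y.2)
        (0, fderiv ℂ (reflect Ξ) y.2 (fderiv ℂ Q y (0, 0, 1), -fderiv ℂ Q y (0, 1, 0))) = 0 ∧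
      fderiv ℂ (fderiv ℂ R) (Ξ (y.1, Q y), reflect Ξ y.2)
        (0, fderiv ℂ (reflect Ξ) y.2 (fderiv ℂ Q y (0, 0, 1), -fderiv ℂ Q y (0, 1, 0)))
        (fderiv ℂ Ξ (y.1, Q y) (1, fderiv ℂ Q y (1, 0, 0)), 0) =
      -(fderiv ℂ R (Ξ (y.1, Q y), reflect Ξ y.2) (fderiv ℂ Ξ (y.1, Q y) (0, 1), 0) *
        segreLevi Q y) := by
    have c1 : ∀ᶠ y in 𝓝 (0 : ℂ × ℂ × ℂ), AnalyticAt ℂ Ξ (y.1, Q y) := by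
      have := hκ.continuousAt.tendsto
      rw [hκ0] at this
      exact this.eventually hΞ.eventually_analyticAt
    have c2 : ∀ᶠ y in 𝓝 (0 : ℂ × ℂ × ℂ), AnalyticAt ℂ (reflect Ξ) y.2 :=
      (continuous_snd.tendsto' (0 : ℂ × ℂ × ℂ) 0 rfl).eventually hΞr.eventually_analyticAt
    have c3 : ∀ᶠ y in 𝓝 (0 : ℂ × ℂ × ℂ), AnalyticAt ℂ R (Ξ (y.1, Q y), reflect Ξ y.2) := by
      have := hPP.continuousAt.tendsto
      rw [hPP0] at this
      exact this.eventually hR.eventually_analyticAt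
    have hd : ∀ᶠ y in 𝓝 (0 : ℂ × ℂ × ℂ),
        HasFDerivAt (fun y : ℂ × ℂ × ℂ => (Ξ (y.1, Q y), reflect Ξ y.2))
          (((fderiv ℂ Ξ (y.1, Q y)).comp ((ContinuousLinearMap.fst ℂ ℂ (ℂ × ℂ)).prod
            (fderiv ℂ Q y))).prod ((fderiv ℂ (reflect Ξ) y.2).comp
              (ContinuousLinearMap.snd ℂ ℂ (ℂ × ℂ)))) y := by
      filter_upwards [c1, c2, hQ.eventually_analyticAt] with y d1 d2 d3
      refine HasFDerivAt.prodMk ?_ ?_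
      · exact hasFDerivAt_comp_of_eq d1.differentiableAt.hasFDerivAt
          (hasFDerivAt_fst.prodMk d3.differentiableAt.hasFDerivAt) rfl
      · exact hasFDerivAt_comp_of_eq d2.differentiableAt.hasFDerivAt hasFDerivAt_snd rfl
    have hker : ∀ᶠ y in 𝓝 (0 : ℂ × ℂ × ℂ), ∀ v : ℂ × ℂ × ℂ,
        fderiv ℂ R (Ξ (y.1, Q y), reflect Ξ y.2)
          (fderiv ℂ Ξ (y.1, Q y) (v.1, fderiv ℂ Q y v), fderiv ℂ (reflect Ξ) y.2 v.2) = 0 := by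
      filter_upwards [hd, c3, hzero.eventually_nhds] with y d1 d2 d3 v
      have h1 := hasFDerivAt_comp_of_eq d2.differentiableAt.hasFDerivAt d1 rfl
      exact congrArg (fun L => L v)
        (h1.unique ((hasFDerivAt_const (0 : ℂ) y).congr_of_eventuallyEq d3))
    have hDQ : ∀ y : ℂ × ℂ × ℂ, fderiv ℂ Q y
        (0, fderiv ℂ Q y (0, 0, 1), -fderiv ℂ Q y (0, 1, 0)) = 0 := by
      intro y
      have : ((0 : ℂ), fderiv ℂ Q y (0, 0, 1), -fderiv ℂ Q y (0, 1, 0)) =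
          fderiv ℂ Q y (0, 0, 1) • ((0 : ℂ), (1 : ℂ), (0 : ℂ)) +
          (-fderiv ℂ Q y (0, 1, 0)) • ((0 : ℂ), (0 : ℂ), (1 : ℂ)) := by simp
      rw [this, map_add, map_smul, map_smul, smul_eq_mul, smul_eq_mul]
      ring
    filter_upwards [hker.eventually_nhds, hd, c1, c3, hQ.eventually_analyticAt]
      with y k1 k2 k3 k4 k5
    have e1 : ∀ᶠ y in 𝓝 y, fderiv ℂ R (Ξ (y.1, Q y), reflect Ξ y.2)
        (fderiv ℂ Ξ (y.1, Q y) (1, fderiv ℂ Q y (1, 0, 0)), 0) = 0 := by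
      filter_upwards [k1] with y hy
      have := hy (1, 0, 0)
      simpa using this
    refine ⟨e1.self_of_nhds, ?_, ?_⟩
    · have := k1.self_of_nhds (0, fderiv ℂ Q y (0, 0, 1), -fderiv ℂ Q y (0, 1, 0))
      rw [hDQ] at this
      simpa using this
    · have f1 := hasFDerivAt_comp_of_eq (g := fderiv ℂ R)
        k4.fderiv.differentiableAt.hasFDerivAt k2 rfl
      have f2 : HasFDerivAt (fun y : ℂ × ℂ × ℂ => fderiv ℂ Ξ (y.1, Q y)) _ y :=
        hasFDerivAt_comp_of_eq (g := fderiv ℂ Ξ) k3.fderiv.differentiableAt.hasFDerivAt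
          (hasFDerivAt_fst.prodMk k5.differentiableAt.hasFDerivAt) rfl
      have f3 : HasFDerivAt (fun y => ((1 : ℂ), fderiv ℂ Q y (1, 0, 0)))
          ((0 : ℂ × ℂ × ℂ →L[ℂ] ℂ).prod (fderiv ℂ (fun y => fderiv ℂ Q y (1, 0, 0)) y)) y :=
        (hasFDerivAt_const _ _).prodMk
          (analyticAt_fderiv_apply k5 (1, 0, 0)).differentiableAt.hasFDerivAt
      have f4 := (f2.clm_apply f3).prodMk (hasFDerivAt_const (0 : ℂ × ℂ) y)
      have f5 := f1.clm_apply f4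
      have f6 := f5.unique ((hasFDerivAt_const (0 : ℂ) y).congr_of_eventuallyEq e1)
      have f7 := congrArg
        (fun L => L (0, fderiv ℂ Q y (0, 0, 1), -fderiv ℂ Q y (0, 1, 0))) f6
      have f8 : fderiv ℂ (fun y => fderiv ℂ Q y (1, 0, 0)) y
          (0, fderiv ℂ Q y (0, 0, 1), -fderiv ℂ Q y (0, 1, 0)) = segreLevi Q y := by
        have : ((0 : ℂ), fderiv ℂ Q y (0, 0, 1), -fderiv ℂ Q y (0, 1, 0)) =
            fderiv ℂ Q y (0, 0, 1) • ((0 : ℂ), (1 : ℂ), (0 : ℂ)) +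
            (-fderiv ℂ Q y (0, 1, 0)) • ((0 : ℂ), (0 : ℂ), (1 : ℂ)) := by simp
        rw [this, map_add, map_smul, map_smul, smul_eq_mul, smul_eq_mul, segreLevi]
        ring
      have f9 : ((0 : ℂ), segreLevi Q y) = segreLevi Q y • ((0 : ℂ), (1 : ℂ)) := by simp
      have f10 : ∀ c : ℂ, ∀ v : ℂ × ℂ, ((c • v, 0) : (ℂ × ℂ) × ℂ × ℂ) = c • (v, 0) := by
        intro c v; simp
      simp only [_root_.add_apply, ContinuousLinearMap.comp_apply,
        ContinuousLinearMap.prod_apply, ContinuousLinearMap.flip_apply, hDQ, f8,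
        _root_.zero_apply, ContinuousLinearMap.coe_fst', ContinuousLinearMap.coe_snd'] at f7
      have z1 : fderiv ℂ Ξ (y.1, Q y) ((0 : ℂ), (0 : ℂ)) = 0 :=
        (fderiv ℂ Ξ (y.1, Q y)).map_zero
      have z2 : fderiv ℂ (fderiv ℂ Ξ) (y.1, Q y) ((0 : ℂ), (0 : ℂ)) = 0 :=
        (fderiv ℂ (fderiv ℂ Ξ) (y.1, Q y)).map_zero
      simp only [z1, z2, _root_.zero_apply, add_zero, f9, map_smul, f10, smul_eq_mul] at f7
      linear_combination f7
  -- the coefficient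
  let c : ℂ × ℂ → ℂ × ℂ × ℂ := fun x => ((Θ x).1, star (Θ x).1, star (Θ x).2)
  have hΘc := h.biholo.1.continuousAt
  have hc : ContinuousAt c q := by simp only [c]; fun_prop
  have hc0 : c q = 0 := by simp [c, h.biholo.2.2]
  let α : ℂ × ℂ → ℂ × ℂ := fun x => fderiv ℂ Ξ (Θ x) (1, fderiv ℂ Q (c x) (1, 0, 0))
  let β : ℂ × ℂ → ℂ × ℂ := fun x =>
    fderiv ℂ (reflect Ξ) (c x).2 (fderiv ℂ Q (c x) (0, 0, 1), -fderiv ℂ Q (c x) (0, 1, 0))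
  let ε : ℂ × ℂ → ℂ × ℂ := fun x => fderiv ℂ Ξ (Θ x) (0, 1)
  let X := tangentialField ρ
  have hX : ContinuousAt X q := (analyticAt_tangentialField hρ.1).continuousAt
  have hXq : X q ≠ 0 := tangentialField_ne_zero hρ.2.1
  have hΞΘ : ContinuousAt (fun x => fderiv ℂ Ξ (Θ x)) q :=
    ContinuousAt.comp_of_eq hΞ.fderiv.continuousAt hΘc h.biholo.2.2
  have hQc : ∀ v, ContinuousAt (fun x => fderiv ℂ Q (c x) v) q := fun v =>
    ContinuousAt.comp_of_eq (hQz v).continuousAt hc hc0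
  have hα : ContinuousAt α q := hΞΘ.clm_apply (continuousAt_const.prodMk (hQc _))
  have hε : ContinuousAt ε q := hΞΘ.clm_apply continuousAt_const
  have hβ : ContinuousAt β q := by
    have h1 : ContinuousAt (fun x => fderiv ℂ (reflect Ξ) (c x).2) q :=
      ContinuousAt.comp_of_eq (f := fun x => (c x).2) hΞr.fderiv.continuousAt
        (continuousAt_snd.comp hc) (by rw [hc0]; rfl)
    exact h1.clm_apply ((hQc _).prodMk (hQc _).neg)
  have hZ : ContinuousAt (wirtingerZ ρ) q := (analyticAt_wirtingerZ hρ.1).continuousAt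
  have hW : ContinuousAt (wirtingerW ρ) q := (analyticAt_wirtingerW hρ.1).continuousAt
  let τ : ℂ × ℂ → ℂ := fun x => wirtingerZ ρ x * (ε x).1 + wirtingerW ρ x * (ε x).2
  have hτ : ContinuousAt τ q := by simp only [τ]; fun_prop
  let μ : ℂ × ℂ → ℂ := fun x => projectionCoefficient (α x) (X x)
  let ν : ℂ × ℂ → ℂ := fun x => projectionCoefficient (star (β x)) (X x)
  have hμ : ContinuousAt μ q := ContinuousAt.projectionCoefficient hα hX hXq
  have hν : ContinuousAt ν q :=
    ContinuousAt.projectionCoefficient (continuous_star.continuousAt.comp hβ) hX hXq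
  have hct : Tendsto c (𝓝 q) (𝓝 0) := by
    have := hc.tendsto
    rwa [hc0] at this
  have hΘt : Tendsto Θ (𝓝 q) (𝓝 0) := by
    have := hΘc.tendsto
    rwa [h.biholo.2.2] at this
  -- relations at the points of `M`
  have main : ∀ᶠ x in 𝓝 q, x ∈ M → α x = μ x • X x ∧ star (β x) = ν x • X x ∧
      (leviDeterminant ρ x : ℂ) * (μ x * star (ν x)) =
        -4 * τ x * segreLevi Q (c x) := by
    have hRc : Tendsto (fun x : ℂ × ℂ => (x, star x)) (𝓝 q) (𝓝 (q, star q)) :=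
      Continuous.tendsto (by fun_prop) q
    filter_upwards [hct.eventually key, h.mem_iff, hΘt.eventually h.segre_iff, hΞ1,
      hRc.eventually hR.eventually_analyticAt, hρ.1.eventually_analyticAt, he.eventually_nhds,
      hX.eventually_ne hXq] with x k1 k2 k3 k4 k5 k6 k7 k8 hx
    have hs : Q (c x) = (Θ x).2 := (k3.1 (k2.1 hx)).symm
    have h1 : ((c x).1, Q (c x)) = Θ x := by rw [hs]
    have h2 : reflect Ξ (c x).2 = star x := by
      rw [reflect_apply]
      have : star (c x).2 = Θ x := by simp [c, Prod.star_def]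
      rw [this, k4]
    rw [h1, h2, k4] at k1
    obtain ⟨m1, m2, m3⟩ := k1
    have hα' : α x = μ x • X x := by
      refine eq_projectionCoefficient_smul k8 ?_
      change wirtingerW ρ x * (α x).2 = -wirtingerZ ρ x * (α x).1
      rw [fderiv_complexification_fst k5 k6 k7] at m1
      linear_combination m1
    have hβ' : star (β x) = ν x • X x := by
      refine eq_projectionCoefficient_smul k8 ?_
      change wirtingerW ρ x * (star (β x)).2 = -wirtingerZ ρ x * (star (β x)).1
      change fderiv ℂ R (x, star x) (0, β x) = 0 at m2
      rw [← star_star (β x), fderiv_complexification_snd k5 k6 k7, star_eq_zero] at m2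
      linear_combination m2
    refine ⟨hα', hβ', ?_⟩
    change fderiv ℂ (fderiv ℂ R) (x, star x) (0, β x) (α x, 0) =
      -(fderiv ℂ R (x, star x) (ε x, 0) * segreLevi Q (c x)) at m3
    rw [fderiv_complexification_fst k5 k6 k7] at m3
    have hβ2 : β x = star (ν x) • star (X x) := by
      rw [← star_star (β x), hβ', star_smul]
    have n1 : ((0, β x) : (ℂ × ℂ) × ℂ × ℂ) = star (ν x) • (0, star (X x)) := by
      rw [hβ2]; simp
    have n2 : ((α x, 0) : (ℂ × ℂ) × ℂ × ℂ) = μ x • (X x, 0) := by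
      rw [hα']; simp
    rw [n1, n2, map_smul, map_smul, _root_.smul_apply, smul_eq_mul, smul_eq_mul] at m3
    rw [leviDeterminant_complexification k5 k6 k7]
    linear_combination 4 * m3
  have hμq : μ q ≠ 0 := by
    intro h0
    have h1 := (main.self_of_nhds h.mem).1
    rw [h0, zero_smul] at h1
    have h2 : fderiv ℂ Ξ 0 (1, fderiv ℂ Q (c q) (1, 0, 0)) = 0 := by
      have h3 : fderiv ℂ Ξ (Θ q) (1, fderiv ℂ Q (c q) (1, 0, 0)) = 0 := h1
      rwa [h.biholo.2.2] at h3
    have h3 := hΞb.1 (h2.trans (fderiv ℂ Ξ 0).map_zero.symm)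
    exact one_ne_zero (congrArg Prod.fst h3)
  have hνq : ν q ≠ 0 := by
    intro h0
    have h1 := (main.self_of_nhds h.mem).2.1
    rw [h0, zero_smul, star_eq_zero] at h1
    have h2 : fderiv ℂ (reflect Ξ) 0 (fderiv ℂ Q 0 (0, 0, 1), -fderiv ℂ Q 0 (0, 1, 0)) = 0 := by
      simp only [β, hc0] at h1
      exact h1
    rw [fderiv_reflect (by simpa using hΞ.differentiableAt), star_zero, star_eq_zero] at h2
    have h3 := hΞb.1 (h2.trans (fderiv ℂ Ξ 0).map_zero.symm)
    exact h.fderiv_omega_ne_zero (star_eq_zero.1 (congrArg Prod.fst h3))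
  have hτq : τ q ≠ 0 := by
    intro h0
    have h1 : wirtingerZ ρ q * (α q).1 + wirtingerW ρ q * (α q).2 = 0 := by
      rw [(main.self_of_nhds h.mem).1]
      change wirtingerZ ρ q * (μ q * wirtingerW ρ q) +
        wirtingerW ρ q * (μ q * -wirtingerZ ρ q) = 0
      ring
    refine hρ.2.1 (ContinuousLinearMap.ext fun v => ?_)
    obtain ⟨u, rfl⟩ := hΞb.2 v
    have h2 : fderiv ℂ Ξ 0 u =
        u.1 • α q + (u.2 - u.1 * fderiv ℂ Q (c q) (1, 0, 0)) • ε q := by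
      simp only [α, ε, h.biholo.2.2]
      rw [← map_smul, ← map_smul, ← map_add]
      congr 1
      refine Prod.ext ?_ ?_ <;> simp
    rw [fderiv_eq_wirtinger, h2]
    simp only [Prod.fst_add, Prod.snd_add, Prod.smul_fst, Prod.smul_snd, smul_eq_mul]
    have h3 : ∀ s t : ℂ, wirtingerZ ρ q * (s * (α q).1 + t * (ε q).1) +
        wirtingerW ρ q * (s * (α q).2 + t * (ε q).2) = 0 := by
      intro s t
      linear_combination s * h1 + t * h0
    rw [h3]
    simp
  have hden : μ q * star (ν q) ≠ 0 := mul_ne_zero hμq (star_ne_zero.2 hνq)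
  have hdc : ContinuousAt (fun x => μ x * star (ν x)) q :=
    hμ.mul (continuous_star.continuousAt.comp hν)
  refine ⟨fun x => -4 * τ x / (μ x * star (ν x)), (continuousAt_const.mul hτ).div hdc hden,
    div_ne_zero (mul_ne_zero (by norm_num) hτq) hden, ?_⟩
  filter_upwards [main, hdc.eventually_ne hden] with x hx1 hx2 hx
  rw [div_mul_eq_mul_div, eq_div_iff hx2]
  exact (hx1 hx).2.2

end Chart

/-! ### The Levi degeneracy set in Segre charts -/

lemma eventually_zero_of_real₂ {G : ℂ × ℂ → ℂ} (hG : AnalyticAt ℂ G 0)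
    (h : ∀ᶠ y : ℝ × ℝ in 𝓝 0, G (y.1, y.2) = 0) : ∀ᶠ y in 𝓝 0, G y = 0 := by
  have h1 := eventually_zero_of_real (x₀ := (0 : ℂ)) hG (range ((↑) : ℝ → ℂ)) (by
    have hc : Tendsto (fun y : ℝ × ℂ => (y.1, y.2.re)) (𝓝 (0, 0)) (𝓝 0) :=
      Continuous.tendsto' (by fun_prop) _ _ (by simp)
    filter_upwards [hc.eventually h] with y hy hS
    obtain ⟨t, ht⟩ := hS
    rw [← ht] at hy ⊢
    simpa using hy)
  have h2 := eventually_zero_of_real (x₀ := (0 : ℂ)) (G := fun y : ℂ × ℂ => G (y.2, y.1))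
    (AnalyticAt.comp_of_eq hG (f := fun y : ℂ × ℂ => (y.2, y.1)) (by fun_prop) rfl) univ (by
    have hc : Tendsto (fun y : ℝ × ℂ => (y.2, (y.1 : ℂ))) (𝓝 (0, 0)) (𝓝 (0, 0)) :=
      Continuous.tendsto' (by fun_prop) _ _ (by simp)
    filter_upwards [hc.eventually h1] with y hy _
    exact hy ⟨y.1, rfl⟩)
  have hc : Tendsto (fun y : ℂ × ℂ => (y.2, y.1)) (𝓝 0) (𝓝 (0, 0)) :=
    Continuous.tendsto' (by fun_prop) _ _ rfl
  filter_upwards [hc.eventually h2] with y hy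
  exact hy trivial

/-- The product of a continuous function and a differentiable function with a zero. -/
lemma hasDerivAt_mul_of_continuousAt {f g : ℝ → ℂ} {g' : ℂ} {x : ℝ} (hf : ContinuousAt f x)
    (hg : HasDerivAt g g' x) (h0 : g x = 0) : HasDerivAt (fun t => f t * g t) (f x * g') x := by
  rw [hasDerivAt_iff_tendsto_slope] at hg ⊢
  have h1 := (hf.tendsto.mono_left (nhdsWithin_le_nhds (s := {x}ᶜ))).mul hg
  refine h1.congr fun t => ?_
  simp only [slope, vsub_eq_sub, h0, mul_zero, sub_zero, Complex.real_smul]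
  ring

lemma IsLocalBiholomorphismToZero.comp {H : ℂ × ℂ → ℂ × ℂ} {Θ : ℂ × ℂ → ℂ × ℂ} {q : ℂ × ℂ}
    (hH : IsLocalBiholomorphismToZero H 0) (hΘ : IsLocalBiholomorphismToZero Θ q) :
    IsLocalBiholomorphismToZero (fun x => H (Θ x)) q ∧
      ∀ v, fderiv ℂ (fun x => H (Θ x)) q v = fderiv ℂ H 0 (fderiv ℂ Θ q v) := by
  have h1 := hasFDerivAt_comp_of_eq hH.1.differentiableAt.hasFDerivAt
    hΘ.1.differentiableAt.hasFDerivAt hΘ.2.2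
  refine ⟨⟨AnalyticAt.comp_of_eq hH.1 hΘ.1 hΘ.2.2, ?_, by simp only [hΘ.2.2, hH.2.2]⟩,
    fun v => by rw [h1.fderiv]; rfl⟩
  rw [h1.fderiv]
  exact hH.2.1.comp hΘ.2.1

section Chart

variable {M : Set (ℂ × ℂ)} {q : ℂ × ℂ} {Θ : ℂ × ℂ → ℂ × ℂ} {φ : ℂ × ℝ → ℝ} {Q : ℂ × ℂ × ℂ → ℂ}
  {ρ : ℂ × ℂ → ℝ}

lemma IsSegreChart.tendsto (h : IsSegreChart M q Θ φ Q) : Tendsto Θ (𝓝 q) (𝓝 0) := by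
  have := h.biholo.1.continuousAt.tendsto
  rwa [h.biholo.2.2] at this

lemma IsSegreChart.mem_leviDegeneracySet_center_iff (h : IsSegreChart M q Θ φ Q)
    (hρ : IsLocalDefiningFunction M q ρ) :
    q ∈ leviDegeneracySet M ↔ segreLevi Q 0 = 0 := by
  have key : ∀ ρ, IsLocalDefiningFunction M q ρ →
      (leviDeterminant ρ q = 0 ↔ segreLevi Q 0 = 0) := by
    intro ρ hρ
    obtain ⟨U, -, hU0, hU⟩ := h.exists_leviDeterminant_eq hρ
    have h1 := hU.self_of_nhds h.mem
    rw [h.biholo.2.2] at h1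
    simp only [Prod.fst_zero, Prod.snd_zero, star_zero, prod_mk_zero_zero] at h1
    rw [← Complex.ofReal_eq_zero, h1, mul_eq_zero, or_iff_right hU0]
  constructor
  · rintro ⟨-, ρ', hρ', h0⟩
    exact (key ρ' hρ').1 h0
  · intro h0
    exact ⟨h.mem, ρ, hρ, (key ρ hρ).2 h0⟩

lemma IsSegreChart.mem_leviDegeneracySet_iff (h : IsSegreChart M q Θ φ Q)
    (hρ : IsLocalDefiningFunction M q ρ) :
    ∀ᶠ x in 𝓝 q, x ∈ M → (x ∈ leviDegeneracySet M ↔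
      segreLevi Q ((Θ x).1, star (Θ x).1, star (Θ x).2) = 0) := by
  filter_upwards [h.translate, hρ.eventually] with x h1 h2 hx
  rw [(h1 hx).mem_leviDegeneracySet_center_iff h2, segreLevi_translate, zero_add]

/-- An adapted chart at a point of `M`. -/
lemma IsLocalDefiningFunction.exists_isSegreChart (hρ : IsLocalDefiningFunction M q ρ)
    (hq : q ∈ M) : ∃ Θ φ Q, IsSegreChart M q Θ φ Q ∧ fderiv ℝ φ 0 = 0 ∧
      ∀ v, fderiv ℝ ρ q v = 1 * (fderiv ℂ Θ q v).2.im := by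
  obtain ⟨Θ, hΘ, hd⟩ := exists_adapted_biholomorphism hρ.2.1
  obtain ⟨φ, Q, h, hφ⟩ := exists_graph hρ hq hΘ one_ne_zero hd
  exact ⟨Θ, φ, Q, h, hφ, hd⟩

lemma IsLocalDefiningFunction.mem_leviDegeneracySet_iff (hρ : IsLocalDefiningFunction M q ρ)
    (hq : q ∈ M) :
    ∀ᶠ x in 𝓝 q, x ∈ M → (x ∈ leviDegeneracySet M ↔ leviDeterminant ρ x = 0) := by
  obtain ⟨Θ, φ, Q, h, -, -⟩ := hρ.exists_isSegreChart hq
  obtain ⟨U, hUc, hU0, hU⟩ := h.exists_leviDeterminant_eq hρ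
  filter_upwards [h.mem_leviDegeneracySet_iff hρ, hU, hUc.eventually_ne hU0] with x h1 h2 h3 hx
  rw [h1 hx, ← Complex.ofReal_eq_zero, h2 hx, mul_eq_zero, or_iff_right h3]

lemma IsLocalDefiningFunction.mem_complexTangentVectors_iff
    (hρ : IsLocalDefiningFunction M q ρ) (hq : q ∈ M) (v : ℂ × ℂ) :
    v ∈ complexTangentVectors M q ↔ wirtingerZ ρ q * v.1 + wirtingerW ρ q * v.2 = 0 := by
  obtain ⟨Θ, φ, Q, h, hφ, hd⟩ := hρ.exists_isSegreChart hq
  rw [h.mem_complexTangentVectors_iff hφ hρ]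
  set c := wirtingerZ ρ q * v.1 + wirtingerW ρ q * v.2 with hc
  have h1 := hd v
  have h2 := hd (I • v)
  rw [fderiv_eq_wirtinger, ← hc, one_mul] at h1
  have h3 : wirtingerZ ρ q * (I • v).1 + wirtingerW ρ q * (I • v).2 =
      I * c := by
    rw [hc, Prod.smul_fst, Prod.smul_snd, smul_eq_mul, smul_eq_mul]; ring
  rw [fderiv_eq_wirtinger, h3, map_smul, one_mul, Prod.smul_snd, smul_eq_mul] at h2
  simp only [Complex.mul_re, Complex.mul_im, Complex.I_re, Complex.I_im, zero_mul, one_mul,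
    zero_sub, zero_add] at h2
  constructor
  · intro h0
    rw [h0] at h1 h2
    exact Complex.ext (by simpa using h1) (by simpa using h2)
  · intro h0
    rw [h0] at h1 h2
    exact Complex.ext (by simpa using h2.symm) (by simpa using h1.symm)

/-- Near a generic Levi degeneracy, all Levi degeneracies are generic. -/
theorem HasGenericLeviDegeneracyAt.eventually (h : HasGenericLeviDegeneracyAt M q) :
    ∀ᶠ x in 𝓝 q, x ∈ leviDegeneracySet M → HasGenericLeviDegeneracyAt M x := by
  obtain ⟨hq, ρ, hρ, hL, X, hX, hd⟩ := h
  have hLa := analyticAt_leviDeterminant hρ.1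
  rw [hρ.mem_complexTangentVectors_iff hq] at hX
  have hX0 := tangentialField_ne_zero hρ.2.1
  have hXs : X = projectionCoefficient X (tangentialField ρ q) • tangentialField ρ q := by
    refine eq_projectionCoefficient_smul hX0 ?_
    change wirtingerW ρ q * X.2 = -wirtingerZ ρ q * X.1
    linear_combination hX
  set c := projectionCoefficient X (tangentialField ρ q)
  have hXa := analyticAt_tangentialField hρ.1
  have hor : fderiv ℝ (leviDeterminant ρ) q (tangentialField ρ q) ≠ 0 ∨
      fderiv ℝ (leviDeterminant ρ) q (I • tangentialField ρ q) ≠ 0 := by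
    by_contra! hcon
    refine hd ?_
    have h1 : c • tangentialField ρ q =
        c.re • tangentialField ρ q + c.im • (I • tangentialField ρ q) := by
      conv_lhs => rw [← Complex.re_add_im c]
      rw [add_smul, mul_smul]
      rfl
    rw [hXs, h1, map_add, map_smul, map_smul, hcon.1, hcon.2]
    simp
  have hmem : ∀ x, IsLocalDefiningFunction M x ρ → x ∈ M → ∀ c : ℂ,
      c • tangentialField ρ x ∈ complexTangentVectors M x := by
    intro x h1 h2 c
    rw [h1.mem_complexTangentVectors_iff h2]
    change wirtingerZ ρ x * (c * wirtingerW ρ x) + wirtingerW ρ x * (c * -wirtingerZ ρ x) = 0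
    ring
  have hgen : ∀ c : ℂ, fderiv ℝ (leviDeterminant ρ) q (c • tangentialField ρ q) ≠ 0 →
      ∀ᶠ x in 𝓝 q, x ∈ leviDegeneracySet M → HasGenericLeviDegeneracyAt M x := by
    intro c hc
    have hcont : ContinuousAt (fun x => fderiv ℝ (leviDeterminant ρ) x
        (c • tangentialField ρ x)) q :=
      hLa.fderiv.continuousAt.clm_apply (hXa.continuousAt.const_smul c)
    filter_upwards [hcont.eventually_ne hc, hρ.eventually, hρ.mem_leviDegeneracySet_iff hq]
      with x h1 h2 h3 hx
    exact ⟨hx.1, ρ, h2, (h3 hx.1).1 hx, _, hmem x h2 hx.1 c, h1⟩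
  rcases hor with h1 | h1
  · exact hgen 1 (by rwa [one_smul])
  · exact hgen I h1

/-- The Levi determinant of the Segre function at a generic Levi degeneracy. -/
theorem IsSegreChart.segreLevi_of_generic (h : IsSegreChart M q Θ φ Q) (hφ : fderiv ℝ φ 0 = 0)
    (hg : HasGenericLeviDegeneracyAt M q) :
    segreLevi Q 0 = 0 ∧ fderiv ℂ (segreLevi Q) 0 (1, 0, 0) ≠ 0 := by
  obtain ⟨hq, ρ, hρ, hL, X, hX, hd⟩ := hg
  have hΛ0 : segreLevi Q 0 = 0 :=
    (h.mem_leviDegeneracySet_center_iff hρ).1 ⟨hq, ρ, hρ, hL⟩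
  refine ⟨hΛ0, fun h0 => hd ?_⟩
  obtain ⟨U, hUc, hU0, hU⟩ := h.exists_leviDeterminant_eq hρ
  obtain ⟨Ξ, hΞ, hΞ0, hΞ1, hΞ2, -, hΞ3, hΞ4⟩ := h.biholo.exists_inverse
  rw [h.mem_complexTangentVectors_iff hφ hρ] at hX
  set c₀ := (fderiv ℂ Θ q X).1 with hc₀
  have hXc : X = fderiv ℂ Ξ 0 (c₀, 0) := by
    rw [← hΞ4 X]
    congr 1
    exact Prod.ext rfl hX
  have hLd := (analyticAt_leviDeterminant hρ.1).differentiableAt.hasFDerivAt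
  have key : ∀ c : ℂ, ((fderiv ℝ (leviDeterminant ρ) q (fderiv ℂ Ξ 0 (c, 0)) : ℝ) : ℂ) =
      U q * (fderiv ℂ (segreLevi Q) 0 (0, 1, 0) * star c) := by
    intro c
    have hline₁ : HasDerivAt (fun t : ℝ => (t : ℂ) * c) c 0 := by
      have h1 : HasDerivAt (fun t : ℝ => (t : ℂ) * c) (1 * c) 0 :=
        (Complex.ofRealCLM.hasDerivAt (x := (0 : ℝ))).mul_const c
      rwa [one_mul] at h1
    have hline : HasDerivAt (fun t : ℝ => ((t : ℂ) * c, (0 : ℝ))) (c, (0 : ℝ)) 0 :=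
      hline₁.prodMk (hasDerivAt_const _ _)
    have hφt : HasDerivAt (fun t : ℝ => φ ((t : ℂ) * c, 0)) 0 0 := by
      have := HasFDerivAt.comp_hasDerivAt_of_eq (0 : ℝ)
        h.analytic_graph.differentiableAt.hasFDerivAt hline (by simp)
      rw [hφ] at this
      exact this
    have hw : HasDerivAt (fun t : ℝ => I * ((φ ((t : ℂ) * c, 0) : ℝ) : ℂ)) 0 0 := by
      have := hφt.ofReal_comp.const_mul I
      simpa using this
    have hg1 : HasDerivAt (fun t : ℝ => ((t : ℂ) * c,
        I * ((φ ((t : ℂ) * c, 0) : ℝ) : ℂ))) (c, 0) 0 := hline₁.prodMk hw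
    have hg0 : ((((0 : ℝ) : ℂ) * c, I * ((φ (((0 : ℝ) : ℂ) * c, 0) : ℝ) : ℂ)) : ℂ × ℂ) =
        0 := by
      simp [h.graph_zero]
    have hgΞ := HasFDerivAt.comp_hasDerivAt_of_eq (0 : ℝ) (hasFDerivAt_real_of_complex hΞ) hg1
      hg0.symm
    have hgL := HasFDerivAt.comp_hasDerivAt_of_eq (0 : ℝ) hLd hgΞ (by
      simp only [Function.comp_apply]
      rw [hg0, hΞ0])
    have hgLc := hgL.ofReal_comp
    have hgt : Tendsto (fun t : ℝ => (((t : ℂ) * c,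
        I * ((φ ((t : ℂ) * c, 0) : ℝ) : ℂ)) : ℂ × ℂ)) (𝓝 0) (𝓝 0) := by
      have := hg1.continuousAt.tendsto
      rwa [hg0] at this
    have hΞt : Tendsto Ξ (𝓝 0) (𝓝 q) := by
      have := hΞ.continuousAt.tendsto
      rwa [hΞ0] at this
    have hstar : HasDerivAt (fun t : ℝ => star ((t : ℂ) * c)) (star c) 0 := by
      have h1 : HasDerivAt (fun t : ℝ => (t : ℂ) * star c) (1 * star c) 0 :=
        (Complex.ofRealCLM.hasDerivAt (x := (0 : ℝ))).mul_const (star c)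
      rw [one_mul] at h1
      refine h1.congr_of_eventuallyEq (Eventually.of_forall fun t => ?_)
      simp
    have hstar2 : HasDerivAt (fun t : ℝ => star (I * ((φ ((t : ℂ) * c, 0) : ℝ) : ℂ)))
        0 0 := by
      have h1 := hφt.ofReal_comp.const_mul (-I)
      simp only [Complex.ofReal_zero, mul_zero] at h1
      refine h1.congr_of_eventuallyEq (Eventually.of_forall fun t => ?_)
      simp
    have hy := hline₁.prodMk (hstar.prodMk hstar2)
    have hΛ := HasFDerivAt.comp_hasDerivAt_of_eq (0 : ℝ)
      (hasFDerivAt_real_of_complex (analyticAt_segreLevi h.analytic)) hy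
        (show (0 : ℂ × ℂ × ℂ) = _ by simp [h.graph_zero])
    have hUt : ContinuousAt (fun t : ℝ => U (Ξ ((t : ℂ) * c,
        I * ((φ ((t : ℂ) * c, 0) : ℝ) : ℂ)))) 0 :=
      ContinuousAt.comp_of_eq hUc hgΞ.continuousAt (by rw [← hΞ0, ← hg0])
    have hprod := hasDerivAt_mul_of_continuousAt hUt hΛ (by
      refine Eq.trans ?_ hΛ0
      refine congrArg (segreLevi Q) ?_
      simp [h.graph_zero])
    have heq := hgLc.unique (hprod.congr_of_eventuallyEq (by
      filter_upwards [(hΞt.comp hgt).eventually hU, hgt.eventually hΞ2,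
        (hΞt.comp hgt).eventually h.mem_iff] with t h1 h2 h3
      simp only [Function.comp_apply] at h1 h2 h3 ⊢
      rw [h2] at h1 h3
      exact h1 (h3.2 (by simp))))
    rw [hg0, hΞ0] at heq
    have e1 : ((c, star c, 0) : ℂ × ℂ × ℂ) =
        c • ((1 : ℂ), (0 : ℂ), (0 : ℂ)) + star c • ((0 : ℂ), (1 : ℂ), (0 : ℂ)) := by simp
    have e2 : fderiv ℂ (segreLevi Q) 0 ((c, star c, 0) : ℂ × ℂ × ℂ) =
        fderiv ℂ (segreLevi Q) 0 (0, 1, 0) * star c := by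
      rw [e1, map_add, map_smul, map_smul, h0, smul_eq_mul, smul_eq_mul]
      ring
    rw [← e2]
    exact heq
  set d := U q * fderiv ℂ (segreLevi Q) 0 (0, 1, 0) with hdef
  have hd0 : d = 0 := by
    have h1 := key 1
    have h2 := key I
    rw [← mul_assoc, ← hdef] at h1 h2
    have h3 := congrArg Complex.im h1
    have h4 := congrArg Complex.im h2
    simp only [star_one, mul_one, Complex.ofReal_im] at h3
    simp at h4
    exact Complex.ext h4 h3.symm
  rw [hXc]
  have h1 := key c₀
  rw [← mul_assoc, ← hdef, hd0, zero_mul] at h1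
  exact_mod_cast h1

end Chart

/-! ### Charts that flatten the Levi degeneracy set -/

/-- The complexification of a real-analytic function of two real variables. -/
theorem exists_complexification_pair {f : ℝ × ℝ → ℂ} (hf : AnalyticAt ℝ f 0) :
    ∃ F : ℂ × ℂ → ℂ, AnalyticAt ℂ F 0 ∧ (∀ᶠ y : ℝ × ℝ in 𝓝 0, F (y.1, y.2) = f y) ∧
      ∀ v : ℝ × ℝ, fderiv ℂ F 0 (v.1, v.2) = fderiv ℝ f 0 v := by
  let e : Fin 2 → ℝ × ℝ := ![(1, 0), (0, 1)]
  let c : Fin 2 → ℝ × ℝ → ℝ := ![fun x => x.1, fun x => x.2]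
  let ℓ : Fin 2 → ℂ × ℂ →L[ℂ] ℂ := ![.fst ℂ ℂ ℂ, .snd ℂ ℂ ℂ]
  let J : ℝ × ℝ →L[ℝ] ℂ × ℂ :=
    (Complex.ofRealCLM.comp (.fst ℝ ℝ ℝ)).prod (Complex.ofRealCLM.comp (.snd ℝ ℝ ℝ))
  obtain ⟨F, hF, hFe⟩ := exists_complexification hf e c
    (by intro x; rw [Fin.sum_univ_two]; refine Prod.ext ?_ ?_ <;> simp [e, c]) ℓ J
    (by intro i x; fin_cases i <;> simp [ℓ, J, c])
  rw [map_zero] at hF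
  refine ⟨F, hF, hFe, fun v => ?_⟩
  have h1 := hasFDerivAt_comp_of_eq (hasFDerivAt_real_of_complex hF) (J.hasFDerivAt (x := 0))
    (map_zero J)
  exact congrArg (fun L => L v) (h1.unique
    (hf.differentiableAt.hasFDerivAt.congr_of_eventuallyEq hFe))

/-- A Segre chart in which the Levi degeneracy set is the real plane. -/
structure IsFlatChart (M : Set (ℂ × ℂ)) (q : ℂ × ℂ) (Θ : ℂ × ℂ → ℂ × ℂ) (φ : ℂ × ℝ → ℝ)
    (Q : ℂ × ℂ × ℂ → ℂ) : Prop where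
  chart : IsSegreChart M q Θ φ Q
  mem_iff : ∀ᶠ x in 𝓝 q, x ∈ leviDegeneracySet M ↔ star (Θ x) = Θ x
  segre_diag : ∀ᶠ y : ℂ × ℂ in 𝓝 0, Q (y.1, y.1, y.2) = y.2
  levi_diag : ∀ᶠ y : ℂ × ℂ in 𝓝 0, segreLevi Q (y.1, y.1, y.2) = 0
  levi_deriv : fderiv ℂ (segreLevi Q) 0 (1, 0, 0) ≠ 0

section Chart

variable {M : Set (ℂ × ℂ)} {q : ℂ × ℂ} {Θ : ℂ × ℂ → ℂ × ℂ} {φ : ℂ × ℝ → ℝ} {Q : ℂ × ℂ × ℂ → ℂ}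

lemma star_eq_self_iff (y : ℂ × ℂ) : star y = y ↔ y = ((y.1.re : ℂ), (y.2.re : ℂ)) := by
  constructor
  · intro h
    have h1 : (starRingEnd ℂ) y.1 = y.1 := congrArg Prod.fst h
    have h2 : (starRingEnd ℂ) y.2 = y.2 := congrArg Prod.snd h
    exact Prod.ext (Complex.conj_eq_iff_re.1 h1).symm (Complex.conj_eq_iff_re.1 h2).symm
  · intro h
    rw [h]
    simp [Prod.star_def]

/-- A chart in which `M` is a graph with `dφ(0) = 0` and the Levi degeneracy set is the real plane
is flat. -/
lemma IsSegreChart.isFlatChart (h : IsSegreChart M q Θ φ Q) (hφ : fderiv ℝ φ 0 = 0)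
    (hg : HasGenericLeviDegeneracyAt M q)
    (hm : ∀ᶠ x in 𝓝 q, x ∈ leviDegeneracySet M ↔ star (Θ x) = Θ x) :
    IsFlatChart M q Θ φ Q := by
  have hg' := hg
  obtain ⟨hq, ρ, hρ, -, -⟩ := hg'
  obtain ⟨Ξ, hΞ, hΞ0, hΞ1, hΞ2, -⟩ := h.biholo.exists_inverse
  have hΞt : Tendsto Ξ (𝓝 0) (𝓝 q) := by
    have := hΞ.continuousAt.tendsto
    rwa [hΞ0] at this
  have hJ : Tendsto (fun y : ℝ × ℝ => ((y.1 : ℂ), (y.2 : ℂ))) (𝓝 0) (𝓝 0) :=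
    Continuous.tendsto' (by fun_prop) _ _ (by simp)
  have key : ∀ᶠ y : ℝ × ℝ in 𝓝 0, Q (y.1, y.1, y.2) = y.2 ∧ segreLevi Q (y.1, y.1, y.2) = 0 := by
    filter_upwards [(hΞt.comp hJ).eventually hm, (hΞt.comp hJ).eventually h.mem_iff,
      (hΞt.comp hJ).eventually (h.mem_leviDegeneracySet_iff hρ), hJ.eventually hΞ2,
      hJ.eventually h.segre_iff] with y h1 h2 h3 h4 h5
    simp only [Function.comp_apply] at h1 h2 h3
    rw [h4] at h1 h2 h3
    have h6 : Ξ ((y.1 : ℂ), (y.2 : ℂ)) ∈ leviDegeneracySet M := by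
      rw [h1]; simp [Prod.star_def]
    have h7 := h5.1 (h2.1 h6.1)
    have h8 := (h3 h6.1).1 h6
    simp only [Complex.star_def, Complex.conj_ofReal] at h7 h8
    exact ⟨h7.symm, h8⟩
  have hdiag : AnalyticAt ℂ (fun y : ℂ × ℂ => (y.1, y.1, y.2)) 0 := by fun_prop
  refine ⟨h, hm, ?_, ?_, (h.segreLevi_of_generic hφ hg).2⟩
  · have h1 : AnalyticAt ℂ (fun y : ℂ × ℂ => Q (y.1, y.1, y.2) - y.2) 0 :=
      (AnalyticAt.comp_of_eq h.analytic hdiag rfl).sub analyticAt_snd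
    filter_upwards [eventually_zero_of_real₂ h1 (by
      filter_upwards [key] with y hy
      exact sub_eq_zero.2 hy.1)] with y hy
    exact sub_eq_zero.1 hy
  · have h1 : AnalyticAt ℂ (fun y : ℂ × ℂ => segreLevi Q (y.1, y.1, y.2)) 0 :=
      AnalyticAt.comp_of_eq (analyticAt_segreLevi h.analytic) hdiag rfl
    exact eventually_zero_of_real₂ h1 (by
      filter_upwards [key] with y hy
      exact hy.2)

/-- Flat charts exist at the generic Levi degeneracies. -/
theorem HasGenericLeviDegeneracyAt.exists_isFlatChart (hg : HasGenericLeviDegeneracyAt M q) :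
    ∃ Θ φ Q, IsFlatChart M q Θ φ Q ∧ fderiv ℝ φ 0 = 0 := by
  have hg' := hg
  obtain ⟨hq, ρ, hρ, hL, X, hX, hd⟩ := hg'
  obtain ⟨Θ₀, φ₀, Q₀, h₀, hφ₀, hd₀⟩ := hρ.exists_isSegreChart hq
  obtain ⟨Ξ₀, hΞ, hΞ0, hΞ1, hΞ2, -, hΞ3, hΞ4⟩ := h₀.biholo.exists_inverse
  rw [h₀.mem_complexTangentVectors_iff hφ₀ hρ] at hX
  set c := (fderiv ℂ Θ₀ q X).1 with hc
  have hXc : X = fderiv ℂ Ξ₀ 0 (c, 0) := by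
    rw [← hΞ4 X]
    congr 1
    exact Prod.ext rfl hX
  have hc0 : c ≠ 0 := by
    intro h0
    rw [h0, prod_mk_zero_zero, map_zero] at hXc
    rw [hXc, map_zero] at hd
    exact hd rfl
  have hφa := h₀.analytic_graph
  have hLa := analyticAt_leviDeterminant hρ.1
  -- the function that defines the Levi degeneracy set
  let ζ : (ℝ × ℝ) × ℝ → ℂ := fun y => c * ((y.2 : ℂ) + I * (y.1.1 : ℂ))
  let g : (ℝ × ℝ) × ℝ → ℂ × ℂ := fun y =>
    (ζ y, (y.1.2 : ℂ) + I * ((φ₀ (ζ y, y.1.2) : ℝ) : ℂ))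
  have hζ : AnalyticAt ℝ ζ 0 := by
    refine analyticAt_const.mul ((analyticAt_ofReal analyticAt_snd).add (analyticAt_const.mul ?_))
    exact analyticAt_ofReal (analyticAt_fst.comp (f := fun y : (ℝ × ℝ) × ℝ => y.1) analyticAt_fst)
  have h12 : AnalyticAt ℝ (fun y : (ℝ × ℝ) × ℝ => y.1.2) 0 :=
    analyticAt_snd.comp (f := fun y : (ℝ × ℝ) × ℝ => y.1) analyticAt_fst
  have hζ0 : ζ 0 = 0 := by simp [ζ]
  have hφζ : AnalyticAt ℝ (fun y : (ℝ × ℝ) × ℝ => φ₀ (ζ y, y.1.2)) 0 :=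
    AnalyticAt.comp_of_eq hφa (hζ.prod h12) (by rw [hζ0]; rfl)
  have hga : AnalyticAt ℝ g 0 :=
    hζ.prod ((analyticAt_ofReal h12).add (analyticAt_const.mul (analyticAt_ofReal hφζ)))
  have hg0 : g 0 = 0 := by simp [g, hζ0, h₀.graph_zero]
  let E : (ℝ × ℝ) × ℝ → ℝ := fun y => leviDeterminant ρ (Ξ₀ (g y))
  have hΞg : AnalyticAt ℝ (fun y => Ξ₀ (g y)) 0 :=
    AnalyticAt.comp_of_eq (analyticAt_real_of_complex hΞ) hga hg0
  have hE : AnalyticAt ℝ E 0 := AnalyticAt.comp_of_eq hLa hΞg (by simp only [hg0, hΞ0])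
  have hE0 : E (0, 0) = 0 := by
    have : E 0 = 0 := by simp only [E, hg0, hΞ0, hL]
    exact this
  have hEd : fderiv ℝ E (0, 0) (0, 1) ≠ 0 := by
    have hline : HasDerivAt (fun t : ℝ => ((0 : ℝ × ℝ), t)) ((0 : ℝ × ℝ), (1 : ℝ)) 0 :=
      (hasDerivAt_const _ _).prodMk (hasDerivAt_id _)
    have h1 : HasDerivAt (fun t : ℝ => c * (t : ℂ)) (c * 1) 0 :=
      (Complex.ofRealCLM.hasDerivAt (x := (0 : ℝ))).const_mul c
    rw [mul_one] at h1
    have h2 : HasDerivAt (fun t : ℝ => φ₀ (c * (t : ℂ), 0)) 0 0 := by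
      have := HasFDerivAt.comp_hasDerivAt_of_eq (0 : ℝ) hφa.differentiableAt.hasFDerivAt
        (h1.prodMk (hasDerivAt_const (0 : ℝ) (0 : ℝ))) (by simp)
      rw [hφ₀] at this
      exact this
    have h3 : HasDerivAt (fun t : ℝ => I * ((φ₀ (c * (t : ℂ), 0) : ℝ) : ℂ)) 0 0 := by
      simpa using h2.ofReal_comp.const_mul I
    have h4 := h1.prodMk h3
    have h5 := HasFDerivAt.comp_hasDerivAt_of_eq (0 : ℝ) (hasFDerivAt_real_of_complex hΞ) h4
      (show (0 : ℂ × ℂ) = _ by simp [h₀.graph_zero])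
    have h6 := HasFDerivAt.comp_hasDerivAt_of_eq (0 : ℝ) hLa.differentiableAt.hasFDerivAt h5
      (show q = Ξ₀ (c * ((0 : ℝ) : ℂ), I * ((φ₀ (c * ((0 : ℝ) : ℂ), 0) : ℝ) : ℂ)) by
        simp [h₀.graph_zero, hΞ0])
    have h7 : HasDerivAt (fun t : ℝ => E (0, t)) (fderiv ℝ E (0, 0) (0, 1)) 0 :=
      HasFDerivAt.comp_hasDerivAt_of_eq (0 : ℝ) hE.differentiableAt.hasFDerivAt hline rfl
    have h8 := h7.unique (h6.congr_of_eventuallyEq (Eventually.of_forall fun t => by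
      simp [E, g, ζ]))
    rw [h8]
    rw [hXc] at hd
    exact hd
  obtain ⟨χ, hχ, hχ0, hχe⟩ := exists_implicit hE hE0 hEd
  -- the parametrization and its complexification
  let f₁ : ℝ × ℝ → ℂ := fun y => c * ((χ y : ℂ) + I * (y.1 : ℂ))
  let f₂ : ℝ × ℝ → ℂ := fun y => (y.2 : ℂ) + I * ((φ₀ (f₁ y, y.2) : ℝ) : ℂ)
  have hf₁d : HasFDerivAt f₁ (c • (Complex.ofRealCLM.comp (fderiv ℝ χ 0) +
      I • Complex.ofRealCLM.comp (.fst ℝ ℝ ℝ))) 0 := by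
    have h1 := Complex.ofRealCLM.hasFDerivAt.comp (0 : ℝ × ℝ) hχ.differentiableAt.hasFDerivAt
    have h2 := Complex.ofRealCLM.hasFDerivAt.comp (0 : ℝ × ℝ)
      ((ContinuousLinearMap.fst ℝ ℝ ℝ).hasFDerivAt (x := 0))
    exact (h1.add (h2.const_mul I)).const_mul c
  have hf₁0 : f₁ 0 = 0 := by simp [f₁, hχ0]
  have hf₁a : AnalyticAt ℝ f₁ 0 :=
    analyticAt_const.mul ((analyticAt_ofReal hχ).add
      (analyticAt_const.mul (analyticAt_ofReal analyticAt_fst)))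
  have hf₂d : HasFDerivAt f₂ (Complex.ofRealCLM.comp (.snd ℝ ℝ ℝ)) 0 := by
    have h1 := Complex.ofRealCLM.hasFDerivAt.comp (0 : ℝ × ℝ)
      ((ContinuousLinearMap.snd ℝ ℝ ℝ).hasFDerivAt (x := 0))
    have h2 := hasFDerivAt_comp_of_eq hφa.differentiableAt.hasFDerivAt
      (hf₁d.prodMk (hasFDerivAt_snd (𝕜 := ℝ) (p := (0 : ℝ × ℝ)))) (by rw [hf₁0]; rfl)
    rw [hφ₀, ContinuousLinearMap.zero_comp] at h2
    have h3 := h1.add ((Complex.ofRealCLM.hasFDerivAt.comp (0 : ℝ × ℝ) h2).const_mul I)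
    exact h3.congr_fderiv (ContinuousLinearMap.ext fun v => by simp)
  have hf₂a : AnalyticAt ℝ f₂ 0 :=
    (analyticAt_ofReal analyticAt_snd).add (analyticAt_const.mul (analyticAt_ofReal
      (AnalyticAt.comp_of_eq hφa (hf₁a.prod analyticAt_snd) (by rw [hf₁0]; rfl))))
  have hf₂0 : f₂ 0 = 0 := by simp [f₂, hf₁0, h₀.graph_zero]
  obtain ⟨F₁, hF₁, hF₁e, hF₁d⟩ := exists_complexification_pair hf₁a
  obtain ⟨F₂, hF₂, hF₂e, hF₂d⟩ := exists_complexification_pair hf₂a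
  have hF₁0 : F₁ 0 = 0 := by
    have := hF₁e.self_of_nhds
    simpa [hf₁0] using this
  have hF₂0 : F₂ 0 = 0 := by
    have := hF₂e.self_of_nhds
    simpa [hf₂0] using this
  have hsplit : ∀ v : ℂ × ℂ, v = v.1 • ((1 : ℂ), (0 : ℂ)) + v.2 • ((0 : ℂ), (1 : ℂ)) := by
    intro v; simp
  have hF₂v : ∀ v, fderiv ℂ F₂ 0 v = v.2 := by
    intro v
    have e1 := hF₂d (1, 0)
    have e2 := hF₂d (0, 1)
    rw [hf₂d.fderiv] at e1 e2
    simp only [Complex.ofReal_one, Complex.ofReal_zero, ContinuousLinearMap.comp_apply,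
      ContinuousLinearMap.coe_snd', Complex.ofRealCLM_apply] at e1 e2
    rw [hsplit v, map_add, map_smul, map_smul, e1, e2]
    simp
  have hF₁v : fderiv ℂ F₁ 0 (1, 0) ≠ 0 := by
    have e1 := hF₁d (1, 0)
    rw [hf₁d.fderiv] at e1
    simp only [Complex.ofReal_one, Complex.ofReal_zero] at e1
    rw [e1]
    simp only [_root_.smul_apply, _root_.add_apply, ContinuousLinearMap.comp_apply,
      ContinuousLinearMap.coe_fst', Complex.ofRealCLM_apply, smul_eq_mul, Complex.ofReal_one,
      mul_one]
    refine mul_ne_zero hc0 fun h1 => ?_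
    have := congrArg Complex.im h1
    simp at this
  let Ψ : ℂ × ℂ → ℂ × ℂ := fun y => (F₁ y, F₂ y)
  have hΨd : HasFDerivAt Ψ ((fderiv ℂ F₁ 0).prod (fderiv ℂ F₂ 0)) 0 :=
    hF₁.differentiableAt.hasFDerivAt.prodMk hF₂.differentiableAt.hasFDerivAt
  have hΨ : IsLocalBiholomorphismToZero Ψ 0 := by
    refine ⟨hF₁.prod hF₂, ?_, by simp [Ψ, hF₁0, hF₂0]⟩
    rw [hΨd.fderiv]
    have hinj : Function.Injective ((fderiv ℂ F₁ 0).prod (fderiv ℂ F₂ 0)) := by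
      refine (injective_iff_map_eq_zero _).2 fun v hv => ?_
      have h1 : fderiv ℂ F₁ 0 v = 0 := congrArg Prod.fst hv
      have h2 : fderiv ℂ F₂ 0 v = 0 := congrArg Prod.snd hv
      rw [hF₂v] at h2
      rw [hsplit v, h2, zero_smul, add_zero, map_smul, smul_eq_mul] at h1
      exact Prod.ext ((mul_eq_zero.1 h1).resolve_right hF₁v) h2
    exact ⟨hinj, LinearMap.injective_iff_surjective.1 hinj⟩
  obtain ⟨Ω, hΩ, hΩ0, hΩ1, hΩ2, hΩb, hΩ3, hΩ4⟩ := hΨ.exists_inverse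
  have hΩl : IsLocalBiholomorphismToZero Ω 0 := ⟨hΩ, hΩb, hΩ0⟩
  obtain ⟨hΘ, hΘd⟩ := hΩl.comp h₀.biholo
  have hΘ2 : ∀ v, fderiv ℝ ρ q v = 1 * (fderiv ℂ (fun x => Ω (Θ₀ x)) q v).2.im := by
    intro v
    rw [hd₀, hΘd]
    have h1 := congrArg Prod.snd (hΩ3 (fderiv ℂ Θ₀ q v))
    rw [hΨd.fderiv] at h1
    change fderiv ℂ F₂ 0 _ = _ at h1
    rw [hF₂v] at h1
    rw [h1]
  obtain ⟨φ, Q, h, hφ⟩ := exists_graph hρ hq hΘ one_ne_zero hΘ2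
  refine ⟨fun x => Ω (Θ₀ x), φ, Q, h.isFlatChart hφ hg ?_, hφ⟩
  -- the Levi degeneracy set is the real plane
  have hΘt := h₀.tendsto
  have hΘ't := h.tendsto
  have hr : ∀ y : ℝ × ℝ, (f₂ y).re = y.2 := fun y => by simp [f₂]
  have hi : ∀ y : ℝ × ℝ, (f₂ y).im = φ₀ (f₁ y, y.2) := fun y => by simp [f₂]
  have hkey : ∀ᶠ y : ℝ × ℝ in 𝓝 0, E (y, χ y) = 0 := by
    have : Tendsto (fun y => (y, χ y)) (𝓝 0) (𝓝 (0, 0)) := by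
      have := (continuousAt_id.prodMk hχ.continuousAt).tendsto
      simpa [hχ0] using this
    filter_upwards [this.eventually hχe] with y hy
    exact hy.2 rfl
  have t1 : Tendsto (fun x => ((((Θ₀ x).1 / c).im, (Θ₀ x).2.re), ((Θ₀ x).1 / c).re)) (𝓝 q)
      (𝓝 (((0 : ℝ × ℝ), (0 : ℝ)))) :=
    (Continuous.tendsto' (by fun_prop : Continuous fun y : ℂ × ℂ =>
      (((y.1 / c).im, y.2.re), (y.1 / c).re)) 0 (0, 0) (by simp)).comp hΘt
  have t2 : Tendsto (fun x => (((Θ₀ x).1 / c).im, (Θ₀ x).2.re)) (𝓝 q) (𝓝 (0 : ℝ × ℝ)) :=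
    (continuous_fst.tendsto' (((0 : ℝ × ℝ), (0 : ℝ))) 0 rfl).comp t1
  have t3 : Tendsto (fun x => ((Ω (Θ₀ x)).1.re, (Ω (Θ₀ x)).2.re)) (𝓝 q) (𝓝 (0 : ℝ × ℝ)) :=
    (Continuous.tendsto' (by fun_prop : Continuous fun y : ℂ × ℂ => (y.1.re, y.2.re)) 0 0
      (by simp)).comp hΘ't
  have hJ : Tendsto (fun y : ℝ × ℝ => ((y.1 : ℂ), (y.2 : ℂ))) (𝓝 0) (𝓝 0) :=
    Continuous.tendsto' (by fun_prop) _ _ (by simp)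
  filter_upwards [hρ.mem_leviDegeneracySet_iff hq, h₀.mem_iff, hΞ1, t1.eventually hχe,
    t2.eventually hF₁e, t2.eventually hF₂e, t2.eventually (hJ.eventually hΩ1),
    t3.eventually hF₁e, t3.eventually hF₂e, t3.eventually hkey, hΘt.eventually hΩ2]
    with x a1 a2 a3 a4 a5 a6 a7 a8 a9 a10 a11
  constructor
  · intro hx
    have b1 := (a1 hx.1).1 hx
    have b2 := a2.1 hx.1
    have b3 : c * ((((Θ₀ x).1 / c).re : ℂ) + I * (((Θ₀ x).1 / c).im : ℂ)) = (Θ₀ x).1 := by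
      rw [mul_comm I, Complex.re_add_im, mul_div_cancel₀ _ hc0]
    have b4 : ((Θ₀ x).2.re : ℂ) + I * ((Θ₀ x).2.im : ℂ) = (Θ₀ x).2 := by
      rw [mul_comm I, Complex.re_add_im]
    have b5 : ((Θ₀ x).1 / c).re = χ (((Θ₀ x).1 / c).im, (Θ₀ x).2.re) := by
      refine a4.1 ?_
      simp only [E, g, ζ]
      rw [b3, ← b2, b4]
      change leviDeterminant ρ (Ξ₀ (Θ₀ x)) = 0
      rw [a3, b1]
    have b6 : f₁ (((Θ₀ x).1 / c).im, (Θ₀ x).2.re) = (Θ₀ x).1 := by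
      simp only [f₁]
      rw [← b5, b3]
    have b7 : f₂ (((Θ₀ x).1 / c).im, (Θ₀ x).2.re) = (Θ₀ x).2 := by
      simp only [f₂]
      rw [b6, ← b2, b4]
    rw [b6] at a5
    rw [b7] at a6
    have b8 : Ψ (((((Θ₀ x).1 / c).im : ℝ) : ℂ), (((Θ₀ x).2.re : ℝ) : ℂ)) = Θ₀ x :=
      Prod.ext a5 a6
    rw [b8] at a7
    rw [a7]
    simp [Prod.star_def]
  · intro hx
    rw [star_eq_self_iff] at hx
    rw [hx] at a11
    have b1 : f₁ ((Ω (Θ₀ x)).1.re, (Ω (Θ₀ x)).2.re) = (Θ₀ x).1 := by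
      rw [← a8]; exact congrArg Prod.fst a11
    have b2 : f₂ ((Ω (Θ₀ x)).1.re, (Ω (Θ₀ x)).2.re) = (Θ₀ x).2 := by
      rw [← a9]; exact congrArg Prod.snd a11
    set y : ℝ × ℝ := ((Ω (Θ₀ x)).1.re, (Ω (Θ₀ x)).2.re) with hy
    have hxM : x ∈ M := by
      rw [a2, ← b1, ← b2, hr, hi]
    rw [a1 hxM]
    have b3 : g (y, χ y) = Θ₀ x := Prod.ext b1 b2
    simp only [E] at a10
    rw [b3, a3] at a10
    exact a10

/-- Translation of a flat chart. -/
theorem IsFlatChart.translate (h : IsFlatChart M q Θ φ Q) :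
    ∀ᶠ x in 𝓝 q, x ∈ leviDegeneracySet M → IsFlatChart M x (fun y => Θ y - Θ x)
      (fun t => φ (t.1 + (Θ x).1, t.2 + (Θ x).2.re) - (Θ x).2.im)
      (fun y => Q (y + ((Θ x).1, (Θ x).1, (Θ x).2)) - (Θ x).2) := by
  have hΘt := h.chart.tendsto
  have hΛ : ∀ᶠ y in 𝓝 0, fderiv ℂ (segreLevi Q) y (1, 0, 0) ≠ 0 :=
    (analyticAt_fderiv_apply (analyticAt_segreLevi h.chart.analytic)
      (1, 0, 0)).continuousAt.eventually_ne h.levi_deriv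
  have hd : Tendsto (fun x => ((Θ x).1, (Θ x).1, (Θ x).2)) (𝓝 q) (𝓝 0) :=
    (Continuous.tendsto' (by fun_prop : Continuous fun y : ℂ × ℂ => (y.1, y.1, y.2)) 0 0
      rfl).comp hΘt
  filter_upwards [h.chart.translate, h.mem_iff.eventually_nhds,
    hΘt.eventually h.segre_diag.eventually_nhds, hΘt.eventually h.levi_diag.eventually_nhds,
    hd.eventually hΛ] with x h1 h2 h3 h4 h5 hx
  have hs : star (Θ x) = Θ x := h2.self_of_nhds.1 hx
  have hs1 : star (Θ x).1 = (Θ x).1 := congrArg Prod.fst hs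
  have hs2 : star (Θ x).2 = (Θ x).2 := congrArg Prod.snd hs
  have h1' := h1 hx.1
  rw [hs1, hs2] at h1'
  have ht : Tendsto (fun y : ℂ × ℂ => y + Θ x) (𝓝 0) (𝓝 (Θ x)) :=
    Continuous.tendsto' (by fun_prop) _ _ (by simp)
  refine ⟨h1', ?_, ?_, ?_, ?_⟩
  · filter_upwards [h2] with y hy
    rw [hy, star_sub, hs, sub_left_inj]
  · filter_upwards [ht.eventually h3] with y hy
    rw [sub_eq_iff_eq_add]
    exact hy
  · filter_upwards [ht.eventually h4] with y hy
    rw [segreLevi_translate]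
    exact hy
  · have : segreLevi (fun y => Q (y + ((Θ x).1, (Θ x).1, (Θ x).2)) - (Θ x).2) =
        fun y => segreLevi Q (y + ((Θ x).1, (Θ x).1, (Θ x).2)) :=
      funext fun y => segreLevi_translate Q _ y _
    rw [this, fderiv_comp_add_right, zero_add]
    exact h5

end Chart

/-! ### Taylor expansions with remainder -/

section Taylor

variable {E : Type*} [NormedAddCommGroup E] [NormedSpace ℂ E]

lemma eventually_zero_of_fst_mul {D : ℂ × E → ℂ} {x₀ : E} (hD : AnalyticAt ℂ D (0, x₀))
    (h : ∀ᶠ y in 𝓝 ((0 : ℂ), x₀), y.1 * D y = 0) : ∀ᶠ y in 𝓝 ((0 : ℂ), x₀), D y = 0 := by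
  filter_upwards [h.eventually_nhds, hD.eventually_continuousAt] with y h1 h2
  by_cases hy : y.1 = 0
  · have hline : Tendsto (fun t : ℂ => (t, y.2)) (𝓝 0) (𝓝 y) :=
      Continuous.tendsto' (by fun_prop) _ _ (by rw [← hy])
    have h3 : Tendsto (fun t : ℂ => D (t, y.2)) (𝓝[≠] 0) (𝓝 (D y)) :=
      (h2.tendsto.comp hline).mono_left nhdsWithin_le_nhds
    have h4 : ∀ᶠ t in 𝓝[≠] (0 : ℂ), D (t, y.2) = 0 := by
      filter_upwards [(hline.mono_left nhdsWithin_le_nhds).eventually h1, self_mem_nhdsWithin]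
        with t ht ht0
      exact (mul_eq_zero.1 ht).resolve_left ht0
    exact tendsto_nhds_unique h3 (tendsto_const_nhds.congr' (h4.mono fun t ht => ht.symm))
  · exact (mul_eq_zero.1 h1.self_of_nhds).resolve_left hy

lemma exists_taylor_one {G : ℂ × E → ℂ} {x₀ : E} (hG : AnalyticAt ℂ G (0, x₀)) :
    ∃ D : ℂ × E → ℂ, AnalyticAt ℂ D (0, x₀) ∧
      ∀ᶠ y in 𝓝 ((0 : ℂ), x₀), G y = G (0, y.2) + y.1 * D y := by
  have h0 : AnalyticAt ℂ (fun y : ℂ × E => G (0, y.2)) (0, x₀) :=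
    AnalyticAt.comp_of_eq hG (f := fun y : ℂ × E => ((0 : ℂ), y.2))
      (analyticAt_const.prod analyticAt_snd) rfl
  obtain ⟨D, hD, hDe⟩ := exists_eq_fst_mul (hG.sub h0)
    (Eventually.of_forall fun x => by simp)
  refine ⟨D, hD, ?_⟩
  filter_upwards [hDe] with y hy
  rw [← hy, Pi.sub_apply]
  ring

lemma exists_taylor_two {G : ℂ × E → ℂ} {x₀ : E} (hG : AnalyticAt ℂ G (0, x₀)) :
    ∃ (D₁ : E → ℂ) (D₂ : ℂ × E → ℂ), AnalyticAt ℂ D₁ x₀ ∧ AnalyticAt ℂ D₂ (0, x₀) ∧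
      ∀ᶠ y in 𝓝 ((0 : ℂ), x₀), G y = G (0, y.2) + y.1 * D₁ y.2 + y.1 ^ 2 * D₂ y := by
  obtain ⟨D, hD, hDe⟩ := exists_taylor_one hG
  obtain ⟨D₂, hD₂, hDe₂⟩ := exists_taylor_one hD
  refine ⟨fun x => D (0, x), D₂, ?_, hD₂, ?_⟩
  · exact AnalyticAt.comp_of_eq hD (f := fun x : E => ((0 : ℂ), x))
      (analyticAt_const.prod analyticAt_id) rfl
  · filter_upwards [hDe, hDe₂] with y h1 h2
    rw [h1, h2]
    ring

/-- The coefficients of a Taylor expansion with remainder. -/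
lemma coeff_jet_of_taylor {u d : ℂ → ℂ} {a b : ℂ} (hd : AnalyticAt ℂ d 0)
    (h : ∀ᶠ t in 𝓝 (0 : ℂ), u t = a + t * b + t ^ 2 * d t) :
    deriv u 0 = b ∧ iteratedDeriv 1 u 0 / (Nat.factorial 1) = b ∧
      iteratedDeriv 2 u 0 / (Nat.factorial 2) = d 0 := by
  have h1 : AnalyticAt ℂ (fun t : ℂ => b * t + t ^ 2 * d t) 0 := by fun_prop
  have h2 : AnalyticAt ℂ (fun t : ℂ => t ^ 2 * d t) 0 := by fun_prop
  have h3 : AnalyticAt ℂ (fun t : ℂ => t) 0 := analyticAt_id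
  have key : jet u = PowerSeries.C a + (PowerSeries.C b * PowerSeries.X +
      PowerSeries.X ^ 2 * jet d) := by
    have e1 : u =ᶠ[𝓝 0] fun t => a + (b * t + t ^ 2 * d t) := by
      filter_upwards [h] with t ht
      rw [ht]; ring
    rw [jet_congr e1, jet_add analyticAt_const h1, jet_const, jet_add (by fun_prop) h2,
      jet_const_mul, jet_mul (h3.fun_pow 2) hd, jet_pow h3, jet_id]
  have k1 := congrArg (PowerSeries.coeff 1) key
  have k2 := congrArg (PowerSeries.coeff 2) key
  rw [coeff_one_jet] at k1
  rw [coeff_jet] at k2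
  have c1 : PowerSeries.coeff 1 (PowerSeries.X ^ 2 * jet d) = 0 := by
    rw [PowerSeries.coeff_X_pow_mul']; simp
  have c2 : PowerSeries.coeff 2 (PowerSeries.X ^ 2 * jet d) = d 0 := by
    rw [PowerSeries.coeff_X_pow_mul']; simp [coeff_jet]
  have c3 : PowerSeries.coeff 2 (PowerSeries.X : PowerSeries ℂ) = 0 := by
    rw [PowerSeries.coeff_X]; simp
  simp only [map_add, PowerSeries.coeff_C_mul, c1, PowerSeries.coeff_C,
    PowerSeries.coeff_one_X, one_ne_zero, if_false] at k1
  simp only [map_add, PowerSeries.coeff_C_mul, c2, c3, PowerSeries.coeff_C,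
    two_ne_zero, if_false] at k2
  refine ⟨by rw [k1]; ring, ?_, by rw [k2]; ring⟩
  rw [iteratedDeriv_one, k1]
  simp

end Taylor

/-! ### Prenormal Segre functions -/

/-- The Segre function `Q` has the form `ω + 2 i z² ζ + ζ² B(z, ζ, ω)`. -/
structure IsPrenormal (Q B : ℂ × ℂ × ℂ → ℂ) : Prop where
  analytic : AnalyticAt ℂ B 0
  eq : ∀ᶠ y in 𝓝 (0 : ℂ × ℂ × ℂ),
    Q y = y.2.2 + 2 * I * y.1 ^ 2 * y.2.1 + y.2.1 ^ 2 * B y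

section Prenormal

variable {M : Set (ℂ × ℂ)} {q : ℂ × ℂ} {Θ : ℂ × ℂ → ℂ × ℂ} {φ : ℂ × ℝ → ℝ}
  {Q B : ℂ × ℂ × ℂ → ℂ}

lemma IsPrenormal.segre_zero_fst (h : IsSegreChart M q Θ φ Q) (hB : IsPrenormal Q B) :
    ∀ᶠ x in 𝓝 (0 : ℂ × ℂ), Q (0, x.1, x.2) = x.2 := by
  have hc := tendsto_zero_prodMk (E := ℂ × ℂ)
  have hc2 : Tendsto (fun x : ℂ × ℂ => (star x.1, (0 : ℂ), star (Q (0, x)))) (𝓝 0) (𝓝 0) := by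
    have h1 : ContinuousAt (fun x : ℂ × ℂ => Q (0, x)) 0 :=
      ContinuousAt.comp_of_eq h.analytic.continuousAt (by fun_prop) rfl
    have h2 : ContinuousAt (fun x : ℂ × ℂ => (star x.1, (0 : ℂ), star (Q (0, x)))) 0 :=
      ContinuousAt.prodMk (by fun_prop)
        (continuousAt_const.prodMk (continuous_star.continuousAt.comp h1))
    have := h2.tendsto
    simpa [h.map_zero] using this
  filter_upwards [hc.eventually h.reality, hc2.eventually hB.eq] with x h1 h2
  rw [reflect_apply] at h1
  have h3 : star ((x.1, 0, Q (0, x)) : ℂ × ℂ × ℂ) = (star x.1, 0, star (Q (0, x))) := by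
    simp [Prod.star_def]
  simp only [h3, h2] at h1
  simpa using h1

/-- The second-order coefficient of a prenormal Segre function is `2 i z + O(z²)`. -/
lemma IsPrenormal.exists_factor (h : IsSegreChart M q Θ φ Q) (hB : IsPrenormal Q B) :
    ∃ B₁ : ℂ × ℂ × ℂ → ℂ, AnalyticAt ℂ B₁ 0 ∧ (∀ᶠ y in 𝓝 0, B y = y.1 * B₁ y) ∧
      ∀ᶠ x in 𝓝 (0 : ℂ × ℂ), B₁ (0, x) = 2 * I := by
  have hc := tendsto_zero_prodMk (E := ℂ × ℂ)
  have hB0 : ∀ᶠ x in 𝓝 (0 : ℂ × ℂ), B (0, x) = 0 := by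
    have h1 : AnalyticAt ℂ (fun x : ℂ × ℂ => B (0, x)) 0 :=
      AnalyticAt.comp_of_eq hB.analytic (f := fun x : ℂ × ℂ => ((0 : ℂ), x)) (by fun_prop) rfl
    have h2 : ∀ᶠ x in 𝓝 ((0 : ℂ), (0 : ℂ)), x.1 * (x.1 * B (0, x)) = 0 := by
      filter_upwards [hc.eventually hB.eq, hB.segre_zero_fst h] with x e1 e2
      have e3 : Q (0, x) = x.2 := e2
      rw [e3] at e1
      linear_combination -e1
    exact eventually_zero_of_fst_mul h1 (eventually_zero_of_fst_mul (analyticAt_fst.mul h1) h2)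
  obtain ⟨B₁, hB₁, hBe⟩ := exists_eq_fst_mul (x₀ := (0 : ℂ × ℂ)) hB.analytic hB0
  refine ⟨B₁, hB₁, hBe, ?_⟩
  -- the reality condition, divided by `z`
  have hBr : AnalyticAt ℂ (reflect B) 0 := analyticAt_reflect (by simpa using hB.analytic)
  have hQ := h.analytic
  have hBrQ : AnalyticAt ℂ (fun y : ℂ × ℂ × ℂ => reflect B (y.2.1, y.1, Q y)) 0 :=
    AnalyticAt.comp_of_eq hBr (f := fun y : ℂ × ℂ × ℂ => (y.2.1, y.1, Q y)) (by fun_prop)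
      (by simp [h.map_zero])
  let D : ℂ × ℂ × ℂ → ℂ := fun y => 2 * I * y.1 * y.2.1 + y.2.1 ^ 2 * B₁ y -
    2 * I * y.2.1 ^ 2 + y.1 * reflect B (y.2.1, y.1, Q y)
  have hD : AnalyticAt ℂ D 0 := by
    simp only [D]
    have : AnalyticAt ℂ B₁ 0 := hB₁
    fun_prop
  have hstar : Tendsto (fun y : ℂ × ℂ × ℂ => (star y.2.1, star y.1, star (Q y))) (𝓝 0) (𝓝 0) := by
    have h1 := hQ.continuousAt
    have h2 : ContinuousAt (fun y : ℂ × ℂ × ℂ => (star y.2.1, star y.1, star (Q y))) 0 := by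
      fun_prop
    have := h2.tendsto
    simpa [h.map_zero] using this
  have hD0 : ∀ᶠ y in 𝓝 ((0 : ℂ), (0 : ℂ × ℂ)), y.1 * D y = 0 := by
    filter_upwards [h.reality, hB.eq, hBe, hstar.eventually hB.eq] with y e1 e2 e3 e4
    rw [reflect_apply] at e1
    have h3 : star ((y.2.1, y.1, Q y) : ℂ × ℂ × ℂ) = (star y.2.1, star y.1, star (Q y)) := by
      simp [Prod.star_def]
    have e5 : reflect B (y.2.1, y.1, Q y) = star (B (star y.2.1, star y.1, star (Q y))) := by
      rw [reflect_apply, h3]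
    rw [h3, e4] at e1
    simp only [D]
    rw [e5]
    simp only [star_add, star_mul', star_star, star_pow] at e1
    have e6 : star (2 * I) = -(2 * I) := by simp
    simp only [Complex.star_def, map_ofNat, Complex.conj_I] at e1
    simp only [Complex.star_def]
    linear_combination e1 - e2 - y.2.1 ^ 2 * e3
  have hDz := eventually_zero_of_fst_mul hD hD0
  have hE : AnalyticAt ℂ (fun x : ℂ × ℂ => B₁ (0, x) - 2 * I) 0 :=
    (AnalyticAt.comp_of_eq hB₁ (f := fun x : ℂ × ℂ => ((0 : ℂ), x)) (by fun_prop) rfl).sub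
      analyticAt_const
  have h2 : ∀ᶠ x in 𝓝 ((0 : ℂ), (0 : ℂ)), x.1 * (x.1 * (B₁ (0, x) - 2 * I)) = 0 := by
    filter_upwards [hc.eventually hDz] with x hx
    simp only [D] at hx
    linear_combination hx
  filter_upwards [eventually_zero_of_fst_mul hE
    (eventually_zero_of_fst_mul (analyticAt_fst.mul hE) h2)] with x hx
  exact sub_eq_zero.1 hx

/-- The Levi determinant of a prenormal Segre function vanishes on `z = ζ = 0`, and its
differential at `0` is `4 i (dz + dζ)`. -/
lemma IsPrenormal.segreLevi (h : IsSegreChart M q Θ φ Q) (hB : IsPrenormal Q B) :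
    (∀ᶠ τ in 𝓝 (0 : ℂ), LeviDegenerate.segreLevi Q (0, 0, τ) = 0) ∧
      ∀ v, fderiv ℂ (LeviDegenerate.segreLevi Q) 0 v = 4 * I * (v.1 + v.2.1) := by
  obtain ⟨B₁, hB₁, hBe, hB₁0⟩ := hB.exists_factor h
  have hBa := hB.analytic
  have hQ := h.analytic
  have hfst : ∀ y : ℂ × ℂ × ℂ, HasFDerivAt (fun y : ℂ × ℂ × ℂ => y.1)
    (ContinuousLinearMap.fst ℂ ℂ (ℂ × ℂ)) y := fun y => hasFDerivAt_fst
  have hsnd1 : ∀ y : ℂ × ℂ × ℂ, HasFDerivAt (fun y : ℂ × ℂ × ℂ => y.2.1)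
    ((ContinuousLinearMap.fst ℂ ℂ ℂ).comp (.snd ℂ ℂ (ℂ × ℂ))) y :=
    fun y => ((ContinuousLinearMap.fst ℂ ℂ ℂ).comp (.snd ℂ ℂ (ℂ × ℂ))).hasFDerivAt
  have hsnd2 : ∀ y : ℂ × ℂ × ℂ, HasFDerivAt (fun y : ℂ × ℂ × ℂ => y.2.2)
    ((ContinuousLinearMap.snd ℂ ℂ ℂ).comp (.snd ℂ ℂ (ℂ × ℂ))) y :=
    fun y => ((ContinuousLinearMap.snd ℂ ℂ ℂ).comp (.snd ℂ ℂ (ℂ × ℂ))).hasFDerivAt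
  have hBz : ∀ᶠ y in 𝓝 (0 : ℂ × ℂ × ℂ), AnalyticAt ℂ B y := hBa.eventually_analyticAt
  have hQd : ∀ᶠ y in 𝓝 (0 : ℂ × ℂ × ℂ), ∀ v : ℂ × ℂ × ℂ, fderiv ℂ Q y v =
      v.2.2 + 2 * I * (2 * y.1 * v.1 * y.2.1 + y.1 ^ 2 * v.2.1) +
        (2 * y.2.1 * v.2.1 * B y + y.2.1 ^ 2 * fderiv ℂ B y v) := by
    filter_upwards [hB.eq.eventually_nhds, hBz] with y e1 e2 v
    have d := ((hsnd2 y).add ((((hfst y).pow 2).const_mul (2 * I)).mul (hsnd1 y))).add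
      (((hsnd1 y).pow 2).mul e2.differentiableAt.hasFDerivAt)
    have d' := (d.congr_of_eventuallyEq e1).fderiv
    rw [d']
    simp
    ring
  have hQz : ∀ᶠ y in 𝓝 (0 : ℂ × ℂ × ℂ), ∀ᶠ y in 𝓝 y, fderiv ℂ Q y (1, 0, 0) =
      4 * I * y.1 * y.2.1 + y.2.1 ^ 2 * fderiv ℂ B y (1, 0, 0) := by
    rw [eventually_eventually_nhds]
    filter_upwards [hQd] with y e1
    rw [e1]
    simp
    ring
  have hQzd : ∀ᶠ y in 𝓝 (0 : ℂ × ℂ × ℂ), ∀ v : ℂ × ℂ × ℂ,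
      fderiv ℂ (fun y => fderiv ℂ Q y (1, 0, 0)) y v =
      4 * I * (v.1 * y.2.1 + y.1 * v.2.1) +
        (2 * y.2.1 * v.2.1 * fderiv ℂ B y (1, 0, 0) +
          y.2.1 ^ 2 * fderiv ℂ (fun y => fderiv ℂ B y (1, 0, 0)) y v) := by
    filter_upwards [hQz, hBz] with y e1 e2 v
    have d := (((hfst y).const_mul (4 * I)).mul (hsnd1 y)).add
      (((hsnd1 y).pow 2).mul (analyticAt_fderiv_apply e2 (1, 0, 0)).differentiableAt.hasFDerivAt)
    have d' := (d.congr_of_eventuallyEq e1).fderiv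
    rw [d']
    simp
    ring
  have hBz0 : fderiv ℂ B 0 (1, 0, 0) = 2 * I := by
    have d := (hfst 0).mul (show AnalyticAt ℂ B₁ 0 from hB₁).differentiableAt.hasFDerivAt
    have d' := (d.congr_of_eventuallyEq hBe).fderiv
    rw [d']
    have := hB₁0.self_of_nhds
    simp only [prod_mk_zero_zero] at this
    simp [this]
  have hsl : ∀ᶠ y in 𝓝 (0 : ℂ × ℂ × ℂ), LeviDegenerate.segreLevi Q y =
      (4 * I * y.1 + 2 * y.2.1 * fderiv ℂ B y (1, 0, 0) +
          y.2.1 ^ 2 * fderiv ℂ (fun y => fderiv ℂ B y (1, 0, 0)) y (0, 1, 0)) *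
        (1 + y.2.1 ^ 2 * fderiv ℂ B y (0, 0, 1)) -
      (y.2.1 ^ 2 * fderiv ℂ (fun y => fderiv ℂ B y (1, 0, 0)) y (0, 0, 1)) *
        fderiv ℂ Q y (0, 1, 0) := by
    filter_upwards [hQd, hQzd] with y e1 e2
    rw [LeviDegenerate.segreLevi, e2, e2, e1 (0, 0, 1)]
    simp only [mul_zero, zero_mul, zero_add, add_zero, mul_one]
    ring
  constructor
  · have hc : Tendsto (fun τ : ℂ => ((0 : ℂ), (0 : ℂ), τ)) (𝓝 0) (𝓝 0) :=
      Continuous.tendsto' (by fun_prop) _ _ rfl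
    filter_upwards [hc.eventually hsl] with τ hτ
    rw [hτ]
    simp
  · intro v
    have a1 := analyticAt_fderiv_apply hBa
    have a2 := analyticAt_fderiv_apply (a1 (1, 0, 0))
    have b1 := (((hfst 0).const_mul (4 * I)).add (((hsnd1 0).const_mul 2).mul
      (a1 (1, 0, 0)).differentiableAt.hasFDerivAt)).add
      (((hsnd1 0).pow 2).mul (a2 (0, 1, 0)).differentiableAt.hasFDerivAt)
    have b2 := (((hsnd1 0).pow 2).mul (a1 (0, 0, 1)).differentiableAt.hasFDerivAt).const_add 1
    have b3 := (((hsnd1 0).pow 2).mul (a2 (0, 0, 1)).differentiableAt.hasFDerivAt).mul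
      (analyticAt_fderiv_apply hQ (0, 1, 0)).differentiableAt.hasFDerivAt
    have b4 := (((b1.mul b2).sub b3).congr_of_eventuallyEq hsl).fderiv
    rw [b4]
    simp [-prod_mk_zero_zero, hBz0]
    ring

end Prenormal

/-! ### Jets of a map onto a prenormal form -/

/-- The second iterated Segre map `(z, s) ↦ Q (z, s, Q̄ (s, 0, 0))` of the Segre function
re-centred at the point with real parameters `e`. -/
def segreIterate (Q : ℂ × ℂ × ℂ → ℂ) (y : ℂ × ℂ × (ℂ × ℂ)) : ℂ :=
  Q (y.1 + y.2.2.1, y.2.1 + y.2.2.1, reflect Q (y.2.1 + y.2.2.1, y.2.2.1, y.2.2.2))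

/-- A Taylor expansion with remainder in one variable. -/
lemma exists_taylor_two_one_variable {u : ℂ → ℂ} (hu : AnalyticAt ℂ u 0) :
    ∃ d : ℂ → ℂ, AnalyticAt ℂ d 0 ∧
      ∀ᶠ t in 𝓝 (0 : ℂ), u t = u 0 + t * deriv u 0 + t ^ 2 * d t := by
  obtain ⟨D₁, D₂, -, h2, he⟩ := exists_taylor_two (E := ℂ) (G := fun y : ℂ × ℂ => u y.1)
    (x₀ := 0) (AnalyticAt.comp_of_eq hu (f := fun y : ℂ × ℂ => y.1) (by fun_prop) rfl)
  have h3 : AnalyticAt ℂ (fun t : ℂ => D₂ (t, 0)) 0 :=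
    AnalyticAt.comp_of_eq h2 (f := fun t : ℂ => (t, (0 : ℂ))) (by fun_prop) rfl
  have hc : Tendsto (fun t : ℂ => (t, (0 : ℂ))) (𝓝 0) (𝓝 ((0 : ℂ), (0 : ℂ))) :=
    Continuous.tendsto' (by fun_prop) _ _ rfl
  have h4 : ∀ᶠ t in 𝓝 (0 : ℂ), u t = u 0 + t * D₁ 0 + t ^ 2 * D₂ (t, 0) := hc.eventually he
  refine ⟨_, h3, ?_⟩
  rw [(coeff_jet_of_taylor h3 h4).1]
  exact h4

section

variable {M : Set (ℂ × ℂ)} {q : ℂ × ℂ} {Θ F : ℂ × ℂ → ℂ × ℂ} {φ φ' : ℂ × ℝ → ℝ}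
  {Q Q' B : ℂ × ℂ × ℂ → ℂ} {H : ℂ × ℂ → ℂ × ℂ}

lemma IsSegreChart.reflect_zero (h : IsSegreChart M q Θ φ Q) : reflect Q 0 = 0 := by
  simp [reflect, h.map_zero]

lemma IsSegreChart.analyticAt_reflect_segre (h : IsSegreChart M q Θ φ Q) :
    AnalyticAt ℂ (reflect Q) 0 := analyticAt_reflect (by simpa using h.analytic)

lemma IsSegreChart.analyticAt_segreIterate (h : IsSegreChart M q Θ φ Q) :
    AnalyticAt ℂ (segreIterate Q) 0 := by
  have h1 : AnalyticAt ℂ (fun y : ℂ × ℂ × (ℂ × ℂ) =>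
      reflect Q (y.2.1 + y.2.2.1, y.2.2.1, y.2.2.2)) 0 :=
    AnalyticAt.comp_of_eq h.analyticAt_reflect_segre
      (f := fun y : ℂ × ℂ × (ℂ × ℂ) => (y.2.1 + y.2.2.1, y.2.2.1, y.2.2.2)) (by fun_prop)
      (by simp)
  exact AnalyticAt.comp_of_eq h.analytic (f := fun y : ℂ × ℂ × (ℂ × ℂ) =>
    (y.1 + y.2.2.1, y.2.1 + y.2.2.1, reflect Q (y.2.1 + y.2.2.1, y.2.2.1, y.2.2.2)))
    (by fun_prop) (by simp [h.reflect_zero])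

theorem IsSegreChart.exists_jet_relations (h : IsSegreChart M q Θ φ Q)
    (h' : IsSegreChart M q F φ' Q') (hB : IsPrenormal Q' B) (hH : AnalyticAt ℂ H 0)
    (hHe : ∀ᶠ x in 𝓝 q, F x = H (Θ x)) {f₀ : ℂ → ℂ}
    (hf₀ : ∀ z, f₀ z = (H (z, Q (z, 0, 0))).1) :
    (∀ᶠ z in 𝓝 (0 : ℂ), (H (z, Q (z, 0, 0))).2 = 0) ∧
    ∃ (g ℓ k : ℂ → ℂ) (C : ℂ), AnalyticAt ℂ g 0 ∧ AnalyticAt ℂ ℓ 0 ∧ AnalyticAt ℂ k 0 ∧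
      g 0 = (fderiv ℂ H 0 (0, 1)).2 ∧ ℓ 0 = (fderiv ℂ H 0 (0, 1)).1 ∧
      ∀ᶠ z in 𝓝 (0 : ℂ),
        fderiv ℂ Q (z, 0, 0) (0, 0, 1) * g z =
          star (g 0) + 2 * I * star (ℓ 0) * f₀ z ^ 2 ∧
        coeffSnd (segreIterate Q) 1 (z, 0) * g z =
          2 * I * star (deriv f₀ 0) * f₀ z ^ 2 ∧
        coeffSnd (segreIterate Q) 2 (z, 0) * g z + coeffSnd (segreIterate Q) 1 (z, 0) ^ 2 * k z =
          4 * I * star (deriv f₀ 0) * f₀ z * coeffSnd (segreIterate Q) 1 (z, 0) * ℓ z +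
            2 * I * C * f₀ z ^ 2 + star (deriv f₀ 0) ^ 2 * B (f₀ z, 0, 0) := by
  have hQ := h.analytic
  have hQ0 := h.map_zero
  have hH0 : H 0 = 0 := by
    have := hHe.self_of_nhds
    rwa [h.biholo.2.2, h'.biholo.2.2, eq_comm] at this
  have hT := h.transition h' hH hHe
  have hW₀ : AnalyticAt ℂ (fun z : ℂ => Q (z, 0, 0)) 0 :=
    AnalyticAt.comp_of_eq hQ (f := fun z : ℂ => (z, (0 : ℂ), (0 : ℂ))) (by fun_prop) rfl
  have hf₀' : f₀ = fun z => (H (z, Q (z, 0, 0))).1 := funext hf₀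
  have hf₀a : AnalyticAt ℂ f₀ 0 := by
    rw [hf₀']
    exact analyticAt_fst.comp (AnalyticAt.comp_of_eq hH (f := fun z : ℂ => (z, Q (z, 0, 0)))
      (by fun_prop) (by simp [hQ0]))
  have hf₀0 : f₀ 0 = 0 := by simp [hf₀, hQ0, hH0]
  -- continuity facts
  have hcz : Tendsto (fun z : ℂ => (z, (0 : ℂ), (0 : ℂ))) (𝓝 0) (𝓝 0) :=
    Continuous.tendsto' (by fun_prop) _ _ rfl
  have hcf : Tendsto (fun z : ℂ => (f₀ z, (0 : ℂ), (0 : ℂ))) (𝓝 0) (𝓝 0) := by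
    have h1 : ContinuousAt (fun z : ℂ => (f₀ z, (0 : ℂ), (0 : ℂ))) 0 :=
      hf₀a.continuousAt.prodMk (by fun_prop)
    have := h1.tendsto
    rwa [hf₀0] at this
  have hrH0 : reflect H 0 = 0 := by simp [reflect, hH0]
  have hrHa : AnalyticAt ℂ (reflect H) 0 := analyticAt_reflect (by simpa using hH)
  have hg0 : ∀ᶠ z in 𝓝 (0 : ℂ), (H (z, Q (z, 0, 0))).2 = 0 := by
    filter_upwards [hcz.eventually hT, hcf.eventually hB.eq] with z h1 h2
    have h3 : (H (z, Q (z, 0, 0))).2 =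
        Q' ((H (z, Q (z, 0, 0))).1, (reflect H 0).1, (reflect H 0).2) := h1
    rw [h3, hrH0, ← hf₀]
    exact h2.trans (by simp)
  refine ⟨hg0, ?_⟩
  -- expansions in the transversal direction
  have hHshift : AnalyticAt ℂ (fun y : ℂ × ℂ => H (y.2, Q (y.2, 0, 0) + y.1)) 0 := by
    have h1 : AnalyticAt ℂ (fun y : ℂ × ℂ => Q (y.2, 0, 0)) 0 :=
      AnalyticAt.comp_of_eq hW₀ (f := fun y : ℂ × ℂ => y.2) (by fun_prop) rfl
    exact AnalyticAt.comp_of_eq hH (f := fun y : ℂ × ℂ => (y.2, Q (y.2, 0, 0) + y.1))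
      (by fun_prop) (by simp [hQ0])
  obtain ⟨g, k₂, hga, hk₂, hge⟩ := exists_taylor_two (x₀ := (0 : ℂ))
    (G := fun y : ℂ × ℂ => (H (y.2, Q (y.2, 0, 0) + y.1)).2) (analyticAt_snd.comp hHshift)
  obtain ⟨ℓ₂, hℓ₂, hℓe⟩ := exists_taylor_one (x₀ := (0 : ℂ))
    (G := fun y : ℂ × ℂ => (H (y.2, Q (y.2, 0, 0) + y.1)).1) (analyticAt_fst.comp hHshift)
  have hℓa : AnalyticAt ℂ (fun z : ℂ => ℓ₂ (0, z)) 0 :=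
    AnalyticAt.comp_of_eq hℓ₂ (f := fun z : ℂ => ((0 : ℂ), z)) (by fun_prop) rfl
  have hka : AnalyticAt ℂ (fun z : ℂ => k₂ (0, z)) 0 :=
    AnalyticAt.comp_of_eq hk₂ (f := fun z : ℂ => ((0 : ℂ), z)) (by fun_prop) rfl
  have hcs0 : Tendsto (fun z : ℂ => ((0 : ℂ), z)) (𝓝 0) (𝓝 ((0 : ℂ), (0 : ℂ))) :=
    Continuous.tendsto' (by fun_prop) _ _ rfl
  have hgd : ∀ᶠ z in 𝓝 (0 : ℂ),
      HasDerivAt (fun t => (H (z, Q (z, 0, 0) + t)).2) (g z) 0 := by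
    filter_upwards [hcs0.eventually hge.eventually_nhds,
      hcs0.eventually hk₂.eventually_analyticAt] with z h1 h2
    have hc : Tendsto (fun t : ℂ => (t, z)) (𝓝 0) (𝓝 (0, z)) :=
      Continuous.tendsto' (by fun_prop) _ _ rfl
    have h3 := hc.eventually h1
    have h4 : DifferentiableAt ℂ (fun t : ℂ => k₂ (t, z)) 0 :=
      DifferentiableAt.comp (0 : ℂ) (f := fun t : ℂ => (t, z)) h2.differentiableAt (by fun_prop)
    have h5 := (((hasDerivAt_id (0 : ℂ)).mul_const (g z)).const_add
      ((H (z, Q (z, 0, 0) + 0)).2)).add (((hasDerivAt_id (0 : ℂ)).pow 2).mul h4.hasDerivAt)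
    refine (h5.congr_of_eventuallyEq (h3.mono fun t ht => ?_)).congr_deriv (by simp)
    simpa using ht
  have hline : HasDerivAt (fun t : ℂ => ((0 : ℂ), t)) (0, 1) 0 :=
    (hasDerivAt_const _ _).prodMk (hasDerivAt_id _)
  have hHline : HasDerivAt (fun t : ℂ => H (0, t)) (fderiv ℂ H 0 (0, 1)) 0 :=
    HasFDerivAt.comp_hasDerivAt_of_eq (0 : ℂ) hH.differentiableAt.hasFDerivAt hline rfl
  have hHline₁ : HasDerivAt (fun t : ℂ => (H (0, t)).1) (fderiv ℂ H 0 (0, 1)).1 0 :=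
    (ContinuousLinearMap.fst ℂ ℂ ℂ).hasFDerivAt.comp_hasDerivAt (0 : ℂ) hHline
  have hHline₂ : HasDerivAt (fun t : ℂ => (H (0, t)).2) (fderiv ℂ H 0 (0, 1)).2 0 :=
    (ContinuousLinearMap.snd ℂ ℂ ℂ).hasFDerivAt.comp_hasDerivAt (0 : ℂ) hHline
  have hgv : g 0 = (fderiv ℂ H 0 (0, 1)).2 := by
    have h1 := hgd.self_of_nhds
    simp only [prod_mk_zero_zero, hQ0, zero_add] at h1
    exact h1.unique hHline₂
  have hℓv : ℓ₂ (0, 0) = (fderiv ℂ H 0 (0, 1)).1 := by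
    have hc : Tendsto (fun t : ℂ => (t, (0 : ℂ))) (𝓝 0) (𝓝 (0, 0)) :=
      Continuous.tendsto' (by fun_prop) _ _ rfl
    have h3 := hc.eventually hℓe
    simp only [prod_mk_zero_zero, hQ0, zero_add] at h3
    have h4 : DifferentiableAt ℂ (fun t : ℂ => ℓ₂ (t, 0)) 0 :=
      (AnalyticAt.comp_of_eq hℓ₂ (f := fun t : ℂ => (t, (0 : ℂ))) (by fun_prop)
        rfl).differentiableAt
    have h5 := ((hasDerivAt_id (0 : ℂ)).mul h4.hasDerivAt).const_add ((H 0).1)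
    have h6 := (h5.congr_of_eventuallyEq h3).unique hHline₁
    simpa using h6
  -- the antiholomorphic side
  have hrH' : ∀ v, fderiv ℂ (reflect H) 0 v = star (fderiv ℂ H 0 (star v)) := by
    intro v
    rw [fderiv_reflect (by simpa using hH.differentiableAt), star_zero]
  have hrline : HasDerivAt (fun t : ℂ => reflect H (0, t)) (star (fderiv ℂ H 0 (0, 1))) 0 := by
    have h1 := HasFDerivAt.comp_hasDerivAt_of_eq (0 : ℂ) hrHa.differentiableAt.hasFDerivAt hline rfl
    rw [hrH'] at h1
    have h2 : star ((0 : ℂ), (1 : ℂ)) = (0, 1) := by simp [Prod.star_def]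
    rwa [h2] at h1
  have hrline₁ : HasDerivAt (fun t : ℂ => (reflect H (0, t)).1)
      (star (fderiv ℂ H 0 (0, 1)).1) 0 :=
    (ContinuousLinearMap.fst ℂ ℂ ℂ).hasFDerivAt.comp_hasDerivAt (0 : ℂ) hrline
  have hrline₂ : HasDerivAt (fun t : ℂ => (reflect H (0, t)).2)
      (star (fderiv ℂ H 0 (0, 1)).2) 0 :=
    (ContinuousLinearMap.snd ℂ ℂ ℂ).hasFDerivAt.comp_hasDerivAt (0 : ℂ) hrline
  have hT' : ∀ᶠ y in 𝓝 (0 : ℂ × ℂ × ℂ), (H (y.1, Q y)).2 = (reflect H y.2).2 +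
      2 * I * (H (y.1, Q y)).1 ^ 2 * (reflect H y.2).1 + (reflect H y.2).1 ^ 2 *
        B ((H (y.1, Q y)).1, (reflect H y.2).1, (reflect H y.2).2) := by
    have a1 : AnalyticAt ℂ (fun y : ℂ × ℂ × ℂ => H (y.1, Q y)) 0 :=
      AnalyticAt.comp_of_eq hH (f := fun y : ℂ × ℂ × ℂ => (y.1, Q y)) (by fun_prop) (by simp [hQ0])
    have a2 : AnalyticAt ℂ (fun y : ℂ × ℂ × ℂ => reflect H y.2) 0 :=
      AnalyticAt.comp_of_eq hrHa (f := fun y : ℂ × ℂ × ℂ => y.2) (by fun_prop) rfl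
    have hc : ContinuousAt (fun y : ℂ × ℂ × ℂ =>
        ((H (y.1, Q y)).1, (reflect H y.2).1, (reflect H y.2).2)) 0 := by
      exact a1.continuousAt.fst.prodMk (a2.continuousAt.fst.prodMk a2.continuousAt.snd)
    have hc' := hc.tendsto
    simp only [Prod.fst_zero, Prod.snd_zero, hQ0, prod_mk_zero_zero, hH0, hrH0] at hc'
    filter_upwards [hT, hc'.eventually hB.eq] with y h1 h2
    rw [h1, h2]
  have E1 : ∀ᶠ z in 𝓝 (0 : ℂ), fderiv ℂ Q (z, 0, 0) (0, 0, 1) * g z =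
      star (g 0) + 2 * I * star (ℓ₂ (0, 0)) * f₀ z ^ 2 := by
    have hcz2 : Tendsto (fun z : ℂ => (z, Q (z, 0, 0))) (𝓝 0) (𝓝 0) := by
      have := (continuousAt_id.prodMk hW₀.continuousAt).tendsto
      simpa [hQ0] using this
    filter_upwards [hcz.eventually hT'.eventually_nhds, hgd,
      hcz.eventually hQ.eventually_analyticAt, hcz2.eventually hH.eventually_analyticAt,
      hcf.eventually hB.analytic.eventually_analyticAt] with z e1 e2 e3 e4 e5
    have hl : HasDerivAt (fun t : ℂ => (z, (0 : ℂ), t)) (0, 0, 1) 0 :=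
      (hasDerivAt_const _ _).prodMk ((hasDerivAt_const _ _).prodMk (hasDerivAt_id _))
    have d1 : HasDerivAt (fun t : ℂ => Q (z, 0, t)) (fderiv ℂ Q (z, 0, 0) (0, 0, 1)) 0 :=
      HasFDerivAt.comp_hasDerivAt_of_eq (0 : ℂ) e3.differentiableAt.hasFDerivAt hl rfl
    have d2 : HasDerivAt (fun t : ℂ => (H (z, Q (z, 0, t))).2)
        (g z * fderiv ℂ Q (z, 0, 0) (0, 0, 1)) 0 := by
      have h1 := HasDerivAt.comp_of_eq (0 : ℂ) e2 (d1.sub_const (Q (z, 0, 0))) (by simp)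
      refine h1.congr_of_eventuallyEq (Eventually.of_forall fun t => ?_)
      simp
    have d3 : DifferentiableAt ℂ (fun t : ℂ => (H (z, Q (z, 0, t))).1) 0 := by
      have h1 : DifferentiableAt ℂ (fun t : ℂ => H (z, Q (z, 0, t))) 0 :=
        DifferentiableAt.comp (0 : ℂ) (f := fun t : ℂ => (z, Q (z, 0, t)))
          e4.differentiableAt ((differentiableAt_const z).prodMk d1.differentiableAt)
      exact h1.fst
    have hr00 : reflect H ((0 : ℂ), (0 : ℂ)) = 0 := hrH0
    have d4 : DifferentiableAt ℂ (fun t : ℂ => B ((H (z, Q (z, 0, t))).1, (reflect H (0, t)).1,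
        (reflect H (0, t)).2)) 0 := by
      have e5' : DifferentiableAt ℂ B ((H (z, Q (z, 0, (0 : ℂ)))).1, (reflect H (0, (0 : ℂ))).1,
          (reflect H (0, (0 : ℂ))).2) := by
        rw [hr00, ← hf₀]
        exact e5.differentiableAt
      exact DifferentiableAt.comp (0 : ℂ) (f := fun t : ℂ => ((H (z, Q (z, 0, t))).1,
        (reflect H (0, t)).1, (reflect H (0, t)).2)) e5'
        (d3.prodMk (hrline₁.differentiableAt.prodMk hrline₂.differentiableAt))
    have d5 := (hrline₂.add (((d3.hasDerivAt.pow 2).const_mul (2 * I)).mul hrline₁)).add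
      ((hrline₁.pow 2).mul d4.hasDerivAt)
    have hc : Tendsto (fun t : ℂ => (z, (0 : ℂ), t)) (𝓝 0) (𝓝 (z, 0, 0)) :=
      Continuous.tendsto' (by fun_prop) _ _ rfl
    have d6 := d2.unique (d5.congr_of_eventuallyEq (hc.eventually e1))
    rw [hgv, hℓv, hf₀, mul_comm, d6]
    simp [hrH0]
    ring
  -- the second iterated Segre map
  have hWa : AnalyticAt ℂ (fun y : ℂ × ℂ => segreIterate Q (y.2, y.1, 0)) 0 :=
    AnalyticAt.comp_of_eq h.analyticAt_segreIterate
      (f := fun y : ℂ × ℂ => (y.2, y.1, (0 : ℂ × ℂ))) (by fun_prop) rfl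
  obtain ⟨W₁, W₂, hW₁, hW₂, hWe⟩ := exists_taylor_two (x₀ := (0 : ℂ)) hWa
  have hW0 : ∀ z, segreIterate Q (z, 0, 0) = Q (z, 0, 0) := by
    intro z
    simp [segreIterate, h.reflect_zero]
  have hWc : ∀ᶠ z in 𝓝 (0 : ℂ), coeffSnd (segreIterate Q) 1 (z, 0) = W₁ z ∧
      coeffSnd (segreIterate Q) 2 (z, 0) = W₂ (0, z) := by
    filter_upwards [hcs0.eventually hWe.eventually_nhds,
      hcs0.eventually hW₂.eventually_analyticAt] with z h1 h2
    have hc : Tendsto (fun t : ℂ => (t, z)) (𝓝 0) (𝓝 (0, z)) :=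
      Continuous.tendsto' (by fun_prop) _ _ rfl
    have h3 : AnalyticAt ℂ (fun t : ℂ => W₂ (t, z)) 0 :=
      AnalyticAt.comp_of_eq h2 (f := fun t : ℂ => (t, z)) (by fun_prop) rfl
    exact (coeff_jet_of_taylor (a := segreIterate Q (z, 0, 0)) h3 (hc.eventually h1)).2
  obtain ⟨C, hC, hCe⟩ := exists_taylor_two_one_variable
    (u := reflect f₀) (analyticAt_reflect (by simpa using hf₀a))
  have hr0 : reflect f₀ 0 = 0 := by simp [reflect, hf₀0]
  rw [hr0, deriv_reflect (by simpa using hf₀a.differentiableAt), star_zero] at hCe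
  obtain ⟨c, hc⟩ : ∃ c, c = star (deriv f₀ 0) := ⟨_, rfl⟩
  rw [← hc] at hCe ⊢
  -- the fundamental identity on the iterated Segre variety
  let δ : ℂ × ℂ → ℂ := fun y => y.1 * (W₁ y.2 + y.1 * W₂ y)
  have hδ : AnalyticAt ℂ δ 0 := by
    have h1 : AnalyticAt ℂ (fun y : ℂ × ℂ => W₁ y.2) 0 :=
      AnalyticAt.comp_of_eq hW₁ (f := fun y : ℂ × ℂ => y.2) (by fun_prop) rfl
    have h2 : AnalyticAt ℂ W₂ 0 := hW₂
    simp only [δ]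
    fun_prop
  have hδz : AnalyticAt ℂ (fun y : ℂ × ℂ => (δ y, y.2)) 0 := by fun_prop
  have hδ0 : (δ 0, (0 : ℂ × ℂ).2) = ((0 : ℂ), (0 : ℂ)) := by simp [δ]
  have hδc : Tendsto (fun y : ℂ × ℂ => (δ y, y.2)) (𝓝 0) (𝓝 ((0 : ℂ), (0 : ℂ))) := by
    have := hδz.continuousAt.tendsto
    rwa [hδ0] at this
  have hfst : Tendsto (fun y : ℂ × ℂ => y.1) (𝓝 0) (𝓝 0) := continuous_fst.tendsto' _ _ rfl
  have hsnd : Tendsto (fun y : ℂ × ℂ => y.2) (𝓝 0) (𝓝 0) := continuous_snd.tendsto' _ _ rfl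
  let b : ℂ × ℂ → ℂ := fun y => f₀ y.2 + δ y * ℓ₂ (δ y, y.2)
  let BB : ℂ × ℂ → ℂ := fun y => B (b y, reflect f₀ y.1, 0)
  have hb : AnalyticAt ℂ b 0 := by
    have h1 : AnalyticAt ℂ (fun y : ℂ × ℂ => f₀ y.2) 0 :=
      AnalyticAt.comp_of_eq hf₀a (f := fun y : ℂ × ℂ => y.2) (by fun_prop) rfl
    have h2 : AnalyticAt ℂ (fun y : ℂ × ℂ => ℓ₂ (δ y, y.2)) 0 := hℓ₂.comp_of_eq hδz hδ0
    exact h1.add (hδ.mul h2)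
  have hBB : AnalyticAt ℂ BB 0 := by
    have h1 : AnalyticAt ℂ (fun y : ℂ × ℂ => reflect f₀ y.1) 0 :=
      AnalyticAt.comp_of_eq (analyticAt_reflect (by simpa using hf₀a))
        (f := fun y : ℂ × ℂ => y.1) (by fun_prop) rfl
    exact AnalyticAt.comp_of_eq hB.analytic (f := fun y : ℂ × ℂ => (b y, reflect f₀ y.1, (0 : ℂ)))
      (by fun_prop) (by simp [b, hf₀0, δ, hr0])
  have hmain : ∀ᶠ y in 𝓝 (0 : ℂ × ℂ), δ y * g y.2 + δ y ^ 2 * k₂ (δ y, y.2) =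
      2 * I * b y ^ 2 * reflect f₀ y.1 + reflect f₀ y.1 ^ 2 * BB y := by
    have hcT : Tendsto (fun y : ℂ × ℂ => (y.2, y.1, reflect Q (y.1, 0, 0))) (𝓝 0) (𝓝 0) := by
      have h1 : AnalyticAt ℂ (fun y : ℂ × ℂ => reflect Q (y.1, 0, 0)) 0 :=
        AnalyticAt.comp_of_eq h.analyticAt_reflect_segre
          (f := fun y : ℂ × ℂ => (y.1, (0 : ℂ), (0 : ℂ))) (by fun_prop) rfl
      have h2 : ContinuousAt (fun y : ℂ × ℂ => (y.2, y.1, reflect Q (y.1, 0, 0))) 0 :=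
        continuousAt_snd.prodMk (continuousAt_fst.prodMk h1.continuousAt)
      have := h2.tendsto
      simpa [h.reflect_zero] using this
    have hstar : Tendsto (fun y : ℂ × ℂ => star y.1) (𝓝 0) (𝓝 0) :=
      (continuous_star.comp continuous_fst).tendsto' _ _ (by simp)
    filter_upwards [hcT.eventually hT', hδc.eventually hge, hδc.eventually hℓe, hWe,
      hstar.eventually hg0, hsnd.eventually hg0] with y e1 e2 e3 e4 e5 e6
    have hW : segreIterate Q (y.2, y.1, 0) = Q (y.2, 0, 0) + δ y := by
      rw [e4, hW0]
      simp only [δ]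
      ring
    have hW' : segreIterate Q (y.2, y.1, 0) = Q (y.2, y.1, reflect Q (y.1, 0, 0)) := by
      simp [segreIterate]
    have hr1 : (reflect H (y.1, reflect Q (y.1, 0, 0))).1 = reflect f₀ y.1 := by
      simp [reflect_apply, hf₀, Prod.star_def]
    have hr2 : (reflect H (y.1, reflect Q (y.1, 0, 0))).2 = 0 := by
      simpa [reflect_apply, Prod.star_def] using e5
    simp only [← hW', hW, hr1, hr2, e2, e3, zero_add, add_zero, e6, ← hf₀] at e1
    exact e1
  have a1 : AnalyticAt ℂ (fun y : ℂ × ℂ => W₁ y.2) ((0 : ℂ), (0 : ℂ)) :=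
    AnalyticAt.comp_of_eq hW₁ (f := fun y : ℂ × ℂ => y.2) (by fun_prop) rfl
  have a2 : AnalyticAt ℂ (fun y : ℂ × ℂ => g y.2) ((0 : ℂ), (0 : ℂ)) :=
    AnalyticAt.comp_of_eq hga (f := fun y : ℂ × ℂ => y.2) (by fun_prop) rfl
  have a3 : AnalyticAt ℂ (fun y : ℂ × ℂ => f₀ y.2) ((0 : ℂ), (0 : ℂ)) :=
    AnalyticAt.comp_of_eq hf₀a (f := fun y : ℂ × ℂ => y.2) (by fun_prop) rfl
  have a4 : AnalyticAt ℂ (fun y : ℂ × ℂ => C y.1) ((0 : ℂ), (0 : ℂ)) :=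
    AnalyticAt.comp_of_eq hC (f := fun y : ℂ × ℂ => y.1) (by fun_prop) rfl
  obtain ⟨K, hK⟩ : ∃ K : ℂ × ℂ → ℂ, ∀ y, K y = k₂ (δ y, y.2) := ⟨_, fun _ => rfl⟩
  obtain ⟨L, hL⟩ : ∃ L : ℂ × ℂ → ℂ, ∀ y, L y = ℓ₂ (δ y, y.2) := ⟨_, fun _ => rfl⟩
  have a5 : AnalyticAt ℂ K ((0 : ℂ), (0 : ℂ)) := by
    rw [funext hK]
    exact hk₂.comp_of_eq hδz hδ0
  have a6 : AnalyticAt ℂ L ((0 : ℂ), (0 : ℂ)) := by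
    rw [funext hL]
    exact hℓ₂.comp_of_eq hδz hδ0
  have a7 : AnalyticAt ℂ BB ((0 : ℂ), (0 : ℂ)) := hBB
  have hD : AnalyticAt ℂ (fun y : ℂ × ℂ => (W₁ y.2 * g y.2 - 2 * I * c * f₀ y.2 ^ 2) +
      y.1 * (W₂ y * g y.2 + (W₁ y.2 + y.1 * W₂ y) ^ 2 * K y -
        (c + y.1 * C y.1) ^ 2 * BB y - 2 * I * f₀ y.2 ^ 2 * C y.1 -
        2 * I * (c + y.1 * C y.1) * (2 * f₀ y.2 * (W₁ y.2 + y.1 * W₂ y) * L y +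
          y.1 * (W₁ y.2 + y.1 * W₂ y) ^ 2 * L y ^ 2))) ((0 : ℂ), (0 : ℂ)) := by
    fun_prop
  have hDz := eventually_zero_of_fst_mul hD (by
    filter_upwards [hmain, hfst.eventually hCe] with y e1 e2
    simp only [zero_add] at e2
    simp only [b, e2, ← hK, ← hL] at e1
    have e3 : δ y = y.1 * (W₁ y.2 + y.1 * W₂ y) := rfl
    linear_combination e1 - (g y.2 + (δ y + y.1 * (W₁ y.2 + y.1 * W₂ y)) * K y -
      2 * I * (y.1 * c + y.1 ^ 2 * C y.1) * (2 * f₀ y.2 * L y +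
        (δ y + y.1 * (W₁ y.2 + y.1 * W₂ y)) * L y ^ 2)) * e3)
  have E2 : ∀ᶠ z in 𝓝 (0 : ℂ), W₁ z * g z - 2 * I * c * f₀ z ^ 2 = 0 := by
    filter_upwards [hcs0.eventually hDz] with z e1
    simpa using e1
  have hD2 : AnalyticAt ℂ (fun y : ℂ × ℂ =>
      (W₂ y * g y.2 + (W₁ y.2 + y.1 * W₂ y) ^ 2 * K y -
        (c + y.1 * C y.1) ^ 2 * BB y - 2 * I * f₀ y.2 ^ 2 * C y.1 -
        2 * I * (c + y.1 * C y.1) * (2 * f₀ y.2 * (W₁ y.2 + y.1 * W₂ y) * L y +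
          y.1 * (W₁ y.2 + y.1 * W₂ y) ^ 2 * L y ^ 2))) ((0 : ℂ), (0 : ℂ)) := by
    fun_prop
  have E3 := eventually_zero_of_fst_mul hD2 (by
    have hsnd' : Tendsto (fun y : ℂ × ℂ => y.2) (𝓝 ((0 : ℂ), (0 : ℂ))) (𝓝 0) := hsnd
    filter_upwards [hDz, hsnd'.eventually E2] with y e1 e2
    linear_combination e1 - e2)
  refine ⟨g, fun z => ℓ₂ (0, z), fun z => k₂ (0, z), C 0, hga, hℓa, hka, hgv, hℓv, ?_⟩
  filter_upwards [E1, E2, hcs0.eventually E3, hWc] with z e1 e2 e3 e4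
  have hδz0 : δ (0, z) = 0 := by simp [δ]
  have hBBz : BB (0, z) = B (f₀ z, 0, 0) := by simp [BB, b, hδz0, hr0]
  rw [e4.1, e4.2]
  simp only [hδz0, hBBz, hK, hL] at e3
  refine ⟨e1, by linear_combination e2, by linear_combination e3⟩

end

/-! ### The slope of the degenerate chains in terms of jets -/

section PowerSeries

open PowerSeries

variable (p r : PowerSeries ℂ)

lemma coeff_zero_mul : coeff 0 (p * r) = coeff 0 p * coeff 0 r := by
  simp [PowerSeries.coeff_mul]

lemma coeff_one_mul : coeff 1 (p * r) = coeff 0 p * coeff 1 r + coeff 1 p * coeff 0 r := by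
  simp [PowerSeries.coeff_mul, Finset.Nat.sum_antidiagonal_eq_sum_range_succ_mk,
    Finset.sum_range_succ]

lemma coeff_two_mul : coeff 2 (p * r) =
    coeff 0 p * coeff 2 r + coeff 1 p * coeff 1 r + coeff 2 p * coeff 0 r := by
  simp [PowerSeries.coeff_mul, Finset.Nat.sum_antidiagonal_eq_sum_range_succ_mk,
    Finset.sum_range_succ]

lemma coeff_three_mul : coeff 3 (p * r) = coeff 0 p * coeff 3 r + coeff 1 p * coeff 2 r +
    coeff 2 p * coeff 1 r + coeff 3 p * coeff 0 r := by
  simp [PowerSeries.coeff_mul, Finset.Nat.sum_antidiagonal_eq_sum_range_succ_mk,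
    Finset.sum_range_succ]

lemma coeff_four_mul : coeff 4 (p * r) = coeff 0 p * coeff 4 r + coeff 1 p * coeff 3 r +
    coeff 2 p * coeff 2 r + coeff 3 p * coeff 1 r + coeff 4 p * coeff 0 r := by
  simp [PowerSeries.coeff_mul, Finset.Nat.sum_antidiagonal_eq_sum_range_succ_mk,
    Finset.sum_range_succ]

/-- The expression of the slope of a degenerate chain in terms of the coefficients of the second
iterated Segre map. -/
def chainExpression (v₁ v₂ w w₃ w₄ b₂ b₃ : ℂ) : ℂ :=
  let a := (w₃ / w - v₁) / 2
  2 / 5 * ((-b₃ + v₁ * b₂ + w * (v₁ ^ 2 - v₂) + 2 * a * (b₂ + w * a + w * v₁) -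
    w / 2 * (w₄ / w - v₂ - a ^ 2 - 2 * a * v₁)) / w ^ 2)

variable {p r} in
/-- The formal relation between the slope and the obstruction to the normal form. -/
lemma slope_eq_of_formal_relations {f g l k V W₁ W₂ : PowerSeries ℂ} {c C₂ β₂ β₃ σ κ : ℂ}
    (hf0 : coeff 0 f = 0) (hf1 : coeff 1 f = c) (hc : c ≠ 0) (hg0 : coeff 0 g ≠ 0)
    (hV0 : coeff 0 V = 1) (hl : coeff 0 l = -σ * c)
    (E1 : V * g = C κ + C (2 * I * (σ * c)) * (f * f))
    (E2 : W₁ * g = C (2 * I * -c) * (f * f))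
    (E3 : W₂ * g + W₁ * W₁ * k = C (4 * I * -c) * (f * (W₁ * l)) +
      C (2 * I * C₂) * (f * f) + C (c ^ 2) * (C (2 * I) * f + C β₂ * (f * f) +
        C β₃ * (f * (f * f)) + f * (f * (f * f)) * r)) :
    coeff 2 W₁ ≠ 0 ∧ coeff 2 W₁ * coeff 0 g = -2 * I * c ^ 3 ∧
      σ = chainExpression (coeff 1 V) (coeff 2 V) (coeff 2 W₁) (coeff 3 W₁)
      (coeff 4 W₁) (coeff 2 W₂) (coeff 3 W₂) -
        2 / 5 * (c ^ 2 / coeff 2 W₁ * (β₃ / (2 * I))) := by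
  have hI : I ≠ 0 := Complex.I_ne_zero
  have hI2 : I ^ 2 = -1 := Complex.I_sq
  have C0 : ∀ (n : ℕ) (x : ℂ), coeff (n + 1) (C x) = 0 := fun n x => by
    rw [PowerSeries.coeff_C, if_neg (Nat.succ_ne_zero n)]
  have k1 := C0 0
  have k2 := C0 1
  simp only [zero_add, Nat.reduceAdd] at k1 k2
  have d20 := congrArg (coeff 0) E2
  have d21 := congrArg (coeff 1) E2
  have d22 := congrArg (coeff 2) E2
  have d23 := congrArg (coeff 3) E2
  have d24 := congrArg (coeff 4) E2
  have d11 := congrArg (coeff 1) E1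
  have d12 := congrArg (coeff 2) E1
  have d30 := congrArg (coeff 0) E3
  have d31 := congrArg (coeff 1) E3
  have d32 := congrArg (coeff 2) E3
  have d33 := congrArg (coeff 3) E3
  simp only [map_add, coeff_C_mul, coeff_zero_mul, coeff_one_mul, coeff_two_mul, coeff_three_mul,
    coeff_four_mul, hf0, hf1, hV0, hl, k1, k2, zero_mul, mul_zero, zero_add, add_zero, one_mul]
    at d20 d21 d22 d23 d24 d11 d12 d30 d31 d32 d33
  have hw0 : coeff 0 W₁ = 0 := (mul_eq_zero.1 d20).resolve_right hg0
  have hw1 : coeff 1 W₁ = 0 := by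
    rw [hw0, zero_mul, zero_add] at d21
    exact (mul_eq_zero.1 d21).resolve_right hg0
  simp only [hw0, hw1, zero_mul, mul_zero, zero_add, add_zero] at d22 d23 d24 d30 d31 d32 d33
  have hb0 : coeff 0 W₂ = 0 := (mul_eq_zero.1 d30).resolve_right hg0
  simp only [hb0, zero_mul, zero_add] at d31 d32 d33
  generalize coeff 0 g = h₀ at *
  generalize coeff 1 g = h₁ at *
  generalize coeff 2 g = h₂ at *
  generalize coeff 2 W₁ = w at *
  generalize coeff 3 W₁ = w₃ at *
  generalize coeff 4 W₁ = w₄ at *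
  generalize coeff 1 W₂ = b₁ at *
  generalize coeff 2 W₂ = b₂ at *
  generalize coeff 3 W₂ = b₃ at *
  generalize coeff 1 V = v₁ at *
  generalize coeff 2 V = v₂ at *
  obtain ⟨a, ha⟩ : ∃ a, coeff 2 f = c * a := ⟨coeff 2 f / c, by field_simp⟩
  obtain ⟨a₂, ha₂⟩ : ∃ a₂, coeff 3 f = c * a₂ := ⟨coeff 3 f / c, by field_simp⟩
  rw [ha] at d23 d24 d32 d33
  rw [ha₂] at d24 d33
  have e1 : w * h₀ = -2 * I * c ^ 3 := by linear_combination d22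
  have hw : w ≠ 0 := by
    rintro rfl
    have h3 : I * c ^ 3 = 0 := by linear_combination (1 / 2) * e1
    exact (mul_ne_zero hI (pow_ne_zero 3 hc)) h3
  refine ⟨hw, e1, ?_⟩
  have e4 : h₁ = -v₁ * h₀ := by linear_combination d11
  have e5 : h₂ = h₀ * (v₁ ^ 2 - v₂ - w * σ) := by
    linear_combination d12 - v₁ * e4 + σ * e1
  have e6 : b₁ = -w := mul_right_cancel₀ hg0 (by linear_combination d31 + e1)
  have e2 : a = (w₃ / w - v₁) / 2 := by
    have : w * a * 2 = w₃ - v₁ * w :=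
      mul_right_cancel₀ hg0 (by linear_combination 2 * a * e1 - d23 + w * e4)
    field_simp
    linear_combination this
  have e3 : a₂ = (v₁ ^ 2 - v₂ - w * σ - w₃ / w * v₁ + w₄ / w - a ^ 2) / 2 := by
    have : w * (a ^ 2 + 2 * a₂) = w * (v₁ ^ 2 - v₂ - w * σ) - w₃ * v₁ + w₄ :=
      mul_right_cancel₀ hg0 (by
        linear_combination (a ^ 2 + 2 * a₂) * e1 - d24 + w * e5 + w₃ * e4)
    field_simp
    linear_combination this
  have e7 : b₁ * h₁ + b₂ * h₀ + w * h₀ * a = 2 * I * C₂ * c ^ 2 + β₂ * c ^ 4 := by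
    linear_combination d32 + a * e1
  have e8 : b₁ * (v₁ ^ 2 - v₂ - w * σ) - b₂ * v₁ + b₃ = -2 * σ * w ^ 2 +
      2 * a * (-b₁ * v₁ + b₂ + w * a) - w * a₂ - w * c ^ 2 * (β₃ / (2 * I)) := by
    have h3 : I * (β₃ / (2 * I)) = β₃ / 2 := by field_simp
    refine mul_right_cancel₀ hg0 ?_
    linear_combination d33 - b₁ * e5 - b₂ * e4 - 2 * a * e7 + 2 * a * b₁ * e4 + 2 * σ * w * e1 +
      a₂ * e1 + c ^ 2 * (β₃ / (2 * I)) * e1 - 2 * c ^ 5 * h3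
  rw [e6] at e8
  have e9 : σ * w ^ 2 * (5 / 2) = (-b₃ + v₁ * b₂ + w * (v₁ ^ 2 - v₂) +
      2 * a * (b₂ + w * a + w * v₁) - w / 2 * (w₄ / w - v₂ - a ^ 2 - 2 * a * v₁)) -
        w * c ^ 2 * (β₃ / (2 * I)) := by
    have h3 : w₃ / w = 2 * a + v₁ := by rw [e2]; ring
    rw [h3] at e3
    linear_combination e8 - w * e3
  simp only [chainExpression, ← e2]
  generalize β₃ / (2 * I) = β at *
  generalize (-b₃ + v₁ * b₂ + w * (v₁ ^ 2 - v₂) +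
      2 * a * (b₂ + w * a + w * v₁) - w / 2 * (w₄ / w - v₂ - a ^ 2 - 2 * a * v₁)) = K at *
  field_simp
  linear_combination 2 * e9

end PowerSeries

section

variable {M : Set (ℂ × ℂ)} {q : ℂ × ℂ} {Θ F : ℂ × ℂ → ℂ × ℂ} {φ φ' : ℂ × ℝ → ℝ}
  {Q Q' B : ℂ × ℂ × ℂ → ℂ} {ρ : ℂ × ℂ → ℝ}

/-- The derivative `Q_ω` along the Segre variety of the point with real parameters `e`. -/
def segreOmega (Q : ℂ × ℂ × ℂ → ℂ) (y : ℂ × ℂ × (ℂ × ℂ)) : ℂ :=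
  fderiv ℂ Q (y.1 + y.2.2.1, y.2.2.1, y.2.2.2) (0, 0, 1)

/-- The function of the flat parameters whose real part is the slope of the degenerate chains. -/
def chainCoefficient (Q : ℂ × ℂ × ℂ → ℂ) (e : ℂ × ℂ) : ℂ :=
  chainExpression (coeffBoth (segreOmega Q) 1 0 e) (coeffBoth (segreOmega Q) 2 0 e)
    (coeffBoth (segreIterate Q) 2 1 e) (coeffBoth (segreIterate Q) 3 1 e)
    (coeffBoth (segreIterate Q) 4 1 e) (coeffBoth (segreIterate Q) 2 2 e)
    (coeffBoth (segreIterate Q) 3 2 e)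

lemma coeffSnd_zero {E : Type*} [NormedAddCommGroup E] [NormedSpace ℂ E] (G : ℂ × ℂ × E → ℂ)
    (x : ℂ × E) : coeffSnd G 0 x = G (x.1, 0, x.2) := by
  simp [coeffSnd]

lemma coeffBoth_eq_coeff_jet {E : Type*} [NormedAddCommGroup E] [NormedSpace ℂ E]
    (G : ℂ × ℂ × E → ℂ) (k l : ℕ) (τ : E) :
    coeffBoth G k l τ = PowerSeries.coeff k (jet fun z => coeffSnd G l (z, τ)) := by
  rw [coeff_jet, coeffBoth]

lemma IsFlatChart.deriv_segre (h : IsFlatChart M q Θ φ Q) :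
    fderiv ℂ Q 0 (0, 0, 1) = 1 ∧ star (fderiv ℂ Q 0 (1, 0, 0)) = fderiv ℂ Q 0 (1, 0, 0) := by
  have hQ := h.chart.analytic.differentiableAt.hasFDerivAt
  have l1 : HasDerivAt (fun t : ℂ => ((0 : ℂ), (0 : ℂ), t)) (0, 0, 1) 0 :=
    (hasDerivAt_const _ _).prodMk ((hasDerivAt_const _ _).prodMk (hasDerivAt_id _))
  have l2 : HasDerivAt (fun t : ℂ => (t, t, (0 : ℂ))) (1, 1, 0) 0 :=
    (hasDerivAt_id _).prodMk ((hasDerivAt_id _).prodMk (hasDerivAt_const _ _))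
  have d1 := HasFDerivAt.comp_hasDerivAt_of_eq (0 : ℂ) hQ l1 rfl
  have d2 := HasFDerivAt.comp_hasDerivAt_of_eq (0 : ℂ) hQ l2 rfl
  have c1 := tendsto_zero_prodMk (E := ℂ)
  have c2 := tendsto_prodMk_zero (E := ℂ)
  have e1 : fderiv ℂ Q 0 (0, 0, 1) = 1 :=
    (d1.congr_of_eventuallyEq ((c1.eventually h.segre_diag).mono fun t ht => ht.symm)).unique
      (hasDerivAt_id _)
  have e2 : fderiv ℂ Q 0 (1, 1, 0) = 0 :=
    (d2.congr_of_eventuallyEq ((c2.eventually h.segre_diag).mono fun t ht => ht.symm)).unique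
      (hasDerivAt_const _ _)
  refine ⟨e1, ?_⟩
  have l3 : HasDerivAt (fun t : ℂ => (t, (0 : ℂ), (0 : ℂ))) (1, 0, 0) 0 :=
    (hasDerivAt_id _).prodMk ((hasDerivAt_const _ _).prodMk (hasDerivAt_const _ _))
  have d3 : HasDerivAt (fun t : ℂ => Q (t, 0, 0)) (fderiv ℂ Q 0 (1, 0, 0)) 0 :=
    HasFDerivAt.comp_hasDerivAt_of_eq (0 : ℂ) hQ l3 rfl
  have l4 : HasDerivAt (fun t : ℂ => ((0 : ℂ), t, Q (t, 0, 0))) (0, 1, fderiv ℂ Q 0 (1, 0, 0)) 0 :=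
    (hasDerivAt_const _ _).prodMk ((hasDerivAt_id _).prodMk d3)
  have d4 := HasFDerivAt.comp_hasDerivAt_of_eq (0 : ℂ)
    h.chart.analyticAt_reflect_segre.differentiableAt.hasFDerivAt l4 (by simp [h.chart.map_zero])
  have c3 : Tendsto (fun t : ℂ => (t, (0 : ℂ), (0 : ℂ))) (𝓝 0) (𝓝 0) :=
    Continuous.tendsto' (by fun_prop) _ _ rfl
  have e3 := (d4.congr_of_eventuallyEq ((c3.eventually h.chart.reality).mono
    fun t ht => ht.symm)).unique (hasDerivAt_const _ _)
  rw [fderiv_reflect (by simpa using h.chart.analytic.differentiableAt), star_zero] at e3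
  have e4 : star ((0 : ℂ), (1 : ℂ), fderiv ℂ Q 0 (1, 0, 0)) =
      (0, 1, star (fderiv ℂ Q 0 (1, 0, 0))) := by simp [Prod.star_def]
  rw [e4] at e3
  have e5 : ((0 : ℂ), (1 : ℂ), star (fderiv ℂ Q 0 (1, 0, 0))) = (1, 1, 0) - (1, 0, 0) +
      star (fderiv ℂ Q 0 (1, 0, 0)) • ((0 : ℂ), (0 : ℂ), (1 : ℂ)) := by simp
  rw [e5, map_add, map_sub, map_smul, e1, e2, star_eq_zero, smul_eq_mul] at e3
  linear_combination e3

/-- A map onto a prenormal form sends the tangent plane of the Levi degeneracy set into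
`{Re z = 0}`. -/
lemma IsFlatChart.star_fderiv (h : IsFlatChart M q Θ φ Q) (h' : IsSegreChart M q F φ' Q')
    (hB : IsPrenormal Q' B) (hρ : IsLocalDefiningFunction M q ρ) {H Ξ : ℂ × ℂ → ℂ × ℂ}
    (hΞ : Tendsto Ξ (𝓝 0) (𝓝 q)) (hΘΞ : ∀ᶠ y in 𝓝 0, Θ (Ξ y) = y) (hH : AnalyticAt ℂ H 0)
    (hHe : ∀ᶠ x in 𝓝 q, F x = H (Θ x)) {v : ℂ × ℂ} (hv : star v = v) :
    star (fderiv ℂ H 0 v).1 = -(fderiv ℂ H 0 v).1 := by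
  have hH0 : H 0 = 0 := by
    have := hHe.self_of_nhds
    rwa [h.chart.biholo.2.2, h'.biholo.2.2, eq_comm] at this
  obtain ⟨-, hs⟩ := hB.segreLevi h'
  have hl : HasDerivAt (fun t : ℝ => t • v) v 0 := by
    simpa using (hasDerivAt_id (0 : ℝ)).smul_const v
  have hcv : Tendsto (fun t : ℝ => t • v) (𝓝 0) (𝓝 0) :=
    Continuous.tendsto' (by fun_prop) _ _ (by simp)
  have d1 : HasDerivAt (fun t : ℝ => H (t • v)) (fderiv ℂ H 0 v) 0 :=
    HasFDerivAt.comp_hasDerivAt_of_eq (0 : ℝ)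
      (hH.differentiableAt.hasFDerivAt.restrictScalars ℝ) hl (by simp)
  have d2 : HasDerivAt (fun t : ℝ => (H (t • v)).1) (fderiv ℂ H 0 v).1 0 :=
    (ContinuousLinearMap.fst ℝ ℂ ℂ).hasFDerivAt.comp_hasDerivAt (0 : ℝ) d1
  have d3 : HasDerivAt (fun t : ℝ => (H (t • v)).2) (fderiv ℂ H 0 v).2 0 :=
    (ContinuousLinearMap.snd ℝ ℂ ℂ).hasFDerivAt.comp_hasDerivAt (0 : ℝ) d1
  have d4 := HasFDerivAt.comp_hasDerivAt_of_eq (0 : ℝ)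
    ((analyticAt_segreLevi h'.analytic).differentiableAt.hasFDerivAt.restrictScalars ℝ)
    (d2.prodMk (d2.star.prodMk d3.star)) (by simp [hH0])
  have hz : ∀ᶠ t : ℝ in 𝓝 0, segreLevi Q' ((H (t • v)).1, star (H (t • v)).1,
      star (H (t • v)).2) = 0 := by
    filter_upwards [(hΞ.comp hcv).eventually h.mem_iff, (hΞ.comp hcv).eventually hHe,
      (hΞ.comp hcv).eventually (h'.mem_leviDegeneracySet_iff hρ), hcv.eventually hΘΞ]
      with t e1 e2 e3 e4
    simp only [Function.comp_apply] at e1 e2 e3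
    rw [e4] at e1 e2
    have e5 : Ξ (t • v) ∈ leviDegeneracySet M := e1.2 (by rw [star_smul, hv]; simp)
    rw [← e2]
    exact (e3 e5.1).1 e5
  have e6 := (d4.congr_of_eventuallyEq (hz.mono fun t ht => ht.symm)).unique (hasDerivAt_const _ _)
  have e7 : 4 * I * ((fderiv ℂ H 0 v).1 + star (fderiv ℂ H 0 v).1) = 0 :=
    (hs _).symm.trans e6
  have e8 := (mul_eq_zero.1 e7).resolve_left (by simp)
  linear_combination e8

lemma IsPrenormal.exists_expansion (h : IsSegreChart M q Θ φ Q) (hB : IsPrenormal Q B) :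
    ∃ (β : ℂ) (r : ℂ → ℂ), AnalyticAt ℂ r 0 ∧ ∀ᶠ x in 𝓝 (0 : ℂ), B (x, 0, 0) =
      2 * I * x + β * (x * x) + coeffBoth B 3 0 0 * (x * (x * x)) +
        x * (x * (x * x)) * r x := by
  obtain ⟨B₁, hB₁, hBe, hB₁0⟩ := hB.exists_factor h
  have hl : Tendsto (fun x : ℂ => (x, (0 : ℂ), (0 : ℂ))) (𝓝 0) (𝓝 0) :=
    Continuous.tendsto' (by fun_prop) _ _ rfl
  obtain ⟨d, hd, hde⟩ := exists_taylor_two_one_variable (u := fun x : ℂ => B₁ (x, 0, 0))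
    (AnalyticAt.comp_of_eq hB₁ (f := fun x : ℂ => (x, (0 : ℂ), (0 : ℂ))) (by fun_prop) rfl)
  obtain ⟨d', hd', hde'⟩ := exists_taylor_two_one_variable hd
  have h1 : B₁ (0, 0, 0) = 2 * I := hB₁0.self_of_nhds
  have hr : AnalyticAt ℂ (fun x => deriv d 0 + x * d' x) 0 := by fun_prop
  have h2 : ∀ᶠ x in 𝓝 (0 : ℂ), B (x, 0, 0) =
      2 * I * x + deriv (fun x : ℂ => B₁ (x, 0, 0)) 0 * (x * x) + d 0 * (x * (x * x)) +
        x * (x * (x * x)) * (deriv d 0 + x * d' x) := by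
    filter_upwards [hl.eventually hBe, hde, hde'] with x e1 e2 e3
    rw [e1, e2, e3, h1]
    ring
  refine ⟨deriv (fun x : ℂ => B₁ (x, 0, 0)) 0, _, hr, ?_⟩
  suffices h3 : coeffBoth B 3 0 0 = d 0 by rwa [h3]
  have hid : AnalyticAt ℂ (fun x : ℂ => x) 0 := analyticAt_id
  rw [coeffBoth_eq_coeff_jet, jet_congr (v := fun x => 2 * I * x +
      (deriv (fun x : ℂ => B₁ (x, 0, 0)) 0 * (x * x) + (d 0 * (x * (x * x)) +
        x * (x * (x * x)) * (deriv d 0 + x * d' x))))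
    (by
      filter_upwards [h2] with x hx
      rw [coeffSnd_zero, hx]
      ring),
    jet_add (by fun_prop) (by fun_prop), jet_add (by fun_prop) (by fun_prop),
    jet_add (by fun_prop) (by fun_prop), jet_const_mul, jet_const_mul, jet_const_mul,
    jet_mul (u := fun x => x * (x * (x * x))) (by fun_prop) hr,
    jet_mul (v := fun x => x * (x * x)) hid (by fun_prop), jet_mul (v := fun x => x * x) hid
    (by fun_prop), jet_mul hid hid, jet_id]
  simp [coeff_three_mul, PowerSeries.coeff_X]

/-- The direction of the degenerate chain at the centre of a flat chart, computed from a map onto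
a prenormal form. -/
theorem IsFlatChart.exists_slope (h : IsFlatChart M q Θ φ Q) (h' : IsSegreChart M q F φ' Q')
    (hB : IsPrenormal Q' B) (hρ : IsLocalDefiningFunction M q ρ) :
    coeffBoth (segreIterate Q) 2 1 0 ≠ 0 ∧ ∃ σ : ℝ,
      (∀ v, (∃ r : ℝ, fderiv ℂ F q v = (0, (r : ℂ))) ↔ ∃ r : ℝ,
        fderiv ℂ Θ q v = ((r : ℂ) * σ, (r : ℂ) * (1 + fderiv ℂ Q 0 (1, 0, 0) * σ))) ∧
      ((coeffBoth B 3 0 0).im = 0 ↔ σ = (chainCoefficient Q 0).re) := by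
  obtain ⟨Ξ, hΞ, hΞ0, hΞ1, hΞ2, hΞ3, hΞ4, hΞ5⟩ := h.chart.biholo.exists_inverse
  have hQ := h.chart.analytic
  have hQ0 := h.chart.map_zero
  have hF := h'.biholo
  obtain ⟨H, hHdef⟩ : ∃ H : ℂ × ℂ → ℂ × ℂ, H = fun y => F (Ξ y) := ⟨_, rfl⟩
  have hH : AnalyticAt ℂ H 0 := by
    rw [hHdef]
    exact hF.1.comp_of_eq hΞ hΞ0
  have hHd : ∀ v, fderiv ℂ H 0 v = fderiv ℂ F q (fderiv ℂ Ξ 0 v) := by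
    intro v
    rw [hHdef, (hasFDerivAt_comp_of_eq hF.1.differentiableAt.hasFDerivAt
      hΞ.differentiableAt.hasFDerivAt hΞ0).fderiv]
    rfl
  have hinj : Function.Injective (fderiv ℂ H 0) := fun v w hvw => by
    rw [hHd, hHd] at hvw
    exact hΞ3.1 (hF.2.1.1 hvw)
  have hHe : ∀ᶠ x in 𝓝 q, F x = H (Θ x) := by
    filter_upwards [hΞ1] with x hx
    rw [hHdef]
    simp only [hx]
  have hΞt : Tendsto Ξ (𝓝 0) (𝓝 q) := by
    have := hΞ.continuousAt.tendsto
    rwa [hΞ0] at this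
  have hreal : ∀ v : ℂ × ℂ, star v = v → star (fderiv ℂ H 0 v).1 = -(fderiv ℂ H 0 v).1 :=
    fun v hv => h.star_fderiv h' hB hρ hΞt hΞ2 hH hHe hv
  obtain ⟨hω, hm⟩ := h.deriv_segre
  obtain ⟨m, hmdef⟩ : ∃ m, m = fderiv ℂ Q 0 (1, 0, 0) := ⟨_, rfl⟩
  rw [← hmdef] at hm ⊢
  obtain ⟨f₀, hf₀⟩ : ∃ f₀ : ℂ → ℂ, ∀ z, f₀ z = (H (z, Q (z, 0, 0))).1 := ⟨_, fun _ => rfl⟩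
  obtain ⟨hg0, g, ℓ, k, C₂, hg, hℓ, hk, hgv, hℓv, hrel⟩ :=
    h.chart.exists_jet_relations h' hB hH hHe hf₀
  -- first derivatives
  have hH0 : H 0 = 0 := by rw [hHdef]; simp [hΞ0, hF.2.2]
  have l3 : HasDerivAt (fun t : ℂ => (t, (0 : ℂ), (0 : ℂ))) (1, 0, 0) 0 :=
    (hasDerivAt_id _).prodMk ((hasDerivAt_const _ _).prodMk (hasDerivAt_const _ _))
  have d3 : HasDerivAt (fun t : ℂ => Q (t, 0, 0)) m 0 := by
    rw [hmdef]
    exact HasFDerivAt.comp_hasDerivAt_of_eq (0 : ℂ) hQ.differentiableAt.hasFDerivAt l3 rfl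
  have d4 : HasDerivAt (fun t : ℂ => H (t, Q (t, 0, 0))) (fderiv ℂ H 0 (1, m)) 0 :=
    HasFDerivAt.comp_hasDerivAt_of_eq (0 : ℂ) hH.differentiableAt.hasFDerivAt
      ((hasDerivAt_id _).prodMk d3) (by simp [hQ0])
  have d5 : HasDerivAt f₀ (fderiv ℂ H 0 (1, m)).1 0 := by
    rw [funext hf₀]
    exact (ContinuousLinearMap.fst ℂ ℂ ℂ).hasFDerivAt.comp_hasDerivAt (0 : ℂ) d4
  have d6 : (fderiv ℂ H 0 (1, m)).2 = 0 :=
    (((ContinuousLinearMap.snd ℂ ℂ ℂ).hasFDerivAt.comp_hasDerivAt (0 : ℂ)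
      d4).congr_of_eventuallyEq (hg0.mono fun t ht => ht.symm)).unique (hasDerivAt_const _ _)
  obtain ⟨c, hc⟩ : ∃ c, c = deriv f₀ 0 := ⟨_, rfl⟩
  have hcv : fderiv ℂ H 0 (1, m) = (c, 0) := by
    rw [hc, d5.deriv]
    exact Prod.ext rfl d6
  have hηv : fderiv ℂ H 0 (0, 1) = (ℓ 0, g 0) := by rw [hgv, hℓv]
  have hc0 : c ≠ 0 := by
    intro h0
    have : ((1 : ℂ), m) = 0 := hinj (by rw [hcv, h0, map_zero]; rfl)
    simpa using congrArg Prod.fst this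
  have hg0' : g 0 ≠ 0 := by
    intro h0
    have h1 : c • ((0 : ℂ), (1 : ℂ)) = ℓ 0 • ((1 : ℂ), m) := hinj (by
      rw [map_smul, map_smul, hcv, hηv, h0]
      simp [mul_comm])
    have h2 := congrArg Prod.fst h1
    have h3 := congrArg Prod.snd h1
    simp at h2 h3
    rw [← h2] at h3
    simp at h3
    exact hc0 h3
  have hcr : star c = -c := by
    have := hreal (1, m) (by rw [Prod.star_def]; simp only [hm, star_one])
    rwa [hcv] at this
  have hηr : star (ℓ 0) = -ℓ 0 := by
    have := hreal (0, 1) (by simp [Prod.star_def])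
    rwa [hηv] at this
  have hf₀0 : f₀ 0 = 0 := by simp [hf₀, hQ0, hH0]
  have hgr : star (g 0) = g 0 := by
    have h1 := hrel.self_of_nhds.1
    rw [hf₀0, show ((0 : ℂ), (0 : ℂ), (0 : ℂ)) = 0 from rfl, hω] at h1
    linear_combination -h1
  obtain ⟨σ, hσ⟩ : ∃ σ : ℝ, (σ : ℂ) = -ℓ 0 / c := by
    refine ⟨(-ℓ 0 / c).re, Complex.conj_eq_iff_re.1 ?_⟩
    have : star (-ℓ 0 / c) = -ℓ 0 / c := by
      rw [star_div₀, star_neg, hηr, hcr]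
      field_simp
    exact this
  have hℓσ : ℓ 0 = -σ * c := by rw [hσ]; field_simp
  obtain ⟨r₀, hr₀⟩ : ∃ r₀ : ℝ, (r₀ : ℂ) = g 0 := ⟨_, Complex.conj_eq_iff_re.1 hgr⟩
  -- the Taylor coefficients
  have hf₀a : AnalyticAt ℂ f₀ 0 := by
    have hl : AnalyticAt ℂ (fun z : ℂ => Q (z, 0, 0)) 0 :=
      AnalyticAt.comp_of_eq hQ (f := fun z : ℂ => (z, (0 : ℂ), (0 : ℂ))) (by fun_prop) rfl
    rw [funext hf₀]
    exact analyticAt_fst.comp (AnalyticAt.comp_of_eq hH (f := fun z : ℂ => (z, Q (z, 0, 0)))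
      (by fun_prop) (by simp [hQ0]))
  obtain ⟨β, r, hr, hBe⟩ := hB.exists_expansion h'
  have hVa : AnalyticAt ℂ (fun z : ℂ => fderiv ℂ Q (z, 0, 0) (0, 0, 1)) 0 :=
    AnalyticAt.comp_of_eq (analyticAt_fderiv_apply hQ (0, 0, 1))
      (f := fun z : ℂ => (z, (0 : ℂ), (0 : ℂ))) (by fun_prop) rfl
  have hWa : ∀ l, AnalyticAt ℂ (fun z : ℂ => coeffSnd (segreIterate Q) l (z, 0)) 0 := fun l =>
    AnalyticAt.comp_of_eq (analyticAt_coeffSnd (x := ((0 : ℂ), (0 : ℂ × ℂ)))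
      h.chart.analyticAt_segreIterate l) (f := fun z : ℂ => (z, (0 : ℂ × ℂ))) (by fun_prop) rfl
  obtain ⟨R, hR⟩ : ∃ R : ℂ → ℂ, ∀ z, R z = r (f₀ z) := ⟨_, fun _ => rfl⟩
  have hra : AnalyticAt ℂ R 0 := by
    rw [funext hR]
    exact hr.comp_of_eq hf₀a hf₀0
  have hBf : ∀ᶠ z in 𝓝 (0 : ℂ), B (f₀ z, 0, 0) =
      2 * I * f₀ z + β * (f₀ z * f₀ z) + coeffBoth B 3 0 0 * (f₀ z * (f₀ z * f₀ z)) +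
        f₀ z * (f₀ z * (f₀ z * f₀ z)) * R z := by
    have := hf₀a.continuousAt.tendsto
    rw [hf₀0] at this
    simpa only [hR] using this.eventually hBe
  have j2 := jet_mul hf₀a hf₀a
  have j3 := jet_mul hf₀a (v := fun z => f₀ z * f₀ z) (by fun_prop)
  have j4 := jet_mul hf₀a (v := fun z => f₀ z * (f₀ z * f₀ z)) (by fun_prop)
  have E1 : jet (fun z => fderiv ℂ Q (z, 0, 0) (0, 0, 1)) * jet g =
      PowerSeries.C (star (g 0)) +
        PowerSeries.C (2 * I * (σ * c)) * (jet f₀ * jet f₀) := by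
    rw [← jet_mul hVa hg, jet_congr (v := fun z => star (g 0) +
        2 * I * (σ * c) * (f₀ z * f₀ z))
      (hrel.mono fun z hz => by
        rw [hz.1, hηr, hℓσ]
        ring),
      jet_add analyticAt_const (by fun_prop), jet_const, jet_const_mul, j2]
  have E2 : jet (fun z => coeffSnd (segreIterate Q) 1 (z, 0)) * jet g =
      PowerSeries.C (2 * I * -c) * (jet f₀ * jet f₀) := by
    rw [← jet_mul (hWa 1) hg, jet_congr (v := fun z => 2 * I * -c * (f₀ z * f₀ z))
      (hrel.mono fun z hz => by
        simp only [hz.2.1, ← hc, hcr]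
        ring), jet_const_mul, j2]
  have hW1k : AnalyticAt ℂ (fun z => coeffSnd (segreIterate Q) 1 (z, 0) *
      coeffSnd (segreIterate Q) 1 (z, 0)) 0 := (hWa 1).mul (hWa 1)
  have hW1l : AnalyticAt ℂ (fun z => coeffSnd (segreIterate Q) 1 (z, 0) * ℓ z) 0 :=
    (hWa 1).mul hℓ
  have E3 : jet (fun z => coeffSnd (segreIterate Q) 2 (z, 0)) * jet g +
      jet (fun z => coeffSnd (segreIterate Q) 1 (z, 0)) *
        jet (fun z => coeffSnd (segreIterate Q) 1 (z, 0)) * jet k =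
      PowerSeries.C (4 * I * -c) * (jet f₀ *
        (jet (fun z => coeffSnd (segreIterate Q) 1 (z, 0)) * jet ℓ)) +
      PowerSeries.C (2 * I * C₂) * (jet f₀ * jet f₀) +
      PowerSeries.C (c ^ 2) * (PowerSeries.C (2 * I) * jet f₀ +
        PowerSeries.C β * (jet f₀ * jet f₀) +
        PowerSeries.C (coeffBoth B 3 0 0) * (jet f₀ * (jet f₀ * jet f₀)) +
        jet f₀ * (jet f₀ * (jet f₀ * jet f₀)) * jet R) := by
    rw [← jet_mul (hWa 1) (hWa 1), ← jet_mul hW1k hk, ← jet_mul (hWa 2) hg,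
      ← jet_add ((hWa 2).fun_mul hg) (hW1k.fun_mul hk), ← j2, ← j3, ← j4,
      ← jet_mul (by fun_prop) hra, ← jet_mul (hWa 1) hℓ, ← jet_mul hf₀a hW1l,
      ← jet_const_mul, ← jet_const_mul, ← jet_const_mul, ← jet_const_mul, ← jet_const_mul,
      ← jet_add (by fun_prop) (by fun_prop), ← jet_add (by fun_prop) (by fun_prop),
      ← jet_add (by fun_prop) (by fun_prop), ← jet_add (by fun_prop) (by fun_prop),
      ← jet_const_mul,
      ← jet_add (by fun_prop) (by fun_prop)]
    refine jet_congr ?_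
    filter_upwards [hrel, hBf] with z e1 e2
    have e3 := e1.2.2
    rw [e2, ← hc, hcr] at e3
    linear_combination e3
  obtain ⟨hw, hw2, hσe⟩ := slope_eq_of_formal_relations (r := jet R)
    (by rw [coeff_zero_jet, hf₀0]) (by rw [coeff_one_jet, hc]) hc0
    (by rwa [coeff_zero_jet]) (by rw [coeff_zero_jet]; exact hω)
    (by rw [coeff_zero_jet, hℓσ]) E1 E2 E3
  have hV : (fun z => fderiv ℂ Q (z, 0, 0) (0, 0, 1)) =
      fun z => coeffSnd (segreOmega Q) 0 (z, 0) := by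
    funext z
    simp [coeffSnd_zero, segreOmega]
  rw [hV] at hσe
  simp only [← coeffBoth_eq_coeff_jet] at hw hw2 hσe
  refine ⟨hw, σ, fun v => ?_, ?_⟩
  · have hFv : fderiv ℂ F q v = fderiv ℂ H 0 (fderiv ℂ Θ q v) := by rw [hHd, hΞ5]
    have hr0 : (r₀ : ℂ) ≠ 0 := by rwa [hr₀]
    have hdir : fderiv ℂ H 0 ((σ : ℂ), 1 + m * σ) = (0, (r₀ : ℂ)) := by
      have : ((σ : ℂ), 1 + m * σ) = (σ : ℂ) • ((1 : ℂ), m) + ((0 : ℂ), (1 : ℂ)) := by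
        simp [mul_comm, add_comm]
      rw [this, map_add, map_smul, hcv, hηv, hℓσ, hr₀]
      simp
    have hdir' : ∀ t : ℂ, fderiv ℂ H 0 (t * σ, t * (1 + m * σ)) = (0, t * r₀) := by
      intro t
      have : (t * σ, t * (1 + m * σ)) = t • ((σ : ℂ), 1 + m * σ) := by simp
      rw [this, map_smul, hdir]
      simp
    constructor
    · rintro ⟨r, hr⟩
      refine ⟨r / r₀, hinj ?_⟩
      rw [hdir', ← hFv, hr]
      push_cast
      field_simp
    · rintro ⟨r, hr⟩
      refine ⟨r * r₀, ?_⟩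
      rw [hFv, hr, hdir']
      push_cast
      rfl
  · rw [coeff_zero_jet] at hw2
    change (σ : ℂ) = chainCoefficient Q 0 - _ at hσe
    obtain ⟨y, hy⟩ : ∃ y : ℝ, c = I * y := by
      refine ⟨c.im, ?_⟩
      have h1 := congrArg Complex.re hcr
      simp at h1
      apply Complex.ext <;> simp
      linarith
    have hy0 : (y : ℂ) ≠ 0 := by
      intro h0
      exact hc0 (by rw [hy, h0, mul_zero])
    have hI := Complex.I_ne_zero
    have h1 : c ^ 2 / coeffBoth (segreIterate Q) 2 1 0 = ((r₀ / (2 * y) : ℝ) : ℂ) := by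
      rw [← hr₀] at hw2
      have h2 : coeffBoth (segreIterate Q) 2 1 0 * r₀ = -2 * y ^ 3 := by
        rw [hw2, hy]
        linear_combination (-2 * y ^ 3 : ℂ) * (Complex.I_pow_four)
      push_cast
      rw [div_eq_div_iff hw (by simpa using hy0), hy]
      linear_combination (2 * y ^ 3 : ℂ) * Complex.I_sq - h2
    rw [h1] at hσe
    have h3 := congrArg Complex.re hσe
    have h4 : (2 / 5 * (((r₀ / (2 * y) : ℝ) : ℂ) * (coeffBoth B 3 0 0 / (2 * I)))).re =
        r₀ / (10 * y) * (coeffBoth B 3 0 0).im := by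
      have : coeffBoth B 3 0 0 / (2 * I) = -I / 2 * coeffBoth B 3 0 0 := by
        field_simp
        rw [Complex.I_sq]
        ring
      rw [this]
      have e : (2 / 5 * (((r₀ / (2 * y) : ℝ) : ℂ) * (-I / 2 * coeffBoth B 3 0 0))) =
        ((r₀ / (10 * y) : ℝ) : ℂ) * (-I * coeffBoth B 3 0 0) := by
        push_cast
        field_simp
        ring
      rw [e, Complex.re_ofReal_mul]
      simp
    rw [Complex.ofReal_re, Complex.sub_re, h4] at h3
    have h5 : r₀ / (10 * y) ≠ 0 := by
      refine div_ne_zero ?_ (mul_ne_zero (by norm_num) (by exact_mod_cast hy0))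
      intro h0
      exact hg0' (by rw [← hr₀, h0, Complex.ofReal_zero])
    constructor
    · intro h0
      rw [h3, h0]
      ring
    · intro h0
      have : r₀ / (10 * y) * (coeffBoth B 3 0 0).im = 0 := by linarith
      exact (mul_eq_zero.1 this).resolve_left h5

end

/-! ### Construction of prenormal charts -/

/-- A triangular map is locally biholomorphic. -/
lemma isLocalBiholomorphismToZero_of_triangular {f g : ℂ × ℂ → ℂ} (hf : AnalyticAt ℂ f 0)
    (hg : AnalyticAt ℂ g 0) (hf0 : f 0 = 0) (hg0 : g 0 = 0) {κ : ℂ}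
    (h1 : fderiv ℂ f 0 (1, 0) ≠ 0) (h2 : ∀ v, fderiv ℂ g 0 v = κ * v.2) (h3 : κ ≠ 0) :
    IsLocalBiholomorphismToZero (fun y => (f y, g y)) 0 ∧
      ∀ v, fderiv ℂ (fun y => (f y, g y)) 0 v = (fderiv ℂ f 0 v, κ * v.2) := by
  have hd : ∀ v, fderiv ℂ (fun y => (f y, g y)) 0 v = (fderiv ℂ f 0 v, κ * v.2) := by
    intro v
    rw [(hf.differentiableAt.hasFDerivAt.prodMk hg.differentiableAt.hasFDerivAt).fderiv, ← h2]
    rfl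
  refine ⟨⟨hf.prod hg, ?_, Prod.ext hf0 hg0⟩, hd⟩
  have hinj : Function.Injective (fderiv ℂ (fun y => (f y, g y)) 0) := by
    rw [injective_iff_map_eq_zero]
    intro v hv
    rw [hd] at hv
    have e2 : v.2 = 0 := (mul_eq_zero.1 (congrArg Prod.snd hv)).resolve_left h3
    have e3 : v = v.1 • ((1 : ℂ), (0 : ℂ)) := by
      refine Prod.ext ?_ ?_ <;> simp [e2]
    have e1 : fderiv ℂ f 0 v = 0 := congrArg Prod.fst hv
    rw [e3, map_smul, smul_eq_mul] at e1
    exact Prod.ext ((mul_eq_zero.1 e1).resolve_right h1) e2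
  exact ⟨hinj, (LinearMap.injective_iff_surjective
    (f := (fderiv ℂ (fun y => (f y, g y)) 0).toLinearMap)).1 hinj⟩

/-- Real cube roots. -/
lemma exists_cube_root {n : ℂ → ℂ} (hn : AnalyticAt ℂ n 0) (h0 : n 0 ∈ Complex.slitPlane)
    (hr : ∀ᶠ t in 𝓝 (0 : ℂ), reflect n t = n t) :
    ∃ k : ℂ → ℂ, AnalyticAt ℂ k 0 ∧ (∀ t, k t ^ 3 = n t) ∧
      ∀ᶠ t in 𝓝 (0 : ℂ), reflect k t = k t := by
  refine ⟨fun t => n t ^ ((3 : ℕ) : ℂ)⁻¹, hn.cpow analyticAt_const h0,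
    fun t => Complex.cpow_nat_inv_pow _ (by norm_num), ?_⟩
  have h1 : ∀ᶠ t in 𝓝 (0 : ℂ), n t ∈ Complex.slitPlane :=
    hn.continuousAt.eventually (Complex.isOpen_slitPlane.mem_nhds h0)
  have h2 := tendsto_star_zero (E := ℂ)
  filter_upwards [h2.eventually h1, hr] with t e1 e2
  rw [reflect_apply] at e2 ⊢
  have h3 := Complex.cpow_conj (n (star t)) (((3 : ℕ) : ℂ)⁻¹)
    (Complex.slitPlane_arg_ne_pi e1)
  have h4 : (starRingEnd ℂ) (((3 : ℕ) : ℂ)⁻¹) = ((3 : ℕ) : ℂ)⁻¹ := by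
    rw [map_inv₀, map_natCast]
  have h5 : (starRingEnd ℂ) (n (star t)) = n t := e2
  rw [h4, h5] at h3
  rw [h3]
  simp

section

variable {M : Set (ℂ × ℂ)} {q : ℂ × ℂ} {Θ F : ℂ × ℂ → ℂ × ℂ} {φ φ' : ℂ × ℝ → ℝ}
  {Q Q' B A : ℂ × ℂ × ℂ → ℂ} {ρ : ℂ × ℂ → ℝ} {H : ℂ × ℂ → ℂ × ℂ}

/-- Change of chart by a map tangent to a real dilation in the transversal coordinate. -/
lemma IsSegreChart.push (h : IsSegreChart M q Θ φ Q) (hφ : fderiv ℝ φ 0 = 0)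
    (hρ : IsLocalDefiningFunction M q ρ) (hH : IsLocalBiholomorphismToZero H 0) {κ : ℝ}
    (hκ : κ ≠ 0) (hd : ∀ v, (fderiv ℂ H 0 v).2 = κ * v.2) :
    ∃ φ' Q', IsSegreChart M q (fun x => H (Θ x)) φ' Q' ∧ fderiv ℝ φ' 0 = 0 ∧
      ∀ᶠ y in 𝓝 (0 : ℂ × ℂ × ℂ), (H (y.1, Q y)).2 =
        Q' ((H (y.1, Q y)).1, (reflect H y.2).1, (reflect H y.2).2) := by
  obtain ⟨κ₀, hκ₀, hk⟩ := h.exists_fderiv_eq hφ hρ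
  obtain ⟨h1, h2⟩ := hH.comp h.biholo
  obtain ⟨φ', Q', h', hφ'⟩ := exists_graph hρ h.mem h1 (κ := κ₀ / κ) (div_ne_zero hκ₀ hκ) (by
    intro v
    rw [hk, h2, hd, Complex.im_ofReal_mul]
    field_simp)
  exact ⟨φ', Q', h', hφ', h.transition h' hH.1 (Eventually.of_forall fun _ => rfl)⟩

/-- The Levi determinant along `ζ = 0` of a Segre function of the form `ω + ζ A`. -/
lemma segreLevi_of_eq (hA : AnalyticAt ℂ A 0)
    (hQ : ∀ᶠ y in 𝓝 (0 : ℂ × ℂ × ℂ), Q y = y.2.2 + y.2.1 * A y) :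
    ∀ᶠ x in 𝓝 (0 : ℂ × ℂ), segreLevi Q (x.1, 0, x.2) = fderiv ℂ A (x.1, 0, x.2) (1, 0, 0) := by
  have hsnd1 : ∀ y : ℂ × ℂ × ℂ, HasFDerivAt (fun y : ℂ × ℂ × ℂ => y.2.1)
    ((ContinuousLinearMap.fst ℂ ℂ ℂ).comp (.snd ℂ ℂ (ℂ × ℂ))) y :=
    fun y => ((ContinuousLinearMap.fst ℂ ℂ ℂ).comp (.snd ℂ ℂ (ℂ × ℂ))).hasFDerivAt
  have hsnd2 : ∀ y : ℂ × ℂ × ℂ, HasFDerivAt (fun y : ℂ × ℂ × ℂ => y.2.2)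
    ((ContinuousLinearMap.snd ℂ ℂ ℂ).comp (.snd ℂ ℂ (ℂ × ℂ))) y :=
    fun y => ((ContinuousLinearMap.snd ℂ ℂ ℂ).comp (.snd ℂ ℂ (ℂ × ℂ))).hasFDerivAt
  have hAa : ∀ᶠ y in 𝓝 (0 : ℂ × ℂ × ℂ), AnalyticAt ℂ A y := hA.eventually_analyticAt
  have hQd : ∀ᶠ y in 𝓝 (0 : ℂ × ℂ × ℂ), ∀ v : ℂ × ℂ × ℂ, fderiv ℂ Q y v =
      v.2.2 + (v.2.1 * A y + y.2.1 * fderiv ℂ A y v) := by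
    filter_upwards [hQ.eventually_nhds, hAa] with y e1 e2 v
    have d := (hsnd2 y).add ((hsnd1 y).mul e2.differentiableAt.hasFDerivAt)
    rw [(d.congr_of_eventuallyEq e1).fderiv]
    simp
    ring
  have hQz : ∀ᶠ y in 𝓝 (0 : ℂ × ℂ × ℂ), ∀ᶠ y in 𝓝 y, fderiv ℂ Q y (1, 0, 0) =
      y.2.1 * fderiv ℂ A y (1, 0, 0) := by
    rw [eventually_eventually_nhds]
    filter_upwards [hQd] with y e1
    rw [e1]
    simp
  have hQzd : ∀ᶠ y in 𝓝 (0 : ℂ × ℂ × ℂ), ∀ v : ℂ × ℂ × ℂ,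
      fderiv ℂ (fun y => fderiv ℂ Q y (1, 0, 0)) y v = v.2.1 * fderiv ℂ A y (1, 0, 0) +
        y.2.1 * fderiv ℂ (fun y => fderiv ℂ A y (1, 0, 0)) y v := by
    filter_upwards [hQz, hAa] with y e1 e2 v
    have d := (hsnd1 y).mul (analyticAt_fderiv_apply e2 (1, 0, 0)).differentiableAt.hasFDerivAt
    rw [(d.congr_of_eventuallyEq e1).fderiv]
    simp
    ring
  have hc := tendsto_slice (E := ℂ)
  filter_upwards [hc.eventually hQd, hc.eventually hQzd] with x e1 e2
  rw [segreLevi, e2, e2, e1 (0, 0, 1)]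
  simp

lemma IsSegreChart.fderiv_segre (h : IsSegreChart M q Θ φ Q) (hφ : fderiv ℝ φ 0 = 0) :
    fderiv ℂ Q 0 (0, 1, 0) = 0 := by
  have key : ∀ ζ : ℂ, fderiv ℂ Q 0 (ζ, star ζ, 0) = 0 := by
    intro ζ
    have hl : HasDerivAt (fun t : ℝ => ((t : ℂ) * ζ, (0 : ℝ))) (ζ, 0) 0 := by
      have h1 : HasDerivAt (fun t : ℝ => (t : ℂ) * ζ) ζ 0 := by
        simpa using (Complex.ofRealCLM.hasDerivAt (x := (0 : ℝ))).mul_const ζ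
      exact h1.prodMk (hasDerivAt_const _ _)
    have hl1 : HasDerivAt (fun t : ℝ => (t : ℂ) * ζ) ζ 0 := by
      simpa using (Complex.ofRealCLM.hasDerivAt (x := (0 : ℝ))).mul_const ζ
    have d1 : HasDerivAt (fun t : ℝ => φ ((t : ℂ) * ζ, 0)) 0 0 := by
      have := HasFDerivAt.comp_hasDerivAt_of_eq (0 : ℝ)
        h.analytic_graph.differentiableAt.hasFDerivAt hl (by simp)
      rwa [hφ, _root_.zero_apply] at this
    have d2 : HasDerivAt (fun t : ℝ => I * (φ ((t : ℂ) * ζ, 0) : ℂ)) 0 0 := by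
      have := (Complex.ofRealCLM.hasFDerivAt.comp_hasDerivAt (0 : ℝ) d1).const_mul I
      simpa using this
    have d3 := HasFDerivAt.comp_hasDerivAt_of_eq (0 : ℝ)
      (h.analytic.differentiableAt.hasFDerivAt.restrictScalars ℝ)
      (hl1.prodMk (hl1.star.prodMk d2.neg)) (by simp [h.graph_zero])
    have hc : Tendsto (fun t : ℝ => ((t : ℂ) * ζ, (0 : ℝ))) (𝓝 0) (𝓝 0) :=
      Continuous.tendsto' (by fun_prop) _ _ (by simp)
    have e1 : ∀ᶠ t : ℝ in 𝓝 0, I * (φ ((t : ℂ) * ζ, 0) : ℂ) =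
        Q ((t : ℂ) * ζ, star ((t : ℂ) * ζ), -(I * (φ ((t : ℂ) * ζ, 0) : ℂ))) := by
      filter_upwards [hc.eventually h.segre_graph] with t ht
      simpa using ht
    have e2 := (d3.congr_of_eventuallyEq e1).unique d2
    simpa using e2
  have k1 := key 1
  have k2 := key I
  have e1 : ((1 : ℂ), star (1 : ℂ), (0 : ℂ)) = (1, 0, 0) + (0, 1, 0) := by simp
  have e2 : (I, star I, (0 : ℂ)) =
      I • ((1 : ℂ), (0 : ℂ), (0 : ℂ)) - I • ((0 : ℂ), (1 : ℂ), (0 : ℂ)) := by simp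
  rw [e1, map_add] at k1
  rw [e2, map_sub, map_smul, map_smul, smul_eq_mul, smul_eq_mul] at k2
  have hI := Complex.I_ne_zero
  refine (mul_eq_zero.1 (?_ : (2 * I) * _ = 0)).resolve_left (by simp)
  linear_combination I * k1 - k2

/-- A Segre chart with `Q (z, 0, ω) = ω` whose Levi determinant vanishes along the transversal
real axis. -/
structure IsStraightChart (M : Set (ℂ × ℂ)) (q : ℂ × ℂ) (Θ : ℂ × ℂ → ℂ × ℂ) (φ : ℂ × ℝ → ℝ)
    (Q A : ℂ × ℂ × ℂ → ℂ) : Prop where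
  chart : IsSegreChart M q Θ φ Q
  fderiv_graph : fderiv ℝ φ 0 = 0
  analytic : AnalyticAt ℂ A 0
  eq : ∀ᶠ y in 𝓝 (0 : ℂ × ℂ × ℂ), Q y = y.2.2 + y.2.1 * (y.1 * A y)
  zero : ∀ᶠ t in 𝓝 (0 : ℂ), A (0, 0, t) = 0
  deriv_ne : fderiv ℂ A 0 (1, 0, 0) ≠ 0

lemma IsSegreChart.segre_zero_fst_of (h : IsSegreChart M q Θ φ Q)
    (h0 : ∀ᶠ x in 𝓝 (0 : ℂ × ℂ), Q (x.1, 0, x.2) = x.2) :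
    ∀ᶠ x in 𝓝 (0 : ℂ × ℂ), Q (0, x.1, x.2) = x.2 := by
  have hc := tendsto_slice (E := ℂ)
  have hs := tendsto_star_zero (E := ℂ × ℂ)
  filter_upwards [hs.eventually (hc.eventually h.reality), hs.eventually h0] with x h1 h2
  simp only [h2] at h1
  have h3 := congrArg star h1
  simpa [reflect_apply, Prod.star_def] using h3

lemma exists_eq_mul_snd {G : ℂ × ℂ × ℂ → ℂ} (hG : AnalyticAt ℂ G 0)
    (h0 : ∀ᶠ x in 𝓝 (0 : ℂ × ℂ), G (x.1, 0, x.2) = 0) :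
    ∃ D, AnalyticAt ℂ D 0 ∧ ∀ᶠ y in 𝓝 (0 : ℂ × ℂ × ℂ), G y = y.2.1 * D y := by
  have h1 : AnalyticAt ℂ (fun y : ℂ × ℂ × ℂ => G (y.2.1, y.1, y.2.2)) (0, 0) :=
    AnalyticAt.comp_of_eq hG (f := fun y : ℂ × ℂ × ℂ => (y.2.1, y.1, y.2.2)) (by fun_prop) rfl
  obtain ⟨D, hD, hDe⟩ := exists_eq_fst_mul h1 (by simpa using h0)
  have hc : Tendsto (fun y : ℂ × ℂ × ℂ => (y.2.1, y.1, y.2.2)) (𝓝 0) (𝓝 ((0 : ℂ), (0 : ℂ × ℂ))) :=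
    Continuous.tendsto' (by fun_prop) _ _ rfl
  refine ⟨fun y => D (y.2.1, y.1, y.2.2), AnalyticAt.comp_of_eq hD
    (f := fun y : ℂ × ℂ × ℂ => (y.2.1, y.1, y.2.2)) (by fun_prop) rfl, ?_⟩
  filter_upwards [hc.eventually hDe] with y hy
  exact hy

lemma IsFlatChart.exists_straight (h : IsFlatChart M q Θ φ Q) (hφ : fderiv ℝ φ 0 = 0)
    (hg : HasGenericLeviDegeneracyAt M q) (hρ : IsLocalDefiningFunction M q ρ) :
    ∃ F φ' Q' A, IsStraightChart M q F φ' Q' A ∧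
      ∀ᶠ x in 𝓝 q, (Θ x).1 = 0 → F x = (0, (Θ x).2) := by
  have hQ := h.chart.analytic
  have hQ0 := h.chart.map_zero
  have hrQ := h.chart.analyticAt_reflect_segre
  obtain ⟨hω, -⟩ := h.deriv_segre
  have hζ := h.chart.fderiv_segre hφ
  have hga : AnalyticAt ℂ (fun y : ℂ × ℂ => reflect Q (0, y)) 0 :=
    AnalyticAt.comp_of_eq hrQ (f := fun y : ℂ × ℂ => ((0 : ℂ), y)) (by fun_prop) rfl
  have hgd : ∀ v, fderiv ℂ (fun y : ℂ × ℂ => reflect Q (0, y)) 0 v = 1 * v.2 := by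
    intro v
    have h1 := hasFDerivAt_comp_of_eq (g := reflect Q) hrQ.differentiableAt.hasFDerivAt
      (ContinuousLinearMap.inr ℂ ℂ (ℂ × ℂ)).hasFDerivAt (x := (0 : ℂ × ℂ)) (by simp)
    have h2 : fderiv ℂ (fun y : ℂ × ℂ => reflect Q (0, y)) 0 v = fderiv ℂ (reflect Q) 0 (0, v) := by
      rw [show (fun y : ℂ × ℂ => reflect Q (0, y)) = fun y =>
        reflect Q (ContinuousLinearMap.inr ℂ ℂ (ℂ × ℂ) y) from rfl, h1.fderiv]
      rfl
    rw [h2, fderiv_reflect (by simpa using hQ.differentiableAt), star_zero]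
    have h3 : star ((0 : ℂ), v) = star v.1 • ((0 : ℂ), (1 : ℂ), (0 : ℂ)) +
        star v.2 • ((0 : ℂ), (0 : ℂ), (1 : ℂ)) := by simp [Prod.star_def]
    rw [h3, map_add, map_smul, map_smul, hω, hζ]
    simp
  obtain ⟨hH, hHd⟩ := isLocalBiholomorphismToZero_of_triangular (f := fun y : ℂ × ℂ => y.1)
    analyticAt_fst hga rfl (by simp [h.chart.reflect_zero]) (by
      rw [fderiv_fst]; simp) hgd one_ne_zero
  obtain ⟨φ', Q', h', hφ', hT⟩ := h.chart.push hφ hρ hH (κ := 1) one_ne_zero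
    (fun v => by rw [hHd]; simp)
  have hQ' := h'.analytic
  obtain ⟨Ξ, hΞ, hΞ0, hΞ1, hΞ2, -⟩ := h.chart.biholo.exists_inverse
  have hΞt : Tendsto Ξ (𝓝 0) (𝓝 q) := by
    have := hΞ.continuousAt.tendsto
    rwa [hΞ0] at this
  have hc1 := tendsto_slice (E := ℂ)
  have hc2 := tendsto_zero_prodMk (E := ℂ)
  have hst := tendsto_star_zero (E := ℂ)
  have hg0 : ∀ᶠ w in 𝓝 (0 : ℂ), reflect Q (0, 0, w) = w := by
    filter_upwards [hst.eventually (hc2.eventually h.segre_diag)] with w hw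
    have h1 := congrArg star hw
    simpa [reflect_apply, Prod.star_def] using h1
  have ha : ∀ᶠ x in 𝓝 (0 : ℂ × ℂ), Q' (x.1, 0, x.2) = x.2 := by
    have hsnd : Tendsto (fun x : ℂ × ℂ => x.2) (𝓝 0) (𝓝 0) := continuous_snd.tendsto' _ _ rfl
    filter_upwards [hc1.eventually hT, hc1.eventually h.chart.reality,
      hsnd.eventually (hst.eventually hg0)] with x e1 e2 e3
    rw [e2] at e1
    have e4 : reflect (fun y : ℂ × ℂ => (y.1, reflect Q (0, y))) (0, x.2) = (0, x.2) := by
      have e5 : star ((0 : ℂ), x.2) = (0, star x.2) := by simp [Prod.star_def]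
      rw [reflect_apply, e5, e3]
      simp [Prod.star_def]
    rw [e4] at e1
    exact e1.symm
  have hb := h'.segre_zero_fst_of ha
  obtain ⟨D, hD, hDe⟩ := exists_eq_mul_snd (G := fun y => Q' y - y.2.2) (by fun_prop)
    (ha.mono fun x hx => by simp [hx])
  have hc3 := tendsto_zero_prodMk (E := ℂ × ℂ)
  have hD0 : ∀ᶠ x in 𝓝 (0 : ℂ × ℂ), D (0, x) = 0 := by
    refine eventually_zero_of_fst_mul (x₀ := (0 : ℂ)) (AnalyticAt.comp_of_eq hD
      (f := fun x : ℂ × ℂ => ((0 : ℂ), x)) (by fun_prop) rfl) ?_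
    filter_upwards [hb, hc3.eventually hDe] with x e1 e2
    have e3 : Q' (0, x) = x.2 := e1
    rw [e3] at e2
    linear_combination -e2
  obtain ⟨A, hA, hAe⟩ := exists_eq_fst_mul (x₀ := (0 : ℂ × ℂ)) hD hD0
  have hA' : AnalyticAt ℂ A 0 := hA
  have hAe' : ∀ᶠ y in 𝓝 (0 : ℂ × ℂ × ℂ), D y = y.1 * A y := hAe
  have hfst : ∀ y : ℂ × ℂ × ℂ, HasFDerivAt (fun y : ℂ × ℂ × ℂ => y.1)
    (ContinuousLinearMap.fst ℂ ℂ (ℂ × ℂ)) y := fun y => hasFDerivAt_fst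
  have hlevi : ∀ᶠ x in 𝓝 (0 : ℂ × ℂ), segreLevi Q' (x.1, 0, x.2) =
      A (x.1, 0, x.2) + x.1 * fderiv ℂ A (x.1, 0, x.2) (1, 0, 0) := by
    filter_upwards [segreLevi_of_eq (Q := Q') hD (hDe.mono fun y hy => by linear_combination hy),
      hc1.eventually hAe'.eventually_nhds, hc1.eventually hA'.eventually_analyticAt] with x e1 e2 e3
    rw [e1, (((hfst _).mul e3.differentiableAt.hasFDerivAt).congr_of_eventuallyEq e2).fderiv]
    simp
    ring
  refine ⟨_, φ', Q', A, ⟨h', hφ', hA', ?_, ?_, ?_⟩, ?_⟩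
  · filter_upwards [hDe, hAe'] with y e1 e2
    rw [← e2, ← e1]
    ring
  · refine eventually_zero_of_real₁ (AnalyticAt.comp_of_eq hA'
      (f := fun t : ℂ => ((0 : ℂ), (0 : ℂ), t)) (by fun_prop) rfl) ?_
    have hct : Tendsto (fun t : ℝ => ((0 : ℂ), (t : ℂ))) (𝓝 0) (𝓝 0) :=
      Continuous.tendsto' (by fun_prop) _ _ (by simp)
    have hct' := tendsto_ofReal_zero
    filter_upwards [hct.eventually hlevi, hct.eventually hΞ2, (hΞt.comp hct).eventually h.mem_iff,
      (hΞt.comp hct).eventually (h'.mem_leviDegeneracySet_iff hρ), hct'.eventually hg0]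
      with t e1 e2 e3 e4 e5
    simp only [Function.comp_apply, e2] at e3 e4
    have e6 : Ξ (0, (t : ℂ)) ∈ leviDegeneracySet M := e3.2 (by simp [Prod.star_def])
    have e7 := (e4 e6.1).1 e6
    rw [e5] at e7
    have e8 : star (t : ℂ) = t := Complex.conj_ofReal t
    rw [e8, star_zero, e1, zero_mul, add_zero] at e7
    exact e7
  · have hne := (h'.segreLevi_of_generic hφ' hg).2
    intro h0
    refine hne ?_
    have l3 : HasDerivAt (fun t : ℂ => (t, (0 : ℂ), (0 : ℂ))) (1, 0, 0) 0 :=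
      (hasDerivAt_id _).prodMk ((hasDerivAt_const _ _).prodMk (hasDerivAt_const _ _))
    have hc4 := tendsto_prodMk_zero (E := ℂ)
    have d1 := HasFDerivAt.comp_hasDerivAt_of_eq (0 : ℂ)
      (analyticAt_segreLevi hQ').differentiableAt.hasFDerivAt l3 rfl
    have d2 := HasFDerivAt.comp_hasDerivAt_of_eq (0 : ℂ)
      hA'.differentiableAt.hasFDerivAt l3 rfl
    have d3 := HasFDerivAt.comp_hasDerivAt_of_eq (0 : ℂ)
      (analyticAt_fderiv_apply hA' (1, 0, 0)).differentiableAt.hasFDerivAt l3 rfl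
    have d4 := d2.add ((hasDerivAt_id (0 : ℂ)).mul d3)
    have d5 := d1.unique (d4.congr_of_eventuallyEq (hc4.eventually hlevi))
    rw [d5]
    simp only [prod_mk_zero_zero] at h0
    simp [h0]
  · have hc5 : Tendsto (fun x => (Θ x).2) (𝓝 q) (𝓝 0) :=
      (continuous_snd.tendsto' (0 : ℂ × ℂ) _ rfl).comp h.chart.tendsto
    filter_upwards [hc5.eventually hg0] with x hx h0
    have : Θ x = (0, (Θ x).2) := Prod.ext h0 rfl
    rw [this] at hx ⊢
    exact Prod.ext rfl hx

lemma IsLocalBiholomorphismToZero.eventually_of_comp (hH : IsLocalBiholomorphismToZero H 0)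
    {P : ℂ × ℂ → Prop} (h : ∀ᶠ y in 𝓝 0, P (H y)) : ∀ᶠ y in 𝓝 0, P y := by
  obtain ⟨Ξ, hΞ, hΞ0, -, hΞ2, -⟩ := hH.exists_inverse
  have hΞt : Tendsto Ξ (𝓝 0) (𝓝 0) := by
    have := hΞ.continuousAt.tendsto
    rwa [hΞ0] at this
  filter_upwards [hΞt.eventually h, hΞ2] with y h1 h2
  rwa [h2] at h1

lemma eventually_zero_of_mul_snd {G : ℂ × ℂ × ℂ → ℂ} (hG : AnalyticAt ℂ G 0)
    (h0 : ∀ᶠ y in 𝓝 (0 : ℂ × ℂ × ℂ), y.2.1 * G y = 0) : ∀ᶠ y in 𝓝 0, G y = 0 := by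
  have hc : Tendsto (fun y : ℂ × ℂ × ℂ => (y.2.1, y.1, y.2.2)) (𝓝 0) (𝓝 0) :=
    Continuous.tendsto' (by fun_prop) _ _ rfl
  have h1 := eventually_zero_of_fst_mul (x₀ := (0 : ℂ × ℂ))
    (AnalyticAt.comp_of_eq hG (f := fun y : ℂ × ℂ × ℂ => (y.2.1, y.1, y.2.2)) (by fun_prop) rfl)
    (hc.eventually h0)
  exact hc.eventually (show ∀ᶠ y in 𝓝 (0 : ℂ × ℂ × ℂ), G (y.2.1, y.1, y.2.2) = 0 from h1)

lemma IsStraightChart.exists_prenormal (h : IsStraightChart M q Θ φ Q A)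
    (hρ : IsLocalDefiningFunction M q ρ) :
    ∃ F φ' Q' B, IsSegreChart M q F φ' Q' ∧ fderiv ℝ φ' 0 = 0 ∧ IsPrenormal Q' B ∧
      ∀ᶠ x in 𝓝 q, (Θ x).1 = 0 → F x = (0, (Θ x).2) := by
  have hA := h.analytic
  have hQ := h.chart.analytic
  have hc1 := tendsto_slice (E := ℂ)
  have hst := tendsto_star_zero (E := ℂ)
  have hsnd : Tendsto (fun x : ℂ × ℂ => x.2) (𝓝 0) (𝓝 0) := continuous_snd.tendsto' _ _ rfl
  obtain ⟨E, hE, hEe⟩ := exists_eq_fst_mul (x₀ := (0 : ℂ)) (G := fun x : ℂ × ℂ => A (x.1, 0, x.2))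
    (AnalyticAt.comp_of_eq hA (f := fun x : ℂ × ℂ => (x.1, (0 : ℂ), x.2)) (by fun_prop) rfl) h.zero
  replace hE : AnalyticAt ℂ E 0 := hE
  replace hEe : ∀ᶠ x in 𝓝 (0 : ℂ × ℂ), A (x.1, 0, x.2) = x.1 * E x := hEe
  have hE0 : E 0 ≠ 0 := by
    have l3 : HasDerivAt (fun t : ℂ => (t, (0 : ℂ), (0 : ℂ))) (1, 0, 0) 0 :=
      (hasDerivAt_id _).prodMk ((hasDerivAt_const _ _).prodMk (hasDerivAt_const _ _))
    have hc4 := tendsto_prodMk_zero (E := ℂ)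
    have d1 := HasFDerivAt.comp_hasDerivAt_of_eq (0 : ℂ) hA.differentiableAt.hasFDerivAt l3 rfl
    have d2 : DifferentiableAt ℂ (fun t : ℂ => E (t, 0)) 0 :=
      (AnalyticAt.comp_of_eq hE (f := fun t : ℂ => (t, (0 : ℂ))) (by fun_prop)
        rfl).differentiableAt
    have d3 := ((hasDerivAt_id (0 : ℂ)).mul d2.hasDerivAt).congr_of_eventuallyEq
      (hc4.eventually hEe)
    have d4 := d1.unique d3
    intro h0
    refine h.deriv_ne ?_
    rw [d4]
    simp [h0]
  -- the dilation factors
  have hI : I ≠ 0 := Complex.I_ne_zero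
  have hEw : AnalyticAt ℂ (fun w : ℂ => E (0, w)) 0 :=
    AnalyticAt.comp_of_eq hE (f := fun w : ℂ => ((0 : ℂ), w)) (by fun_prop) rfl
  obtain ⟨e, he⟩ : ∃ e : ℂ → ℂ, e = fun w => E (0, w) / (2 * I) := ⟨_, rfl⟩
  have hea : AnalyticAt ℂ e 0 := by
    rw [he]
    exact hEw.div_const
  have he0 : e 0 ≠ 0 := by
    rw [he]
    exact div_ne_zero hE0 (by simp)
  have hra : AnalyticAt ℂ (reflect e) 0 := analyticAt_reflect (by simpa using hea)
  obtain ⟨k, hk, hk3, hkr⟩ := exists_cube_root (n := fun w => e w * reflect e w) (hea.mul hra) (by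
      have h1 : e 0 * reflect e 0 = ((Complex.normSq (e 0) : ℝ) : ℂ) := by
        rw [reflect_apply, star_zero]
        exact Complex.mul_conj _
      simp only [h1, Complex.ofReal_mem_slitPlane]
      exact Complex.normSq_pos.2 he0)
    (Eventually.of_forall fun t => by simp [reflect_apply, mul_comm])
  have hk0 : k 0 ≠ 0 := by
    intro h0
    have h1 := hk3 0
    rw [h0] at h1
    have h2 : e 0 * reflect e 0 ≠ 0 := mul_ne_zero he0 (by simpa [reflect_apply] using he0)
    exact h2 (by rw [← h1]; simp)
  obtain ⟨c, hc⟩ : ∃ c : ℂ → ℂ, ∀ w, c w = e w / k w := ⟨_, fun _ => rfl⟩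
  have hca : AnalyticAt ℂ c 0 := by
    rw [funext hc]
    exact hea.div hk hk0
  have hc0 : c 0 ≠ 0 := by
    rw [hc]
    exact div_ne_zero he0 hk0
  have hcc : ∀ᶠ w in 𝓝 (0 : ℂ), c w ^ 2 * reflect c w = e w ∧ reflect c w ≠ 0 := by
    filter_upwards [hkr, hk.continuousAt.eventually_ne hk0, hst.eventually
      (hca.continuousAt.eventually_ne hc0)] with w e1 e2 e3
    refine ⟨?_, by rw [reflect_apply]; simpa using e3⟩
    have e4 : reflect c w = reflect e w / k w := by
      rw [reflect_apply, hc, star_div₀, ← e1, reflect_apply, reflect_apply]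
    have e5 := hk3 w
    rw [e4, hc]
    field_simp
    linear_combination -(e w) * e5
  obtain ⟨s, hs⟩ : ∃ s : ℂ × ℂ → ℂ, ∀ y, s y = (E y / E (0, y.2)) ^ ((2 : ℕ) : ℂ)⁻¹ :=
    ⟨_, fun _ => rfl⟩
  have hEw' : AnalyticAt ℂ (fun y : ℂ × ℂ => E (0, y.2)) 0 :=
    AnalyticAt.comp_of_eq hE (f := fun y : ℂ × ℂ => ((0 : ℂ), y.2)) (by fun_prop) rfl
  have hsa : AnalyticAt ℂ s 0 := by
    rw [funext hs]
    refine (hE.fun_div hEw' hE0).cpow analyticAt_const ?_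
    simp [hE0]
  have hs2 : ∀ y, s y ^ 2 = E y / E (0, y.2) := fun y => by
    rw [hs]
    exact Complex.cpow_nat_inv_pow _ two_ne_zero
  have hEw0 : ∀ᶠ w in 𝓝 (0 : ℂ), E (0, w) ≠ 0 := hEw.continuousAt.eventually_ne hE0
  have hs1 : ∀ᶠ w in 𝓝 (0 : ℂ), s (0, w) = 1 := by
    filter_upwards [hEw0] with w hw
    rw [hs, div_self hw, Complex.one_cpow]
  obtain ⟨u, hu⟩ : ∃ u : ℂ × ℂ → ℂ, ∀ y, u y = c y.2 * s y := ⟨_, fun _ => rfl⟩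
  have hua : AnalyticAt ℂ u 0 := by
    rw [funext hu]
    exact (AnalyticAt.comp_of_eq hca (f := fun y : ℂ × ℂ => y.2) (by fun_prop) rfl).mul hsa
  have hu0 : u 0 ≠ 0 := by
    rw [hu, show s 0 = 1 from hs1.self_of_nhds]
    simpa using hc0
  have hfa : AnalyticAt ℂ (fun y : ℂ × ℂ => y.1 * u y) 0 := by fun_prop
  obtain ⟨hH, hHd⟩ := isLocalBiholomorphismToZero_of_triangular (κ := 1) hfa
    (analyticAt_snd (p := (0 : ℂ × ℂ))) (by simp) rfl (by
      have := ((hasFDerivAt_fst (𝕜 := ℂ) (p := (0 : ℂ × ℂ))).mul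
        hua.differentiableAt.hasFDerivAt).fderiv
      rw [show (fun y : ℂ × ℂ => y.1 * u y) = Prod.fst * u from rfl, this]
      simpa using hu0) (fun v => by rw [fderiv_snd]; simp) one_ne_zero
  obtain ⟨φ', Q', h', hφ', hT⟩ := h.chart.push h.fderiv_graph hρ hH (κ := 1) one_ne_zero
    (fun v => by rw [hHd]; simp)
  have hQ' := h'.analytic
  have hru : AnalyticAt ℂ (reflect u) 0 := analyticAt_reflect (by simpa using hua)
  have hT' : ∀ᶠ y in 𝓝 (0 : ℂ × ℂ × ℂ),
      Q y = Q' (y.1 * u (y.1, Q y), y.2.1 * reflect u y.2, y.2.2) := by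
    filter_upwards [hT] with y hy
    have e1 : reflect (fun y : ℂ × ℂ => (y.1 * u y, y.2)) y.2 =
        (y.2.1 * reflect u y.2, y.2.2) := by
      simp [reflect_apply, Prod.star_def]
    rw [e1] at hy
    exact hy
  have hQz : ∀ᶠ x in 𝓝 (0 : ℂ × ℂ), Q (x.1, 0, x.2) = x.2 := by
    filter_upwards [hc1.eventually h.eq] with x hx
    rw [hx]
    simp
  have ha : ∀ᶠ x in 𝓝 (0 : ℂ × ℂ), Q' (x.1, 0, x.2) = x.2 := by
    refine hH.eventually_of_comp (P := fun x => Q' (x.1, 0, x.2) = x.2) ?_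
    filter_upwards [hc1.eventually hT', hQz] with x e1 e2
    rw [e2, zero_mul] at e1
    exact e1.symm
  obtain ⟨D, hD, hDe⟩ := exists_eq_mul_snd (G := fun y => Q' y - y.2.2) (by fun_prop)
    (ha.mono fun x hx => by simp [hx])
  have hDz : AnalyticAt ℂ (fun y : ℂ × ℂ × ℂ => D (y.1, 0, y.2.2)) 0 :=
    AnalyticAt.comp_of_eq hD (f := fun y : ℂ × ℂ × ℂ => (y.1, (0 : ℂ), y.2.2)) (by fun_prop) rfl
  obtain ⟨B, hB, hBe⟩ := exists_eq_mul_snd (G := fun y => D y - D (y.1, 0, y.2.2)) (by fun_prop)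
    (Eventually.of_forall fun x => by simp)
  have hin : AnalyticAt ℂ (fun y : ℂ × ℂ × ℂ =>
      (y.1 * u (y.1, Q y), y.2.1 * reflect u y.2, y.2.2)) 0 := by
    have h1 : AnalyticAt ℂ (fun y : ℂ × ℂ × ℂ => u (y.1, Q y)) 0 :=
      AnalyticAt.comp_of_eq hua (f := fun y : ℂ × ℂ × ℂ => (y.1, Q y)) (by fun_prop)
        (by simp [h.chart.map_zero])
    have h2 : AnalyticAt ℂ (fun y : ℂ × ℂ × ℂ => reflect u y.2) 0 :=
      AnalyticAt.comp_of_eq hru (f := fun y : ℂ × ℂ × ℂ => y.2) (by fun_prop) rfl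
    have h3 : AnalyticAt ℂ (fun y : ℂ × ℂ × ℂ => y.2.1) 0 := by fun_prop
    exact (analyticAt_fst.fun_mul h1).prod ((h3.fun_mul h2).prod (by fun_prop))
  have hint : Tendsto (fun y : ℂ × ℂ × ℂ =>
      (y.1 * u (y.1, Q y), y.2.1 * reflect u y.2, y.2.2)) (𝓝 0) (𝓝 0) := by
    have := hin.continuousAt.tendsto
    simpa using this
  have hid : ∀ᶠ y in 𝓝 (0 : ℂ × ℂ × ℂ), y.1 * A y - reflect u y.2 *
      D (y.1 * u (y.1, Q y), y.2.1 * reflect u y.2, y.2.2) = 0 := by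
    refine eventually_zero_of_mul_snd ?_ ?_
    · have h2 : AnalyticAt ℂ (fun y : ℂ × ℂ × ℂ => reflect u y.2) 0 :=
        AnalyticAt.comp_of_eq hru (f := fun y : ℂ × ℂ × ℂ => y.2) (by fun_prop) rfl
      have h3 : AnalyticAt ℂ (fun y : ℂ × ℂ × ℂ =>
          D (y.1 * u (y.1, Q y), y.2.1 * reflect u y.2, y.2.2)) 0 :=
        hD.comp_of_eq hin (by simp)
      exact (analyticAt_fst.fun_mul hA).fun_sub (h2.fun_mul h3)
    · filter_upwards [h.eq, hT', hint.eventually hDe] with y e1 e2 e3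
      simp only [← e2] at e3
      linear_combination e3 - e1
  have hDv : ∀ᶠ x in 𝓝 (0 : ℂ × ℂ), D (x.1, 0, x.2) = 2 * I * x.1 ^ 2 := by
    refine hH.eventually_of_comp (P := fun x => D (x.1, 0, x.2) = 2 * I * x.1 ^ 2) ?_
    filter_upwards [hc1.eventually hid, hQz, hEe, hsnd.eventually hcc, hsnd.eventually hEw0,
      hsnd.eventually (hst.eventually hs1)] with x e1 e2 e3 e4 e5 e6
    have e7 : reflect u (0, x.2) = reflect c x.2 := by
      have : star ((0 : ℂ), x.2) = (0, star x.2) := by simp [Prod.star_def]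
      rw [reflect_apply, this, hu, e6, mul_one, reflect_apply]
    rw [e2, zero_mul, e7, e3] at e1
    refine mul_left_cancel₀ e4.2 ?_
    have e8 : 2 * I * (c x.2 ^ 2 * reflect c x.2) * s x ^ 2 = E x := by
      rw [e4.1, hs2, he]
      field_simp
    simp only [hu] at e1 ⊢
    linear_combination -e1 - x.1 ^ 2 * e8
  refine ⟨_, φ', Q', B, h', hφ', ⟨hB, ?_⟩, ?_⟩
  · have hc2 : Tendsto (fun y : ℂ × ℂ × ℂ => (y.1, y.2.2)) (𝓝 0) (𝓝 0) :=
      Continuous.tendsto' (by fun_prop) _ _ rfl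
    filter_upwards [hDe, hBe, hc2.eventually hDv] with y e1 e2 e3
    linear_combination e1 + y.2.1 * e2 + y.2.1 * e3
  · refine Eventually.of_forall fun x hx => ?_
    simp [hx]

/-- Straightening a real curve in the Levi degeneracy set. -/
lemma IsFlatChart.shift (h : IsFlatChart M q Θ φ Q) (hφ : fderiv ℝ φ 0 = 0)
    (hg : HasGenericLeviDegeneracyAt M q) (hρ : IsLocalDefiningFunction M q ρ) {a : ℂ → ℂ}
    (ha : AnalyticAt ℂ a 0) (ha0 : a 0 = 0) (har : ∀ᶠ t in 𝓝 (0 : ℂ), reflect a t = a t) :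
    ∃ φ' Q', IsFlatChart M q (fun x => ((Θ x).1 - a (Θ x).2, (Θ x).2)) φ' Q' ∧
      fderiv ℝ φ' 0 = 0 := by
  have ha2 : AnalyticAt ℂ (fun y : ℂ × ℂ => a y.2) 0 :=
    AnalyticAt.comp_of_eq ha (f := fun y : ℂ × ℂ => y.2) (by fun_prop) rfl
  have hfa : AnalyticAt ℂ (fun y : ℂ × ℂ => y.1 - a y.2) 0 := by fun_prop
  have hd2 : fderiv ℂ (fun y : ℂ × ℂ => a y.2) 0 (1, 0) = 0 := by
    have := hasFDerivAt_comp_of_eq (g := a) (f := fun y : ℂ × ℂ => y.2) (x := 0) (y := 0)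
      ha.differentiableAt.hasFDerivAt (hasFDerivAt_snd (𝕜 := ℂ)) rfl
    rw [this.fderiv]
    simp
  obtain ⟨hH, hHd⟩ := isLocalBiholomorphismToZero_of_triangular (κ := 1) hfa
    (analyticAt_snd (p := (0 : ℂ × ℂ))) (by simp [ha0]) rfl (by
      rw [fderiv_fun_sub differentiableAt_fst ha2.differentiableAt, _root_.sub_apply, hd2,
        fderiv_fst]
      simp) (fun v => by rw [fderiv_snd]; simp) one_ne_zero
  obtain ⟨φ', Q', h', hφ', -⟩ := h.chart.push hφ hρ hH (κ := 1) one_ne_zero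
    (fun v => by rw [hHd]; simp)
  refine ⟨φ', Q', h'.isFlatChart hφ' hg ?_, hφ'⟩
  have hc5 : Tendsto (fun x => (Θ x).2) (𝓝 q) (𝓝 0) :=
    (continuous_snd.tendsto' (0 : ℂ × ℂ) _ rfl).comp h.chart.tendsto
  filter_upwards [h.mem_iff, hc5.eventually har] with x e1 e2
  rw [e1, reflect_apply] at *
  have key : star (Θ x).2 = (Θ x).2 → star (a (Θ x).2) = a (Θ x).2 := fun h0 => by
    rwa [h0] at e2
  rw [Prod.ext_iff, Prod.ext_iff]
  simp only [Prod.fst_star, Prod.snd_star, star_sub]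
  constructor
  · rintro ⟨h1, h2⟩
    exact ⟨by rw [h1, key h2], h2⟩
  · rintro ⟨h1, h2⟩
    rw [key h2] at h1
    exact ⟨sub_left_injective h1, h2⟩

/-- A prenormal chart along a real curve in the Levi degeneracy set. -/
theorem IsFlatChart.exists_prenormal (h : IsFlatChart M q Θ φ Q) (hφ : fderiv ℝ φ 0 = 0)
    (hg : HasGenericLeviDegeneracyAt M q) (hρ : IsLocalDefiningFunction M q ρ) {a : ℂ → ℂ}
    (ha : AnalyticAt ℂ a 0) (ha0 : a 0 = 0) (har : ∀ᶠ t in 𝓝 (0 : ℂ), reflect a t = a t) :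
    ∃ F φ' Q' B, IsSegreChart M q F φ' Q' ∧ fderiv ℝ φ' 0 = 0 ∧ IsPrenormal Q' B ∧
      ∀ᶠ x in 𝓝 q, (Θ x).1 = a (Θ x).2 → F x = (0, (Θ x).2) := by
  obtain ⟨φ₁, Q₁, h₁, hφ₁⟩ := h.shift hφ hg hρ ha ha0 har
  obtain ⟨F₂, φ₂, Q₂, A, h₂, h₂'⟩ := h₁.exists_straight hφ₁ hg hρ
  obtain ⟨F, φ', Q', B, h₃, hφ₃, hB, h₃'⟩ := h₂.exists_prenormal hρ
  refine ⟨F, φ', Q', B, h₃, hφ₃, hB, ?_⟩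
  filter_upwards [h₂', h₃'] with x e1 e2 hx
  have e3 := e1 (by simp [hx])
  have e4 := e2 (by rw [e3])
  rw [e4, e3]

end

/-! ### Normal forms and Segre functions -/

lemma exists_taylor_snd {G : ℂ × ℂ × ℂ → ℂ} (hG : AnalyticAt ℂ G 0) :
    ∃ D, AnalyticAt ℂ D 0 ∧
      (∀ᶠ y in 𝓝 (0 : ℂ × ℂ × ℂ), G y = G (y.1, 0, y.2.2) + y.2.1 * coeffSnd G 1 (y.1, y.2.2) +
        y.2.1 ^ 2 * D y) ∧
      ∀ᶠ x in 𝓝 (0 : ℂ × ℂ), coeffSnd G 2 x = D (x.1, 0, x.2) := by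
  have h1 : AnalyticAt ℂ (fun y : ℂ × ℂ × ℂ => G (y.2.1, y.1, y.2.2)) (0, 0) :=
    AnalyticAt.comp_of_eq hG (f := fun y : ℂ × ℂ × ℂ => (y.2.1, y.1, y.2.2)) (by fun_prop) rfl
  obtain ⟨D₁, D₂, -, hD₂, hDe⟩ := exists_taylor_two h1
  have hc : Tendsto (fun y : ℂ × ℂ × ℂ => (y.2.1, y.1, y.2.2)) (𝓝 0) (𝓝 ((0 : ℂ), (0 : ℂ × ℂ))) :=
    Continuous.tendsto' (by fun_prop) _ _ rfl
  have hc' : Tendsto (fun y : ℂ × ℂ × ℂ => (y.1, y.2.2)) (𝓝 0) (𝓝 0) :=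
    Continuous.tendsto' (by fun_prop) _ _ rfl
  have hcx : Tendsto (fun x : ℂ × ℂ => ((0 : ℂ), x)) (𝓝 0) (𝓝 ((0 : ℂ), (0 : ℂ × ℂ))) :=
    Continuous.tendsto' (by fun_prop) _ _ rfl
  have key : ∀ᶠ x in 𝓝 (0 : ℂ × ℂ), coeffSnd G 1 x = D₁ x ∧ coeffSnd G 2 x = D₂ (0, x) := by
    filter_upwards [hcx.eventually hDe.eventually_nhds,
      hcx.eventually hD₂.eventually_analyticAt] with x e1 e2
    have hc3 : Tendsto (fun t : ℂ => (t, x)) (𝓝 0) (𝓝 (0, x)) :=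
      Continuous.tendsto' (by fun_prop) _ _ rfl
    have h3 : AnalyticAt ℂ (fun t : ℂ => D₂ (t, x)) 0 :=
      AnalyticAt.comp_of_eq e2 (f := fun t : ℂ => (t, x)) (by fun_prop) rfl
    exact (coeff_jet_of_taylor (a := G (x.1, 0, x.2)) h3 (hc3.eventually e1)).2
  refine ⟨fun y => D₂ (y.2.1, y.1, y.2.2), AnalyticAt.comp_of_eq hD₂
    (f := fun y : ℂ × ℂ × ℂ => (y.2.1, y.1, y.2.2)) (by fun_prop) rfl, ?_,
    key.mono fun x hx => hx.2⟩
  filter_upwards [hc.eventually hDe, hc'.eventually key] with y e1 e2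
  rw [e2.1]
  exact e1

section

variable {M : Set (ℂ × ℂ)} {q : ℂ × ℂ} {Θ F : ℂ × ℂ → ℂ × ℂ} {φ φ' : ℂ × ℝ → ℝ}
  {Q Q' B G : ℂ × ℂ × ℂ → ℂ} {ρ : ℂ × ℂ → ℝ}

lemma IsSegreChart.complexification_eq (h : IsSegreChart M q Θ φ Q) (hG : AnalyticAt ℂ G 0)
    (hGe : ∀ᶠ x in 𝓝 (0 : ℂ × ℝ), G (x.1, star x.1, x.2) = φ x) :
    AnalyticAt ℂ (fun y : ℂ × ℂ × ℂ => (y.1, y.2.1, (Q y + y.2.2) / 2)) 0 ∧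
      ∀ᶠ y in 𝓝 (0 : ℂ × ℂ × ℂ),
        Q y = y.2.2 + 2 * I * G (y.1, y.2.1, (Q y + y.2.2) / 2) := by
  have hQ := h.analytic
  have h1 : AnalyticAt ℂ (fun y : ℂ × ℂ × ℂ => (y.1, y.2.1, (Q y + y.2.2) / 2)) 0 := by fun_prop
  refine ⟨h1, ?_⟩
  have h2 : AnalyticAt ℂ (fun y : ℂ × ℂ × ℂ => G (y.1, y.2.1, (Q y + y.2.2) / 2)) 0 :=
    hG.comp_of_eq h1 (by simp [h.map_zero])
  have hD : AnalyticAt ℂ (fun y : ℂ × ℂ × ℂ =>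
      Q y - y.2.2 - 2 * I * G (y.1, y.2.1, (Q y + y.2.2) / 2)) 0 :=
    (hQ.fun_sub (by fun_prop)).fun_sub (analyticAt_const.fun_mul h2)
  have hc : Tendsto (fun y : ℂ × ℂ => (y.1, y.2.re)) (𝓝 0) (𝓝 0) :=
    Continuous.tendsto' (by fun_prop) _ _ rfl
  filter_upwards [h.eventually_zero hD (by
    filter_upwards [hc.eventually hGe] with y e1 e2 e3
    simp only [← e3, eq_I_mul_two_im, eq_two_re, e1, e2, sub_self])] with y hy
  linear_combination hy

lemma complexification_symm (hG : AnalyticAt ℂ G 0)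
    (hGe : ∀ᶠ x in 𝓝 (0 : ℂ × ℝ), G (x.1, star x.1, x.2) = φ x) :
    ∀ᶠ y in 𝓝 (0 : ℂ × ℂ × ℂ), reflect G (y.2.1, y.1, y.2.2) = G y := by
  have h1 : AnalyticAt ℂ (fun y : ℂ × ℂ × ℂ => reflect G (y.2.1, y.1, y.2.2)) 0 :=
    AnalyticAt.comp_of_eq (analyticAt_reflect (by simpa using hG))
      (f := fun y : ℂ × ℂ × ℂ => (y.2.1, y.1, y.2.2)) (by fun_prop) rfl
  have h2 := eventually_zero_of_conj (h1.fun_sub hG) (by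
    filter_upwards [hGe] with x hx
    have e1 : star ((star x.1, x.1, (x.2 : ℂ)) : ℂ × ℂ × ℂ) = (x.1, star x.1, (x.2 : ℂ)) := by
      simp [Prod.star_def]
    simp only [reflect_apply, e1, hx]
    simp)
  filter_upwards [h2] with y hy
  exact sub_eq_zero.1 hy

/-- The normalization conditions for a prenormal Segre function. -/
def IsNormalized (B : ℂ × ℂ × ℂ → ℂ) : Prop :=
  ∀ᶠ t : ℝ in 𝓝 0, (coeffBoth B 3 0 (t : ℂ)).im = 0 ∧ (coeffBoth B 4 0 (t : ℂ)).re = 0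

lemma eventually_zero_of_fst_mul' {D : ℂ × ℂ × ℂ → ℂ} (hD : AnalyticAt ℂ D 0)
    (h : ∀ᶠ y in 𝓝 (0 : ℂ × ℂ × ℂ), y.1 * D y = 0) : ∀ᶠ y in 𝓝 (0 : ℂ × ℂ × ℂ), D y = 0 :=
  eventually_zero_of_fst_mul (x₀ := (0 : ℂ × ℂ)) hD h

/-- The complexified graph of a prenormal hypersurface. -/
lemma IsPrenormal.exists_graph_expansion (h : IsSegreChart M q Θ φ Q) (hB : IsPrenormal Q B)
    (hG : AnalyticAt ℂ G 0) (hGe : ∀ᶠ x in 𝓝 (0 : ℂ × ℝ), G (x.1, star x.1, x.2) = φ x) :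
    ∃ R, AnalyticAt ℂ R 0 ∧ (∀ᶠ y in 𝓝 (0 : ℂ × ℂ × ℂ), G y =
      y.1 ^ 2 * y.2.1 + y.1 * y.2.1 ^ 2 + y.1 ^ 2 * y.2.1 ^ 2 * R y) ∧
      ∀ᶠ x in 𝓝 (0 : ℂ × ℂ), B (x.1, 0, x.2) =
        2 * I * (x.1 + x.1 ^ 2 * R (x.1, 0, x.2)) := by
  have hI : I ≠ 0 := Complex.I_ne_zero
  have hBa := hB.analytic
  obtain ⟨ha, hQG⟩ := h.complexification_eq hG hGe
  have hat : Tendsto (fun y : ℂ × ℂ × ℂ => (y.1, y.2.1, (Q y + y.2.2) / 2)) (𝓝 0) (𝓝 0) := by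
    have := ha.continuousAt.tendsto
    simpa [h.map_zero] using this
  have hQ0 : ∀ᶠ x in 𝓝 (0 : ℂ × ℂ), Q (x.1, 0, x.2) = x.2 := by
    filter_upwards [tendsto_slice.eventually hB.eq] with x hx
    rw [hx]
    simp
  have hG0 : ∀ᶠ x in 𝓝 (0 : ℂ × ℂ), G (x.1, 0, x.2) = 0 := by
    filter_upwards [hQ0, tendsto_slice.eventually hQG] with x e1 e2
    rw [e1] at e2
    have e3 : (x.2 + x.2) / 2 = x.2 := by ring
    rw [e3] at e2
    have e4 : (2 * I) * G (x.1, 0, x.2) = 0 := by linear_combination -e2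
    exact (mul_eq_zero.1 e4).resolve_left (by simp)
  obtain ⟨G₁, hG₁, hG₁e⟩ := exists_eq_mul_snd hG hG0
  have h1 : AnalyticAt ℂ (fun y : ℂ × ℂ × ℂ => G₁ (y.1, y.2.1, (Q y + y.2.2) / 2)) 0 :=
    hG₁.comp_of_eq ha (by simp [h.map_zero])
  have hid₁ : ∀ᶠ y in 𝓝 (0 : ℂ × ℂ × ℂ), 2 * I * y.1 ^ 2 + y.2.1 * B y -
      2 * I * G₁ (y.1, y.2.1, (Q y + y.2.2) / 2) = 0 := by
    refine eventually_zero_of_mul_snd (AnalyticAt.fun_sub (by fun_prop)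
      (analyticAt_const.fun_mul h1)) ?_
    filter_upwards [hQG, hB.eq, hat.eventually hG₁e] with y e1 e2 e3
    rw [e3] at e1
    linear_combination e1 - e2
  have hG₁0 : ∀ᶠ x in 𝓝 (0 : ℂ × ℂ), G₁ (x.1, 0, x.2) = x.1 ^ 2 := by
    filter_upwards [hQ0, tendsto_slice.eventually hid₁] with x e1 e2
    rw [e1] at e2
    have e3 : (x.2 + x.2) / 2 = x.2 := by ring
    rw [e3] at e2
    refine mul_left_cancel₀ (show 2 * I ≠ 0 by simp) ?_
    linear_combination -e2
  obtain ⟨G₂, hG₂, hG₂e⟩ := exists_eq_mul_snd (G := fun y => G₁ y - y.1 ^ 2) (by fun_prop)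
    (hG₁0.mono fun x hx => by simp [hx])
  have h2 : AnalyticAt ℂ (fun y : ℂ × ℂ × ℂ => G₂ (y.1, y.2.1, (Q y + y.2.2) / 2)) 0 :=
    hG₂.comp_of_eq ha (by simp [h.map_zero])
  have hid₂ : ∀ᶠ y in 𝓝 (0 : ℂ × ℂ × ℂ),
      B y - 2 * I * G₂ (y.1, y.2.1, (Q y + y.2.2) / 2) = 0 := by
    refine eventually_zero_of_mul_snd (hBa.fun_sub (analyticAt_const.fun_mul h2)) ?_
    filter_upwards [hid₁, hat.eventually hG₂e] with y e1 e2
    linear_combination e1 + 2 * I * e2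
  have hBG : ∀ᶠ x in 𝓝 (0 : ℂ × ℂ), B (x.1, 0, x.2) = 2 * I * G₂ (x.1, 0, x.2) := by
    filter_upwards [hQ0, tendsto_slice.eventually hid₂] with x e1 e2
    rw [e1] at e2
    have e3 : (x.2 + x.2) / 2 = x.2 := by ring
    rw [e3] at e2
    linear_combination e2
  -- symmetry
  have hsym := complexification_symm hG hGe
  have hGe' : ∀ᶠ y in 𝓝 (0 : ℂ × ℂ × ℂ), G y = y.1 ^ 2 * y.2.1 + y.2.1 ^ 2 * G₂ y := by
    filter_upwards [hG₁e, hG₂e] with y e1 e2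
    linear_combination e1 + y.2.1 * e2
  have hrG₂ : AnalyticAt ℂ (fun y : ℂ × ℂ × ℂ => reflect G₂ (y.2.1, y.1, y.2.2)) 0 :=
    AnalyticAt.comp_of_eq (analyticAt_reflect (by simpa using hG₂))
      (f := fun y : ℂ × ℂ × ℂ => (y.2.1, y.1, y.2.2)) (by fun_prop) rfl
  have hst : Tendsto (fun y : ℂ × ℂ × ℂ => star ((y.2.1, y.1, y.2.2) : ℂ × ℂ × ℂ)) (𝓝 0) (𝓝 0) :=
    Continuous.tendsto' (by fun_prop) _ _ (by simp)
  have hsym₂ : ∀ᶠ y in 𝓝 (0 : ℂ × ℂ × ℂ), y.2.1 ^ 2 * y.1 +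
      y.1 ^ 2 * reflect G₂ (y.2.1, y.1, y.2.2) = y.1 ^ 2 * y.2.1 + y.2.1 ^ 2 * G₂ y := by
    filter_upwards [hsym, hGe', hst.eventually hGe'] with y e1 e2 e3
    rw [reflect_apply, e3] at e1
    rw [← e2, ← e1, reflect_apply]
    simp [Prod.star_def]
  have hcx := tendsto_zero_prodMk (E := ℂ × ℂ)
  have hz0 : ∀ {D : ℂ × ℂ × ℂ → ℂ}, AnalyticAt ℂ D 0 →
      AnalyticAt ℂ (fun x : ℂ × ℂ => D (0, x)) ((0 : ℂ), (0 : ℂ)) := fun hD =>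
    AnalyticAt.comp_of_eq hD (f := fun x : ℂ × ℂ => ((0 : ℂ), x)) (by fun_prop) rfl
  have hG₂0 : ∀ᶠ x in 𝓝 (0 : ℂ × ℂ), G₂ (0, x) = 0 := by
    refine eventually_zero_of_fst_mul (x₀ := (0 : ℂ)) (hz0 hG₂)
      (eventually_zero_of_fst_mul (x₀ := (0 : ℂ)) (analyticAt_fst.fun_mul (hz0 hG₂)) ?_)
    filter_upwards [hcx.eventually hsym₂] with x e1
    linear_combination -e1
  obtain ⟨G₃, hG₃, hG₃e⟩ := exists_eq_fst_mul (x₀ := (0 : ℂ × ℂ)) hG₂ hG₂0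
  replace hG₃ : AnalyticAt ℂ G₃ 0 := hG₃
  replace hG₃e : ∀ᶠ y in 𝓝 (0 : ℂ × ℂ × ℂ), G₂ y = y.1 * G₃ y := hG₃e
  have hid₃ : ∀ᶠ y in 𝓝 (0 : ℂ × ℂ × ℂ), y.2.1 ^ 2 +
      y.1 * reflect G₂ (y.2.1, y.1, y.2.2) - (y.1 * y.2.1 + y.2.1 ^ 2 * G₃ y) = 0 := by
    refine eventually_zero_of_fst_mul' (AnalyticAt.fun_sub (AnalyticAt.fun_add (by fun_prop)
      (analyticAt_fst.fun_mul hrG₂)) (by fun_prop)) ?_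
    filter_upwards [hsym₂, hG₃e] with y e1 e2
    linear_combination e1 + y.2.1 ^ 2 * e2
  have hG₃0 : ∀ᶠ x in 𝓝 (0 : ℂ × ℂ), G₃ (0, x) - 1 = 0 := by
    have h3 : AnalyticAt ℂ (fun x : ℂ × ℂ => G₃ (0, x) - 1) ((0 : ℂ), (0 : ℂ)) :=
      (hz0 hG₃).fun_sub analyticAt_const
    refine eventually_zero_of_fst_mul (x₀ := (0 : ℂ)) h3
      (eventually_zero_of_fst_mul (x₀ := (0 : ℂ)) (analyticAt_fst.fun_mul h3) ?_)
    filter_upwards [hcx.eventually hid₃] with x e1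
    linear_combination -e1
  obtain ⟨R, hR, hRe⟩ := exists_eq_fst_mul (x₀ := (0 : ℂ × ℂ))
    (hG₃.fun_sub (analyticAt_const (v := (1 : ℂ)))) hG₃0
  replace hR : AnalyticAt ℂ R 0 := hR
  have hG₂R : ∀ᶠ y in 𝓝 (0 : ℂ × ℂ × ℂ), G₂ y = y.1 + y.1 ^ 2 * R y := by
    filter_upwards [hG₃e, show ∀ᶠ y in 𝓝 (0 : ℂ × ℂ × ℂ), G₃ y - 1 = y.1 * R y from hRe]
      with y e1 e2
    linear_combination e1 + y.1 * e2
  refine ⟨R, hR, ?_, ?_⟩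
  · filter_upwards [hGe', hG₂R] with y e1 e2
    linear_combination e1 + y.2.1 ^ 2 * e2
  · filter_upwards [hBG, tendsto_slice.eventually hG₂R] with x e1 e2
    rw [e1, e2]

/-- Coefficients of `z + z² R`. -/
lemma coeffBoth_of_slice {R : ℂ × ℂ × ℂ → ℂ} (hR : AnalyticAt ℂ R 0)
    (h : ∀ᶠ x in 𝓝 (0 : ℂ × ℂ), B (x.1, 0, x.2) =
      2 * I * (x.1 + x.1 ^ 2 * R (x.1, 0, x.2))) :
    ∀ᶠ τ in 𝓝 (0 : ℂ), coeffBoth B 3 0 τ = 2 * I * coeffBoth R 1 0 τ ∧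
      coeffBoth B 4 0 τ = 2 * I * coeffBoth R 2 0 τ := by
  have hc := tendsto_zero_prodMk (E := ℂ)
  have hc' : Tendsto (fun τ : ℂ => ((0 : ℂ), (0 : ℂ), τ)) (𝓝 0) (𝓝 0) :=
    Continuous.tendsto' (by fun_prop) _ _ rfl
  filter_upwards [hc.eventually h.eventually_nhds, hc'.eventually hR.eventually_analyticAt]
    with τ e1 e2
  have hcz : Tendsto (fun z : ℂ => (z, τ)) (𝓝 0) (𝓝 (0, τ)) :=
    Continuous.tendsto' (by fun_prop) _ _ rfl
  have h1 : AnalyticAt ℂ (fun z : ℂ => coeffSnd R 0 (z, τ)) 0 := by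
    simp only [coeffSnd_zero]
    exact AnalyticAt.comp_of_eq e2 (f := fun z : ℂ => (z, (0 : ℂ), τ)) (by fun_prop) rfl
  have hid : AnalyticAt ℂ (fun z : ℂ => z) 0 := analyticAt_id
  have h2 : (fun z => coeffSnd B 0 (z, τ)) =ᶠ[𝓝 0]
      fun z => 2 * I * (z + z * (z * coeffSnd R 0 (z, τ))) := by
    filter_upwards [hcz.eventually e1] with z hz
    simp only [coeffSnd_zero] at hz ⊢
    rw [hz]
    ring
  have h3 : jet (fun z => coeffSnd B 0 (z, τ)) = PowerSeries.C (2 * I) *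
      (PowerSeries.X + PowerSeries.X * (PowerSeries.X * jet fun z => coeffSnd R 0 (z, τ))) := by
    rw [jet_congr h2, jet_const_mul, jet_add hid (by fun_prop), jet_mul hid (by fun_prop),
      jet_mul hid h1, jet_id]
  simp only [coeffBoth_eq_coeff_jet, h3]
  constructor
  · simp [coeff_three_mul, PowerSeries.coeff_X]
  · simp [coeff_four_mul, PowerSeries.coeff_X]

theorem IsPrenormal.isNormalFormFunction (h : IsSegreChart M q Θ φ Q) (hB : IsPrenormal Q B)
    (hN : IsNormalized B) : IsNormalFormFunction φ := by
  obtain ⟨G, hG, hGe⟩ := exists_complexification_graph h.analytic_graph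
  obtain ⟨R, hR, hGR, hBR⟩ := hB.exists_graph_expansion h hG hGe
  obtain ⟨ε₁, hε₁, hcoef, -, hsum⟩ := exists_hasSum_coeffBoth hR
  have hc : Tendsto (fun x : ℂ × ℝ => (x.1, star x.1, (x.2 : ℂ))) (𝓝 0) (𝓝 0) :=
    Continuous.tendsto' (by fun_prop) _ _ (by simp)
  have hct := tendsto_ofReal_zero
  obtain ⟨ε₂, hε₂, h2⟩ := Metric.eventually_nhds_iff.1 (hGe.and (hc.eventually hGR))
  obtain ⟨ε₃, hε₃, h3⟩ := Metric.eventually_nhds_iff.1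
    (hN.and (hct.eventually (coeffBoth_of_slice hR hBR)))
  obtain ⟨ε, hε, hle⟩ : ∃ ε > 0, ε ≤ ε₁ ∧ ε ≤ ε₂ ∧ ε ≤ ε₃ :=
    ⟨min ε₁ (min ε₂ ε₃), by positivity, min_le_left _ _, (min_le_right _ _).trans (min_le_left _ _),
      (min_le_right _ _).trans (min_le_right _ _)⟩
  have habs : ∀ u ∈ Ioo (-ε) ε, ‖(u : ℂ)‖ < ε ∧ ‖u‖ < ε := fun u hu => by
    rw [Complex.norm_real, and_self, Real.norm_eq_abs, abs_lt]
    exact hu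
  refine ⟨h.analytic_graph, fun k l u => coeffBoth R (k - 2) (l - 2) u, ε, hε, ?_, ?_, ?_⟩
  · intro k l u hu
    exact (analyticAt_real_of_complex (hcoef (k - 2) (l - 2) u
      ((habs u hu).1.trans_le hle.1))).comp_of_eq (f := fun u : ℝ => (u : ℂ))
      (Complex.ofRealCLM.analyticAt u) rfl
  · intro u hu
    obtain ⟨⟨k1, k2⟩, k3, k4⟩ := h3 (show dist u 0 < ε₃ by
      simpa using (habs u hu).2.trans_le hle.2.2)
    rw [k3] at k1
    rw [k4] at k2
    simpa using And.intro k1 k2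
  · intro z hz u hu
    obtain ⟨k1, k2⟩ := h2 (show dist (z, u) (0 : ℂ × ℝ) < ε₂ by
      rw [dist_zero_right, Prod.norm_mk]
      exact max_lt (hz.trans_le hle.2.1) ((habs u hu).2.trans_le hle.2.1))
    have k3 := (hsum z (star z) u (hz.trans_le hle.1) (by simpa using hz.trans_le hle.1)
      ((habs u hu).1.trans_le hle.1)).mul_left (z ^ 2 * star z ^ 2)
    have k4 : ((φ (z, u) - 2 * (z ^ 2 * starRingEnd ℂ z).re : ℝ) : ℂ) =
        z ^ 2 * star z ^ 2 * R (z, star z, u) := by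
      have e1 : ((2 * (z ^ 2 * starRingEnd ℂ z).re : ℝ) : ℂ) = z ^ 2 * star z + star z ^ 2 * z := by
        rw [← Complex.add_conj]
        simp
      rw [Complex.ofReal_sub, e1, ← k1, k2]
      ring
    rw [k4]
    convert! k3 using 2 with n
    simp only [Nat.add_sub_cancel, pow_add, starRingEnd_apply]
    ring

lemma IsNormalFormFunction.zero (hφ : IsNormalFormFunction φ) : φ 0 = 0 := by
  obtain ⟨-, Φ, ε, hε, -, -, hs⟩ := hφ
  have h1 := hs 0 (by simpa using hε) 0 (by simpa using hε)
  simp only [map_zero, ne_eq, Nat.add_eq_zero_iff, OfNat.ofNat_ne_zero, and_false,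
    not_false_eq_true, zero_pow, mul_zero] at h1
  have h2 := h1.unique hasSum_zero
  simpa using h2

/-- The Taylor coefficients of the complexification of a normal form function. -/
lemma IsNormalFormFunction.coeffBoth_eq (hφ : IsNormalFormFunction φ) (hG : AnalyticAt ℂ G 0)
    (hGe : ∀ᶠ x in 𝓝 (0 : ℂ × ℝ), G (x.1, star x.1, x.2) = φ x) :
    ∀ᶠ u : ℝ in 𝓝 0, (∀ k, coeffBoth G k 0 u = 0) ∧
      (∀ k, coeffBoth G k 1 u = if k = 2 then 1 else 0) ∧
      (coeffBoth G 3 2 u).re = 0 ∧ (coeffBoth G 4 2 u).im = 0 := by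
  obtain ⟨-, Φ, ε₀, hε₀, -, hn, hs⟩ := hφ
  obtain ⟨ε₁, hε₁, -, -, hsum⟩ := exists_hasSum_coeffBoth hG
  obtain ⟨ε₂, hε₂, h2⟩ := Metric.eventually_nhds_iff.1 hGe
  obtain ⟨ε, hε, hle⟩ : ∃ ε > 0, ε ≤ ε₀ ∧ ε ≤ ε₁ ∧ ε ≤ ε₂ :=
    ⟨min ε₀ (min ε₁ ε₂), by positivity, min_le_left _ _, (min_le_right _ _).trans (min_le_left _ _),
      (min_le_right _ _).trans (min_le_right _ _)⟩
  filter_upwards [Metric.ball_mem_nhds (0 : ℝ) hε] with u hu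
  have hu1 : ‖u‖ < ε := by simpa using hu
  have hu2 : ‖(u : ℂ)‖ < ε := by simpa using hu1
  have hu3 : u ∈ Ioo (-ε₀) ε₀ := by
    rw [Real.norm_eq_abs] at hu1
    exact abs_lt.1 (hu1.trans_le hle.1)
  have key := eq_zero_of_hasSum_conj (a := fun k l => coeffBoth G k l u -
      ((if (k, l) = (2, 1) then 1 else 0) + (if (k, l) = (1, 2) then 1 else 0) +
        (if 2 ≤ k ∧ 2 ≤ l then Φ k l u else 0))) hε (by
    intro z hz
    have k1 := hsum z (star z) u (hz.trans_le hle.2.1) (by simpa using hz.trans_le hle.2.1)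
      (hu2.trans_le hle.2.1)
    have k2 := h2 (show dist (z, u) (0 : ℂ × ℝ) < ε₂ by
      rw [dist_zero_right, Prod.norm_mk]
      exact max_lt (hz.trans_le hle.2.2) (hu1.trans_le hle.2.2))
    have k3 := hs z (hz.trans_le hle.1) u hu3
    have hinj : Function.Injective (fun n : ℕ × ℕ => (n.1 + 2, n.2 + 2)) := fun n m hnm => by
      simp only [Prod.mk.injEq, Nat.add_right_cancel_iff] at hnm
      exact Prod.ext hnm.1 hnm.2
    have k4 : HasSum (fun n : ℕ × ℕ => if 2 ≤ n.1 ∧ 2 ≤ n.2 then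
        Φ n.1 n.2 u * z ^ n.1 * (starRingEnd ℂ z) ^ n.2 else 0)
        ((φ (z, u) - 2 * (z ^ 2 * starRingEnd ℂ z).re : ℝ) : ℂ) := by
      rw [← hinj.hasSum_iff]
      · convert! k3 using 2 with n
      · intro n hnr
        rw [if_neg]
        rintro ⟨h1, h2⟩
        exact hnr ⟨(n.1 - 2, n.2 - 2), Prod.ext (by simp only; omega) (by simp only; omega)⟩
    have k5 := k1.sub (((hasSum_ite_eq ((2, 1) : ℕ × ℕ) (z ^ 2 * star z)).add
      (hasSum_ite_eq ((1, 2) : ℕ × ℕ) (star z ^ 2 * z))).add k4)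
    have e1 : ((2 * (z ^ 2 * starRingEnd ℂ z).re : ℝ) : ℂ) = z ^ 2 * star z + star z ^ 2 * z := by
      rw [← Complex.add_conj]
      simp
    have e2 : G (z, star z, (u : ℂ)) - (z ^ 2 * star z + star z ^ 2 * z +
        ((φ (z, u) - 2 * (z ^ 2 * starRingEnd ℂ z).re : ℝ) : ℂ)) = 0 := by
      rw [Complex.ofReal_sub, e1, ← k2]
      ring
    rw [e2] at k5
    convert! k5 using 2 with n
    obtain ⟨k, l⟩ := n
    have e3 : starRingEnd ℂ z = star z := rfl
    simp only [e3]
    by_cases c1 : (k, l) = (2, 1)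
    · obtain ⟨rfl, rfl⟩ := Prod.mk.injEq .. ▸ c1
      simp
      ring
    · by_cases c2 : (k, l) = (1, 2)
      · obtain ⟨rfl, rfl⟩ := Prod.mk.injEq .. ▸ c2
        simp
        ring
      · by_cases c3 : 2 ≤ k ∧ 2 ≤ l
        · simp only [c1, c2, c3, if_true, if_false, and_self]
          ring
        · simp only [c1, c2, c3, if_false]
          ring)
  refine ⟨fun k => ?_, fun k => ?_, ?_, ?_⟩
  · simpa using key k 0
  · have := key k 1
    simp only [Prod.mk.injEq, and_true, OfNat.one_ne_ofNat, and_false, if_false, add_zero,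
      Nat.not_ofNat_le_one, sub_eq_zero] at this
    exact this
  · have := key 3 2
    simp only [Prod.mk.injEq, Nat.reduceEqDiff, and_true, if_false, le_refl,
      Nat.reduceLeDiff, and_self, if_true, zero_add, sub_eq_zero, OfNat.ofNat_ne_one] at this
    rw [this]
    exact (hn u hu3).1
  · have := key 4 2
    simp only [Prod.mk.injEq, Nat.reduceEqDiff, and_true, if_false, le_refl,
      Nat.reduceLeDiff, and_self, if_true, zero_add, sub_eq_zero, OfNat.ofNat_ne_one] at this
    rw [this]
    exact (hn u hu3).2

/-- The complexification of a normal form function has the form `z² ζ + ζ² D`. -/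
lemma IsNormalFormFunction.exists_expansion (hφ : IsNormalFormFunction φ) (hG : AnalyticAt ℂ G 0)
    (hGe : ∀ᶠ x in 𝓝 (0 : ℂ × ℝ), G (x.1, star x.1, x.2) = φ x) :
    ∃ D, AnalyticAt ℂ D 0 ∧
      (∀ᶠ y in 𝓝 (0 : ℂ × ℂ × ℂ), G y = y.1 ^ 2 * y.2.1 + y.2.1 ^ 2 * D y) ∧
      ∀ᶠ u : ℝ in 𝓝 0, (coeffBoth D 3 0 u).re = 0 ∧ (coeffBoth D 4 0 u).im = 0 := by
  have hcoef := hφ.coeffBoth_eq hG hGe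
  obtain ⟨ε, hε, -, hs, -⟩ := exists_hasSum_coeffBoth hG
  obtain ⟨D, hD, hDe, hD2⟩ := exists_taylor_snd hG
  have hpair : ∀ {P : ℂ × ℂ → Prop}, (∀ᶠ u : ℝ in 𝓝 0, ∀ z : ℂ, ‖z‖ < ε → ‖(u : ℂ)‖ < ε →
      P (z, u)) → ∀ᶠ y : ℝ × ℝ in 𝓝 0, P (y.1, y.2) := by
    intro P hP
    have hc1 : Tendsto (fun y : ℝ × ℝ => y.2) (𝓝 0) (𝓝 0) := continuous_snd.tendsto' _ _ rfl
    have hc2 : Tendsto (fun y : ℝ × ℝ => ‖(y.1 : ℂ)‖) (𝓝 0) (𝓝 0) :=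
      Continuous.tendsto' (by fun_prop) _ _ (by simp)
    have hc3 : Tendsto (fun y : ℝ × ℝ => ‖(y.2 : ℂ)‖) (𝓝 0) (𝓝 0) :=
      Continuous.tendsto' (by fun_prop) _ _ (by simp)
    filter_upwards [hc1.eventually hP, hc2.eventually (gt_mem_nhds hε),
      hc3.eventually (gt_mem_nhds hε)] with y e1 e2 e3
    exact e1 _ e2 e3
  have ha : ∀ l, AnalyticAt ℂ (coeffSnd G l) 0 := fun l => analyticAt_coeffSnd hG l
  have h0 : ∀ᶠ x in 𝓝 (0 : ℂ × ℂ), coeffSnd G 0 x = 0 := by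
    refine eventually_zero_of_real₂ (ha 0) (hpair (P := fun x => coeffSnd G 0 x = 0) ?_)
    filter_upwards [hcoef] with u hu z hz hu'
    have := hs z u hz hu' 0
    simp only [hu.1, zero_mul] at this
    exact this.unique hasSum_zero
  have h1 : ∀ᶠ x in 𝓝 (0 : ℂ × ℂ), coeffSnd G 1 x - x.1 ^ 2 = 0 := by
    refine eventually_zero_of_real₂ ((ha 1).fun_sub (by fun_prop))
      (hpair (P := fun x => coeffSnd G 1 x - x.1 ^ 2 = 0) ?_)
    filter_upwards [hcoef] with u hu z hz hu'
    have h3 := hs z u hz hu' 1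
    have h4 : (fun k => coeffBoth G k 1 (u : ℂ) * z ^ k) =
        fun k => if k = 2 then z ^ 2 else 0 := by
      funext k
      rw [hu.2.1]
      split_ifs with h
      · rw [h, one_mul]
      · rw [zero_mul]
    rw [h4] at h3
    rw [h3.unique (hasSum_ite_eq 2 _), sub_self]
  refine ⟨D, hD, ?_, ?_⟩
  · have hc' : Tendsto (fun y : ℂ × ℂ × ℂ => (y.1, y.2.2)) (𝓝 0) (𝓝 0) :=
      Continuous.tendsto' (by fun_prop) _ _ rfl
    filter_upwards [hDe, hc'.eventually h0, hc'.eventually h1] with y e1 e2 e3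
    rw [coeffSnd_zero] at e2
    simp only at e2
    rw [e2] at e1
    linear_combination e1 + y.2.1 * e3
  · have h3 : ∀ k, ∀ᶠ τ in 𝓝 (0 : ℂ), coeffBoth G k 2 τ = coeffBoth D k 0 τ := by
      intro k
      have hc := tendsto_zero_prodMk (E := ℂ)
      filter_upwards [hc.eventually hD2.eventually_nhds] with τ hτ
      have hc2 : Tendsto (fun z : ℂ => (z, τ)) (𝓝 0) (𝓝 (0, τ)) :=
        Continuous.tendsto' (by fun_prop) _ _ rfl
      rw [coeffBoth_eq_coeff_jet, coeffBoth_eq_coeff_jet, jet_congr]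
      filter_upwards [hc2.eventually hτ] with z hz
      rw [hz, coeffSnd_zero]
    have hct := tendsto_ofReal_zero
    filter_upwards [hcoef, hct.eventually (h3 3), hct.eventually (h3 4)] with u e1 e2 e3
    rw [← e2, ← e3]
    exact e1.2.2

lemma IsNormalFormFunction.fderiv_zero (hφ : IsNormalFormFunction φ) : fderiv ℝ φ 0 = 0 := by
  obtain ⟨G, hG, hGe⟩ := exists_complexification_graph hφ.1
  obtain ⟨D, hD, hDe, -⟩ := hφ.exists_expansion hG hGe
  have hz : DifferentiableAt ℂ (fun y : ℂ × ℂ × ℂ => y.1 ^ 2 + y.2.1 * D y) 0 :=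
    (AnalyticAt.fun_add (by fun_prop) (AnalyticAt.fun_mul (by fun_prop) hD)).differentiableAt
  have h1 : HasFDerivAt G (0 : ℂ × ℂ × ℂ →L[ℂ] ℂ) 0 := by
    have h2 : HasFDerivAt (fun y : ℂ × ℂ × ℂ => y.2.1)
        ((ContinuousLinearMap.fst ℂ ℂ ℂ).comp (ContinuousLinearMap.snd ℂ ℂ (ℂ × ℂ)))
        (0 : ℂ × ℂ × ℂ) :=
      ((ContinuousLinearMap.fst ℂ ℂ ℂ).comp (ContinuousLinearMap.snd ℂ ℂ (ℂ × ℂ))).hasFDerivAt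
    have h3 := h2.mul hz.hasFDerivAt
    refine (h3.congr_of_eventuallyEq ?_).congr_fderiv (by ext <;> simp)
    filter_upwards [hDe] with y hy
    rw [hy]
    simp only [Pi.mul_apply]
    ring
  have h4 : HasFDerivAt (fun x : ℂ × ℝ => (x.1, star x.1, (x.2 : ℂ)))
      ((ContinuousLinearMap.fst ℝ ℂ ℝ).prod
        ((((starL' ℝ : ℂ ≃L[ℝ] ℂ) : ℂ →L[ℝ] ℂ).comp (ContinuousLinearMap.fst ℝ ℂ ℝ)).prod
          (Complex.ofRealCLM.comp (ContinuousLinearMap.snd ℝ ℂ ℝ)))) 0 :=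
    ((ContinuousLinearMap.fst ℝ ℂ ℝ).prod
      ((((starL' ℝ : ℂ ≃L[ℝ] ℂ) : ℂ →L[ℝ] ℂ).comp (ContinuousLinearMap.fst ℝ ℂ ℝ)).prod
        (Complex.ofRealCLM.comp (ContinuousLinearMap.snd ℝ ℂ ℝ)))).hasFDerivAt
  have h5 := hasFDerivAt_comp_of_eq (h1.restrictScalars ℝ) h4 (by simp)
  have h6 := Complex.ofRealCLM.hasFDerivAt.comp (0 : ℂ × ℝ) hφ.1.differentiableAt.hasFDerivAt
  have h7 := h6.unique (h5.congr_of_eventuallyEq (by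
    filter_upwards [hGe] with x hx
    exact hx.symm))
  refine ContinuousLinearMap.ext fun v => ?_
  simpa using congrArg (fun L : ℂ × ℝ →L[ℝ] ℂ => L v) h7

theorem IsNormalFormFunction.exists_isPrenormal (hφ : IsNormalFormFunction φ)
    (h : IsSegreChart M q Θ φ Q) : ∃ B, IsPrenormal Q B ∧ IsNormalized B := by
  obtain ⟨G, hG, hGe⟩ := exists_complexification_graph hφ.1
  obtain ⟨D, hD, hDe, hDn⟩ := hφ.exists_expansion hG hGe
  obtain ⟨ha, hQG⟩ := h.complexification_eq hG hGe
  have hat : Tendsto (fun y : ℂ × ℂ × ℂ => (y.1, y.2.1, (Q y + y.2.2) / 2)) (𝓝 0) (𝓝 0) := by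
    have := ha.continuousAt.tendsto
    simpa [h.map_zero] using this
  have hQe : ∀ᶠ y in 𝓝 (0 : ℂ × ℂ × ℂ), Q y = y.2.2 + 2 * I * y.1 ^ 2 * y.2.1 +
      y.2.1 ^ 2 * (2 * I * D (y.1, y.2.1, (Q y + y.2.2) / 2)) := by
    filter_upwards [hQG, hat.eventually hDe] with y e1 e2
    rw [e2] at e1
    linear_combination e1
  refine ⟨fun y => 2 * I * D (y.1, y.2.1, (Q y + y.2.2) / 2),
    ⟨analyticAt_const.fun_mul (hD.comp_of_eq ha (by simp [h.map_zero])), hQe⟩, ?_⟩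
  have h3 : ∀ k, ∀ᶠ τ in 𝓝 (0 : ℂ),
      coeffBoth (fun y => 2 * I * D (y.1, y.2.1, (Q y + y.2.2) / 2)) k 0 τ =
        2 * I * coeffBoth D k 0 τ := by
    intro k
    have hc := tendsto_zero_prodMk (E := ℂ)
    filter_upwards [hc.eventually (tendsto_slice.eventually hQe).eventually_nhds] with τ hτ
    have hc2 : Tendsto (fun z : ℂ => (z, τ)) (𝓝 0) (𝓝 (0, τ)) :=
      Continuous.tendsto' (by fun_prop) _ _ rfl
    rw [coeffBoth_eq_coeff_jet, coeffBoth_eq_coeff_jet, ← PowerSeries.coeff_C_mul,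
      ← jet_const_mul, jet_congr]
    filter_upwards [hc2.eventually hτ] with z hz
    have e1 : Q (z, 0, τ) = τ := by simpa using hz
    simp only [coeffSnd_zero, e1]
    congr 2
    ring_nf
  have hct := tendsto_ofReal_zero
  unfold IsNormalized
  filter_upwards [hDn, hct.eventually (h3 3), hct.eventually (h3 4)] with t e1 e2 e3
  rw [e2, e3]
  simpa using e1

end

section

variable {M : Set (ℂ × ℂ)} {q : ℂ × ℂ} {Θ F : ℂ × ℂ → ℂ × ℂ} {φ φ' : ℂ × ℝ → ℝ}
  {Q Q' B : ℂ × ℂ × ℂ → ℂ} {ρ : ℂ × ℂ → ℝ} {S : ℂ × ℂ → ℂ}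

/-! ### The slope field -/

lemma segreIterate_translate (Q : ℂ × ℂ × ℂ → ℂ) {e : ℂ × ℂ} (he : star e = e) (z s : ℂ) :
    segreIterate (fun y => Q (y + (e.1, e.1, e.2)) - e.2) (z, s, 0) =
      segreIterate Q (z, s, e) - e.2 := by
  obtain ⟨a, b⟩ := e
  have h1 : star a = a := congrArg Prod.fst he
  have h2 : star b = b := congrArg Prod.snd he
  simp only [segreIterate, reflect_apply, Prod.star_def, Prod.mk_add_mk, Prod.fst_zero,
    Prod.snd_zero, add_zero, zero_add, star_add, star_sub, h1, h2, star_zero, sub_add_cancel]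

lemma segreOmega_translate (Q : ℂ × ℂ × ℂ → ℂ) (e : ℂ × ℂ) (z s : ℂ) :
    segreOmega (fun y => Q (y + (e.1, e.1, e.2)) - e.2) (z, s, 0) = segreOmega Q (z, s, e) := by
  simp [segreOmega, fderiv_sub_const, fderiv_comp_add_right]

lemma chainCoefficient_translate (Q : ℂ × ℂ × ℂ → ℂ) {e : ℂ × ℂ} (he : star e = e) :
    chainCoefficient (fun y => Q (y + (e.1, e.1, e.2)) - e.2) 0 = chainCoefficient Q e := by
  have h1 : ∀ k l, 0 < l → coeffBoth (segreIterate (fun y => Q (y + (e.1, e.1, e.2)) - e.2)) k l 0 =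
      coeffBoth (segreIterate Q) k l e := by
    intro k l hl
    simp only [coeffBoth, coeffSnd, segreIterate_translate Q he]
    simp only [sub_eq_neg_add, iteratedDeriv_const_add hl]
  have h2 : ∀ k l, coeffBoth (segreOmega (fun y => Q (y + (e.1, e.1, e.2)) - e.2)) k l 0 =
      coeffBoth (segreOmega Q) k l e := by
    intro k l
    simp only [coeffBoth, coeffSnd, segreOmega_translate Q]
  simp [chainCoefficient, h1, h2]

lemma IsFlatChart.coeffBoth_ne_zero (h : IsFlatChart M q Θ φ Q) (hφ : fderiv ℝ φ 0 = 0)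
    (hg : HasGenericLeviDegeneracyAt M q) : coeffBoth (segreIterate Q) 2 1 0 ≠ 0 := by
  have hg' := hg
  obtain ⟨-, ρ, hρ, -⟩ := hg'
  obtain ⟨F, φ', Q', B, h', -, hB, -⟩ := h.exists_prenormal hφ hg hρ (a := fun _ => 0)
    analyticAt_const rfl (by simp [reflect_apply])
  exact (h.exists_slope h' hB hρ).1

lemma IsFlatChart.analyticAt_chainCoefficient (h : IsFlatChart M q Θ φ Q)
    (hw : coeffBoth (segreIterate Q) 2 1 0 ≠ 0) : AnalyticAt ℂ (chainCoefficient Q) 0 := by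
  have h1 : ∀ k l, AnalyticAt ℂ (coeffBoth (segreIterate Q) k l) 0 :=
    fun k l => analyticAt_coeffBoth h.chart.analyticAt_segreIterate k l
  have ho : AnalyticAt ℂ (segreOmega Q) 0 :=
    (analyticAt_fderiv_apply h.chart.analytic (0, 0, 1)).comp_of_eq
      (f := fun y : ℂ × ℂ × (ℂ × ℂ) => (y.1 + y.2.2.1, y.2.2.1, y.2.2.2)) (by fun_prop) (by simp)
  have h2 : ∀ k l, AnalyticAt ℂ (coeffBoth (segreOmega Q) k l) 0 :=
    fun k l => analyticAt_coeffBoth ho k l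
  obtain ⟨v₁, hv₁⟩ : ∃ v, v = coeffBoth (segreOmega Q) 1 0 := ⟨_, rfl⟩
  obtain ⟨v₂, hv₂⟩ : ∃ v, v = coeffBoth (segreOmega Q) 2 0 := ⟨_, rfl⟩
  obtain ⟨w, hw'⟩ : ∃ v, v = coeffBoth (segreIterate Q) 2 1 := ⟨_, rfl⟩
  obtain ⟨w₃, hw₃⟩ : ∃ v, v = coeffBoth (segreIterate Q) 3 1 := ⟨_, rfl⟩
  obtain ⟨w₄, hw₄⟩ : ∃ v, v = coeffBoth (segreIterate Q) 4 1 := ⟨_, rfl⟩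
  obtain ⟨b₂, hb₂⟩ : ∃ v, v = coeffBoth (segreIterate Q) 2 2 := ⟨_, rfl⟩
  obtain ⟨b₃, hb₃⟩ : ∃ v, v = coeffBoth (segreIterate Q) 3 2 := ⟨_, rfl⟩
  have a1 : AnalyticAt ℂ v₁ 0 := hv₁ ▸ h2 _ _
  have a2 : AnalyticAt ℂ v₂ 0 := hv₂ ▸ h2 _ _
  have a3 : AnalyticAt ℂ w 0 := hw' ▸ h1 _ _
  have a4 : AnalyticAt ℂ w₃ 0 := hw₃ ▸ h1 _ _
  have a5 : AnalyticAt ℂ w₄ 0 := hw₄ ▸ h1 _ _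
  have a6 : AnalyticAt ℂ b₂ 0 := hb₂ ▸ h1 _ _
  have a7 : AnalyticAt ℂ b₃ 0 := hb₃ ▸ h1 _ _
  have hw0 : w 0 ≠ 0 := hw' ▸ hw
  have : chainCoefficient Q = fun e => chainExpression (v₁ e) (v₂ e) (w e) (w₃ e) (w₄ e) (b₂ e)
      (b₃ e) := by
    funext e
    simp [chainCoefficient, hv₁, hv₂, hw', hw₃, hw₄, hb₂, hb₃]
  rw [this]
  simp only [chainExpression]
  have d1 : AnalyticAt ℂ (fun e => w₃ e / w e) 0 := a4.fun_div a3 hw0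
  have d2 : AnalyticAt ℂ (fun e => w₄ e / w e) 0 := a5.fun_div a3 hw0
  have d3 : AnalyticAt ℂ (fun e => (w e ^ 2)⁻¹) 0 := (a3.fun_pow 2).fun_inv (pow_ne_zero 2 hw0)
  simp only [div_eq_mul_inv _ (w _ ^ 2)]
  fun_prop

/-- `S` is the field of slopes `dz/dw`, in a flat chart `Θ`, of the directions `dF⁻¹(0, 1)` for
the maps `F` onto prenormal forms whose first obstruction vanishes. -/
structure IsSlopeField (M : Set (ℂ × ℂ)) (q : ℂ × ℂ) (Θ : ℂ × ℂ → ℂ × ℂ) (S : ℂ × ℂ → ℂ) :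
    Prop where
  analytic : AnalyticAt ℂ S 0
  reflect_eq : ∀ᶠ y in 𝓝 0, reflect S y = S y
  iff_slope : ∀ᶠ x in 𝓝 q, x ∈ leviDegeneracySet M → ∀ F φ' Q' B, IsSegreChart M x F φ' Q' →
    IsPrenormal Q' B → ((coeffBoth B 3 0 0).im = 0 ↔ ∀ v, (∃ r : ℝ, fderiv ℂ F x v = (0, (r : ℂ))) ↔
      ∃ r : ℝ, fderiv ℂ Θ x v = (r * S (Θ x), (r : ℂ)))

lemma IsFlatChart.exists_isSlopeField (h : IsFlatChart M q Θ φ Q) (hφ : fderiv ℝ φ 0 = 0)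
    (hg : HasGenericLeviDegeneracyAt M q) : ∃ S, IsSlopeField M q Θ S := by
  have hC := h.analyticAt_chainCoefficient (h.coeffBoth_ne_zero hφ hg)
  obtain ⟨-, ρ, hρ, -⟩ := hg
  obtain ⟨C, hCdef⟩ : ∃ C, C = chainCoefficient Q := ⟨_, rfl⟩
  rw [← hCdef] at hC
  have hm : AnalyticAt ℂ (fun e : ℂ × ℂ => fderiv ℂ Q (e.1, e.1, e.2) (1, 0, 0)) 0 :=
    (analyticAt_fderiv_apply h.chart.analytic (1, 0, 0)).comp_of_eq
      (f := fun e : ℂ × ℂ => (e.1, e.1, e.2)) (by fun_prop) rfl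
  have hm0 : fderiv ℂ Q ((0 : ℂ × ℂ).1, (0 : ℂ × ℂ).1, (0 : ℂ × ℂ).2) (1, 0, 0) = 0 := by
    have l : HasDerivAt (fun t : ℂ => (t, t, (0 : ℂ))) (1, 1, 0) 0 :=
      (hasDerivAt_id _).prodMk ((hasDerivAt_id _).prodMk (hasDerivAt_const _ _))
    have d := HasFDerivAt.comp_hasDerivAt_of_eq (0 : ℂ)
      h.chart.analytic.differentiableAt.hasFDerivAt l rfl
    have c := tendsto_prodMk_zero (E := ℂ)
    have e := (d.congr_of_eventuallyEq ((c.eventually h.segre_diag).mono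
      fun t ht => ht.symm)).unique (hasDerivAt_const (0 : ℂ) (0 : ℂ))
    have : ((1 : ℂ), (1 : ℂ), (0 : ℂ)) = (1, 0, 0) + (0, 1, 0) := by simp
    rw [this, map_add, h.chart.fderiv_segre hφ, add_zero] at e
    exact e
  obtain ⟨m, hmdef⟩ : ∃ m : ℂ × ℂ → ℂ, m = fun e => fderiv ℂ Q (e.1, e.1, e.2) (1, 0, 0) := ⟨_, rfl⟩
  rw [← hmdef] at hm
  replace hm0 : m 0 = 0 := by rw [hmdef]; exact hm0
  obtain ⟨c, hcdef⟩ : ∃ c : ℂ × ℂ → ℂ, c = fun e => (C e + reflect C e) / 2 := ⟨_, rfl⟩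
  have hCr : AnalyticAt ℂ (reflect C) 0 := analyticAt_reflect (by simpa using hC)
  have hc : AnalyticAt ℂ c 0 := by
    rw [hcdef]
    fun_prop
  obtain ⟨T, hTdef⟩ : ∃ T : ℂ × ℂ → ℂ, T = fun e => c e / (1 + m e * c e) := ⟨_, rfl⟩
  have hT : AnalyticAt ℂ T 0 := by
    rw [hTdef]
    exact hc.fun_div (by fun_prop) (by simp [hm0])
  have hTr : AnalyticAt ℂ (reflect T) 0 := analyticAt_reflect (by simpa using hT)
  have hd : ∀ᶠ e in 𝓝 0, 1 + m e * c e ≠ 0 :=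
    (show AnalyticAt ℂ (fun e => 1 + m e * c e) 0 by fun_prop).continuousAt.eventually_ne
      (by simp [hm0])
  refine ⟨fun e => (T e + reflect T e) / 2, by fun_prop, Eventually.of_forall fun y => ?_, ?_⟩
  · simp [reflect_apply, add_comm]
  have hΘt := h.chart.tendsto
  filter_upwards [h.translate, hρ.eventually, hΘt.eventually hd, h.mem_iff] with x h1 h2 h3 h4 hx
    F φ' Q' B h' hB
  have hreal : star (Θ x) = Θ x := h4.1 hx
  have hch := chainCoefficient_translate Q hreal
  have h5 := (h1 hx).deriv_segre.2
  obtain ⟨-, σ, hσ1, hσ2⟩ := (h1 hx).exists_slope h' hB h2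
  rw [hch] at hσ2
  have e1 : fderiv ℂ (fun y => Q (y + ((Θ x).1, (Θ x).1, (Θ x).2)) - (Θ x).2) 0 (1, 0, 0) =
      m (Θ x) := by
    rw [fderiv_sub_const, fderiv_comp_add_right, zero_add, hmdef]
  rw [e1] at hσ1 h5
  have e2 : c (Θ x) = ((chainCoefficient Q (Θ x)).re : ℂ) := by
    rw [hcdef]
    simp only [reflect_apply, hreal, hCdef]
    rw [Complex.re_eq_add_conj]
    rfl
  obtain ⟨c₀, hc₀⟩ : ∃ c₀ : ℝ, c₀ = (chainCoefficient Q (Θ x)).re := ⟨_, rfl⟩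
  rw [← hc₀] at hσ2 e2
  obtain ⟨m₀, hm₀⟩ : ∃ m₀ : ℝ, m (Θ x) = m₀ := Complex.conj_eq_iff_real.1 h5
  have e3 : (T (Θ x) + reflect T (Θ x)) / 2 = c₀ / (1 + m₀ * c₀) := by
    simp [reflect_apply, hreal, hTdef, e2, hm₀]
  rw [e3, hσ2]
  rw [e2, hm₀] at h3
  simp only [fderiv_sub_const, hm₀] at hσ1 ⊢
  have h3' : 1 + m₀ * c₀ ≠ 0 := by exact_mod_cast h3
  constructor
  · rintro rfl v
    rw [hσ1]
    constructor
    · rintro ⟨r, hr⟩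
      refine ⟨r * (1 + m₀ * σ), ?_⟩
      rw [hr, Prod.mk.injEq]
      push_cast
      exact ⟨by rw [mul_assoc, mul_comm (1 + _), div_mul_cancel₀ _ h3], rfl⟩
    · rintro ⟨r, hr⟩
      refine ⟨r / (1 + m₀ * σ), ?_⟩
      rw [hr, Prod.mk.injEq]
      push_cast
      exact ⟨by field_simp, by field_simp⟩
  · intro hv
    obtain ⟨v, hv'⟩ := ((h1 hx).chart.biholo.2.1).2 ((c₀ / (1 + m₀ * c₀) : ℂ), (1 : ℂ))
    simp only [fderiv_sub_const] at hv'
    obtain ⟨r, hr⟩ := (hσ1 v).1 ((hv v).2 ⟨1, by rw [hv']; simp⟩)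
    rw [hv', Prod.mk.injEq] at hr
    obtain ⟨r1, r2⟩ := hr
    have r1' : c₀ / (1 + m₀ * c₀) = r * σ := by exact_mod_cast r1
    have r2' : 1 = r * (1 + m₀ * σ) := by exact_mod_cast r2
    field_simp at r1'
    grind

/-- `Θ` is a chart in which the Levi degeneracy set is the set of real points and the directions
`dF⁻¹(0, 1)`, for the maps `F` onto prenormal forms whose first obstruction vanishes, are the
vertical ones. -/
structure IsLeafChart (M : Set (ℂ × ℂ)) (q : ℂ × ℂ) (Θ : ℂ × ℂ → ℂ × ℂ) : Prop where
  biholo : IsLocalBiholomorphismToZero Θ q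
  mem_iff : ∀ᶠ x in 𝓝 q, x ∈ leviDegeneracySet M ↔ star (Θ x) = Θ x
  iff_vertical : ∀ᶠ x in 𝓝 q, x ∈ leviDegeneracySet M → ∀ F φ' Q' B, IsSegreChart M x F φ' Q' →
    IsPrenormal Q' B → ((coeffBoth B 3 0 0).im = 0 ↔
      ∀ v, (∃ r : ℝ, fderiv ℂ F x v = (0, (r : ℂ))) ↔ ∃ r : ℝ, fderiv ℂ Θ x v = (0, (r : ℂ)))

theorem HasGenericLeviDegeneracyAt.exists_isLeafChart (hg : HasGenericLeviDegeneracyAt M q) :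
    ∃ Θ, IsLeafChart M q Θ ∧ ∃ F φ Q B, IsSegreChart M q F φ Q ∧ fderiv ℝ φ 0 = 0 ∧
      IsPrenormal Q B ∧ ∀ᶠ x in 𝓝 q, (Θ x).1 = 0 → F x = (0, (Θ x).2) := by
  obtain ⟨Θ, φ, Q, h, hφ⟩ := hg.exists_isFlatChart
  obtain ⟨S, hS⟩ := h.exists_isSlopeField hφ hg
  have hg' := hg
  obtain ⟨-, ρ, hρ, -⟩ := hg'
  obtain ⟨Y, hY, hY0, hYS, hYr⟩ := exists_flowBox hS.analytic hS.reflect_eq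
  have hY00 : Y 0 = 0 := hY0.self_of_nhds
  have hY1 : fderiv ℂ Y 0 (1, 0) = 1 := by
    have l : HasDerivAt (fun t : ℂ => (t, (0 : ℂ))) (1, 0) 0 :=
      (hasDerivAt_id _).prodMk (hasDerivAt_const _ _)
    have d := HasFDerivAt.comp_hasDerivAt_of_eq (0 : ℂ) hY.differentiableAt.hasFDerivAt l rfl
    exact (d.congr_of_eventuallyEq (hY0.mono fun t ht => ht.symm)).unique (hasDerivAt_id _)
  obtain ⟨Ψ, hΨdef⟩ : ∃ Ψ : ℂ × ℂ → ℂ × ℂ, Ψ = fun y => (Y y, y.2) := ⟨_, rfl⟩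
  have hΨ : IsLocalBiholomorphismToZero Ψ 0 := by
    rw [hΨdef]
    exact (isLocalBiholomorphismToZero_of_triangular hY analyticAt_snd hY00 rfl
      (by rw [hY1]; exact one_ne_zero) (fun v => by rw [fderiv_snd, one_mul]; rfl) one_ne_zero).1
  obtain ⟨Λ, hΛ, hΛ0, hΛ1, hΛ2, hΛ3, -⟩ := hΨ.exists_inverse
  have hΛb : IsLocalBiholomorphismToZero Λ 0 := ⟨hΛ, hΛ3, hΛ0⟩
  have hΘt := h.chart.tendsto
  obtain ⟨hb, -⟩ := hΛb.comp h.chart.biholo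
  have hΘ't : Tendsto (fun x => Λ (Θ x)) (𝓝 q) (𝓝 0) := by
    have := hb.1.continuousAt.tendsto
    rwa [h.chart.biholo.2.2, hΛ0] at this
  have hst := tendsto_star_zero (E := ℂ × ℂ)
  have hΨs : ∀ᶠ y in 𝓝 0, star (Ψ y) = Ψ (star y) := by
    filter_upwards [hYr] with y hy
    rw [hΨdef]
    refine Prod.ext ?_ rfl
    have : star (star (Y (star y))) = star (Y y) := congrArg star hy
    rw [star_star] at this
    exact this.symm
  have hY1' : ∀ᶠ y in 𝓝 0, fderiv ℂ Y y (1, 0) ≠ 0 :=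
    (analyticAt_fderiv_apply hY (1, 0)).continuousAt.eventually_ne (by rw [hY1]; exact one_ne_zero)
  have hΘΨ : ∀ᶠ x in 𝓝 q, Ψ (Λ (Θ x)) = Θ x := hΘt.eventually hΛ2
  refine ⟨fun x => Λ (Θ x), ⟨hb, ?_, ?_⟩, ?_⟩
  · filter_upwards [h.mem_iff, hΘΨ, hΘ't.eventually hΨs, hΘ't.eventually hΛ1,
      (hst.comp hΘ't).eventually hΛ1] with x h1 h2 h3 h4 h5
    rw [h1]
    constructor
    · intro h6
      rw [← h2, h3] at h6
      have h7 := congrArg Λ h6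
      simp only [Function.comp_apply] at h5
      rwa [h5, h4] at h7
    · intro h6
      rw [← h2, h3, h6]
  · filter_upwards [hS.iff_slope, hΘΨ.eventually_nhds, hΘ't.eventually hY1', hΘ't.eventually hYS,
      hΘ't.eventually hY.eventually_analyticAt, hb.1.eventually_analyticAt] with
      x h1 h2 h3 h4 h5 h6 hx F φ' Q' B h' hB
    rw [h1 hx F φ' Q' B h' hB]
    have d1 : HasFDerivAt Ψ ((fderiv ℂ Y (Λ (Θ x))).prod (ContinuousLinearMap.snd ℂ ℂ ℂ))
        (Λ (Θ x)) := by
      rw [hΨdef]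
      exact h5.differentiableAt.hasFDerivAt.prodMk hasFDerivAt_snd
    have d2 := d1.comp x h6.differentiableAt.hasFDerivAt
    have d3 : ∀ v, fderiv ℂ Θ x v = (fderiv ℂ Y (Λ (Θ x)) (fderiv ℂ (fun x => Λ (Θ x)) x v),
        (fderiv ℂ (fun x => Λ (Θ x)) x v).2) := by
      intro v
      rw [(d2.congr_of_eventuallyEq (h2.mono fun t ht => ht.symm)).fderiv]
      rfl
    have d4 : ∀ w : ℂ × ℂ, fderiv ℂ Y (Λ (Θ x)) w =
        fderiv ℂ Y (Λ (Θ x)) (1, 0) * w.1 + S (Θ x) * w.2 := by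
      intro w
      have e1 : w = w.1 • ((1 : ℂ), (0 : ℂ)) + w.2 • ((0 : ℂ), (1 : ℂ)) := by
        ext <;> simp
      have e2 : (Y (Λ (Θ x)), (Λ (Θ x)).2) = Θ x := by
        have := h2.self_of_nhds
        rwa [hΨdef] at this
      rw [e1, map_add, map_smul, map_smul, h4, e2]
      simp [mul_comm]
    have d5 : ∀ v, (∃ r : ℝ, fderiv ℂ Θ x v = (r * S (Θ x), (r : ℂ))) ↔
        ∃ r : ℝ, fderiv ℂ (fun x => Λ (Θ x)) x v = (0, (r : ℂ)) := by
      intro v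
      refine exists_congr fun r => ?_
      rw [d3, d4, Prod.ext_iff, Prod.ext_iff]
      constructor
      · rintro ⟨k1, k2⟩
        simp only at k1 k2 ⊢
        rw [k2, mul_comm (S _), add_eq_right] at k1
        exact ⟨(mul_eq_zero.1 k1).resolve_left h3, k2⟩
      · rintro ⟨k1, k2⟩
        simp only at k1 k2 ⊢
        rw [k1, k2, mul_zero, zero_add, mul_comm]
        exact ⟨rfl, rfl⟩
    simp only [d5]
  · have hat := tendsto_zero_prodMk (E := ℂ)
    obtain ⟨F, φ', Q', B, h₁, hφ₁, hB, hF⟩ := h.exists_prenormal hφ hg hρ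
      (a := fun t => Y (0, t)) (hY.comp_of_eq (f := fun t : ℂ => ((0 : ℂ), t)) (by fun_prop) rfl)
      hY00 (by
        filter_upwards [hat.eventually hYr] with t ht
        have : star (Y (star 0, star t)) = Y (0, t) := ht
        rwa [star_zero] at this)
    refine ⟨F, φ', Q', B, h₁, hφ₁, hB, ?_⟩
    filter_upwards [hF, hΘΨ] with x h1 h2 hx
    rw [hΨdef] at h2
    have k1 := congrArg Prod.fst h2
    have k2 := congrArg Prod.snd h2
    simp only at k1 k2 hx
    have k3 : Λ (Θ x) = (0, (Θ x).2) := Prod.ext hx k2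
    rw [k3] at k1
    rw [h1 k1.symm, k2]

end

section

variable {M : Set (ℂ × ℂ)} {q : ℂ × ℂ} {Θ F Ξ : ℂ × ℂ → ℂ × ℂ} {φ φ' : ℂ × ℝ → ℝ}
  {Q Q' B : ℂ × ℂ × ℂ → ℂ} {ρ : ℂ × ℂ → ℝ}

/-! ### The chains in leaf charts -/

lemma eventually_eq_of_hasDerivAt_zero {E : Type*} [NormedAddCommGroup E] [NormedSpace ℝ E]
    {u : ℝ → E} {t₀ : ℝ} (h : ∀ᶠ t in 𝓝 t₀, HasDerivAt u 0 t) : ∀ᶠ t in 𝓝 t₀, u t = u t₀ := by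
  obtain ⟨ε, hε, hb⟩ := Metric.eventually_nhds_iff_ball.1 h
  filter_upwards [Metric.ball_mem_nhds t₀ hε] with t ht
  exact Metric.isOpen_ball.is_const_of_deriv_eq_zero (convex_ball t₀ ε).isPreconnected
    (fun s hs => (hb s hs).differentiableAt.differentiableWithinAt) (fun s hs => (hb s hs).deriv) ht
    (Metric.mem_ball_self hε)

lemma IsPrenormal.translate (h : IsSegreChart M q F φ Q) (hB : IsPrenormal Q B)
    (hρ : IsLocalDefiningFunction M q ρ) : ∀ᶠ x in 𝓝 q, ∀ t : ℝ, F x = (0, (t : ℂ)) →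
      x ∈ leviDegeneracySet M ∧ ∃ φ' Q', IsSegreChart M x (fun y => F y - F x) φ' Q' ∧
        IsPrenormal Q' (fun y => B (y + (0, 0, (t : ℂ)))) := by
  have hFt := h.tendsto
  have hc : Tendsto (fun y : ℂ × ℂ => ((0 : ℂ), (0 : ℂ), y.2)) (𝓝 0) (𝓝 0) :=
    Continuous.tendsto' (by fun_prop) _ _ rfl
  have hc2 := tendsto_snd_zero (E := ℂ)
  filter_upwards [h.translate, h.mem_iff, h.mem_leviDegeneracySet_iff hρ,
    hFt.eventually h.segre_iff, (hc.comp hFt).eventually hB.eq.eventually_nhds,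
    (hc.comp hFt).eventually hB.analytic.eventually_analyticAt,
    (hc2.comp hFt).eventually (hB.segreLevi h).1] with x h1 h2 h3 h4 h5 h6 h7 t ht
  simp only [Function.comp_apply, ht] at h2 h4 h5 h6 h7
  have hst : star (t : ℂ) = t := Complex.conj_ofReal t
  have e1 := h5.self_of_nhds
  have hx : x ∈ M := by
    rw [h2, h4]
    simp only [star_zero, hst]
    rw [e1]
    simp
  refine ⟨?_, _, _, h1 hx, ?_, ?_⟩
  · rw [h3 hx, ht]
    simpa only [star_zero, hst] using h7
  · exact h6.comp_of_eq (by fun_prop) (by simp)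
  · have hc3 : Tendsto (fun y : ℂ × ℂ × ℂ => y + (0, 0, (t : ℂ))) (𝓝 0) (𝓝 (0, 0, (t : ℂ))) :=
      Continuous.tendsto' (by fun_prop) _ _ (by simp)
    filter_upwards [hc3.eventually h5] with y hy
    simp only [ht, star_zero, hst]
    rw [hy]
    simp only [Prod.fst_add, Prod.snd_add, add_zero]
    ring

lemma coeffBoth_translate (B : ℂ × ℂ × ℂ → ℂ) (k l : ℕ) (t : ℂ) :
    coeffBoth (fun y => B (y + (0, 0, t))) k l 0 = coeffBoth B k l t := by
  simp [coeffBoth, coeffSnd]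

lemma IsLeafChart.im_eq_zero_iff (hL : IsLeafChart M q Θ) (h : IsSegreChart M q F φ Q)
    (hB : IsPrenormal Q B) (hρ : IsLocalDefiningFunction M q ρ) :
    ∀ᶠ x in 𝓝 q, ∀ t : ℝ, F x = (0, (t : ℂ)) → ((coeffBoth B 3 0 (t : ℂ)).im = 0 ↔
      ∀ v, (∃ r : ℝ, fderiv ℂ F x v = (0, (r : ℂ))) ↔ ∃ r : ℝ, fderiv ℂ Θ x v = (0, (r : ℂ))) := by
  filter_upwards [hL.iff_vertical, hB.translate h hρ] with x h1 h2 t ht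
  obtain ⟨h3, φ', Q', h', hB'⟩ := h2 t ht
  have := h1 h3 _ _ _ _ h' hB'
  rw [coeffBoth_translate] at this
  simpa only [fderiv_sub_const] using this

lemma IsLocalBiholomorphismToZero.eventually_injective (h : IsLocalBiholomorphismToZero Θ q) :
    ∀ᶠ x in 𝓝 q, Function.Injective (fderiv ℂ Θ x) := by
  obtain ⟨Ξ, hΞ, -, h1, -⟩ := h.exists_inverse
  have hΘt : Tendsto Θ (𝓝 q) (𝓝 0) := by
    have := h.1.continuousAt.tendsto
    rwa [h.2.2] at this
  filter_upwards [h1.eventually_nhds, h.1.eventually_analyticAt,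
    hΘt.eventually hΞ.eventually_analyticAt] with x h2 h3 h4
  have d := h4.differentiableAt.hasFDerivAt.comp x h3.differentiableAt.hasFDerivAt
  have e := (d.congr_of_eventuallyEq (h2.mono fun t ht => ht.symm)).unique (hasFDerivAt_id x)
  refine Function.LeftInverse.injective (g := fderiv ℂ Ξ (Θ x)) fun v => ?_
  exact congrArg (fun L : ℂ × ℂ →L[ℂ] ℂ × ℂ => L v) e

/-- A map onto a prenormal form which is the identity on the leaf `z = 0` has no first
obstruction. -/
lemma IsLeafChart.eventually_im_eq_zero (hL : IsLeafChart M q Θ) (h : IsSegreChart M q F φ Q)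
    (hB : IsPrenormal Q B) (hρ : IsLocalDefiningFunction M q ρ)
    (hF : ∀ᶠ x in 𝓝 q, (Θ x).1 = 0 → F x = (0, (Θ x).2)) :
    ∀ᶠ t : ℝ in 𝓝 0, (coeffBoth B 3 0 (t : ℂ)).im = 0 := by
  obtain ⟨Ξ, hΞ, hΞ0, -, hΞ2, -⟩ := hL.biholo.exists_inverse
  have hc := tendsto_zero_prodMk (E := ℂ)
  have hct := tendsto_ofReal_zero
  have hΞt : Tendsto (fun t : ℂ => Ξ (0, t)) (𝓝 0) (𝓝 q) := by
    have := hΞ.continuousAt.tendsto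
    rw [hΞ0] at this
    exact this.comp hc
  have e1 : ∀ᶠ t in 𝓝 (0 : ℂ), Θ (Ξ (0, t)) = (0, t) := hc.eventually hΞ2
  have e2 : ∀ᶠ t in 𝓝 (0 : ℂ), F (Ξ (0, t)) = (0, t) := by
    filter_upwards [hΞt.eventually hF, e1] with t h1 h2
    rw [h2] at h1
    exact h1 rfl
  have hv : ∀ {G : ℂ × ℂ → ℂ × ℂ} {t : ℂ}, AnalyticAt ℂ G (Ξ (0, t)) → AnalyticAt ℂ Ξ (0, t) →
      (∀ᶠ s in 𝓝 t, G (Ξ (0, s)) = (0, s)) →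
      fderiv ℂ G (Ξ (0, t)) (fderiv ℂ Ξ (0, t) (0, 1)) = (0, 1) := by
    intro G t hG hΞ hGe
    have l : ∀ s : ℂ, HasDerivAt (fun t : ℂ => ((0 : ℂ), t)) (0, 1) s :=
      fun s => (hasDerivAt_const _ _).prodMk (hasDerivAt_id _)
    have d1 := hΞ.differentiableAt.hasFDerivAt.comp_hasDerivAt t (l t)
    have d2 := hG.differentiableAt.hasFDerivAt.comp_hasDerivAt t d1
    exact (d2.congr_of_eventuallyEq (hGe.mono fun s hs => hs.symm)).unique (l t)
  filter_upwards [hct.eventually (hΞt.eventually (hL.im_eq_zero_iff h hB hρ)),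
    hct.eventually e1.eventually_nhds, hct.eventually e2.eventually_nhds,
    hct.eventually (hΞt.eventually hL.biholo.eventually_injective),
    hct.eventually (hΞt.eventually h.biholo.eventually_injective),
    hct.eventually (hΞt.eventually hL.biholo.1.eventually_analyticAt),
    hct.eventually (hΞt.eventually h.biholo.1.eventually_analyticAt),
    hct.eventually (hc.eventually hΞ.eventually_analyticAt)] with t h1 h2 h3 h4 h5 h6 h7 h8
  rw [h1 t h3.self_of_nhds]
  have k1 := hv h6 h8 h2
  have k2 := hv h7 h8 h3
  have k3 : ∀ {L : ℂ × ℂ →L[ℂ] ℂ × ℂ} {w v : ℂ × ℂ}, Function.Injective L → L w = (0, 1) → ∀ r : ℝ,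
      L v = (0, (r : ℂ)) ↔ v = (r : ℂ) • w := by
    intro L w v hLi hw r
    have : L ((r : ℂ) • w) = (0, (r : ℂ)) := by rw [map_smul, hw]; simp
    rw [← this, hLi.eq_iff]
  intro v
  simp only [k3 h4 k1, k3 h5 k2]

/-- A map onto a prenormal form without first obstruction sends a leaf to `{z = 0}`. -/
lemma IsLeafChart.eventually_fst_eq_zero (hL : IsLeafChart M q Θ) (h : IsSegreChart M q F φ Q)
    (hB : IsPrenormal Q B) (hρ : IsLocalDefiningFunction M q ρ)
    (hN : ∀ᶠ t : ℝ in 𝓝 0, (coeffBoth B 3 0 (t : ℂ)).im = 0) :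
    ∀ᶠ x in 𝓝 q, (Θ x).1 = 0 ↔ (F x).1 = 0 := by
  obtain ⟨Ξ, hΞ, hΞ0, hΞ1, hΞ2, hΞb, -⟩ := h.biholo.exists_inverse
  have hc := tendsto_zero_prodMk (E := ℂ)
  have hct := tendsto_ofReal_zero
  have hΞt' : Tendsto Ξ (𝓝 0) (𝓝 q) := by
    have := hΞ.continuousAt.tendsto
    rwa [hΞ0] at this
  have hΞt : Tendsto (fun t : ℂ => Ξ (0, t)) (𝓝 0) (𝓝 q) := hΞt'.comp hc
  have hu : ∀ᶠ t : ℝ in 𝓝 0, HasDerivAt (fun t : ℝ => (Θ (Ξ (0, (t : ℂ)))).1) 0 t := by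
    filter_upwards [hN, hct.eventually (hΞt.eventually (hL.im_eq_zero_iff h hB hρ)),
      hct.eventually (hc.eventually hΞ2.eventually_nhds),
      hct.eventually (hΞt.eventually hL.biholo.1.eventually_analyticAt),
      hct.eventually (hΞt.eventually h.biholo.1.eventually_analyticAt),
      hct.eventually (hc.eventually hΞ.eventually_analyticAt)] with t h1 h2 h3 h4 h5 h6
    have l : HasDerivAt (fun t : ℝ => ((0 : ℂ), (t : ℂ))) (0, 1) t :=
      (hasDerivAt_const _ _).prodMk Complex.ofRealCLM.hasDerivAt
    have d1 := h5.differentiableAt.hasFDerivAt.comp _ h6.differentiableAt.hasFDerivAt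
    have d2 := (d1.congr_of_eventuallyEq (h3.mono fun s hs => hs.symm)).unique (hasFDerivAt_id _)
    have d3 : fderiv ℂ F (Ξ (0, (t : ℂ))) (fderiv ℂ Ξ (0, (t : ℂ)) (0, 1)) = (0, ((1 : ℝ) : ℂ)) := by
      simpa using congrArg (fun L : ℂ × ℂ →L[ℂ] ℂ × ℂ => L (0, 1)) d2
    obtain ⟨r, hr⟩ := ((h2 t h3.self_of_nhds).1 h1 _).1 ⟨1, d3⟩
    have d4 := (h4.differentiableAt.hasFDerivAt.comp _
      h6.differentiableAt.hasFDerivAt).restrictScalars ℝ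
    have d5 := d4.comp_hasDerivAt t l
    have d6 := hasFDerivAt_fst.comp_hasDerivAt t d5
    convert! d6 using 1
    change 0 = (fderiv ℂ Θ (Ξ (0, (t : ℂ))) (fderiv ℂ Ξ (0, (t : ℂ)) (0, 1))).1
    rw [hr]
  have hu' := eventually_eq_of_hasDerivAt_zero hu
  have hu0 : (Θ (Ξ (0, ((0 : ℝ) : ℂ)))).1 = 0 := by
    have : ((0 : ℂ), ((0 : ℝ) : ℂ)) = 0 := by simp
    rw [this, hΞ0, hL.biholo.2.2]
    rfl
  have hΘΞ : AnalyticAt ℂ (fun y => Θ (Ξ y)) 0 := hL.biholo.1.comp_of_eq hΞ hΞ0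
  have hg : AnalyticAt ℂ (fun y => (Θ (Ξ y)).1) 0 := analyticAt_fst.comp hΘΞ
  have hg0 : ∀ᶠ t in 𝓝 (0 : ℂ), (Θ (Ξ (0, t))).1 = 0 := by
    refine eventually_zero_of_real₁ (G := fun t => (Θ (Ξ (0, t))).1)
      (hg.comp_of_eq (f := fun t : ℂ => ((0 : ℂ), t)) (by fun_prop) rfl) ?_
    filter_upwards [hu'] with t ht
    rw [ht, hu0]
  obtain ⟨D, hD, hDe⟩ := exists_eq_fst_mul (x₀ := (0 : ℂ)) hg hg0
  have hD0 : D 0 ≠ 0 := by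
    intro h0
    have d1 : HasFDerivAt (fun y => (Θ (Ξ y)).1) (0 : ℂ × ℂ →L[ℂ] ℂ) 0 := by
      have d := (hasFDerivAt_fst (𝕜 := ℂ) (p := (0 : ℂ × ℂ))).mul hD.differentiableAt.hasFDerivAt
      refine (d.congr_of_eventuallyEq hDe).congr_fderiv ?_
      rw [show D (0 : ℂ × ℂ) = 0 from h0]
      exact ContinuousLinearMap.ext fun v => by simp
    have d2 := hasFDerivAt_fst.comp _ (hasFDerivAt_comp_of_eq
      hL.biholo.1.differentiableAt.hasFDerivAt hΞ.differentiableAt.hasFDerivAt hΞ0)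
    have d3 := d1.unique d2
    obtain ⟨v, hv⟩ := hL.biholo.2.1.2 (1, 0)
    obtain ⟨w, hw⟩ := hΞb.2 v
    have d4 := congrArg (fun L : ℂ × ℂ →L[ℂ] ℂ => L w) d3
    simp [hw, hv] at d4
  have hFt := h.tendsto
  filter_upwards [hΞ1, hFt.eventually hDe, hFt.eventually (hD.continuousAt.eventually_ne hD0)]
    with x h1 h2 h3
  rw [h1] at h2
  rw [h2, mul_eq_zero]
  exact or_iff_left h3

lemma IsNormalizingMap.exists_isPrenormal (hF : IsNormalizingMap M q F) :
    ∃ φ Q B, IsSegreChart M q F φ Q ∧ IsPrenormal Q B ∧ IsNormalized B ∧ fderiv ℝ φ 0 = 0 := by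
  obtain ⟨hb, φ, hφ, hM⟩ := hF
  obtain ⟨Q, hQ⟩ := exists_isSegreChart hb hφ.1 hM hφ.zero
  obtain ⟨B, hB, hN⟩ := hφ.exists_isPrenormal hQ
  exact ⟨φ, Q, B, hQ, hB, hN, hφ.fderiv_zero⟩

/-- The slope of the degenerate chains is vertical in a leaf chart. -/
lemma IsLeafChart.pulledBackDirection_eq (hL : IsLeafChart M q Θ) :
    ∀ᶠ x in 𝓝 q, x ∈ leviDegeneracySet M → ∀ F, IsNormalizingMap M x F →
      pulledBackDirection F x = {v | ∃ r : ℝ, fderiv ℂ Θ x v = (0, (r : ℂ))} := by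
  filter_upwards [hL.iff_vertical] with x h1 hx F hF
  obtain ⟨φ, Q, B, h, hB, hN, -⟩ := hF.exists_isPrenormal
  have h2 := (h1 hx F φ Q B h hB).1 (by simpa using hN.self_of_nhds.1)
  ext v
  exact h2 v

end

section

variable {M : Set (ℂ × ℂ)} {q : ℂ × ℂ} {Θ F Ξ : ℂ × ℂ → ℂ × ℂ} {φ φ' : ℂ × ℝ → ℝ}
  {Q Q' A A' B B' : ℂ × ℂ × ℂ → ℂ} {ρ : ℂ × ℂ → ℝ} {k r : ℂ → ℂ} {f c : ℂ × ℂ → ℂ}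

/-! ### Transition relations between prenormal forms -/

/-- The second order Taylor expansion of `k` at variable points. -/
lemma exists_taylor_shift (hk : AnalyticAt ℂ k 0) : ∃ K : ℂ × ℂ → ℂ, AnalyticAt ℂ K 0 ∧
    (∀ᶠ y in 𝓝 (0 : ℂ × ℂ), k (y.2 + y.1) = k y.2 + y.1 * deriv k y.2 + y.1 ^ 2 * K y) ∧
    ∀ᶠ t in 𝓝 (0 : ℂ), K (0, t) = deriv (deriv k) t / 2 := by
  have h1 : AnalyticAt ℂ (fun y : ℂ × ℂ => k (y.2 + y.1)) (0, 0) :=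
    AnalyticAt.comp_of_eq hk (f := fun y : ℂ × ℂ => y.2 + y.1) (by fun_prop) (by simp)
  obtain ⟨D, K, hD, hK, he⟩ := exists_taylor_two h1
  simp only [add_zero] at he
  have hKc := tendsto_zero_prodMk (E := ℂ)
  have h2 : ∀ᶠ t in 𝓝 (0 : ℂ), deriv k t = D t ∧ K (0, t) = deriv (deriv k) t / 2 := by
    have hK' : AnalyticAt ℂ K (0 : ℂ × ℂ) := hK
    filter_upwards [hKc.eventually he.eventually_nhds,
      hKc.eventually hK'.eventually_analyticAt] with t ht hKt
    have hc : Tendsto (fun s : ℂ => (s, t)) (𝓝 0) (𝓝 (0, t)) :=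
      Continuous.tendsto' (by fun_prop) _ _ rfl
    have h3 := coeff_jet_of_taylor (u := fun s => k (t + s)) (d := fun s => K (s, t))
      (hKt.comp_of_eq (f := fun s : ℂ => (s, t)) (by fun_prop) rfl) (by simpa using hc.eventually ht)
    rw [← h3.1, ← h3.2.2, deriv_comp_const_add, iteratedDeriv_succ, iteratedDeriv_one]
    have e1 : deriv (fun s => k (t + s)) = fun s => deriv k (t + s) := by
      funext s
      rw [deriv_comp_const_add]
    rw [e1, deriv_comp_const_add]
    simp
  refine ⟨K, hK, ?_, h2.mono fun t ht => ht.2⟩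
  have hs := tendsto_snd_zero (E := ℂ)
  filter_upwards [he, hs.eventually h2] with y h3 h4
  rw [h3, h4.1]

/-- The transition relation between two Segre functions, after division by `ζ`. -/
lemma transition_divided (hA : AnalyticAt ℂ A 0)
    (hQ : ∀ᶠ y in 𝓝 (0 : ℂ × ℂ × ℂ), Q y = y.2.2 + y.2.1 * A y) (hA' : AnalyticAt ℂ A' 0)
    (hQ' : ∀ᶠ y in 𝓝 (0 : ℂ × ℂ × ℂ), Q' y = y.2.2 + y.2.1 * A' y)
    (hf : AnalyticAt ℂ f 0) (hf0 : f 0 = 0) (hc : AnalyticAt ℂ c 0) (hk : AnalyticAt ℂ k 0)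
    (hk0 : k 0 = 0) {K : ℂ × ℂ → ℂ} (hK : AnalyticAt ℂ K 0)
    (hKe : ∀ᶠ y in 𝓝 (0 : ℂ × ℂ), k (y.2 + y.1) = k y.2 + y.1 * deriv k y.2 + y.1 ^ 2 * K y)
    (hT : ∀ᶠ y in 𝓝 (0 : ℂ × ℂ × ℂ),
      k (Q y) = Q' (f (y.1, Q y), y.2.1 * c y.2, k y.2.2)) :
    ∀ᶠ y in 𝓝 (0 : ℂ × ℂ × ℂ),
      A y * deriv k y.2.2 + y.2.1 * A y ^ 2 * K (y.2.1 * A y, y.2.2) =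
        c y.2 * A' (f (y.1, y.2.2 + y.2.1 * A y), y.2.1 * c y.2, k y.2.2) := by
  obtain ⟨u, hu⟩ : ∃ u : ℂ × ℂ × ℂ → ℂ × ℂ, ∀ y, u y = (y.2.1 * A y, y.2.2) := ⟨_, fun _ => rfl⟩
  have hua : AnalyticAt ℂ u 0 := by
    rw [show u = fun y => (y.2.1 * A y, y.2.2) from funext hu]
    fun_prop
  have hu0 : u 0 = 0 := by simp [hu]
  obtain ⟨v, hv⟩ : ∃ v : ℂ × ℂ × ℂ → ℂ × ℂ, ∀ y, v y = (y.1, y.2.2 + y.2.1 * A y) :=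
    ⟨_, fun _ => rfl⟩
  have hva : AnalyticAt ℂ v 0 := by
    rw [show v = fun y => (y.1, y.2.2 + y.2.1 * A y) from funext hv]
    fun_prop
  have hv0 : v 0 = 0 := by simp [hv]
  obtain ⟨c₁, hc₁⟩ : ∃ g : ℂ × ℂ × ℂ → ℂ, ∀ y, g y = c y.2 := ⟨_, fun _ => rfl⟩
  have hca : AnalyticAt ℂ c₁ 0 := funext hc₁ ▸ hc.comp_of_eq analyticAt_snd rfl
  obtain ⟨k₁, hk₁⟩ : ∃ g : ℂ × ℂ × ℂ → ℂ, ∀ y, g y = k y.2.2 := ⟨_, fun _ => rfl⟩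
  have hka : AnalyticAt ℂ k₁ 0 :=
    funext hk₁ ▸ hk.comp_of_eq (f := fun y : ℂ × ℂ × ℂ => y.2.2) (by fun_prop) rfl
  obtain ⟨k₂, hk₂⟩ : ∃ g : ℂ × ℂ × ℂ → ℂ, ∀ y, g y = deriv k y.2.2 := ⟨_, fun _ => rfl⟩
  have hkd : AnalyticAt ℂ k₂ 0 :=
    funext hk₂ ▸ hk.deriv.comp_of_eq (f := fun y : ℂ × ℂ × ℂ => y.2.2) (by fun_prop) rfl
  obtain ⟨f₁, hf₁⟩ : ∃ g : ℂ × ℂ × ℂ → ℂ, ∀ y, g y = f (v y) := ⟨_, fun _ => rfl⟩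
  have hfa : AnalyticAt ℂ f₁ 0 := funext hf₁ ▸ hf.comp_of_eq hva hv0
  obtain ⟨K₁, hK₁⟩ : ∃ g : ℂ × ℂ × ℂ → ℂ, ∀ y, g y = K (u y) := ⟨_, fun _ => rfl⟩
  have hKa : AnalyticAt ℂ K₁ 0 := funext hK₁ ▸ hK.comp_of_eq hua hu0
  obtain ⟨w, hw⟩ : ∃ w : ℂ × ℂ × ℂ → ℂ × ℂ × ℂ, ∀ y, w y = (f₁ y, y.2.1 * c₁ y, k₁ y) :=
    ⟨_, fun _ => rfl⟩
  have hwa : AnalyticAt ℂ w 0 := by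
    rw [funext hw]
    fun_prop
  have hw0 : w 0 = 0 := by simp [hw, hf₁, hk₁, hv0, hf0, hk0]
  obtain ⟨A₁, hA₁⟩ : ∃ g : ℂ × ℂ × ℂ → ℂ, ∀ y, g y = A' (w y) := ⟨_, fun _ => rfl⟩
  have hA'a : AnalyticAt ℂ A₁ 0 := funext hA₁ ▸ hA'.comp_of_eq hwa hw0
  have hut : Tendsto u (𝓝 0) (𝓝 0) := by
    have := hua.continuousAt.tendsto
    rwa [hu0] at this
  have hwt : Tendsto w (𝓝 0) (𝓝 0) := by
    have := hwa.continuousAt.tendsto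
    rwa [hw0] at this
  have h := eventually_zero_of_mul_snd (G := fun y => A y * k₂ y + y.2.1 * A y ^ 2 * K₁ y -
    c₁ y * A₁ y) (by fun_prop) (by
      filter_upwards [hT, hQ, hut.eventually hKe, hwt.eventually hQ'] with y h1 h2 h3 h4
      rw [← hK₁, hu] at h3
      rw [h2] at h1
      simp only at h3
      rw [h3, ← hk₁, ← hk₂] at h1
      rw [← hA₁, hw] at h4
      rw [← hc₁, show f (y.1, y.2.2 + y.2.1 * A y) = f₁ y by rw [hf₁, hv], h4] at h1
      simp only at h1
      linear_combination h1)
  filter_upwards [h] with y hy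
  simp only [hK₁, hA₁, hw, hf₁, hu, hv, hc₁, hk₁, hk₂] at hy
  exact sub_eq_zero.1 hy

lemma transition_first_order (hA : AnalyticAt ℂ A 0)
    (hQ : ∀ᶠ y in 𝓝 (0 : ℂ × ℂ × ℂ), Q y = y.2.2 + y.2.1 * A y) (hA' : AnalyticAt ℂ A' 0)
    (hQ' : ∀ᶠ y in 𝓝 (0 : ℂ × ℂ × ℂ), Q' y = y.2.2 + y.2.1 * A' y)
    (hf : AnalyticAt ℂ f 0) (hf0 : f 0 = 0) (hc : AnalyticAt ℂ c 0) (hk : AnalyticAt ℂ k 0)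
    (hk0 : k 0 = 0)
    (hT : ∀ᶠ y in 𝓝 (0 : ℂ × ℂ × ℂ),
      k (Q y) = Q' (f (y.1, Q y), y.2.1 * c y.2, k y.2.2)) :
    ∀ᶠ x in 𝓝 (0 : ℂ × ℂ),
      A (x.1, 0, x.2) * deriv k x.2 = c (0, x.2) * A' (f x, 0, k x.2) := by
  obtain ⟨K, hK, hKe, -⟩ := exists_taylor_shift hk
  filter_upwards [tendsto_slice.eventually
    (transition_divided hA hQ hA' hQ' hf hf0 hc hk hk0 hK hKe hT)] with x hx
  simpa using hx

/-- The second order part of the transition relation for a map `(z, w) ↦ (r(w) z, k(w))`. -/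
lemma transition_second_order (hB : IsPrenormal Q B) (hB' : IsPrenormal Q' B')
    (hr : AnalyticAt ℂ r 0) (hk : AnalyticAt ℂ k 0) (hk0 : k 0 = 0)
    (hkr : ∀ᶠ t in 𝓝 0, deriv k t = r t ^ 3) (hr0 : r 0 ≠ 0)
    (hT : ∀ᶠ y in 𝓝 (0 : ℂ × ℂ × ℂ),
      k (Q y) = Q' (r (Q y) * y.1, y.2.1 * r y.2.2, k y.2.2)) :
    ∀ᶠ x in 𝓝 (0 : ℂ × ℂ), r x.2 * B (x.1, 0, x.2) + 2 * deriv r x.2 * x.1 ^ 4 =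
      B' (r x.2 * x.1, 0, k x.2) := by
  obtain ⟨K, hK, hKe, hK0⟩ := exists_taylor_shift hk
  have hBa := hB.analytic
  have hBa' := hB'.analytic
  obtain ⟨A, hA⟩ : ∃ A : ℂ × ℂ × ℂ → ℂ, ∀ y, A y = 2 * I * y.1 ^ 2 + y.2.1 * B y :=
    ⟨_, fun _ => rfl⟩
  have hAa : AnalyticAt ℂ A 0 := by
    rw [show A = fun y => 2 * I * y.1 ^ 2 + y.2.1 * B y from funext hA]
    fun_prop
  obtain ⟨A', hA'⟩ : ∃ A : ℂ × ℂ × ℂ → ℂ, ∀ y, A y = 2 * I * y.1 ^ 2 + y.2.1 * B' y :=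
    ⟨_, fun _ => rfl⟩
  have hAa' : AnalyticAt ℂ A' 0 := by
    rw [show A' = fun y => 2 * I * y.1 ^ 2 + y.2.1 * B' y from funext hA']
    fun_prop
  obtain ⟨f, hf⟩ : ∃ f : ℂ × ℂ → ℂ, ∀ y, f y = r y.2 * y.1 := ⟨_, fun _ => rfl⟩
  have hfa : AnalyticAt ℂ f 0 := by
    rw [show f = fun y => r y.2 * y.1 from funext hf]
    exact (hr.comp_of_eq analyticAt_snd rfl).fun_mul analyticAt_fst
  have hra : AnalyticAt ℂ (fun y : ℂ × ℂ => r y.2) 0 := hr.comp_of_eq analyticAt_snd rfl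
  have h1 := transition_divided (Q := Q) (Q' := Q') hAa (hB.eq.mono fun y hy => by rw [hy, hA]; ring) hAa'
    (hB'.eq.mono fun y hy => by rw [hy, hA']; ring) hfa (by simp [hf]) hra hk hk0 hK hKe
    (by simpa only [hf] using hT)
  obtain ⟨R, hR, hRe, -⟩ := exists_taylor_shift hr
  obtain ⟨u, hu⟩ : ∃ u : ℂ × ℂ × ℂ → ℂ × ℂ, ∀ y, u y = (y.2.1 * A y, y.2.2) := ⟨_, fun _ => rfl⟩
  have hua : AnalyticAt ℂ u 0 := by
    rw [show u = fun y => (y.2.1 * A y, y.2.2) from funext hu]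
    fun_prop
  have hu0 : u 0 = 0 := by simp [hu]
  have hut : Tendsto u (𝓝 0) (𝓝 0) := by
    have := hua.continuousAt.tendsto
    rwa [hu0] at this
  have hsnd : Tendsto (fun y : ℂ × ℂ × ℂ => y.2.2) (𝓝 0) (𝓝 0) :=
    Continuous.tendsto' (by fun_prop) _ _ rfl
  have hsnd' := tendsto_snd_zero (E := ℂ)
  have hcomp : ∀ {g : ℂ → ℂ}, AnalyticAt ℂ g 0 → AnalyticAt ℂ (fun y : ℂ × ℂ × ℂ => g y.2.2) 0 :=
    fun hg => hg.comp_of_eq (f := fun y : ℂ × ℂ × ℂ => y.2.2) (by fun_prop) rfl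
  obtain ⟨R₁, hR₁⟩ : ∃ g : ℂ × ℂ × ℂ → ℂ, ∀ y, g y = R (u y) := ⟨_, fun _ => rfl⟩
  have hRa : AnalyticAt ℂ R₁ 0 := funext hR₁ ▸ hR.comp_of_eq hua hu0
  obtain ⟨K₁, hK₁⟩ : ∃ g : ℂ × ℂ × ℂ → ℂ, ∀ y, g y = K (u y) := ⟨_, fun _ => rfl⟩
  have hKa : AnalyticAt ℂ K₁ 0 := funext hK₁ ▸ hK.comp_of_eq hua hu0
  obtain ⟨r₁, hr₁⟩ : ∃ g : ℂ × ℂ × ℂ → ℂ, ∀ y, g y = r y.2.2 := ⟨_, fun _ => rfl⟩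
  have hra' : AnalyticAt ℂ r₁ 0 := funext hr₁ ▸ hcomp hr
  obtain ⟨r₂, hr₂⟩ : ∃ g : ℂ × ℂ × ℂ → ℂ, ∀ y, g y = deriv r y.2.2 := ⟨_, fun _ => rfl⟩
  have hrd : AnalyticAt ℂ r₂ 0 := funext hr₂ ▸ hcomp hr.deriv
  obtain ⟨k₁, hk₁⟩ : ∃ g : ℂ × ℂ × ℂ → ℂ, ∀ y, g y = k y.2.2 := ⟨_, fun _ => rfl⟩
  have hka : AnalyticAt ℂ k₁ 0 := funext hk₁ ▸ hcomp hk
  obtain ⟨P, hP⟩ : ∃ P : ℂ × ℂ × ℂ → ℂ, ∀ y, P y = A y * r₂ y + y.2.1 * A y ^ 2 * R₁ y :=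
    ⟨_, fun _ => rfl⟩
  have hPa : AnalyticAt ℂ P 0 := by
    rw [funext hP]
    fun_prop
  obtain ⟨w, hw⟩ : ∃ w : ℂ × ℂ × ℂ → ℂ × ℂ × ℂ, ∀ y, w y =
      ((r₁ y + y.2.1 * P y) * y.1, y.2.1 * r₁ y, k₁ y) := ⟨_, fun _ => rfl⟩
  have hwa : AnalyticAt ℂ w 0 := by
    rw [funext hw]
    fun_prop
  obtain ⟨B₁, hB₁⟩ : ∃ g : ℂ × ℂ × ℂ → ℂ, ∀ y, g y = B' (w y) := ⟨_, fun _ => rfl⟩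
  have hBw : AnalyticAt ℂ B₁ 0 := funext hB₁ ▸ hBa'.comp_of_eq hwa (by simp [hw, hk₁, hk0])
  have h := eventually_zero_of_mul_snd (G := fun y => B y * r₁ y ^ 3 + A y ^ 2 * K₁ y -
      r₁ y * (2 * I * y.1 ^ 2 * (2 * r₁ y * P y + y.2.1 * P y ^ 2) + r₁ y * B₁ y))
    (by fun_prop) (by
      filter_upwards [h1, hsnd.eventually hkr, hut.eventually hRe] with y e1 e2 e3
      rw [← hR₁, hu] at e3
      simp only at e3
      have e4 : r (y.2.2 + y.2.1 * A y) = r₁ y + y.2.1 * P y := by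
        rw [e3, hP, hr₁, hr₂]
        ring
      rw [e2, hA', hf, ← hu, ← hK₁] at e1
      simp only at e1
      rw [e4, ← hr₁, ← hk₁, ← hw, ← hB₁] at e1
      linear_combination e1 - r₁ y ^ 3 * hA y)
  have hra0 : ∀ᶠ t in 𝓝 (0 : ℂ), r t ≠ 0 := hr.continuousAt.eventually_ne hr0
  have hkd : ∀ᶠ t in 𝓝 (0 : ℂ), deriv (deriv k) t = 3 * r t ^ 2 * deriv r t := by
    filter_upwards [hkr.eventually_nhds, hr.eventually_analyticAt] with t h2 h3
    rw [EventuallyEq.deriv_eq h2]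
    have := h3.differentiableAt.hasDerivAt.pow 3
    convert! this.deriv using 1
  filter_upwards [tendsto_slice.eventually h, hsnd'.eventually hK0, hsnd'.eventually hkd,
    hsnd'.eventually hra0] with x e1 e2 e3 e4
  simp only [hP, hw, hu, hA, hB₁, hK₁, hr₁, hr₂, hk₁, zero_mul, add_zero, e2, e3] at e1
  refine mul_left_cancel₀ (pow_ne_zero 2 e4) ?_
  linear_combination e1 + (8 * r x.2 ^ 2 * deriv r x.2 - 6 * r x.2 ^ 2 * deriv r x.2) * x.1 ^ 4 * Complex.I_sq
end

section

variable {M : Set (ℂ × ℂ)} {q : ℂ × ℂ} {Θ F Ξ : ℂ × ℂ → ℂ × ℂ} {φ φ' : ℂ × ℝ → ℝ}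
  {Q Q' A A' B B' : ℂ × ℂ × ℂ → ℂ} {ρ : ℂ × ℂ → ℝ} {k r β : ℂ → ℂ} {f c : ℂ × ℂ → ℂ}

/-! ### Existence of the normal form -/

lemma coeff_jet_comp_const_mul (u : ℂ → ℂ) (a : ℂ) (n : ℕ) :
    PowerSeries.coeff n (jet fun z => u (a * z)) = a ^ n * PowerSeries.coeff n (jet u) := by
  have h : iteratedDeriv n (fun z => u (a * z)) = fun z => a ^ n * iteratedDeriv n u (a * z) := by
    induction n with
    | zero => simp
    | succ n ih =>
      rw [iteratedDeriv_succ, ih]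
      funext z
      rw [deriv_const_mul_field, deriv_comp_mul_left, ← iteratedDeriv_succ, smul_eq_mul]
      ring
  simp only [coeff_jet, h, mul_zero, mul_div_assoc]

lemma transition_coeff (hB : AnalyticAt ℂ B 0)
    (h : ∀ᶠ x in 𝓝 (0 : ℂ × ℂ), r x.2 * B (x.1, 0, x.2) + 2 * deriv r x.2 * x.1 ^ 4 =
      B' (r x.2 * x.1, 0, k x.2)) : ∀ᶠ t in 𝓝 (0 : ℂ),
    r t * coeffBoth B 3 0 t = r t ^ 3 * coeffBoth B' 3 0 (k t) ∧
    r t * coeffBoth B 4 0 t + 2 * deriv r t = r t ^ 4 * coeffBoth B' 4 0 (k t) := by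
  have hc := tendsto_zero_prodMk (E := ℂ)
  have hc' : Tendsto (fun t : ℂ => ((0 : ℂ), (0 : ℂ), t)) (𝓝 0) (𝓝 0) :=
    Continuous.tendsto' (by fun_prop) _ _ rfl
  filter_upwards [hc.eventually h.eventually_nhds, hc'.eventually hB.eventually_analyticAt]
    with t h1 h2
  have hs : Tendsto (fun z : ℂ => (z, t)) (𝓝 0) (𝓝 (0, t)) :=
    Continuous.tendsto' (by fun_prop) _ _ rfl
  have h3 : AnalyticAt ℂ (fun z : ℂ => B (z, 0, t)) 0 :=
    h2.comp_of_eq (f := fun z : ℂ => (z, (0 : ℂ), t)) (by fun_prop) rfl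
  have hid : AnalyticAt ℂ (fun z : ℂ => z) 0 := analyticAt_id
  have h4 := jet_congr (u := fun z => r t * B (z, 0, t) + 2 * deriv r t * z ^ 4)
    (v := fun z => B' (r t * z, 0, k t)) (hs.eventually h1)
  rw [jet_add (analyticAt_const.fun_mul h3) (by fun_prop), jet_const_mul, jet_const_mul,
    jet_pow hid, jet_id] at h4
  have h5 := congrArg (PowerSeries.coeff 3) h4
  have h6 := congrArg (PowerSeries.coeff 4) h4
  rw [coeff_jet_comp_const_mul (fun z => B' (z, 0, k t))] at h5 h6
  simp only [coeffBoth_eq_coeff_jet, coeffSnd_zero]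
  simp only [map_add, PowerSeries.coeff_C_mul, PowerSeries.coeff_X_pow] at h5 h6
  exact ⟨by simpa using h5, by simpa using h6⟩

lemma exists_real_primitive (hβ : AnalyticAt ℂ β 0) (hr : ∀ᶠ t in 𝓝 (0 : ℂ), reflect β t = β t) :
    ∃ P, AnalyticAt ℂ P 0 ∧ P 0 = 0 ∧ (∀ᶠ t in 𝓝 (0 : ℂ), deriv P t = β t) ∧
      ∀ᶠ t in 𝓝 (0 : ℂ), reflect P t = P t := by
  have hsnd := tendsto_snd_zero (E := ℂ)
  have hc := tendsto_zero_prodMk (E := ℂ)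
  obtain ⟨Y, hY, hY0, hYd, hYr⟩ := exists_flowBox (S := fun y => β y.2)
    (hβ.comp_of_eq analyticAt_snd rfl) (by
      filter_upwards [hsnd.eventually hr] with y hy
      exact hy)
  refine ⟨fun t => Y (0, t), hY.comp_of_eq (f := fun t : ℂ => ((0 : ℂ), t)) (by fun_prop) rfl,
    hY0.self_of_nhds, ?_, ?_⟩
  · filter_upwards [hc.eventually hYd, hc.eventually hY.eventually_analyticAt] with t h1 h2
    rw [← h1]
    have l : HasDerivAt (fun t : ℂ => ((0 : ℂ), t)) (0, 1) t :=
      (hasDerivAt_const _ _).prodMk (hasDerivAt_id _)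
    exact (h2.differentiableAt.hasFDerivAt.comp_hasDerivAt t l).deriv
  · filter_upwards [hc.eventually hYr] with t ht
    have : star (Y (star 0, star t)) = Y (0, t) := ht
    rwa [star_zero] at this

/-- A prenormal form can be changed into another one by a map `(z, w) ↦ (r(w) z, k(w))`, provided
`k' = r³`. -/
lemma IsPrenormal.exists_rescale (h : IsSegreChart M q F φ Q) (hφ : fderiv ℝ φ 0 = 0)
    (hB : IsPrenormal Q B) (hρ : IsLocalDefiningFunction M q ρ) (hr : AnalyticAt ℂ r 0)
    (hr0 : r 0 = 1) (hrr : ∀ᶠ t in 𝓝 0, reflect r t = r t) (hk : AnalyticAt ℂ k 0)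
    (hk0 : k 0 = 0) (hkr : ∀ᶠ t in 𝓝 0, reflect k t = k t)
    (hkd : ∀ᶠ t in 𝓝 0, deriv k t = r t ^ 3) :
    ∃ φ' Q' B', IsSegreChart M q (fun x => (r (F x).2 * (F x).1, k (F x).2)) φ' Q' ∧
      IsPrenormal Q' B' ∧ ∀ᶠ t in 𝓝 (0 : ℂ),
        r t * coeffBoth B 3 0 t = r t ^ 3 * coeffBoth B' 3 0 (k t) ∧
        r t * coeffBoth B 4 0 t + 2 * deriv r t = r t ^ 4 * coeffBoth B' 4 0 (k t) := by
  have hra : AnalyticAt ℂ (fun y : ℂ × ℂ => r y.2) 0 := hr.comp_of_eq analyticAt_snd rfl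
  have hka : AnalyticAt ℂ (fun y : ℂ × ℂ => k y.2) 0 := hk.comp_of_eq analyticAt_snd rfl
  have hfa : AnalyticAt ℂ (fun y : ℂ × ℂ => r y.2 * y.1) 0 := hra.fun_mul analyticAt_fst
  have hkd0 : deriv k 0 = 1 := by rw [hkd.self_of_nhds, hr0, one_pow]
  have hkv : ∀ v, fderiv ℂ (fun y : ℂ × ℂ => k y.2) 0 v = 1 * v.2 := by
    intro v
    have d := hasFDerivAt_comp_of_eq (f := fun y : ℂ × ℂ => y.2) (x := (0 : ℂ × ℂ))
      hk.differentiableAt.hasFDerivAt hasFDerivAt_snd rfl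
    rw [d.fderiv]
    change fderiv ℂ k 0 v.2 = _
    rw [fderiv_eq_smul_deriv, hkd0, smul_eq_mul, one_mul, mul_one]
  have hf1 : fderiv ℂ (fun y : ℂ × ℂ => r y.2 * y.1) 0 (1, 0) ≠ 0 := by
    have d := hra.differentiableAt.hasFDerivAt.mul (hasFDerivAt_fst (p := (0 : ℂ × ℂ)))
    have e : fderiv ℂ (fun y : ℂ × ℂ => r y.2 * y.1) 0 (1, 0) = r 0 * 1 + 0 := by
      rw [show (fun y : ℂ × ℂ => r y.2 * y.1) = (fun y : ℂ × ℂ => r y.2) * Prod.fst from rfl,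
        d.fderiv]
      simp
    rw [e, hr0]
    norm_num
  obtain ⟨hH, hHd⟩ := isLocalBiholomorphismToZero_of_triangular hfa hka (by simp) hk0 hf1 hkv
    one_ne_zero
  obtain ⟨φ', Q', h', -, hT⟩ := h.push hφ hρ hH (κ := 1) one_ne_zero
    (fun v => by rw [hHd]; simp)
  have hsnd2 : Tendsto (fun y : ℂ × ℂ × ℂ => y.2.2) (𝓝 0) (𝓝 0) :=
    Continuous.tendsto' (by fun_prop) _ _ rfl
  have hT' : ∀ᶠ y in 𝓝 (0 : ℂ × ℂ × ℂ),
      k (Q y) = Q' (r (Q y) * y.1, y.2.1 * r y.2.2, k y.2.2) := by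
    filter_upwards [hT, hsnd2.eventually hrr, hsnd2.eventually hkr] with y e1 e2 e3
    have e4 : reflect (fun y : ℂ × ℂ => (r y.2 * y.1, k y.2)) y.2 =
        (reflect r y.2.2 * y.2.1, reflect k y.2.2) := by
      simp [reflect_apply, Prod.star_def]
    rw [e4, e2, e3] at e1
    simp only at e1
    rw [e1, mul_comm y.2.1]
  have hQ' := h'.analytic
  have hBa := hB.analytic
  have e1 : ∀ᶠ x in 𝓝 (0 : ℂ × ℂ), Q' (x.1, 0, x.2) = x.2 := by
    refine hH.eventually_of_comp (P := fun x => Q' (x.1, 0, x.2) = x.2) ?_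
    filter_upwards [tendsto_slice.eventually hT', tendsto_slice.eventually hB.eq] with x e2 e3
    simp only [zero_mul] at e2
    have e4 : Q (x.1, 0, x.2) = x.2 := by rw [e3]; simp
    rw [e4] at e2
    exact e2.symm
  obtain ⟨A', hA', hAe'⟩ := exists_eq_mul_snd (G := fun y => Q' y - y.2.2) (by fun_prop) (by
    filter_upwards [e1] with x hx
    rw [hx, sub_self])
  have e5 := transition_first_order (Q := Q) (Q' := Q')
    (A := fun y => 2 * I * y.1 ^ 2 + y.2.1 * B y) (by fun_prop)
    (hB.eq.mono fun y hy => by rw [hy]; ring) hA'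
    (hAe'.mono fun y hy => by rw [← hy]; ring) hfa (by simp) hra hk hk0 hT'
  have hsnd := tendsto_snd_zero (E := ℂ)
  have hrne : ∀ᶠ t in 𝓝 (0 : ℂ), r t ≠ 0 :=
    hr.continuousAt.eventually_ne (by rw [hr0]; exact one_ne_zero)
  have e6 : ∀ᶠ x in 𝓝 (0 : ℂ × ℂ), A' (x.1, 0, x.2) = 2 * I * x.1 ^ 2 := by
    refine hH.eventually_of_comp (P := fun x => A' (x.1, 0, x.2) = 2 * I * x.1 ^ 2) ?_
    filter_upwards [e5, hsnd.eventually hkd, hsnd.eventually hrne] with x k1 k2 k3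
    rw [k2] at k1
    refine mul_left_cancel₀ k3 ?_
    linear_combination -k1
  obtain ⟨B', hB', hBe'⟩ := exists_eq_mul_snd (G := fun y => A' y - 2 * I * y.1 ^ 2)
    (by fun_prop) (by
      filter_upwards [e6] with x hx
      rw [hx, sub_self])
  have hP : IsPrenormal Q' B' := ⟨hB', by
    filter_upwards [hAe', hBe'] with y k1 k2
    linear_combination k1 + y.2.1 * k2⟩
  exact ⟨φ', Q', B', h', hP, transition_coeff hBa (transition_second_order hB hP hr hk hk0 hkd
    (by rw [hr0]; exact one_ne_zero) hT')⟩

/-- The existence of the normal form at a generic Levi degeneracy. -/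
theorem HasGenericLeviDegeneracyAt.exists_isNormalizingMap
    (hg : HasGenericLeviDegeneracyAt M q) : ∃ F, IsNormalizingMap M q F := by
  obtain ⟨Θ, hL, F, φ, Q, B, h, hφ, hB, hF⟩ := hg.exists_isLeafChart
  obtain ⟨-, ρ, hρ, -⟩ := hg
  have h3 := hL.eventually_im_eq_zero h hB hρ hF
  obtain ⟨b, hb⟩ : ∃ b : ℂ → ℂ, ∀ t, b t = coeffBoth B 4 0 t := ⟨_, fun _ => rfl⟩
  have hba : AnalyticAt ℂ b 0 := funext hb ▸ analyticAt_coeffBoth hB.analytic 4 0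
  have hbr : AnalyticAt ℂ (reflect b) 0 := analyticAt_reflect (by simpa using hba)
  obtain ⟨P, hP, hP0, hPd, hPr⟩ := exists_real_primitive
    (β := fun t => -(b t + reflect b t) / 4) (by fun_prop)
    (Eventually.of_forall fun t => by simp [reflect_apply, add_comm])
  obtain ⟨r, hr⟩ : ∃ r : ℂ → ℂ, ∀ t, r t = Complex.exp (P t) := ⟨_, fun _ => rfl⟩
  have hra : AnalyticAt ℂ r 0 := by
    rw [funext hr]
    exact hP.cexp
  have hrr : ∀ᶠ t in 𝓝 (0 : ℂ), reflect r t = r t := by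
    filter_upwards [hPr] with t ht
    rw [reflect_apply, hr, hr, ← ht, reflect_apply]
    exact (Complex.exp_conj _).symm
  have hrd : ∀ᶠ t in 𝓝 (0 : ℂ), deriv r t = -(b t + reflect b t) / 4 * r t := by
    filter_upwards [hPd, hP.eventually_analyticAt] with t h1 h2
    have := h2.differentiableAt.hasDerivAt.cexp
    rw [funext hr, this.deriv, h1]
    ring
  obtain ⟨k, hk, hk0, hkd, hkr⟩ := exists_real_primitive (β := fun t => r t ^ 3) (hra.fun_pow 3) (by
    filter_upwards [hrr] with t ht
    rw [reflect_apply] at ht ⊢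
    rw [star_pow, ht])
  obtain ⟨φ', Q', B', h', hB', hT⟩ := hB.exists_rescale h hφ hρ hra (by simp [hr, hP0]) hrr hk hk0
    hkr hkd
  refine ⟨_, h'.biholo, φ', hB'.isNormalFormFunction h' ?_, h'.mem_iff⟩
  have hct := tendsto_ofReal_zero
  have hr0 : r 0 = 1 := by rw [hr, hP0, Complex.exp_zero]
  have hks : HasStrictDerivAt (fun t : ℝ => (k t).re) 1 0 := by
    have e : deriv k ((0 : ℝ) : ℂ) = 1 := by
      rw [Complex.ofReal_zero, hkd.self_of_nhds, hr0, one_pow]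
    have hk' : AnalyticAt ℂ k ((0 : ℝ) : ℂ) := by simpa using hk
    have := hk'.hasStrictDerivAt.real_of_complex
    rwa [e] at this
  have hmap := hks.map_nhds_eq one_ne_zero
  rw [Complex.ofReal_zero, hk0, Complex.zero_re] at hmap
  unfold IsNormalized
  rw [← hmap, eventually_map]
  filter_upwards [hct.eventually hT, hct.eventually hrr, hct.eventually hkr, hct.eventually hrd, h3,
    hct.eventually (hra.continuousAt.eventually_ne (by rw [hr0]; exact one_ne_zero))]
    with t e1 e2 e3 e4 e5 e6
  have hst : star (t : ℂ) = t := Complex.conj_ofReal t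
  rw [reflect_apply, hst] at e2 e3
  obtain ⟨r₀, hr₀⟩ := Complex.conj_eq_iff_real.1 e2
  have e7 : (((k t).re : ℝ) : ℂ) = k t := Complex.conj_eq_iff_re.1 e3
  have hr₀' : r₀ ≠ 0 := by
    rintro rfl
    exact e6 (by rw [hr₀, Complex.ofReal_zero])
  rw [e7]
  rw [e4, reflect_apply, hst, ← hb, hr₀] at e1
  constructor
  · have e8 := congrArg Complex.im e1.1
    rw [Complex.im_ofReal_mul, e5, mul_zero, ← Complex.ofReal_pow, Complex.im_ofReal_mul] at e8
    exact (mul_eq_zero.1 e8.symm).resolve_left (pow_ne_zero 3 hr₀')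
  · have e8 : b t + star (b t) = ((2 * (b t).re : ℝ) : ℂ) := Complex.add_conj _
    rw [e8] at e1
    have e9 := congrArg Complex.re e1.2
    have e10 : (2 * (-((2 * (b t).re : ℝ) : ℂ) / 4 * r₀) : ℂ) = ((-(b t).re * r₀ : ℝ) : ℂ) := by
      push_cast
      ring
    rw [e10, Complex.add_re, Complex.re_ofReal_mul, Complex.ofReal_re, ← Complex.ofReal_pow,
      Complex.re_ofReal_mul] at e9
    refine (mul_eq_zero.1 (?_ : r₀ ^ 4 * _ = 0)).resolve_left (pow_ne_zero 4 hr₀')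
    rw [← e9]
    ring

end

section

variable {M : Set (ℂ × ℂ)} {q : ℂ × ℂ} {Θ F G H : ℂ × ℂ → ℂ × ℂ} {φ φ' : ℂ × ℝ → ℝ}
  {Q Q' B B' : ℂ × ℂ × ℂ → ℂ} {ρ : ℂ × ℂ → ℝ} {k r u : ℂ → ℂ}

/-! ### Uniqueness of the normalizing maps -/

lemma eventually_eq_of_deriv_zero (hu : AnalyticAt ℂ u 0) (h : ∀ᶠ t : ℝ in 𝓝 0, deriv u t = 0) :
    ∀ᶠ t in 𝓝 (0 : ℂ), u t = u 0 := by
  have hct := tendsto_ofReal_zero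
  have h1 := eventually_eq_of_hasDerivAt_zero (u := fun t : ℝ => u t) (t₀ := 0) (by
    filter_upwards [h, hct.eventually hu.eventually_analyticAt] with t h2 h3
    have := h3.differentiableAt.hasDerivAt.comp_ofReal
    rwa [h2] at this)
  have h2 := eventually_zero_of_real₁ (G := fun t => u t - u 0) (by fun_prop) (by
    filter_upwards [h1] with t ht
    rw [ht, Complex.ofReal_zero, sub_self])
  filter_upwards [h2] with t ht
  exact sub_eq_zero.1 ht

/-- A map between prenormal forms that preserves `{z = 0}` is of the form
`(z, w) ↦ (r(w) z, k(w))`. -/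
lemma IsPrenormal.exists_transition (h : IsSegreChart M q F φ Q) (hB : IsPrenormal Q B)
    (h' : IsSegreChart M q G φ' Q') (hB' : IsPrenormal Q' B') (hH : IsLocalBiholomorphismToZero H 0)
    (hHe : ∀ᶠ x in 𝓝 q, G x = H (F x)) (hH1 : ∀ᶠ t in 𝓝 (0 : ℂ), (H (0, t)).1 = 0) :
    ∃ r k : ℂ → ℂ, AnalyticAt ℂ r 0 ∧ AnalyticAt ℂ k 0 ∧ r 0 ≠ 0 ∧ k 0 = 0 ∧
      (∀ᶠ t in 𝓝 (0 : ℂ), reflect r t = r t) ∧ (∀ᶠ t in 𝓝 (0 : ℂ), reflect k t = k t) ∧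
      (∀ᶠ t in 𝓝 (0 : ℂ), deriv k t = r t ^ 3) ∧
      (∀ᶠ y in 𝓝 (0 : ℂ × ℂ), H y = (r y.2 * y.1, k y.2)) ∧ ∀ᶠ t in 𝓝 (0 : ℂ),
        r t * coeffBoth B 3 0 t = r t ^ 3 * coeffBoth B' 3 0 (k t) ∧
        r t * coeffBoth B 4 0 t + 2 * deriv r t = r t ^ 4 * coeffBoth B' 4 0 (k t) := by
  have hBa := hB.analytic
  have hBa' := hB'.analytic
  have hT := h.transition h' hH.1 hHe
  have hH0 := hH.2.2
  have hf : AnalyticAt ℂ (fun y => (H y).1) 0 := analyticAt_fst.comp hH.1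
  have hg : AnalyticAt ℂ (fun y => (H y).2) 0 := analyticAt_snd.comp hH.1
  obtain ⟨f, hfa, hfe⟩ := exists_eq_fst_mul (x₀ := (0 : ℂ)) hf hH1
  replace hfa : AnalyticAt ℂ f 0 := hfa
  replace hfe : ∀ᶠ y in 𝓝 (0 : ℂ × ℂ), (H y).1 = y.1 * f y := hfe
  have hat := tendsto_zero_prodMk (E := ℂ)
  have hsnd := tendsto_snd_zero (E := ℂ)
  have hsnd2 := tendsto_snd_zero (E := ℂ × ℂ)
  have hst := tendsto_star_zero (E := ℂ × ℂ)
  have hst1 := tendsto_star_zero (E := ℂ)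
  obtain ⟨k, hk⟩ : ∃ k : ℂ → ℂ, ∀ t, k t = (H (0, t)).2 := ⟨_, fun _ => rfl⟩
  obtain ⟨r, hr⟩ : ∃ r : ℂ → ℂ, ∀ t, r t = f (0, t) := ⟨_, fun _ => rfl⟩
  have hka : AnalyticAt ℂ k 0 :=
    funext hk ▸ hg.comp_of_eq (f := fun t : ℂ => ((0 : ℂ), t)) (by fun_prop) rfl
  have hra : AnalyticAt ℂ r 0 :=
    funext hr ▸ hfa.comp_of_eq (f := fun t : ℂ => ((0 : ℂ), t)) (by fun_prop) rfl
  have hk0 : k 0 = 0 := by rw [hk, show ((0 : ℂ), (0 : ℂ)) = 0 from rfl, hH0]; rfl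
  have hg0 : ∀ᶠ y in 𝓝 (0 : ℂ × ℂ), (H y).2 = reflect k y.2 := by
    have hm : Tendsto (fun x : ℂ × ℂ => ((H x).1, (0 : ℂ), reflect k x.2)) (𝓝 0) (𝓝 0) := by
      have h1 : AnalyticAt ℂ (fun x : ℂ × ℂ => reflect k x.2) 0 :=
        (analyticAt_reflect (by simpa using hka)).comp_of_eq analyticAt_snd rfl
      have := (hf.prod (analyticAt_const (v := (0 : ℂ)).prod h1)).continuousAt.tendsto
      simpa [hH0, reflect_apply, hk0] using this
    filter_upwards [tendsto_slice.eventually hT, tendsto_slice.eventually hB.eq,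
      hsnd.eventually (hst1.eventually hH1), hm.eventually hB'.eq] with x e1 e2 e3 e4
    have e5 : Q (x.1, 0, x.2) = x.2 := by rw [e2]; simp
    have e6 : reflect H (0, x.2) = (0, reflect k x.2) := by
      have e7 : star ((0 : ℂ), x.2) = (0, star x.2) := Prod.ext (star_zero _) rfl
      rw [reflect_apply, reflect_apply, hk, e7]
      exact Prod.ext ((congrArg star e3).trans (star_zero _)) rfl
    simp only [e5, e6] at e1
    rw [e1, e4]
    simp
  have hkr : ∀ᶠ t in 𝓝 (0 : ℂ), reflect k t = k t := by
    filter_upwards [hat.eventually hg0] with t ht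
    rw [hk, ht]
  have hHs : ∀ᶠ y in 𝓝 (0 : ℂ × ℂ), (H y).2 = k y.2 := by
    filter_upwards [hg0, hsnd.eventually hkr] with y e1 e2
    rw [e1, e2]
  obtain ⟨c, hc⟩ : ∃ c, c = reflect f := ⟨_, rfl⟩
  have hca : AnalyticAt ℂ c 0 := hc ▸ analyticAt_reflect (by simpa using hfa)
  have hHr : ∀ᶠ y in 𝓝 (0 : ℂ × ℂ), reflect H y = (y.1 * c y, k y.2) := by
    filter_upwards [hst.eventually hfe, hst.eventually hHs, hsnd.eventually hkr] with y e1 e2 e3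
    rw [reflect_apply]
    refine Prod.ext ?_ ?_
    · simp [Prod.star_def, hc, reflect_apply] at e1 ⊢
      simp [e1]
    · rw [← e3, reflect_apply]
      exact congrArg star e2
  have hQt : Tendsto (fun y : ℂ × ℂ × ℂ => (y.1, Q y)) (𝓝 0) (𝓝 0) := by
    have := (analyticAt_fst.prod h.analytic).continuousAt.tendsto
    simpa [h.map_zero] using this
  have hT2 : ∀ᶠ y in 𝓝 (0 : ℂ × ℂ × ℂ),
      k (Q y) = Q' ((H (y.1, Q y)).1, y.2.1 * c y.2, k y.2.2) := by
    filter_upwards [hT, hQt.eventually hHs, hsnd2.eventually hHr] with y e1 e2 e3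
    rw [← e2, e1, e3]
  have h1 := transition_first_order (Q := Q) (Q' := Q') (f := fun y => (H y).1)
    (A := fun y => 2 * I * y.1 ^ 2 + y.2.1 * B y)
    (A' := fun y => 2 * I * y.1 ^ 2 + y.2.1 * B' y) (by fun_prop)
    (hB.eq.mono fun y hy => by rw [hy]; ring) (by fun_prop)
    (hB'.eq.mono fun y hy => by rw [hy]; ring) hf (by rw [hH0]; rfl) hca hka hk0 hT2
  have hkd2 : AnalyticAt ℂ (fun y : ℂ × ℂ => deriv k y.2) 0 :=
    hka.deriv.comp_of_eq analyticAt_snd rfl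
  have hc2 : AnalyticAt ℂ (fun y : ℂ × ℂ => c (0, y.2)) 0 :=
    hca.comp_of_eq (f := fun y : ℂ × ℂ => ((0 : ℂ), y.2)) (by fun_prop) rfl
  have hI := Complex.I_ne_zero
  have h2 : ∀ᶠ y in 𝓝 (0 : ℂ × ℂ), deriv k y.2 - c (0, y.2) * f y ^ 2 = 0 := by
    have hd : AnalyticAt ℂ (fun y : ℂ × ℂ => deriv k y.2 - c (0, y.2) * f y ^ 2) 0 :=
      hkd2.fun_sub (hc2.fun_mul (hfa.fun_pow 2))
    refine eventually_zero_of_fst_mul (x₀ := (0 : ℂ)) hd (eventually_zero_of_fst_mul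
      (x₀ := (0 : ℂ)) (analyticAt_fst.fun_mul hd) ?_)
    filter_upwards [h1, hfe] with y e1 e2
    rw [e2] at e1
    refine mul_left_cancel₀ (mul_ne_zero two_ne_zero hI) ?_
    linear_combination e1
  have hr0 : r 0 ≠ 0 := by
    intro h0
    have e1 : fderiv ℂ H 0 (1, 0) = 0 := by
      have d := (hasFDerivAt_fst (𝕜 := ℂ) (p := (0 : ℂ × ℂ))).mul hfa.differentiableAt.hasFDerivAt
      have d2 := hasFDerivAt_comp_of_eq (f := fun y : ℂ × ℂ => y.2) (x := (0 : ℂ × ℂ))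
        hka.differentiableAt.hasFDerivAt hasFDerivAt_snd rfl
      have d3 := (d.prodMk d2).congr_of_eventuallyEq (f₁ := H) (by
        filter_upwards [hfe, hHs] with y e1 e2
        exact Prod.ext e1 e2)
      have h0' : f 0 = 0 := by rw [← h0, hr]; rfl
      rw [d3.fderiv]
      simp [h0']
    have e2 := hH.2.1.1 (e1.trans (map_zero _).symm)
    simp at e2
  have hcr : ∀ t, c (0, t) = reflect r t := by
    intro t
    rw [hc, reflect_apply, reflect_apply, hr, Prod.star_def, star_zero]
  have hrn : ∀ᶠ t in 𝓝 (0 : ℂ), r t ≠ 0 := hra.continuousAt.eventually_ne hr0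
  have hrn' : ∀ᶠ t in 𝓝 (0 : ℂ), reflect r t ≠ 0 := by
    filter_upwards [hst1.eventually hrn] with t ht
    simpa [reflect_apply] using ht
  have hkd : ∀ᶠ t in 𝓝 (0 : ℂ), deriv k t = reflect r t * r t ^ 2 := by
    filter_upwards [hat.eventually h2] with t ht
    rw [← hcr, hr]
    exact sub_eq_zero.1 ht
  have hrr : ∀ᶠ t in 𝓝 (0 : ℂ), reflect r t = r t := by
    filter_upwards [hkd, hst1.eventually hkd, hrn, hrn', hkr.eventually_nhds,
      hst1.eventually hka.eventually_analyticAt] with t e1 e2 e3 e4 e5 e6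
    have e7 := deriv_reflect e6.differentiableAt
    rw [EventuallyEq.deriv_eq e5] at e7
    have e8 : deriv k t = r t * reflect r t ^ 2 := by
      rw [e7, e2]
      simp [reflect_apply]
    refine mul_left_cancel₀ (mul_ne_zero e3 e4) ?_
    linear_combination e1 - e8
  have hkd' : ∀ᶠ t in 𝓝 (0 : ℂ), deriv k t = r t ^ 3 := by
    filter_upwards [hkd, hrr] with t e1 e2
    rw [e1, e2]
    ring
  have hfr : ∀ᶠ y in 𝓝 (0 : ℂ × ℂ), f y = r y.2 := by
    have hs : ∀ᶠ y in 𝓝 (0 : ℂ × ℂ), f y + r y.2 ≠ 0 := by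
      have : AnalyticAt ℂ (fun y : ℂ × ℂ => f y + r y.2) 0 :=
        hfa.fun_add (hra.comp_of_eq analyticAt_snd rfl)
      refine this.continuousAt.eventually_ne ?_
      have h0' : f 0 = r 0 := by rw [hr]; rfl
      simpa [h0'] using hr0
    filter_upwards [h2, hsnd.eventually hkd, hsnd.eventually hrn', hs] with y e1 e2 e3 e4
    rw [hcr, e2] at e1
    refine sub_eq_zero.1 (mul_left_cancel₀ (mul_ne_zero e3 e4) ?_)
    linear_combination -e1
  have hHf : ∀ᶠ y in 𝓝 (0 : ℂ × ℂ), H y = (r y.2 * y.1, k y.2) := by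
    filter_upwards [hfe, hfr, hHs] with y e1 e2 e3
    exact Prod.ext (by rw [e1, e2, mul_comm]) e3
  have hT3 : ∀ᶠ y in 𝓝 (0 : ℂ × ℂ × ℂ),
      k (Q y) = Q' (r (Q y) * y.1, y.2.1 * r y.2.2, k y.2.2) := by
    filter_upwards [hT2, hQt.eventually hHf, (hst.comp hsnd2).eventually hfr,
      (hsnd.comp hsnd2).eventually hrr] with y e1 e2 e3 e4
    have e5 : c y.2 = r y.2.2 := by
      simp only [Function.comp_apply] at e3 e4
      rw [← e4, hc, reflect_apply, e3]
      rfl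
    rw [e1, e2, e5]
  exact ⟨r, k, hra, hka, hr0, hk0, hrr, hkr, hkd', hHf,
    transition_coeff hBa (transition_second_order hB hB' hra hka hk0 hkd' hr0 hT3)⟩

/-- The uniqueness of the normalizing map with given differential on the complex tangent space. -/
theorem IsNormalizingMap.eventuallyEq (hg : HasGenericLeviDegeneracyAt M q)
    (hF : IsNormalizingMap M q F) (hG : IsNormalizingMap M q G)
    (hFG : ∀ X ∈ complexTangentVectors M q, fderiv ℂ F q X = fderiv ℂ G q X) : F =ᶠ[𝓝 q] G := by
  obtain ⟨Θ, hL, -⟩ := hg.exists_isLeafChart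
  obtain ⟨-, ρ, hρ, -⟩ := hg
  obtain ⟨φ, Q, B, h, hB, hN, hφ⟩ := hF.exists_isPrenormal
  obtain ⟨φ', Q', B', h', hB', hN', -⟩ := hG.exists_isPrenormal
  have h1 := hL.eventually_fst_eq_zero h hB hρ (hN.mono fun t ht => ht.1)
  have h2 := hL.eventually_fst_eq_zero h' hB' hρ (hN'.mono fun t ht => ht.1)
  obtain ⟨Ξ, hΞ, hΞ0, hΞ1, hΞ2, hΞ3, hΞ4, -⟩ := h.biholo.exists_inverse
  have hHa : AnalyticAt ℂ (fun y => G (Ξ y)) 0 := h'.biholo.1.comp_of_eq hΞ hΞ0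
  have hHd : ∀ v, fderiv ℂ (fun y => G (Ξ y)) 0 v = fderiv ℂ G q (fderiv ℂ Ξ 0 v) := by
    intro v
    rw [(hasFDerivAt_comp_of_eq h'.biholo.1.differentiableAt.hasFDerivAt
      hΞ.differentiableAt.hasFDerivAt hΞ0).fderiv]
    rfl
  have hH : IsLocalBiholomorphismToZero (fun y => G (Ξ y)) 0 :=
    ⟨hHa, by rw [funext hHd]; exact h'.biholo.2.1.comp hΞ3, by simp only [hΞ0, h'.biholo.2.2]⟩
  have hat := tendsto_zero_prodMk (E := ℂ)
  have hct := tendsto_ofReal_zero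
  have hΞt : Tendsto Ξ (𝓝 0) (𝓝 q) := by
    have := hΞ.continuousAt.tendsto
    rwa [hΞ0] at this
  obtain ⟨r, k, hr, hk, hr0, hk0, hrr, hkr, hkd, hHe, hco⟩ := hB.exists_transition h h' hB' hH
    (by filter_upwards [hΞ1] with x hx; rw [hx]) (by
      filter_upwards [hat.eventually hΞ2, hat.eventually (hΞt.eventually h1),
        hat.eventually (hΞt.eventually h2)] with t e1 e2 e3
      rw [← e3, e2, e1])
  have hr1 : r 0 = 1 := by
    have e1 : fderiv ℂ (fun y => G (Ξ y)) 0 (1, 0) = (1, 0) := by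
      rw [hHd, ← hFG _ ((h.mem_complexTangentVectors_iff hφ hρ _).2 (by rw [hΞ4])), hΞ4]
    have l : HasDerivAt (fun t : ℂ => (t, (0 : ℂ))) (1, 0) 0 :=
      (hasDerivAt_id _).prodMk (hasDerivAt_const _ _)
    have d := hasFDerivAt_fst.comp_hasDerivAt (0 : ℂ)
      (HasFDerivAt.comp_hasDerivAt_of_eq (0 : ℂ) hHa.differentiableAt.hasFDerivAt l rfl)
    have hs := tendsto_prodMk_zero (E := ℂ)
    have d2 : HasDerivAt (fun t : ℂ => r 0 * t) (r 0) 0 := by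
      simpa using (hasDerivAt_id (0 : ℂ)).const_mul (r 0)
    have d3 := d.unique (d2.congr_of_eventuallyEq (by
      filter_upwards [hs.eventually hHe] with t ht
      simp [ht]))
    simp [e1] at d3
    exact d3.symm
  have hkre : Tendsto (fun t : ℝ => (k t).re) (𝓝 0) (𝓝 0) := by
    have := (Complex.continuous_re.tendsto _).comp (hk.continuousAt.tendsto.comp hct)
    rwa [hk0] at this
  have hrd : ∀ᶠ t : ℝ in 𝓝 0, deriv r t = 0 := by
    filter_upwards [hct.eventually hco, hct.eventually hrr.eventually_nhds, hct.eventually hkr, hN,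
      hkre.eventually hN', hct.eventually hr.eventually_analyticAt] with t e1 e2 e3 e4 e5 e6
    have hst : star (t : ℂ) = t := Complex.conj_ofReal t
    have e7 := deriv_reflect (f := r) (x := (t : ℂ)) (by rw [hst]; exact e6.differentiableAt)
    rw [EventuallyEq.deriv_eq e2, hst] at e7
    obtain ⟨d, hd⟩ := Complex.conj_eq_iff_real.1 e7.symm
    have e8 := e2.self_of_nhds
    rw [reflect_apply, hst] at e3 e8
    obtain ⟨r₀, hr₀⟩ := Complex.conj_eq_iff_real.1 e8
    rw [Complex.conj_eq_iff_re.1 e3] at e5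
    have e9 := congrArg Complex.re e1.2
    rw [hr₀, hd, ← Complex.ofReal_pow, Complex.add_re, Complex.re_ofReal_mul, e4.2,
      Complex.re_ofReal_mul, e5.2] at e9
    simp at e9
    rw [hd, e9, Complex.ofReal_zero]
  have hr' : ∀ᶠ t in 𝓝 (0 : ℂ), r t = 1 := hr1 ▸ eventually_eq_of_deriv_zero hr hrd
  have hk' := eventually_eq_of_deriv_zero (u := fun t => k t - t) (by fun_prop) (by
    filter_upwards [hct.eventually hkd, hct.eventually hr', hct.eventually hk.eventually_analyticAt]
      with t e1 e2 e3
    rw [deriv_fun_sub e3.differentiableAt differentiableAt_fun_id, e1, e2, deriv_id'']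
    simp)
  have hs := tendsto_snd_zero (E := ℂ)
  have hFt := h.tendsto
  filter_upwards [hΞ1, hFt.eventually hHe, hFt.eventually (hs.eventually hr'),
    hFt.eventually (hs.eventually hk')] with x e1 e2 e3 e4
  rw [hk0, sub_zero, sub_eq_zero] at e4
  rw [e1, e3, e4, one_mul] at e2
  exact e2.symm

end

section

variable {M : Set (ℂ × ℂ)} {q : ℂ × ℂ} {Θ F : ℂ × ℂ → ℂ × ℂ}

/-! ### The foliation by degenerate chains -/

lemma isEmbedding_domRestrict_of_leftInvOn {X Y : Type*} [TopologicalSpace X] [TopologicalSpace Y]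
    {f : X → Y} {g : Y → X} {S : Set X} (hf : ContinuousOn f S)
    (hg : ∀ x ∈ S, ContinuousAt g (f x)) (h : ∀ x ∈ S, g (f x) = x) :
    IsEmbedding (S.domRestrict f) := by
  refine ⟨isInducing_iff_nhds.2 fun x => le_antisymm ?_ ?_, fun x y hxy => ?_⟩
  · exact (continuousOn_iff_continuous_domRestrict.1 hf).continuousAt.le_comap
  · have h1 : 𝓝 (f x) ≤ comap g (𝓝 (g (f x))) := (hg x x.2).le_comap
    calc comap (S.domRestrict f) (𝓝 (f x)) ≤ comap (S.domRestrict f) (comap g (𝓝 (g (f x)))) :=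
          comap_mono h1
      _ = 𝓝 x := by
        rw [comap_comap, h x x.2, nhds_subtype]
        congr 1
        funext y
        exact h y y.2
  · exact Subtype.ext (by rw [← h x x.2, ← h y y.2]; exact congrArg g hxy)

lemma HasGenericLeviDegeneracyAt.mem (h : HasGenericLeviDegeneracyAt M q) :
    q ∈ leviDegeneracySet M :=
  ⟨h.1, h.2.imp fun _ hρ => ⟨hρ.1, hρ.2.1⟩⟩

/-- In a normal form, the points of the hypersurface with `z = 0` are degenerate and real. -/
lemma IsNormalizingMap.eventually_of_fst_eq_zero (hF : IsNormalizingMap M q F)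
    {ρ : ℂ × ℂ → ℝ} (hρ : IsLocalDefiningFunction M q ρ) :
    ∀ᶠ x in 𝓝 q, x ∈ M → (F x).1 = 0 → x ∈ leviDegeneracySet M := by
  obtain ⟨φ, Q, B, h, hB, -⟩ := hF.exists_isPrenormal
  have hFt := h.tendsto
  have hc : Tendsto (fun y : ℂ × ℂ => ((0 : ℂ), (0 : ℂ), star y.2)) (𝓝 0) (𝓝 0) :=
    Continuous.tendsto' (by fun_prop) _ _ (by simp)
  filter_upwards [h.mem_iff, hFt.eventually h.segre_iff, (hc.comp hFt).eventually hB.eq,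
    hB.translate h hρ] with x h1 h2 h3 h4 hx h0
  have h5 := h2.1 (h1.1 hx)
  simp only [Function.comp_apply] at h3
  rw [h0, star_zero, h3] at h5
  have h6 : star (F x).2 = (F x).2 := by simpa using h5.symm
  exact (h4 (F x).2.re (Prod.ext h0 (Complex.conj_eq_iff_re.1 h6).symm)).1

theorem HasGenericLeviDegeneracyAt.exists_foliation (hg : HasGenericLeviDegeneracyAt M q) :
    ∃ U : Set (ℂ × ℂ), IsOpen U ∧ q ∈ U ∧
      (∀ x ∈ U ∩ leviDegeneracySet M, HasGenericLeviDegeneracyAt M x ∧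
        ∀ F, IsNormalizingMap M x F → chainSlope M x = pulledBackDirection F x) ∧
      ∃ (ψ : ℝ × ℝ → ℂ × ℂ) (ε : ℝ), 0 < ε ∧ IsChainFoliationChart M q U ψ ε ∧
        (∀ (γ : ℝ → ℂ × ℂ) (a b : ℝ), IsDegenerateChain M γ a b →
          ∀ t₀ ∈ Ioo a b, ∀ s ∈ Ioo (-ε) ε, ∀ t₁ ∈ Ioo (-ε) ε, γ t₀ = ψ (s, t₁) →
            ∀ᶠ t in 𝓝 t₀, ∃ t' ∈ Ioo (-ε) ε, γ t = ψ (s, t')) ∧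
        (∀ F, IsNormalizingMap M q F →
          ∀ᶠ x in 𝓝 q, ((∃ t ∈ Ioo (-ε) ε, x = ψ (0, t)) ↔ (x ∈ M ∧ (F x).1 = 0))) := by
  obtain ⟨Θ, hL, -⟩ := hg.exists_isLeafChart
  have hgen := hg.eventually
  have hg' := hg
  obtain ⟨-, ρ, hρ, -⟩ := hg'
  obtain ⟨e, he, heq, hes⟩ := exists_openPartialHomeomorph hL.biholo.1 hL.biholo.2.1
  rw [hL.biholo.2.2] at hes
  have he0 : e q = 0 := (he q).trans hL.biholo.2.2
  have hes0 : e.symm 0 = q := by rw [← he0, e.left_inv heq]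
  have hest : Tendsto e.symm (𝓝 0) (𝓝 q) := by
    have := hes.continuousAt.tendsto
    rwa [hes0] at this
  have hP : ∀ᶠ y in 𝓝 (0 : ℂ × ℂ), y ∈ e.target ∧ AnalyticAt ℂ e.symm y ∧
      (e.symm y ∈ leviDegeneracySet M ↔ star (Θ (e.symm y)) = Θ (e.symm y)) ∧
      (e.symm y ∈ leviDegeneracySet M → HasGenericLeviDegeneracyAt M (e.symm y)) ∧
      (e.symm y ∈ leviDegeneracySet M → ∀ F, IsNormalizingMap M (e.symm y) F →
        pulledBackDirection F (e.symm y) =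
          {v | ∃ r : ℝ, fderiv ℂ Θ (e.symm y) v = (0, (r : ℂ))}) ∧
      AnalyticAt ℂ Θ (e.symm y) := by
    have ht : e.target ∈ 𝓝 (0 : ℂ × ℂ) := e.open_target.mem_nhds (he0 ▸ e.map_source heq)
    filter_upwards [ht, hes.eventually_analyticAt, hest.eventually hL.mem_iff,
      hest.eventually hgen, hest.eventually hL.pulledBackDirection_eq,
      hest.eventually hL.biholo.1.eventually_analyticAt] with y h1 h2 h3 h4 h5 h6
    exact ⟨h1, h2, h3, h4, h5, h6⟩
  obtain ⟨ε, hε, hb⟩ := Metric.eventually_nhds_iff_ball.1 hP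
  choose hbt hba hbm hbg hbp hbΘ using hb
  have hΘe : ∀ y ∈ Metric.ball (0 : ℂ × ℂ) ε, Θ (e.symm y) = y := fun y hy => by
    rw [← he, e.right_inv (hbt y hy)]
  have hball : ∀ {s t : ℝ}, ((s : ℂ), (t : ℂ)) ∈ Metric.ball (0 : ℂ × ℂ) ε ↔
      s ∈ Ioo (-ε) ε ∧ t ∈ Ioo (-ε) ε := by
    intro s t
    rw [mem_ball_zero_iff, Prod.norm_mk, max_lt_iff, Complex.norm_real, Complex.norm_real,
      Real.norm_eq_abs, Real.norm_eq_abs, abs_lt, abs_lt]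
    rfl
  have hstar : ∀ s t : ℝ, star ((s : ℂ), (t : ℂ)) = ((s : ℂ), (t : ℂ)) := fun s t => by
    simp [Prod.star_def]
  have hmem : ∀ {s t : ℝ}, s ∈ Ioo (-ε) ε → t ∈ Ioo (-ε) ε →
      e.symm ((s : ℂ), (t : ℂ)) ∈ leviDegeneracySet M := fun {s t} hs ht => by
    rw [hbm _ (hball.2 ⟨hs, ht⟩), hΘe _ (hball.2 ⟨hs, ht⟩), hstar]
  obtain ⟨U, hU⟩ : ∃ U, U = e.source ∩ e ⁻¹' Metric.ball (0 : ℂ × ℂ) ε := ⟨_, rfl⟩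
  have hUo : IsOpen U := hU ▸ e.isOpen_inter_preimage Metric.isOpen_ball
  have hUq : q ∈ U := by
    rw [hU]
    exact ⟨heq, by rw [mem_preimage, he0]; exact Metric.mem_ball_self hε⟩
  have hUm : ∀ x ∈ U, Θ x ∈ Metric.ball (0 : ℂ × ℂ) ε ∧ e.symm (Θ x) = x := fun x hx => by
    rw [hU] at hx
    rw [← he]
    exact ⟨hx.2, e.left_inv hx.1⟩
  have hreal : ∀ x ∈ U, x ∈ leviDegeneracySet M → (Θ x).1.re ∈ Ioo (-ε) ε ∧
      (Θ x).2.re ∈ Ioo (-ε) ε ∧ Θ x = (((Θ x).1.re : ℂ), ((Θ x).2.re : ℂ)) := by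
    intro x hx hxS
    obtain ⟨h1, h2⟩ := hUm x hx
    have h3 := hbm _ h1
    rw [h2] at h3
    have h4 := (star_eq_self_iff _).1 (h3.1 hxS)
    rw [h4] at h1
    exact ⟨(hball.1 h1).1, (hball.1 h1).2, h4⟩
  have hslope : ∀ x ∈ U, x ∈ leviDegeneracySet M →
      chainSlope M x = {v | ∃ r : ℝ, fderiv ℂ Θ x v = (0, (r : ℂ))} := by
    intro x hx hxS
    obtain ⟨h1, h2⟩ := hUm x hx
    have h3 := hbp _ h1
    have h4 := hbg _ h1
    rw [h2] at h3 h4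
    obtain ⟨F, hF⟩ := (h4 hxS).exists_isNormalizingMap
    ext v
    constructor
    · rintro ⟨G, hG, hv⟩
      rwa [h3 hxS G hG] at hv
    · intro hv
      exact ⟨F, hF, by rwa [h3 hxS F hF]⟩
  obtain ⟨ψ, hψ⟩ : ∃ ψ : ℝ × ℝ → ℂ × ℂ, ∀ x, ψ x = e.symm ((x.1 : ℂ), (x.2 : ℂ)) :=
    ⟨_, fun _ => rfl⟩
  have hψU : ∀ s ∈ Ioo (-ε) ε, ∀ t ∈ Ioo (-ε) ε, ψ (s, t) ∈ U := fun s hs t ht => by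
    have h1 : ((s : ℂ), (t : ℂ)) ∈ Metric.ball (0 : ℂ × ℂ) ε := hball.2 ⟨hs, ht⟩
    rw [hU, hψ]
    refine ⟨e.map_target (hbt _ h1), ?_⟩
    rw [mem_preimage, e.right_inv (hbt _ h1)]
    exact h1
  have hΘψ : ∀ s ∈ Ioo (-ε) ε, ∀ t ∈ Ioo (-ε) ε, Θ (ψ (s, t)) = ((s : ℂ), (t : ℂ)) :=
    fun s hs t ht => by rw [hψ, hΘe _ (hball.2 ⟨hs, ht⟩)]
  have hψS : ∀ s ∈ Ioo (-ε) ε, ∀ t ∈ Ioo (-ε) ε, ψ (s, t) ∈ leviDegeneracySet M :=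
    fun s hs t ht => by rw [hψ]; exact hmem hs ht
  have hψa : AnalyticOnNhd ℝ ψ (Ioo (-ε) ε ×ˢ Ioo (-ε) ε) := by
    rintro ⟨s, t⟩ ⟨hs, ht⟩
    rw [funext hψ]
    exact (analyticAt_real_of_complex (hba _ (hball.2 ⟨hs, ht⟩))).comp_of_eq
      ((analyticAt_ofReal analyticAt_fst).prod (analyticAt_ofReal analyticAt_snd)) rfl
  have hΘa : ∀ s ∈ Ioo (-ε) ε, ∀ t ∈ Ioo (-ε) ε, AnalyticAt ℂ Θ (ψ (s, t)) :=
    fun s hs t ht => by rw [hψ]; exact hbΘ _ (hball.2 ⟨hs, ht⟩)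
  have hψx : ∀ x ∈ U, x ∈ leviDegeneracySet M → ψ ((Θ x).1.re, (Θ x).2.re) = x := by
    intro x hx hxS
    rw [hψ, ← (hreal x hx hxS).2.2]
    exact (hUm x hx).2
  have h0 : (0 : ℝ) ∈ Ioo (-ε) ε := ⟨by linarith, hε⟩
  refine ⟨U, hUo, hUq, ?_, ψ, ε, hε, ⟨hψa, ?_, ?_, ?_, ?_, ?_⟩, ?_, ?_⟩
  · rintro x ⟨hx, hxS⟩
    obtain ⟨h1, h2⟩ := hUm x hx
    have h3 := hbp _ h1
    have h4 := hbg _ h1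
    rw [h2] at h3 h4
    exact ⟨h4 hxS, fun F hF => by rw [hslope x hx hxS, h3 hxS F hF]⟩
  · rintro ⟨s, t⟩ hst
    have d1 := (hψa _ hst).differentiableAt.hasFDerivAt
    have d2 := (hasFDerivAt_real_of_complex (hΘa s hst.1 t hst.2)).comp (s, t) d1
    have l : HasFDerivAt (fun x : ℝ × ℝ => ((x.1 : ℂ), (x.2 : ℂ)))
        ((Complex.ofRealCLM.comp (.fst ℝ ℝ ℝ)).prod (Complex.ofRealCLM.comp (.snd ℝ ℝ ℝ))) (s, t) :=
      (Complex.ofRealCLM.hasFDerivAt.comp (s, t) hasFDerivAt_fst).prodMk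
        (Complex.ofRealCLM.hasFDerivAt.comp (s, t) hasFDerivAt_snd)
    have d3 := d2.unique (l.congr_of_eventuallyEq (by
      filter_upwards [(isOpen_Ioo.prod isOpen_Ioo).mem_nhds hst] with x hx
      exact hΘψ x.1 hx.1 x.2 hx.2))
    refine (injective_iff_map_eq_zero _).2 fun v hv => ?_
    have d4 := congrArg (fun L : ℝ × ℝ →L[ℝ] ℂ × ℂ => L v) d3
    simp [hv, Prod.ext_iff] at d4
    exact Prod.ext (by exact_mod_cast d4.1.symm) (by exact_mod_cast d4.2.symm)
  · refine isEmbedding_domRestrict_of_leftInvOn (g := fun x => ((Θ x).1.re, (Θ x).2.re))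
      hψa.continuousOn (fun x hx => ?_) (fun x hx => ?_)
    · have := (hΘa x.1 hx.1 x.2 hx.2).continuousAt
      exact ContinuousAt.comp (f := Θ) (g := fun y : ℂ × ℂ => (y.1.re, y.2.re))
        (by fun_prop) this
    · rw [← Prod.mk.eta (p := x), hΘψ x.1 hx.1 x.2 hx.2]
      rfl
  · ext x
    constructor
    · rintro ⟨⟨s, t⟩, ⟨hs, ht⟩, rfl⟩
      exact ⟨hψU s hs t ht, hψS s hs t ht⟩
    · rintro ⟨hx, hxS⟩
      obtain ⟨h1, h2, -⟩ := hreal x hx hxS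
      exact ⟨_, ⟨h1, h2⟩, hψx x hx hxS⟩
  · rw [hψ]
    simpa using hes0
  · intro s hs t ht
    have hx := hψU s hs t ht
    have hxS := hψS s hs t ht
    have l : AnalyticAt ℝ (fun t : ℝ => (s, t)) t := analyticAt_const.prod analyticAt_id
    have ha : AnalyticAt ℝ (fun t => ψ (s, t)) t := (hψa (s, t) ⟨hs, ht⟩).comp l
    have hgx : HasGenericLeviDegeneracyAt M (ψ (s, t)) := by
      rw [hψ]
      exact hbg _ (hball.2 ⟨hs, ht⟩) (hmem hs ht)
    have d1 := (hasFDerivAt_real_of_complex (hΘa s hs t ht)).comp_hasDerivAt t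
      ha.differentiableAt.hasDerivAt
    have d2 : HasDerivAt (fun t : ℝ => ((s : ℂ), (t : ℂ))) (0, 1) t :=
      (hasDerivAt_const _ _).prodMk Complex.ofRealCLM.hasDerivAt
    have d3 : fderiv ℂ Θ (ψ (s, t)) (deriv (fun t => ψ (s, t)) t) = (0, 1) :=
      d1.unique (d2.congr_of_eventuallyEq (by
        filter_upwards [isOpen_Ioo.mem_nhds ht] with x hx
        exact hΘψ s hs x hx))
    refine ⟨ha, hgx, fun h => ?_, ?_⟩
    · rw [h, map_zero] at d3
      exact zero_ne_one (congrArg Prod.snd d3)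
    · rw [hslope _ hx hxS]
      exact ⟨1, by simpa using d3⟩
  · intro γ a b hγ t₀ ht₀ s hs t₁ ht₁ h1
    have hc : ∀ t ∈ Ioo a b, ContinuousAt γ t := fun t ht => (hγ t ht).1.continuousAt
    have hγU : ∀ᶠ t in 𝓝 t₀, t ∈ Ioo a b ∧ γ t ∈ U :=
      (isOpen_Ioo.eventually_mem ht₀).and
        ((hc t₀ ht₀).eventually (hUo.eventually_mem (h1 ▸ hψU s hs t₁ ht₁)))
    have hd : ∀ᶠ t in 𝓝 t₀, HasDerivAt (fun t => (Θ (γ t)).1) 0 t := by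
      filter_upwards [hγU] with t ht
      obtain ⟨g1, g2, -, g3⟩ := hγ t ht.1
      rw [hslope _ ht.2 g2.mem] at g3
      obtain ⟨r, hr⟩ := g3
      have hΘt : AnalyticAt ℂ Θ (γ t) := by
        have := hbΘ _ (hUm _ ht.2).1
        rwa [(hUm _ ht.2).2] at this
      have d := hasFDerivAt_fst.comp_hasDerivAt t ((hasFDerivAt_real_of_complex hΘt).comp_hasDerivAt
        t g1.differentiableAt.hasDerivAt)
      convert! d using 1
      change 0 = (fderiv ℂ Θ (γ t) (deriv γ t)).1
      rw [hr]
    filter_upwards [hγU, eventually_eq_of_hasDerivAt_zero hd] with t ht h2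
    have hS := (hγ t ht.1).2.1.mem
    obtain ⟨-, h3, -⟩ := hreal _ ht.2 hS
    refine ⟨_, h3, ?_⟩
    have h4 : (Θ (γ t)).1.re = s := by rw [h2, h1, hΘψ s hs t₁ ht₁, Complex.ofReal_re]
    rw [← h4]
    exact (hψx _ ht.2 hS).symm
  · intro F hF
    obtain ⟨φ, Q, B, h, hB, hN, -⟩ := hF.exists_isPrenormal
    filter_upwards [hUo.eventually_mem hUq, hF.eventually_of_fst_eq_zero hρ,
      hL.eventually_fst_eq_zero h hB hρ (hN.mono fun t ht => ht.1)] with x hx h1 h2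
    constructor
    · rintro ⟨t, ht, rfl⟩
      exact ⟨(hψS 0 h0 t ht).1, h2.1 (by rw [hΘψ 0 h0 t ht, Complex.ofReal_zero])⟩
    · rintro ⟨hxM, hx0⟩
      have hxS := h1 hxM hx0
      refine ⟨_, (hreal x hx hxS).2.1, ?_⟩
      have h3 := hψx x hx hxS
      rw [h2.2 hx0, Complex.zero_re] at h3
      exact h3.symm

end

end LeviDegenerate

end

theorem theorem1 (M : Set (ℂ × ℂ)) (p : ℂ × ℂ)
    (hM : LeviDegenerate.IsRealAnalyticHypersurface M)
    (hp : LeviDegenerate.HasGenericLeviDegeneracyAt M p) :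
    -- existence of a convergent normal form
    (∃ F, LeviDegenerate.IsNormalizingMap M p F) ∧
    -- the germ of the normalizing map is determined by its differential on `T^ℂ_p M`
    (∀ F G, LeviDegenerate.IsNormalizingMap M p F → LeviDegenerate.IsNormalizingMap M p G →
      (∀ X ∈ LeviDegenerate.complexTangentVectors M p, fderiv ℂ F p X = fderiv ℂ G p X) →
      F =ᶠ[𝓝 p] G) ∧
    -- the Levi degeneracy set near `p` is canonically foliated by degenerate chains
    ∃ U : Set (ℂ × ℂ), IsOpen U ∧ p ∈ U ∧
      (∀ q ∈ U ∩ LeviDegenerate.leviDegeneracySet M,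
        LeviDegenerate.HasGenericLeviDegeneracyAt M q ∧
        ∀ F, LeviDegenerate.IsNormalizingMap M q F →
          LeviDegenerate.chainSlope M q = LeviDegenerate.pulledBackDirection F q) ∧
      ∃ (ψ : ℝ × ℝ → ℂ × ℂ) (ε : ℝ), 0 < ε ∧ LeviDegenerate.IsChainFoliationChart M p U ψ ε ∧
        -- every degenerate chain is locally contained in a leaf
        (∀ (γ : ℝ → ℂ × ℂ) (a b : ℝ), LeviDegenerate.IsDegenerateChain M γ a b →
          ∀ t₀ ∈ Ioo a b, ∀ s ∈ Ioo (-ε) ε, ∀ t₁ ∈ Ioo (-ε) ε, γ t₀ = ψ (s, t₁) →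
            ∀ᶠ t in 𝓝 t₀, ∃ t' ∈ Ioo (-ε) ε, γ t = ψ (s, t')) ∧
        -- in any normal form at `p`, the chain through `p` is locally given by `z = 0`
        (∀ F, LeviDegenerate.IsNormalizingMap M p F →
          ∀ᶠ x in 𝓝 p, ((∃ t ∈ Ioo (-ε) ε, x = ψ (0, t)) ↔ (x ∈ M ∧ (F x).1 = 0))) := by
  exact ⟨hp.exists_isNormalizingMap, fun _ _ hF hG hFG => hF.eventuallyEq hp hG hFG,
    hp.exists_foliation⟩
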